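/- Let $S$ be a scheme and let $n\ge 2$. A \emph{relative pinhole camera} on an $S$-scheme $\pi:P\to S$ is a rational map $P\dashrightarrow \mathbf P^2_S$ over $S$ arising as follows: $(P,\mathcal O_P(1))$ is a Zariski form of $(\mathbf P^3_S,\mathcal O(1))$ (Zariski-locally on $S$, $P\cong\mathbf P^3_S$ over $S$ in such a way that the invertible sheaf $\mathcal O_P(1)$ corresponds to $\mathcal O(1)$), there is a homomorphism $\sigma:\mathcal O_P^{\oplus 3}\to\mathcal O_P(1)$ whose cokernel is an invertible sheaf on (the image of) a section $Z$ of $\pi$, called the camera center, and the rational map is represented by the morphism $P\setminus Z\to\mathbf P^2_S$ that the surjection $\sigma|_{P\setminus Z}$ defines by the universal property of projective space. A \emph{relative multiview configuration} of length $n$ over $S$ is a proper $S$-scheme $P$ of finite presentation with a rational map $\Phi:P\dashrightarrow(\mathbf P^2_S)^n$ ($n$-fold fibre product over $S$) each of whose components $\mathrm{pr}_i\circ\Phi$ is a relative pinhole camera; it is \emph{general} if the camera centers $Z_1,\dots,Z_n$ are pairwise disjoint. An \emph{isomorphism} between $\Phi^1:P_1\dashrightarrow(\mathbf P^2_S)^n$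 and $\Phi^2:P_2\dashrightarrow(\mathbf P^2_S)^n$ is an isomorphism $\varepsilon:P_1\to P_2$ of $S$-schemes with $\Phi^1=\Phi^2\circ\varepsilon$ (equality of morphisms on the open subscheme where both sides are regular). The \emph{multiview scheme} $\mathrm{Sch}(\Phi)\subset(\mathbf P^2_S)^n$ of a general configuration $\Phi$ is the scheme-theoretic image of $\Phi$, that is, of the morphism $P\setminus(Z_1\cup\dots\cup Z_n)\to(\mathbf P^2_S)^n$; equivalently, it is the scheme-theoretic image of the morphism from the blowup of $P$ in $Z_1\cup\dots\cup Z_n$ to $(\mathbf P^2_S)^n$ that extends $\Phi$. \textbf{Proposition.} Two general relative multiview configurations $\Phi^1,\Phi^2$ of length $n\ge 2$ over $S$ are isomorphic if and only if $\mathrm{Sch}(\Phi^1)=\mathrm{Sch}(\Phi^2)$ as closed subschemes of $(\mathbf P^2_S)^n$. -/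

import Mathlib

open CategoryTheory CategoryTheory.Limits AlgebraicGeometry TopologicalSpace

universe u

noncomputable section

namespace Multiview

/-! ### Projective space over a base scheme -/

/-- The grading of `ℤ[x₀, …, xₘ]` by total degree. -/
abbrev grading (m : ℕ) : ℕ → Submodule (ULift.{u} ℤ) (MvPolynomial (Fin (m + 1)) (ULift.{u} ℤ)) :=
  MvPolynomial.homogeneousSubmodule (Fin (m + 1)) (ULift.{u} ℤ)

instance gradedAlgebra (m : ℕ) : GradedAlgebra (grading.{u} m) := MvPolynomial.gradedAlgebra

/-- `ℙᵐ` over the integers, as `Proj ℤ[x₀, …, xₘ]`. -/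
def ProjectiveSpaceInt (m : ℕ) : Scheme.{u} := Proj (grading.{u} m)

/-- The standard chart `D₊(xⱼ)` of `ℙᵐ`. -/
def chart (m : ℕ) (j : Fin (m + 1)) : (ProjectiveSpaceInt.{u} m).Opens :=
  Proj.basicOpen (grading.{u} m) (MvPolynomial.X j)

/-- The function `xᵢ / xⱼ` on the chart `D₊(xⱼ)`. -/
def ratio (m : ℕ) (i j : Fin (m + 1)) : Γ(ProjectiveSpaceInt.{u} m, chart m j) :=
  (Proj.awayToSection (grading.{u} m) (MvPolynomial.X j)).hom
    (HomogeneousLocalization.Away.mk (grading.{u} m) (MvPolynomial.isHomogeneous_X _ j) 1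
      (MvPolynomial.X i) (MvPolynomial.isHomogeneous_X _ i))

/-- `ℙᵐ_S = S × ℙᵐ_ℤ`. -/
def ProjectiveSpace (m : ℕ) (S : Scheme.{u}) : Scheme.{u} :=
  pullback (terminal.from S) (terminal.from (ProjectiveSpaceInt.{u} m))

namespace ProjectiveSpace

/-- The structure morphism `ℙᵐ_S ⟶ S`. -/
def toBase (m : ℕ) (S : Scheme.{u}) : ProjectiveSpace m S ⟶ S := pullback.fst _ _

/-- The projection `ℙᵐ_S ⟶ ℙᵐ_ℤ`. -/
def toInt (m : ℕ) (S : Scheme.{u}) : ProjectiveSpace m S ⟶ ProjectiveSpaceInt.{u} m :=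
  pullback.snd _ _

end ProjectiveSpace

/-! ### Invertible sheaves and the universal property of projective space -/

section Sheaves

open Scheme.Modules

variable {X : Scheme.{u}}

/-- Restriction of sections of a sheaf of modules. -/
def res (L : X.Modules) {U V : X.Opens} (h : V ≤ U) (s : Γ(L, U)) : Γ(L, V) :=
  (L.presheaf.map (homOfLE h).op).hom s

/-- `s` is a basis of `L` over `U`: multiplication by `s` is an isomorphism `𝒪_U ≅ L|_U`. -/
def IsGenerator (L : X.Modules) {U : X.Opens} (s : Γ(L, U)) : Prop :=
  ∀ (V : X.Opens) (h : V ≤ U), Function.Bijective fun a : Γ(X, V) ↦ a • res L h s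

/-- `L` is an invertible sheaf. -/
def IsInvertible (L : X.Modules) : Prop :=
  ∀ x : X, ∃ (U : X.Opens) (s : Γ(L, U)), x ∈ U ∧ IsGenerator L s

/-- The morphism `f : X ⟶ ℙᵐ_ℤ` is the one attached by the universal property of projective space
to `L` and its sections `s₀, …, sₘ`: there is an isomorphism `f^* 𝒪(1) ≅ L` carrying `xᵢ` to `sᵢ`.
Concretely, over the preimage of the chart `D₊(xⱼ)` the sheaf `L` is free on `sⱼ`, and
`sᵢ = f^*(xᵢ / xⱼ) sⱼ` there. -/
def IsClassifiedBy {m : ℕ} (f : X ⟶ ProjectiveSpaceInt.{u} m) (L : X.Modules)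
    (s : Fin (m + 1) → Γ(L, ⊤)) : Prop :=
  ∀ j, IsGenerator L (res L (le_top : f ⁻¹ᵁ chart m j ≤ ⊤) (s j)) ∧
    ∀ i, res L (le_top : f ⁻¹ᵁ chart m j ≤ ⊤) (s i) =
      ((f.app (chart m j)).hom (ratio m i j) : Γ(X, f ⁻¹ᵁ chart m j)) •
        res L (le_top : f ⁻¹ᵁ chart m j ≤ ⊤) (s j)

/-- The restriction of a sheaf of modules to an open subscheme. -/
abbrev restr (L : X.Modules) (U : X.Opens) : (U : Scheme.{u}).Modules :=
  Scheme.Modules.restrict L U.ι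

/-- The restriction of a global section to an open subscheme. -/
def restrSection (L : X.Modules) (U : X.Opens) (s : Γ(L, ⊤)) : Γ(restr L U, ⊤) :=
  (Scheme.Modules.restrictAppIso U.ι L ⊤).inv.hom (res L le_top s)

/-- `(P, L)` is a Zariski form of `(ℙᵐ_S, 𝒪(1))`: every point of `S` has an open neighbourhood `U`
with an isomorphism `P|_U ≅ ℙᵐ_U` over `U` under which `𝒪(1)` corresponds to `L|_U`. -/
def IsZariskiForm (m : ℕ) {P S : Scheme.{u}} (π : P ⟶ S) (L : P.Modules) : Prop :=
  ∀ x : S, ∃ U : S.Opens, x ∈ U ∧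
    ∃ (e : ((π ⁻¹ᵁ U : P.Opens) : Scheme.{u}) ≅ ProjectiveSpace m (U : Scheme.{u}))
      (s : Fin (m + 1) → Γ(restr L (π ⁻¹ᵁ U), ⊤)),
      e.hom ≫ ProjectiveSpace.toBase m (U : Scheme.{u}) = π ∣_ U ∧
      IsClassifiedBy (e.hom ≫ ProjectiveSpace.toInt m (U : Scheme.{u})) (restr L (π ⁻¹ᵁ U)) s

/-- The homomorphism `σ : 𝒪_P^k ⟶ L` given by `k` global sections of `L` has as cokernel the
direct image `z_* N` of an invertible sheaf `N` along `z : S ⟶ P`. In other words there is an exact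
sequence `𝒪_P^k ⟶ L ⟶ z_* N ⟶ 0` of sheaves of modules on `P`: the map `q : L ⟶ z_* N` is
surjective (on sections, locally), and its kernel is the image of `σ` (whose sections are
the sections of `L` that are locally linear combinations of the given ones). -/
def HasInvertibleCokernelAlong {P S : Scheme.{u}} (z : S ⟶ P) (L : P.Modules) {k : ℕ}
    (σ : Fin k → Γ(L, ⊤)) : Prop :=
  ∃ (N : S.Modules) (q : L ⟶ (Scheme.Modules.pushforward z).obj N), IsInvertible N ∧
    (∀ (V : P.Opens) (t : Γ((Scheme.Modules.pushforward z).obj N, V)), ∀ x ∈ V,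
      ∃ (W : P.Opens) (h : W ≤ V) (s : Γ(L, W)), x ∈ W ∧
        (q.app W).hom s = res ((Scheme.Modules.pushforward z).obj N) h t) ∧
    (∀ (V : P.Opens) (s : Γ(L, V)), (q.app V).hom s = 0 ↔ ∀ x ∈ V,
      ∃ (W : P.Opens) (h : W ≤ V), x ∈ W ∧
        res L h s ∈ Submodule.span Γ(P, W) (Set.range fun i ↦ res L (le_top : W ≤ ⊤) (σ i)))

end Sheaves

/-! ### Cameras and multiview configurations -/

/-- The open complement of a closed subscheme. -/
def compl {X : Scheme.{u}} (I : X.IdealSheafData) : X.Opens :=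
  ⟨(I.support : Set X)ᶜ, I.support.isClosed.isOpen_compl⟩

/-- A relative pinhole camera on the `S`-scheme `π : P ⟶ S`: a section `Z` of `π`, the camera
center, and a morphism `P ∖ Z ⟶ ℙ²_S` over `S` representing the rational map, which is given by
three sections `σ : 𝒪_P³ ⟶ 𝒪_P(1)` with cokernel an invertible sheaf on `Z`; here `P` together
with `𝒪_P(1)` is a Zariski form of `(ℙ³_S, 𝒪(1))`. -/
structure Camera {P S : Scheme.{u}} (π : P ⟶ S) where
  /-- The camera center, as a section of `π`. -/
  center : S ⟶ P
  center_comp : center ≫ π = 𝟙 S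
  /-- The morphism on the complement of the center. -/
  map : (compl center.ker : Scheme.{u}) ⟶ ProjectiveSpace 2 S
  map_toBase : map ≫ ProjectiveSpace.toBase 2 S = (compl center.ker).ι ≫ π
  exists_sections : ∃ (L : P.Modules) (σ : Fin 3 → Γ(L, ⊤)),
    IsZariskiForm 3 π L ∧ HasInvertibleCokernelAlong center L σ ∧
    IsClassifiedBy (map ≫ ProjectiveSpace.toInt 2 S) (restr L (compl center.ker))
      (fun i ↦ restrSection L (compl center.ker) (σ i))

/-- The closed subscheme of `P` that is the center of the camera. -/
abbrev Camera.Z {P S : Scheme.{u}} {π : P ⟶ S} (c : Camera π) : P.IdealSheafData := c.center.ker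

/-- A relative multiview configuration of length `n` over `S`. -/
structure Configuration (S : Scheme.{u}) (n : ℕ) where
  /-- The source of the cameras. -/
  P : Scheme.{u}
  /-- The structure morphism. -/
  π : P ⟶ S
  isProper : IsProper π
  locallyOfFinitePresentation : LocallyOfFinitePresentation π
  /-- The cameras. -/
  camera : Fin n → Camera π

/-- `(ℙ²_S)ⁿ`, the `n`-fold fibre product of `ℙ²_S` over `S`. -/
def PlanePower (S : Scheme.{u}) (n : ℕ) : Scheme.{u} :=
  widePullback S (fun _ : Fin n ↦ ProjectiveSpace 2 S) (fun _ ↦ ProjectiveSpace.toBase 2 S)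

namespace Configuration

variable {S : Scheme.{u}} {n : ℕ}

/-- A configuration is general if the camera centers are pairwise disjoint. -/
def IsGeneral (Φ : Configuration S n) : Prop :=
  ∀ i j, i ≠ j → Disjoint (Φ.camera i).Z.support (Φ.camera j).Z.support

/-- The scheme-theoretic union of the camera centers. -/
def Z (Φ : Configuration S n) : Φ.P.IdealSheafData := ⨅ i, (Φ.camera i).Z

lemma compl_Z_le (Φ : Configuration S n) (i : Fin n) : compl Φ.Z ≤ compl (Φ.camera i).Z :=
  Set.compl_subset_compl.2 (Scheme.IdealSheafData.support_antitone (iInf_le _ i))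

/-- The morphism `P ∖ Z ⟶ (ℙ²_S)ⁿ` representing the rational map of the configuration. -/
def map (Φ : Configuration S n) : (compl Φ.Z : Scheme.{u}) ⟶ PlanePower S n :=
  WidePullback.lift ((compl Φ.Z).ι ≫ Φ.π)
    (fun i ↦ Φ.P.homOfLE (Φ.compl_Z_le i) ≫ (Φ.camera i).map) (fun i ↦ by
      rw [Category.assoc, (Φ.camera i).map_toBase]
      exact Φ.P.homOfLE_ι_assoc _ _)

/-- An isomorphism of configurations: an isomorphism `ε : P₁ ≅ P₂` of `S`-schemes with
`Φ₁ = Φ₂ ∘ ε` on the open subscheme where both sides are regular. -/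
structure Iso (Φ₁ Φ₂ : Configuration S n) where
  /-- The isomorphism of the sources. -/
  ε : Φ₁.P ≅ Φ₂.P
  comp_π : ε.hom ≫ Φ₂.π = Φ₁.π
  comm : Φ₁.P.homOfLE (inf_le_left : compl Φ₁.Z ⊓ ε.hom ⁻¹ᵁ compl Φ₂.Z ≤ compl Φ₁.Z) ≫ Φ₁.map =
    Φ₁.P.homOfLE
      (inf_le_right : compl Φ₁.Z ⊓ ε.hom ⁻¹ᵁ compl Φ₂.Z ≤ ε.hom ⁻¹ᵁ compl Φ₂.Z) ≫
      (ε.hom ∣_ compl Φ₂.Z) ≫ Φ₂.map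

/-- The multiview scheme (joint image) of a configuration, as a closed subscheme of `(ℙ²_S)ⁿ`: the
scheme-theoretic image of the rational map. It is also the scheme-theoretic image of the extension
of that map to the blowup of `P` in `Z`, see `ker_eq_multiviewScheme` below. -/
def multiviewScheme (Φ : Configuration S n) : (PlanePower S n).IdealSheafData := Φ.map.ker

end Configuration

/-! ### The multiview scheme as the image of the blowup -/

/-- The ideal sheaf is that of an effective Cartier divisor. -/
def IsEffectiveCartier {X : Scheme.{u}} (I : X.IdealSheafData) : Prop :=
  ∀ x : X, ∃ V : X.affineOpens, x ∈ V.1 ∧ ∃ d ∈ nonZeroDivisors Γ(X, V.1), I.ideal V = Ideal.span {d}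

/-- `b : R ⟶ P` is the blowup of `P` in the closed subscheme with ideal sheaf `I`. -/
def IsBlowup {R P : Scheme.{u}} (b : R ⟶ P) (I : P.IdealSheafData) : Prop :=
  IsEffectiveCartier (I.comap b) ∧
    ∀ (T : Scheme.{u}) (g : T ⟶ P), IsEffectiveCartier (I.comap g) → ∃! h : T ⟶ R, h ≫ b = g

lemma ker_compl_ι {X : Scheme.{u}} {I : X.IdealSheafData} (hI : IsEffectiveCartier I) :
    (compl I).ι.ker = ⊥ := by
  rw [eq_bot_iff]
  choose V hxV d hd hId using hI
  refine Scheme.IdealSheafData.le_of_iSup_eq_top V ?_ fun x a ha ↦ ?_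
  · refine top_le_iff.1 fun x _ ↦ ?_
    exact Opens.mem_iSup.2 ⟨x, hxV x⟩
  have ha' := Scheme.Hom.ideal_ker_le _ _ ha
  have hD : X.basicOpen (d x) ≤ compl I := by
    intro y hy hy'
    have hyV : y ∈ (V x).1 := X.basicOpen_le _ hy
    have := (Scheme.IdealSheafData.mem_support_iff_of_mem (I := I) (U := V x) hyV).1 hy'
    rw [hId, Scheme.zeroLocus_span] at this
    simp at this
    exact this hy
  have h0 : X.presheaf.map (homOfLE (X.basicOpen_le (d x))).op a = 0 := by
    have hle : X.basicOpen (d x) ≤ (compl I).ι ''ᵁ ((compl I).ι ⁻¹ᵁ (V x).1) :=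
      fun y hy ↦ ⟨⟨y, hD hy⟩, X.basicOpen_le _ hy, rfl⟩
    have h1 : X.presheaf.map (homOfLE (X.basicOpen_le (d x))).op =
        X.presheaf.map (homOfLE ((compl I).ι.image_preimage_le (V x).1)).op ≫
          X.presheaf.map (homOfLE hle).op := X.presheaf.map_comp _ _
    have h2 : (X.presheaf.map (homOfLE ((compl I).ι.image_preimage_le (V x).1)).op).hom a = 0 :=
      ha'
    rw [h1, CommRingCat.comp_apply]
    exact (congrArg _ h2).trans (map_zero _)
  obtain ⟨n, hn⟩ := exists_pow_mul_eq_zero_of_res_basicOpen_eq_zero_of_isCompact X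
    (V x).2.isCompact a (d x) h0
  have : a = 0 := (mem_nonZeroDivisors_iff.1 (pow_mem (hd x) n)).1 a hn
  simp [this]

lemma isEffectiveCartier_top {X : Scheme.{u}} : IsEffectiveCartier (⊤ : X.IdealSheafData) := by
  intro x
  obtain ⟨_, ⟨V, hV, rfl⟩, hxV, -⟩ :=
    X.isBasis_affineOpens.exists_subset_of_mem_open (Set.mem_univ x) isOpen_univ
  exact ⟨⟨V, hV⟩, hxV, 1, one_mem _, by simp⟩

lemma IsBlowup.isIso_restrict {R P : Scheme.{u}} {b : R ⟶ P} {I : P.IdealSheafData}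
    (hb : IsBlowup b I) : IsIso (b ∣_ compl I) := by
  have top_of (T : Scheme.{u}) (g : T ⟶ P) (hg : Set.range g ⊆ compl I) :
      IsEffectiveCartier (I.comap g) := by
    have : I.comap g = ⊤ := by
      rw [← Scheme.IdealSheafData.support_eq_bot_iff]
      ext x
      have : g x ∉ I.support := hg ⟨x, rfl⟩
      simpa using this
    rw [this]
    exact isEffectiveCartier_top
  obtain ⟨h, hh, -⟩ := hb.2 _ (compl I).ι (top_of _ _ (by simp))
  have hr : Set.range h ⊆ b ⁻¹ᵁ compl I := by
    rintro _ ⟨x, rfl⟩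
    change b (h x) ∈ compl I
    rw [← Scheme.Hom.comp_apply, hh]
    exact x.2
  let k : (compl I : Scheme.{u}) ⟶ (b ⁻¹ᵁ compl I : R.Opens) :=
    IsOpenImmersion.lift (b ⁻¹ᵁ compl I).ι h (by simpa using hr)
  have hk : k ≫ (b ⁻¹ᵁ compl I).ι = h := IsOpenImmersion.lift_fac _ _ _
  have h2 : k ≫ (b ∣_ compl I) = 𝟙 _ := by
    rw [← cancel_mono (compl I).ι, Category.assoc, morphismRestrict_ι, reassoc_of% hk, hh,
      Category.id_comp]
  refine ⟨k, ?_, h2⟩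
  rw [← cancel_mono (b ⁻¹ᵁ compl I).ι]
  refine (hb.2 _ ((b ⁻¹ᵁ compl I).ι ≫ b) (top_of _ _ ?_)).unique ?_ ?_
  · rintro _ ⟨x, rfl⟩
    exact x.2
  · rw [Category.assoc, Category.assoc, reassoc_of% hk, hh, morphismRestrict_ι]
  · simp

lemma preimage_compl {R P : Scheme.{u}} (b : R ⟶ P) (I : P.IdealSheafData) :
    b ⁻¹ᵁ compl I = compl (I.comap b) := by
  ext x
  simp [compl]

/-- If `b : R ⟶ P` is the blowup of `P` in `Z` and `ρ : R ⟶ (ℙ²_S)ⁿ` extends the configuration,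
then the multiview scheme is the scheme-theoretic image of `ρ`. -/
theorem ker_eq_multiviewScheme {S : Scheme.{u}} {n : ℕ} (Φ : Configuration S n) {R : Scheme.{u}}
    (b : R ⟶ Φ.P) (hb : IsBlowup b Φ.Z) (ρ : R ⟶ PlanePower S n)
    (hρ : (b ⁻¹ᵁ compl Φ.Z).ι ≫ ρ = (b ∣_ compl Φ.Z) ≫ Φ.map) :
    ρ.ker = Φ.multiviewScheme := by
  have := hb.isIso_restrict
  have h1 := Scheme.Hom.ker_comp_of_isIso (b ∣_ compl Φ.Z) Φ.map
  rw [← hρ, Scheme.Hom.ker_comp, preimage_compl, ker_compl_ι hb.1,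
    Scheme.IdealSheafData.map_bot] at h1
  exact h1

end Multiview

end

noncomputable section

namespace Multiview

/-! The multiview scheme records which equations hold between the images of a point, and the
trilinear ones already determine the cameras up to a projective transformation. Locally on `S` a
camera is a `3 × 4` matrix of functions on the base (`Camera.exists_matrix`). Its kernel over a
field is at most a line, because a kernel vector is a point of the camera center; hence it has rank
3 at every point (`IsCameraMatrix.linearIndependent`). A trilinear form in the images under three
cameras vanishes on the multiview scheme as soon as substituting the matrices gives the zero
polynomial, and conversely. So configurations with the same multiview scheme have matrices `M`, `N`
that satisfy the same trilinear relations (`relation_of_multiviewScheme_eq`).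

The rest of the local argument is linear algebra over a local ring (`exists_substitution`). Since
the centers of cameras `i` and `j` are disjoint, the row spaces of `M i` and `M j` span all linear
forms and meet in a pencil `α * M i = β * M j` (`exists_pencil`). The relation that says so carries
over to `N`, which gives `β * N j = μ • (α * N i)` with a unit `μ`. Matching bases then gives an
invertible `T` with `N i * T = M i` and `N j * T = μ • M j`. For any further camera `k`, each row of
`M k` is a combination of rows of `M i` and `M j`; multiplied by a form of the pencil this yields
trilinear relations, which force `N k * T` to be a multiple of `M k`. Thus `T` is a local
isomorphism of configurations. It is unique up to a scalar (`eq_smul_one_of_substitution`), so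
general configurations have no automorphisms but the identity, and the local isomorphisms glue
(`exists_iso_of_multiviewScheme_eq`).

To speak of matrices at all, two identifications of `P` with projective space must differ by a
matrix, locally on the base (`IsCoord.exists_linear`). Over a field this follows from unique
factorization. In general, the images of a standard frame provide a candidate matrix. After
correction by it, the two identifications agree on field-valued points and on the frame, so their
difference is nilpotent, and it vanishes because a vector field on projective space that vanishes on
a frame is zero (`eq_of_cocycle_of_isNilpotent`). The base rings are arbitrary: polynomial
identities are tested at points with values in localizations into which the polynomial ring injects.

For the other direction, an isomorphism only identifies the two maps where both are regular. The
complement of the centers is schematically dense, so restricting to the common regular locus does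
not change the scheme-theoretic images (`Configuration.Iso.multiviewScheme_eq`). -/

lemma eval₂_smul_of_isHomogeneous {σ R D : Type*} [CommSemiring R] [CommSemiring D]
    {F : MvPolynomial σ R} {n : ℕ} (hF : F.IsHomogeneous n) (φ : R →+* D) (c : D) (v : σ → D) :
    MvPolynomial.eval₂ φ (fun i ↦ c * v i) F = c ^ n * MvPolynomial.eval₂ φ v F := by
  rw [MvPolynomial.eval₂_eq, MvPolynomial.eval₂_eq, Finset.mul_sum]
  refine Finset.sum_congr rfl fun d hd ↦ ?_
  have h : ∑ i ∈ d.support, d i = n := by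
    have := hF (MvPolynomial.mem_support_iff.1 hd)
    rw [Finsupp.weight_apply, Finsupp.sum] at this
    simpa using this
  simp_rw [mul_pow, Finset.prod_mul_distrib, Finset.prod_pow_eq_pow_sum, h]
  ring

/-! ### Degree zero fractions and the coordinate rings of the standard charts. -/

section Away

variable {m : ℕ}

/-- All coefficient homomorphisms out of the base ring agree, so composites of them are exchanged by
`Subsingleton.elim` below. -/
instance (R : Type*) [Ring R] : Subsingleton (ULift.{u} ℤ →+* R) :=
  ⟨fun f g ↦ by
    have h := RingHom.ext_int (f.comp (ULift.ringEquiv (R := ℤ)).symm.toRingHom)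
      (g.comp (ULift.ringEquiv (R := ℤ)).symm.toRingHom)
    ext x
    exact congr($h x.down)⟩

/-- The ring homomorphism out of `ULift ℤ`. -/
def fromULiftInt (R : Type*) [Ring R] : ULift.{u} ℤ →+* R :=
  (Int.castRingHom R).comp (ULift.ringEquiv (R := ℤ)).toRingHom

lemma X_mem_grading (j : Fin (m + 1)) : MvPolynomial.X j ∈ grading.{u} m 1 :=
  MvPolynomial.isHomogeneous_X _ j

/-- The degree zero fraction `xᵢ / xⱼ`. -/
def awayX (i j : Fin (m + 1)) :
    HomogeneousLocalization.Away (grading.{u} m) (MvPolynomial.X j) :=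
  HomogeneousLocalization.Away.mk (grading.{u} m) (X_mem_grading j) 1
      (MvPolynomial.X i) (X_mem_grading i)

lemma val_awayX (i j : Fin (m + 1)) : (awayX.{u} i j).val *
      algebraMap (MvPolynomial (Fin (m + 1)) (ULift.{u} ℤ)) _ (MvPolynomial.X j) =
    algebraMap (MvPolynomial (Fin (m + 1)) (ULift.{u} ℤ)) _ (MvPolynomial.X i) := by
  rw [awayX, HomogeneousLocalization.Away.val_mk, Localization.mk_eq_mk']
  have := IsLocalization.mk'_spec (Localization.Away (MvPolynomial.X (R := ULift.{u} ℤ) j))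
    (MvPolynomial.X i) (⟨(MvPolynomial.X j) ^ 1, 1, rfl⟩ :
      Submonoid.powers (MvPolynomial.X (R := ULift.{u} ℤ) j))
  simpa only [pow_one] using this

/-- By homogeneity `F / xⱼⁿ` is `F` evaluated at the ratios `xᵢ / xⱼ`. Hence the ratios generate the
ring, and homomorphisms out of it are determined by them. -/
lemma exists_eval₂_awayX (j : Fin (m + 1))
    (z : HomogeneousLocalization.Away (grading.{u} m) (MvPolynomial.X j)) :
    ∃ F : MvPolynomial (Fin (m + 1)) (ULift.{u} ℤ),
      MvPolynomial.eval₂ (fromULiftInt _) (fun i ↦ awayX i j) F = z := by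
  obtain ⟨n, F, hF, rfl⟩ := HomogeneousLocalization.Away.mk_surjective (grading.{u} m)
    (X_mem_grading j) z
  refine ⟨F, HomogeneousLocalization.val_injective _ ?_⟩
  rw [HomogeneousLocalization.Away.val_mk]
  have hF' : F.IsHomogeneous n := by simpa using hF
  have h1 : HomogeneousLocalization.val (MvPolynomial.eval₂ (fromULiftInt _)
      (fun i ↦ awayX.{u} i j) F) = MvPolynomial.eval₂ (fromULiftInt _)
      (fun i ↦ (awayX.{u} i j).val) F := by
    have := MvPolynomial.hom_eval₂ F (fromULiftInt _) (algebraMap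
      (HomogeneousLocalization.Away (grading.{u} m) (MvPolynomial.X j))
      (Localization.Away (MvPolynomial.X (R := ULift.{u} ℤ) j))) (fun i ↦ awayX.{u} i j)
    rw [Subsingleton.elim (RingHom.comp _ (fromULiftInt _)) (fromULiftInt _)] at this
    exact this
  rw [h1]
  have h2 := eval₂_smul_of_isHomogeneous hF'
    (fromULiftInt.{u} (Localization.Away (MvPolynomial.X (R := ULift.{u} ℤ) j)))
    (algebraMap (MvPolynomial (Fin (m + 1)) (ULift.{u} ℤ))
      (Localization.Away (MvPolynomial.X (R := ULift.{u} ℤ) j)) (MvPolynomial.X j))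
    (fun i ↦ (awayX.{u} i j).val)
  simp_rw [fun i ↦ (mul_comm _ _).trans (val_awayX.{u} i j)] at h2
  have h3 : MvPolynomial.eval₂ (fromULiftInt.{u} _)
      (fun i ↦ algebraMap (MvPolynomial (Fin (m + 1)) (ULift.{u} ℤ))
        (Localization.Away (MvPolynomial.X (R := ULift.{u} ℤ) j)) (MvPolynomial.X i)) F =
      algebraMap _ _ F := by
    have := MvPolynomial.hom_eval₂ F MvPolynomial.C
      (algebraMap (MvPolynomial (Fin (m + 1)) (ULift.{u} ℤ)) (Localization.Away
        (MvPolynomial.X (R := ULift.{u} ℤ) j))) MvPolynomial.X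
    rw [Subsingleton.elim (RingHom.comp _ MvPolynomial.C) (fromULiftInt _),
      MvPolynomial.eval₂_eta] at this
    exact this.symm
  rw [Localization.mk_eq_mk', eq_comm, IsLocalization.mk'_eq_iff_eq_mul, ← h3, h2]
  simp [mul_comm]

lemma away_hom_ext {D : Type*} [CommRing D] {j : Fin (m + 1)}
    {φ ψ : HomogeneousLocalization.Away (grading.{u} m) (MvPolynomial.X j) →+* D}
    (h : ∀ i, φ (awayX i j) = ψ (awayX i j)) : φ = ψ := by
  ext z
  obtain ⟨F, rfl⟩ := exists_eval₂_awayX j z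
  rw [MvPolynomial.hom_eval₂, MvPolynomial.hom_eval₂,
    Subsingleton.elim (φ.comp _) (fromULiftInt _), Subsingleton.elim (ψ.comp _) (fromULiftInt _)]
  congr 1
  ext i
  exact h i

/-- The ring homomorphism sending `xᵢ / xⱼ` to `vᵢ / vⱼ`. -/
def awayLift {D : Type*} [CommRing D] {j : Fin (m + 1)} (v : Fin (m + 1) → D) (hv : IsUnit (v j)) :
    HomogeneousLocalization.Away (grading.{u} m) (MvPolynomial.X j) →+* D :=
  (IsLocalization.Away.lift (S := Localization.Away (MvPolynomial.X (R := ULift.{u} ℤ) j))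
    (MvPolynomial.X j) (g := MvPolynomial.eval₂Hom (fromULiftInt.{u} D) v)
    (by simpa using hv)).comp (algebraMap _ _)

lemma awayLift_awayX {D : Type*} [CommRing D] {j : Fin (m + 1)} (v : Fin (m + 1) → D)
    (hv : IsUnit (v j)) (i : Fin (m + 1)) : awayLift v hv (awayX.{u} i j) * v j = v i := by
  have h := congr(IsLocalization.Away.lift
    (S := Localization.Away (MvPolynomial.X (R := ULift.{u} ℤ) j))
    (MvPolynomial.X j) (g := MvPolynomial.eval₂Hom (fromULiftInt.{u} D) v)
    (by simpa using hv) $(val_awayX.{u} i j))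
  rw [map_mul, IsLocalization.Away.lift_eq, IsLocalization.Away.lift_eq] at h
  simp only [MvPolynomial.coe_eval₂Hom, MvPolynomial.eval₂_X] at h
  exact h

end Away

lemma map_appLE_top {X Y : Scheme.{u}} (f : X ⟶ Y) (V : Y.Opens) (h : ⊤ ≤ f ⁻¹ᵁ V) :
    Y.presheaf.map (homOfLE (le_top : V ≤ ⊤)).op ≫ f.appLE V ⊤ h = f.appTop := by
  rw [Scheme.Hom.map_appLE]
  exact f.appLE_eq_app

/-! ### The standard charts of projective space and their transition functions. -/

section Chart

variable {m : ℕ}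

lemma ratio_eq (i j : Fin (m + 1)) : ratio.{u} m i j =
    (Proj.awayToSection (grading.{u} m) (MvPolynomial.X j)).hom (awayX i j) := rfl

lemma isAffineOpen_chart (j : Fin (m + 1)) : IsAffineOpen (chart.{u} m j) :=
  Proj.isAffineOpen_basicOpen _ _ (X_mem_grading j) one_pos

lemma awayX_self (j : Fin (m + 1)) : awayX.{u} j j = 1 := by
  apply HomogeneousLocalization.val_injective
  rw [HomogeneousLocalization.val_one, awayX, HomogeneousLocalization.Away.val_mk]
  convert Localization.mk_self _
  simp

@[simp]
lemma ratio_self (j : Fin (m + 1)) : ratio.{u} m j j = 1 := by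
  rw [ratio_eq, awayX_self]
  exact map_one _

lemma iSup_chart : ⨆ j, chart.{u} m j = ⊤ := by
  refine Proj.iSup_basicOpen_eq_top' _ _ (fun i ↦ ⟨1, X_mem_grading i⟩) ?_
  refine Algebra.eq_top_iff.2 fun x ↦ ?_
  induction x using MvPolynomial.induction_on with
  | C a =>
    exact Subalgebra.algebraMap_mem _ (⟨MvPolynomial.C a, MvPolynomial.isHomogeneous_C _ a⟩ :
      grading.{u} m 0)
  | add p q hp hq => exact add_mem hp hq
  | mul_X p i hp => exact mul_mem hp (Algebra.subset_adjoin ⟨i, rfl⟩)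

lemma exists_mem_chart (x : ProjectiveSpaceInt.{u} m) : ∃ j, x ∈ chart m j := by
  have : x ∈ ⨆ j, chart.{u} m j := by rw [iSup_chart]; trivial
  simpa using this

lemma isLocalizationElem_eq (i j : Fin (m + 1)) :
    HomogeneousLocalization.Away.isLocalizationElem (X_mem_grading.{u} j) (X_mem_grading i) =
      awayX i j := by
  apply HomogeneousLocalization.val_injective
  rw [awayX, HomogeneousLocalization.Away.val_mk, HomogeneousLocalization.Away.val_mk]
  simp

lemma val_awayMap_awayX (i j k : Fin (m + 1)) {y : MvPolynomial (Fin (m + 1)) (ULift.{u} ℤ)}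
    (hy : y = MvPolynomial.X j * MvPolynomial.X k) :
    (HomogeneousLocalization.awayMap (grading.{u} m) (X_mem_grading k) hy (awayX i j)).val *
      algebraMap (MvPolynomial (Fin (m + 1)) (ULift.{u} ℤ)) _ (MvPolynomial.X j) =
    algebraMap (MvPolynomial (Fin (m + 1)) (ULift.{u} ℤ)) _ (MvPolynomial.X i) := by
  rw [HomogeneousLocalization.val_awayMap]
  have := congr(Localization.awayLift (algebraMap _ (Localization.Away y))
    (MvPolynomial.X j) (isUnit_of_dvd_unit (map_dvd _ ⟨_, hy⟩)
      (IsLocalization.Away.algebraMap_isUnit y)) $(val_awayX.{u} i j))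
  rw [map_mul] at this
  simpa [Localization.awayLift] using this

lemma ratio_mul_ratio (i j k : Fin (m + 1)) {U : (ProjectiveSpaceInt.{u} m).Opens}
    (hj : U ≤ chart m j) (hk : U ≤ chart m k) :
    (ProjectiveSpaceInt.{u} m).presheaf.map (homOfLE hk).op (ratio m i k) *
    (ProjectiveSpaceInt.{u} m).presheaf.map (homOfLE hj).op (ratio m k j) =
    (ProjectiveSpaceInt.{u} m).presheaf.map (homOfLE hj).op (ratio m i j) := by
  have hle : U ≤ Proj.basicOpen (grading.{u} m) (MvPolynomial.X j * MvPolynomial.X k) := by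
    rw [Proj.basicOpen_mul]
    exact le_inf hj hk
  have h1 := Proj.awayMap_awayToSection (grading.{u} m) (X_mem_grading k)
    (rfl : MvPolynomial.X j * MvPolynomial.X k = MvPolynomial.X j * MvPolynomial.X k)
  have h2 := Proj.awayMap_awayToSection (grading.{u} m) (X_mem_grading j)
    (mul_comm _ _ : MvPolynomial.X j * MvPolynomial.X k = MvPolynomial.X k * MvPolynomial.X j)
  -- Every section in the identity is restricted from `D₊(xⱼxₖ)`, so the identity can be checked
  -- among fractions with denominator a power of `xⱼxₖ`.
  let ψ : HomogeneousLocalization.Away (grading.{u} m) (MvPolynomial.X j * MvPolynomial.X k) →+*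
      Γ(ProjectiveSpaceInt.{u} m, U) :=
    ((Proj (grading.{u} m)).presheaf.map (homOfLE hle).op).hom.comp
      (Proj.awayToSection (grading.{u} m) (MvPolynomial.X j * MvPolynomial.X k)).hom
  have e1 (i) : (ProjectiveSpaceInt.{u} m).presheaf.map (homOfLE hj).op (ratio m i j) =
      ψ (HomogeneousLocalization.awayMap (grading.{u} m) (X_mem_grading k) rfl (awayX i j)) := by
    have e : (Proj (grading.{u} m)).presheaf.map (homOfLE hj).op =
      (Proj (grading.{u} m)).presheaf.map (homOfLE (Proj.basicOpen_mono _ _ _ (dvd_mul_right _ _))).op ≫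
        (Proj (grading.{u} m)).presheaf.map (homOfLE hle).op := by
      exact (Proj (grading.{u} m)).presheaf.map_comp _ _
    have := congr(($h1 ≫ (Proj (grading.{u} m)).presheaf.map (homOfLE hle).op).hom (awayX i j))
    rw [Category.assoc, Category.assoc, ← e] at this
    exact this.symm
  have e2 (i) : (ProjectiveSpaceInt.{u} m).presheaf.map (homOfLE hk).op (ratio m i k) =
      ψ (HomogeneousLocalization.awayMap (grading.{u} m) (X_mem_grading j) (mul_comm _ _)
          (awayX i k)) := by
    have e : (Proj (grading.{u} m)).presheaf.map (homOfLE hk).op =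
      (Proj (grading.{u} m)).presheaf.map (homOfLE (Proj.basicOpen_mono _ _ _ (dvd_mul_left _ _))).op ≫
        (Proj (grading.{u} m)).presheaf.map (homOfLE hle).op := by
      exact (Proj (grading.{u} m)).presheaf.map_comp _ _
    have := congr(($h2 ≫ (Proj (grading.{u} m)).presheaf.map (homOfLE hle).op).hom (awayX i k))
    rw [Category.assoc, Category.assoc, ← e] at this
    exact this.symm
  rw [e1, e1, e2]
  refine (map_mul ψ _ _).symm.trans (congrArg ψ ?_)
  apply HomogeneousLocalization.val_injective
  rw [HomogeneousLocalization.val_mul]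
  -- After multiplication by the unit `xⱼxₖ` the claim is a combination of the relations `(xₐ / x_b)
  -- x_b = xₐ`.
  have hu := IsLocalization.Away.algebraMap_isUnit
    (S := Localization.Away (MvPolynomial.X (R := ULift.{u} ℤ) j * MvPolynomial.X k))
    (MvPolynomial.X (R := ULift.{u} ℤ) j * MvPolynomial.X k)
  refine hu.mul_right_cancel ?_
  have a1 := val_awayMap_awayX.{u} i j k rfl
  have a2 := val_awayMap_awayX.{u} k j k rfl
  have a3 := val_awayMap_awayX.{u} i k j (mul_comm (MvPolynomial.X j) (MvPolynomial.X k))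
  rw [map_mul]
  linear_combination (algebraMap (MvPolynomial (Fin (m + 1)) (ULift.{u} ℤ)) _
      (MvPolynomial.X k)) *
    (HomogeneousLocalization.awayMap (grading.{u} m) (X_mem_grading j)
      (mul_comm (MvPolynomial.X j) (MvPolynomial.X k)) (awayX i k)).val * a2 +
    (algebraMap (MvPolynomial (Fin (m + 1)) (ULift.{u} ℤ)) _ (MvPolynomial.X k)) * a3 -
    (algebraMap (MvPolynomial (Fin (m + 1)) (ULift.{u} ℤ)) _ (MvPolynomial.X k)) * a1

/-- The inclusion of the chart `D₊(xⱼ)`. -/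
def chartι (j : Fin (m + 1)) :
    Spec (.of (HomogeneousLocalization.Away (grading.{u} m) (MvPolynomial.X j))) ⟶
      ProjectiveSpaceInt.{u} m :=
  Proj.awayι (grading.{u} m) (MvPolynomial.X j) (X_mem_grading j) one_pos

instance (j : Fin (m + 1)) : IsOpenImmersion (chartι.{u} j) :=
  inferInstanceAs (IsOpenImmersion (Proj.awayι _ _ _ _))

lemma opensRange_chartι (j : Fin (m + 1)) : (chartι.{u} j).opensRange = chart m j :=
  Proj.opensRange_awayι _ _ _ _

lemma top_le_chartι_preimage (j : Fin (m + 1)) : ⊤ ≤ chartι.{u} j ⁻¹ᵁ chart m j := by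
  rintro x -
  change chartι.{u} j x ∈ chart m j
  rw [← opensRange_chartι]
  exact ⟨x, rfl⟩

lemma chartι_preimage (i j : Fin (m + 1)) :
    chartι.{u} j ⁻¹ᵁ chart m i = PrimeSpectrum.basicOpen (awayX i j) := by
  rw [← isLocalizationElem_eq]
  exact Proj.awayι_preimage_basicOpen (grading.{u} m) (X_mem_grading j) one_pos
    (X_mem_grading i) one_pos

lemma chartι_appLE_ratio (i j : Fin (m + 1)) :
    ((chartι.{u} j).appLE (chart m j) ⊤ (top_le_chartι_preimage j)).hom (ratio m i j) =
      (Scheme.ΓSpecIso _).inv.hom (awayX i j) := by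
  -- Stated for any `g` equal to the explicit composite, so that the composite can be substituted
  -- together with the proof of the inclusion.
  have key : ∀ (g : Spec (.of (HomogeneousLocalization.Away (grading.{u} m) (MvPolynomial.X j))) ⟶
      Proj (grading.{u} m)) (hg : ⊤ ≤ g ⁻¹ᵁ Proj.basicOpen (grading.{u} m) (MvPolynomial.X j)),
      g = (Proj.basicOpenIsoSpec (grading.{u} m) _ (X_mem_grading j) one_pos).inv ≫
        (Proj.basicOpen (grading.{u} m) (MvPolynomial.X j)).ι →
      Proj.awayToSection (grading.{u} m) (MvPolynomial.X j) ≫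
        g.appLE (Proj.basicOpen (grading.{u} m) (MvPolynomial.X j)) ⊤ hg =
      (Scheme.ΓSpecIso _).inv := by
    rintro _ hg rfl
    have h1 := Proj.basicOpenToSpec_app_top (grading.{u} m) (MvPolynomial.X j)
    rw [← Proj.basicOpenIsoSpec_hom _ _ (X_mem_grading j) one_pos] at h1
    have h2 : (Proj.basicOpenIsoSpec (grading.{u} m) _ (X_mem_grading j) one_pos).hom.appTop ≫
      (Proj.basicOpenIsoSpec (grading.{u} m) _ (X_mem_grading j) one_pos).inv.appTop = 𝟙 _ := by
      rw [← Scheme.Hom.comp_appTop]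
      simp
    rw [← cancel_epi (Scheme.ΓSpecIso _).hom, Iso.hom_inv_id, ← h2, Scheme.Hom.appTop, h1]
    simp only [Category.assoc]
    congr 2
    have h3 : (Proj.basicOpen (grading.{u} m) (MvPolynomial.X j)).ι.app
        (Proj.basicOpen (grading.{u} m) (MvPolynomial.X j)) =
      (Proj.basicOpen (grading.{u} m) (MvPolynomial.X j)).topIso.inv ≫
        (Proj.basicOpen (grading.{u} m) (MvPolynomial.X j)).toScheme.presheaf.map
          (homOfLE le_top).op := by
      rw [Scheme.Opens.ι_app, Scheme.Opens.topIso_inv, Scheme.Opens.toScheme_presheaf_map]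
      exact Functor.map_comp _ _ _
    rw [Scheme.Hom.comp_appLE, h3, Category.assoc]
    exact congrArg (_ ≫ ·) (map_appLE_top
      (Proj.basicOpenIsoSpec (grading.{u} m) _ (X_mem_grading j) one_pos).inv
      ((Proj.basicOpen (grading.{u} m) (MvPolynomial.X j)).ι ⁻¹ᵁ
        Proj.basicOpen (grading.{u} m) (MvPolynomial.X j)) hg)
  have h := key (chartι j) (top_le_chartι_preimage j) (Proj.basicOpenIsoSpec_inv_ι _ _ _ _).symm
  exact congr(($h).hom (awayX i j))

/-- Inside the affine chart `D₊(xⱼ)` both sides are the basic open set of the fraction `xᵢ / xⱼ`. -/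
lemma basicOpen_ratio (i j : Fin (m + 1)) :
    (ProjectiveSpaceInt.{u} m).basicOpen (ratio m i j) = chart m i ⊓ chart m j := by
  have h : chartι.{u} j ⁻¹ᵁ (ProjectiveSpaceInt.{u} m).basicOpen (ratio m i j) =
      chartι.{u} j ⁻¹ᵁ chart m i := by
    have := Scheme.basicOpen_appLE (chartι.{u} j) ⊤ (chart m j) (top_le_chartι_preimage j)
      (ratio m i j)
    rw [top_inf_eq] at this
    rw [chartι_preimage, ← this]
    erw [chartι_appLE_ratio]
    rw [basicOpen_eq_of_affine]
  ext x
  by_cases hx : x ∈ chart m j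
  · rw [← opensRange_chartι] at hx
    obtain ⟨y, rfl⟩ := hx
    have hy : chartι.{u} j y ∈ chart m j := top_le_chartι_preimage j trivial
    have h' : chartι.{u} j y ∈ (ProjectiveSpaceInt.{u} m).basicOpen (ratio m i j) ↔
        chartι.{u} j y ∈ chart m i := iff_of_eq congr(y ∈ $h)
    exact h'.trans ⟨fun h ↦ ⟨h, hy⟩, fun h ↦ h.1⟩
  · exact ⟨fun h ↦ (hx (Scheme.basicOpen_le _ _ h)).elim, fun h ↦ (hx h.2).elim⟩

end Chart

/-! ### Restriction and pullback of functions. -/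

section Sections

variable {X Y : Scheme.{u}}

/-- Restriction of functions on a scheme. -/
def rs {U V : X.Opens} (h : V ≤ U) : Γ(X, U) →+* Γ(X, V) := (X.presheaf.map (homOfLE h).op).hom

@[simp]
lemma rs_rs {U V W : X.Opens} (h : V ≤ U) (h' : W ≤ V) (s : Γ(X, U)) :
    rs h' (rs h s) = rs (h'.trans h) s :=
  congr(($((X.presheaf.map_comp (homOfLE h).op (homOfLE h').op).symm)).hom s)

@[simp]
lemma rs_self {U : X.Opens} (h : U ≤ U) (s : Γ(X, U)) : rs h s = s :=
  congr(($(X.presheaf.map_id (.op U))).hom s)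

lemma ext_of_local {U : X.Opens} (s t : Γ(X, U))
    (h : ∀ x ∈ U, ∃ (V : X.Opens) (hV : V ≤ U), x ∈ V ∧ rs hV s = rs hV t) : s = t := by
  refine TopCat.Presheaf.section_ext X.sheaf U s t fun x hx ↦ ?_
  obtain ⟨V, hV, hxV, e⟩ := h x hx
  have := congr(X.presheaf.germ V x hxV $e)
  erw [X.presheaf.germ_res_apply, X.presheaf.germ_res_apply] at this
  exact this

lemma rs_appLE (f : X ⟶ Y) {U : Y.Opens} {V W : X.Opens} (h : V ≤ f ⁻¹ᵁ U) (h' : W ≤ V)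
    (s : Γ(Y, U)) : rs h' ((f.appLE U V h).hom s) = (f.appLE U W (h'.trans h)).hom s :=
  congr(($(Scheme.Hom.appLE_map f h (homOfLE h').op)).hom s)

lemma appLE_rs (f : X ⟶ Y) {U U' : Y.Opens} {V : X.Opens} (h' : U' ≤ U) (h : V ≤ f ⁻¹ᵁ U')
    (s : Γ(Y, U)) : (f.appLE U' V h).hom (rs h' s) =
      (f.appLE U V (h.trans (f.preimage_mono h'))).hom s :=
  congr(($(Scheme.Hom.map_appLE f h (homOfLE h').op)).hom s)

lemma app_eq (f : X ⟶ Y) {U : Y.Opens} (s : Γ(Y, U)) :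
    (f.app U).hom s = (f.appLE U (f ⁻¹ᵁ U) le_rfl).hom s := by
  rw [Scheme.Hom.appLE_eq_app]

lemma ι_appLE_eq_rs (U : X.Opens) {V : X.Opens} {W : (U : Scheme.{u}).Opens} (e : W ≤ U.ι ⁻¹ᵁ V)
    (s : Γ(X, V)) : (U.ι.appLE V W e).hom s =
      rs (show U.ι ''ᵁ W ≤ V from Set.image_subset_iff.2 e) s :=
  congr(($(Scheme.Opens.ι_appLE U V W e)).hom s)

lemma appTop_eq (f : X ⟶ Y) (s : Γ(Y, ⊤)) :
    (f.appTop).hom s = (f.appLE ⊤ ⊤ f.preimage_top.ge).hom s :=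
  congr(($((f.appLE_eq_app (U := ⊤)).symm)).hom s)

lemma appLE_comp {Z : Scheme.{u}} (f : X ⟶ Y) (g : Y ⟶ Z) {U : Z.Opens} {V : Y.Opens} {W : X.Opens}
    (h : V ≤ g ⁻¹ᵁ U) (h' : W ≤ f ⁻¹ᵁ V) (s : Γ(Z, U)) :
    (f.appLE V W h').hom ((g.appLE U V h).hom s) =
      ((f ≫ g).appLE U W (h'.trans (f.preimage_mono h))).hom s :=
  congr(($(Scheme.Hom.appLE_comp_appLE f g U V W h h')).hom s)

lemma basicOpen_rs {U V : X.Opens} (h : V ≤ U) (s : Γ(X, U)) :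
    X.basicOpen (rs h s) = V ⊓ X.basicOpen s := X.basicOpen_res s (homOfLE h).op

lemma isUnit_rs_basicOpen {U : X.Opens} (s : Γ(X, U)) {V : X.Opens} (h : V ≤ X.basicOpen s) :
    IsUnit (rs (h.trans (X.basicOpen_le s)) s) := by
  rw [← rs_rs (X.basicOpen_le s) h]
  exact (RingedSpace.isUnit_res_basicOpen _ s).map _

lemma basicOpen_appTop (f : X ⟶ Y) (s : Γ(Y, ⊤)) :
    X.basicOpen (f.appTop.hom s) = f ⁻¹ᵁ Y.basicOpen s := by
  rw [appTop_eq]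
  exact (Scheme.basicOpen_appLE _ _ _ _ _).trans (top_inf_eq _)

lemma isUnit_of_basicOpen_eq_top {s : Γ(X, ⊤)} (h : X.basicOpen s = ⊤) : IsUnit s := by
  have := isUnit_rs_basicOpen s h.ge
  rwa [rs_self] at this

end Sections

/-! ### Homogeneous coordinates of morphisms to projective space. -/

section Rep

variable {X Y : Scheme.{u}} {m : ℕ}

/-- The morphism `f` to projective space is given by the homogeneous coordinates `v`. -/
structure Rep (f : X ⟶ ProjectiveSpaceInt.{u} m) (v : Fin (m + 1) → Γ(X, ⊤)) : Prop where
  preimage : ∀ j, f ⁻¹ᵁ chart m j = X.basicOpen (v j)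
  eq : ∀ i j, rs (le_top : f ⁻¹ᵁ chart m j ≤ ⊤) (v i) =
    (f.app (chart m j)).hom (ratio m i j) * rs (le_top : f ⁻¹ᵁ chart m j ≤ ⊤) (v j)

lemma Rep.of_le_preimage (f : X ⟶ ProjectiveSpaceInt.{u} m) (j : Fin (m + 1))
    (h : ⊤ ≤ f ⁻¹ᵁ chart m j) : Rep f fun i ↦ (f.appLE (chart m j) ⊤ h).hom (ratio m i j) := by
  constructor
  · intro k
    rw [Scheme.basicOpen_appLE, basicOpen_ratio, top_inf_eq]
    exact le_antisymm (fun x hx ↦ ⟨hx, h trivial⟩) fun x hx ↦ hx.1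
  · intro i k
    have hle : f ⁻¹ᵁ chart m k ≤ f ⁻¹ᵁ (chart m j ⊓ chart m k) := fun x hx ↦ ⟨h trivial, hx⟩
    have := congr((f.appLE (chart m j ⊓ chart m k) (f ⁻¹ᵁ chart m k) hle).hom
      $(ratio_mul_ratio i j k inf_le_left inf_le_right))
    erw [map_mul, appLE_rs, appLE_rs, appLE_rs] at this
    rw [rs_appLE, rs_appLE, app_eq]
    exact this.symm

lemma Rep.comp {f : X ⟶ ProjectiveSpaceInt.{u} m} {v : Fin (m + 1) → Γ(X, ⊤)} (h : Rep f v)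
    (g : Y ⟶ X) : Rep (g ≫ f) fun i ↦ g.appTop.hom (v i) := by
  constructor
  · intro j
    rw [basicOpen_appTop, ← h.preimage]
    rfl
  · intro i j
    have := congr((g.appLE (f ⁻¹ᵁ chart m j) ((g ≫ f) ⁻¹ᵁ chart m j)
      (Scheme.Hom.comp_preimage g f _).le).hom $(h.eq i j))
    rw [map_mul, appLE_rs, appLE_rs, app_eq, appLE_comp] at this
    rw [appTop_eq, appTop_eq, rs_appLE, rs_appLE, app_eq]
    exact this

lemma Rep.exists_mem {f : X ⟶ ProjectiveSpaceInt.{u} m} {v : Fin (m + 1) → Γ(X, ⊤)} (h : Rep f v)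
    (x : X) : ∃ j, x ∈ X.basicOpen (v j) := by
  obtain ⟨j, hj⟩ := exists_mem_chart (f x)
  exact ⟨j, by rw [← h.preimage]; exact hj⟩

lemma Rep.isUnit {f : X ⟶ ProjectiveSpaceInt.{u} m} {v : Fin (m + 1) → Γ(X, ⊤)} (h : Rep f v)
    (j : Fin (m + 1)) : IsUnit (rs (le_top : f ⁻¹ᵁ chart m j ≤ ⊤) (v j)) :=
  isUnit_rs_basicOpen (v j) (h.preimage j).le

/-- Both vectors are multiples of the same vector of ratios on each chart. Proportionality is
expressed by `2 × 2` minors throughout, so that no scalar factor has to be chosen globally. -/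
lemma Rep.mul_eq {f : X ⟶ ProjectiveSpaceInt.{u} m} {v w : Fin (m + 1) → Γ(X, ⊤)} (h : Rep f v)
    (h' : Rep f w) (i j : Fin (m + 1)) : v i * w j = v j * w i := by
  refine ext_of_local _ _ fun x _ ↦ ?_
  obtain ⟨k, hk⟩ := exists_mem_chart (f x)
  refine ⟨f ⁻¹ᵁ chart m k, le_top, hk, ?_⟩
  rw [map_mul, map_mul, h.eq i k, h.eq j k, h'.eq i k, h'.eq j k]
  ring

lemma Rep.of_mul_eq {f : X ⟶ ProjectiveSpaceInt.{u} m} {v w : Fin (m + 1) → Γ(X, ⊤)} (h : Rep f v)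
    (hw : ∀ i j, v i * w j = v j * w i) (hc : ∀ x : X, ∃ j, x ∈ X.basicOpen (w j)) : Rep f w := by
  -- If `a j` and `b k` are invertible at `x`, then so is `a k * b j`, hence `b j`.
  have key : ∀ (a b : Fin (m + 1) → Γ(X, ⊤)), (∀ i j, a i * b j = a j * b i) → (∀ x : X, ∃ j,
      x ∈ X.basicOpen (b j)) → ∀ j, X.basicOpen (a j) ≤ X.basicOpen (b j) := by
    intro a b hab hb j x hx
    obtain ⟨k, hk⟩ := hb x
    have : x ∈ X.basicOpen (a j * b k) := by rw [Scheme.basicOpen_mul]; exact ⟨hx, hk⟩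
    rw [hab, Scheme.basicOpen_mul] at this
    exact this.2
  constructor
  · intro j
    rw [h.preimage]
    exact le_antisymm (key v w hw hc j)
      (key w v (fun i j ↦ by rw [mul_comm, ← hw, mul_comm]) h.exists_mem j)
  · intro i j
    refine (h.isUnit j).mul_left_cancel ?_
    rw [← map_mul, hw, map_mul, h.eq i j, mul_left_comm, mul_assoc]
    

/-- Both morphisms factor through an affine chart, whose ring is generated by the ratios. -/
lemma hom_ext_of_le_preimage {f g : X ⟶ ProjectiveSpaceInt.{u} m} {j : Fin (m + 1)}
    (hf : ⊤ ≤ f ⁻¹ᵁ chart m j) (hg : ⊤ ≤ g ⁻¹ᵁ chart m j)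
    (h : ∀ i, (f.appLE (chart m j) ⊤ hf).hom (ratio m i j) =
      (g.appLE (chart m j) ⊤ hg).hom (ratio m i j)) : f = g := by
  have hr (k : X ⟶ ProjectiveSpaceInt.{u} m) (hk : ⊤ ≤ k ⁻¹ᵁ chart m j) :
      Set.range k ⊆ Set.range (chartι.{u} j) := by
    rintro _ ⟨x, rfl⟩
    have : k x ∈ (chartι.{u} j).opensRange := by
      rw [opensRange_chartι]; exact hk (x := x) trivial
    exact this
  have key : ∀ (a b : X ⟶ Spec (.of (HomogeneousLocalization.Away (grading.{u} m)
      (MvPolynomial.X j)))) (ha : ⊤ ≤ (a ≫ chartι j) ⁻¹ᵁ chart m j)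
      (hb : ⊤ ≤ (b ≫ chartι j) ⁻¹ᵁ chart m j),
      (∀ i, ((a ≫ chartι j).appLE (chart m j) ⊤ ha).hom (ratio m i j) =
      ((b ≫ chartι j).appLE (chart m j) ⊤ hb).hom (ratio m i j)) → a = b := by
    intro a b ha hb hab
    refine ext_of_isAffine ?_
    rw [← cancel_epi (Scheme.ΓSpecIso _).inv]
    ext1
    refine away_hom_ext fun i ↦ ?_
    have := hab i
    rw [← appLE_comp a _ (top_le_chartι_preimage j) le_top,
      ← appLE_comp b _ (top_le_chartι_preimage j) le_top, chartι_appLE_ratio,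
      ← appTop_eq, ← appTop_eq] at this
    exact this
  rw [← IsOpenImmersion.lift_fac (chartι j) f (hr f hf),
    ← IsOpenImmersion.lift_fac (chartι j) g (hr g hg)]
  congr 1
  refine key _ _ ?_ ?_ ?_ <;> simp only [IsOpenImmersion.lift_fac]
  exacts [hf, hg, h]

lemma hom_ext_of_local {f g : X ⟶ Y}
    (h : ∀ x : X, ∃ U : X.Opens, x ∈ U ∧ U.ι ≫ f = U.ι ≫ g) : f = g := by
  choose U hx hU using h
  exact Scheme.Cover.hom_ext (X.openCoverOfIsOpenCover U
    (.mk (eq_top_iff.2 fun x _ ↦ Opens.mem_iSup.2 ⟨x, hx x⟩))) _ _ hU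

lemma Rep.ext {f g : X ⟶ ProjectiveSpaceInt.{u} m} {v : Fin (m + 1) → Γ(X, ⊤)} (hf : Rep f v)
    (hg : Rep g v) : f = g := by
  refine hom_ext_of_local fun x ↦ ?_
  obtain ⟨j, hj⟩ := exists_mem_chart (f x)
  have e : f ⁻¹ᵁ chart m j = g ⁻¹ᵁ chart m j := (hf.preimage j).trans (hg.preimage j).symm
  refine ⟨f ⁻¹ᵁ chart m j, hj, ?_⟩
  have h1 : ⊤ ≤ ((f ⁻¹ᵁ chart m j).ι ≫ f) ⁻¹ᵁ chart m j := fun y _ ↦ y.2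
  have h2 : ⊤ ≤ ((f ⁻¹ᵁ chart m j).ι ≫ g) ⁻¹ᵁ chart m j := fun y _ ↦ e.le y.2
  refine hom_ext_of_le_preimage h1 h2 fun i ↦ ?_
  have a1 := (Rep.of_le_preimage _ _ h1).mul_eq (hf.comp _) i j
  have a2 := (Rep.of_le_preimage _ _ h2).mul_eq (hg.comp _) i j
  have b (k : X ⟶ ProjectiveSpaceInt.{u} m) (h : ⊤ ≤ ((f ⁻¹ᵁ chart m j).ι ≫ k) ⁻¹ᵁ chart m j) :
      (((f ⁻¹ᵁ chart m j).ι ≫ k).appLE (chart m j) ⊤ h).hom (ratio m j j) = 1 := by simp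
  rw [b, one_mul] at a1 a2
  have hu : IsUnit ((f ⁻¹ᵁ chart m j).ι.appTop.hom (v j)) := by
    refine isUnit_of_basicOpen_eq_top ?_
    rw [← (hf.comp _).preimage]
    exact top_le_iff.1 h1
  exact hu.mul_right_cancel (a1.trans a2.symm)

lemma exists_rep_of_isUnit (v : Fin (m + 1) → Γ(X, ⊤)) {j : Fin (m + 1)} (hv : IsUnit (v j)) :
    ∃ f : X ⟶ ProjectiveSpaceInt.{u} m, Rep f v := by
  let a := X.toSpecΓ ≫ Spec.map (CommRingCat.ofHom (awayLift.{u} v hv))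
  have hle : ⊤ ≤ (a ≫ chartι j) ⁻¹ᵁ chart m j := fun x _ ↦ top_le_chartι_preimage j trivial
  have h1 := Rep.of_le_preimage (a ≫ chartι j) j hle
  refine ⟨a ≫ chartι j, ?_⟩
  have h2 (i) : ((a ≫ chartι j).appLE (chart m j) ⊤ hle).hom (ratio m i j) * v j = v i := by
    rw [← awayLift_awayX v hv i, ← appLE_comp a _ (top_le_chartι_preimage j) le_top,
      chartι_appLE_ratio, ← appTop_eq]
    congr 1
    have : (Scheme.ΓSpecIso _).inv ≫ a.appTop = CommRingCat.ofHom (awayLift.{u} v hv) := by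
      simp [a]
    exact congr(($this).hom (awayX i j))
  refine h1.of_mul_eq (fun i k ↦ ?_) fun x ↦ ⟨j, ?_⟩
  · rw [← h2 i, ← h2 k]; ring
  · rw [Scheme.basicOpen_of_isUnit _ hv]; trivial

lemma exists_glue {ι : Type u} (U : ι → X.Opens) (hU : ∀ x : X, ∃ i, x ∈ U i)
    (f : ∀ i, (U i : Scheme.{u}) ⟶ Y)
    (h : ∀ i j, X.homOfLE (inf_le_left : U i ⊓ U j ≤ U i) ≫ f i =
      X.homOfLE (inf_le_right : U i ⊓ U j ≤ U j) ≫ f j) :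
    ∃ g : X ⟶ Y, ∀ i, (U i).ι ≫ g = f i := by
  let 𝒰 := X.openCoverOfIsOpenCover U
    (.mk (eq_top_iff.2 fun x _ ↦ Opens.mem_iSup.2 (hU x)))
  refine ⟨Scheme.Cover.glueMorphisms 𝒰 f fun i j ↦ ?_, fun i ↦ Scheme.Cover.ι_glueMorphisms 𝒰 f _ i⟩
  have hr : Set.range (pullback.fst (𝒰.f i) (𝒰.f j) ≫ (U i).ι) ⊆ Set.range (U i ⊓ U j).ι := by
    rintro _ ⟨x, rfl⟩
    rw [Scheme.Opens.range_ι]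
    refine ⟨(pullback.fst (𝒰.f i) (𝒰.f j) x).2, ?_⟩
    have : (pullback.fst (𝒰.f i) (𝒰.f j) ≫ (U i).ι) = pullback.snd (𝒰.f i) (𝒰.f j) ≫ (U j).ι :=
      pullback.condition
    rw [this]
    exact (pullback.snd (𝒰.f i) (𝒰.f j) x).2
  let k := IsOpenImmersion.lift (U i ⊓ U j).ι _ hr
  have hk : k ≫ (U i ⊓ U j).ι = _ := IsOpenImmersion.lift_fac _ _ hr
  have e1 : pullback.fst (𝒰.f i) (𝒰.f j) = k ≫ X.homOfLE inf_le_left := by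
    refine (cancel_mono (U i).ι).1 ?_
    rw [Category.assoc, X.homOfLE_ι]
    exact hk.symm
  have e2 : pullback.snd (𝒰.f i) (𝒰.f j) = k ≫ X.homOfLE inf_le_right := by
    refine (cancel_mono (U j).ι).1 ?_
    rw [Category.assoc, X.homOfLE_ι, hk]
    exact pullback.condition.symm
  rw [e1, e2]
  exact (Category.assoc _ _ _).trans (congr(k ≫ $(h i j)).trans (Category.assoc _ _ _).symm)

/-- Proportional coordinates on the overlaps describe the same morphism there, so the local
morphisms glue although the coordinate vectors themselves need not. -/
lemma Rep.glue {ι : Type u} (U : ι → X.Opens) (hU : ∀ x : X, ∃ i, x ∈ U i)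
    (v : ∀ i, Fin (m + 1) → Γ((U i : Scheme.{u}), ⊤))
    (hv : ∀ i, ∃ f : (U i : Scheme.{u}) ⟶ ProjectiveSpaceInt.{u} m, Rep f (v i))
    (h : ∀ i j a b, (X.homOfLE (inf_le_left : U i ⊓ U j ≤ U i)).appTop.hom (v i a) *
        (X.homOfLE (inf_le_right : U i ⊓ U j ≤ U j)).appTop.hom (v j b) =
      (X.homOfLE (inf_le_left : U i ⊓ U j ≤ U i)).appTop.hom (v i b) *
        (X.homOfLE (inf_le_right : U i ⊓ U j ≤ U j)).appTop.hom (v j a)) :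
    ∃ f : X ⟶ ProjectiveSpaceInt.{u} m, ∀ i, Rep ((U i).ι ≫ f) (v i) := by
  choose f hf using hv
  obtain ⟨g, hg⟩ := exists_glue U hU f fun i j ↦ by
    refine Rep.ext (v := fun a ↦ (X.homOfLE (inf_le_right : U i ⊓ U j ≤ U j)).appTop.hom (v j a))
      (((hf i).comp _).of_mul_eq (h i j) ((hf j).comp _).exists_mem) ((hf j).comp _)
  exact ⟨g, fun i ↦ by rw [hg]; exact hf i⟩

lemma Rep.of_local {f : X ⟶ ProjectiveSpaceInt.{u} m} {v : Fin (m + 1) → Γ(X, ⊤)}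
    (h : ∀ x : X, ∃ U : X.Opens, x ∈ U ∧ Rep (U.ι ≫ f) fun i ↦ U.ι.appTop.hom (v i)) : Rep f v := by
  constructor
  · intro j
    ext x
    obtain ⟨U, hxU, hU⟩ := h x
    have := hU.preimage j
    rw [basicOpen_appTop] at this
    exact iff_of_eq congr((⟨x, hxU⟩ : U) ∈ $this)
  · intro i j
    refine ext_of_local _ _ fun x hx ↦ ?_
    obtain ⟨U, hxU, hU⟩ := h x
    let W := (U.ι ≫ f) ⁻¹ᵁ chart m j
    have hW : U.ι ''ᵁ W ≤ f ⁻¹ᵁ chart m j := by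
      rintro _ ⟨y, hy, rfl⟩
      exact hy
    refine ⟨U.ι ''ᵁ W, hW, ⟨⟨x, hxU⟩, hx, rfl⟩, ?_⟩
    have h1 (w : Γ(X, ⊤)) : rs (le_top : W ≤ ⊤) (U.ι.appTop.hom w) =
        rs (le_top : U.ι ''ᵁ W ≤ ⊤) w := by
      rw [appTop_eq, rs_appLE, ι_appLE_eq_rs]
    have h2 : ((U.ι ≫ f).app (chart m j)).hom (ratio m i j) =
        rs hW ((f.app (chart m j)).hom (ratio m i j)) := by
      rw [app_eq, app_eq, ← appLE_comp U.ι f le_rfl (Scheme.Hom.comp_preimage _ _ _).le,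
        ι_appLE_eq_rs]
    have h3 := hU.eq i j
    rw [map_mul, rs_rs, rs_rs, ← h1, ← h1, ← h2]
    exact h3

/-- The universal property of projective space for the trivial line bundle: where `v j` is
invertible, the vector is mapped into the chart `D₊(xⱼ)`. -/
lemma exists_rep (v : Fin (m + 1) → Γ(X, ⊤)) (hv : ∀ x : X, ∃ j, x ∈ X.basicOpen (v j)) :
    ∃ f : X ⟶ ProjectiveSpaceInt.{u} m, Rep f v := by
  obtain ⟨f, hf⟩ := Rep.glue (ι := ULift (Fin (m + 1))) (fun j ↦ X.basicOpen (v j.down))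
    (fun x ↦ (hv x).elim fun j hj ↦ ⟨⟨j⟩, hj⟩)
    (fun j i ↦ (X.basicOpen (v j.down)).ι.appTop.hom (v i)) (fun j ↦ by
      refine exists_rep_of_isUnit _ (j := j.down) ?_
      refine isUnit_of_basicOpen_eq_top ?_
      rw [basicOpen_appTop]
      simp) (fun i j a b ↦ by
      simp only [← CommRingCat.comp_apply, ← Scheme.Hom.comp_appTop, Scheme.homOfLE_ι]
      rw [mul_comm])
  exact ⟨f, Rep.of_local fun x ↦ (hv x).elim fun j hj ↦ ⟨_, hj, hf ⟨j⟩⟩⟩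

end Rep

/-! ### Morphisms to affine schemes. -/

section Affine

/-- The canonical ring homomorphism from a ring to the functions on its spectrum. -/
def toΓ (D : Type u) [CommRing D] : D →+* Γ(Spec (.of D), ⊤) := (Scheme.ΓSpecIso (.of D)).inv.hom

lemma toΓ_bijective (D : Type u) [CommRing D] : Function.Bijective (toΓ D) :=
  ConcreteCategory.bijective_of_isIso (Scheme.ΓSpecIso (.of D)).inv

lemma toΓ_injective (D : Type u) [CommRing D] : Function.Injective (toΓ D) := (toΓ_bijective D).1

lemma basicOpen_toΓ {D : Type u} [CommRing D] (a : D) :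
    (Spec (.of D)).basicOpen (toΓ D a) = PrimeSpectrum.basicOpen a :=
  basicOpen_eq_of_affine (R := .of D) a

variable {Y B : Scheme.{u}} [IsAffine B]

/-- The morphism to an affine scheme attached to a homomorphism of rings of functions. -/
def toAffine (φ : Γ(B, ⊤) →+* Γ(Y, ⊤)) : Y ⟶ B :=
  Y.toSpecΓ ≫ Spec.map (CommRingCat.ofHom φ) ≫ B.isoSpec.inv

lemma toAffine_appTop (φ : Γ(B, ⊤) →+* Γ(Y, ⊤)) :
    (toAffine φ).appTop = CommRingCat.ofHom φ := by
  have h : B.isoSpec.inv.appTop = (Scheme.ΓSpecIso _).inv := by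
    have h1 : B.isoSpec.hom.appTop = (Scheme.ΓSpecIso _).hom := by
      rw [Scheme.isoSpec_hom, Scheme.toSpecΓ_appTop]
    have h2 : B.isoSpec.inv.appTop ≫ B.isoSpec.hom.appTop = 𝟙 _ := by
      rw [← Scheme.Hom.comp_appTop]; simp
    rw [← cancel_mono (Scheme.ΓSpecIso _).hom, ← h1, h2, h1]
    simp
  rw [toAffine, Scheme.Hom.comp_appTop, Scheme.Hom.comp_appTop, h, Scheme.toSpecΓ_appTop,
    Category.assoc, Scheme.ΓSpecIso_naturality]
  exact Iso.inv_hom_id_assoc (Scheme.ΓSpecIso _) _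

@[simp]
lemma toAffine_appTop_hom (φ : Γ(B, ⊤) →+* Γ(Y, ⊤)) : (toAffine φ).appTop.hom = φ :=
  congr(($(toAffine_appTop φ)).hom)

lemma hom_ext_of_appTop {f g : Y ⟶ B} (h : f.appTop.hom = g.appTop.hom) : f = g :=
  ext_of_isAffine (CommRingCat.hom_ext h)

lemma exists_hom_spec {D : Type u} [CommRing D] (φ : D →+* Γ(Y, ⊤)) :
    ∃ h : Y ⟶ Spec (.of D), ∀ a, h.appTop.hom (toΓ D a) = φ a := by
  refine ⟨toAffine (φ.comp (Scheme.ΓSpecIso (.of D)).hom.hom), fun a ↦ ?_⟩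
  rw [toAffine_appTop_hom]
  exact congr(φ ($((Scheme.ΓSpecIso (.of D)).inv_hom_id).hom a))

end Affine

/-! ### Homogeneous polynomials and rings for testing polynomial identities. -/

section Forms

lemma coeff_eval₂_X_mul_C {σ A : Type*} [CommRing A] (G : MvPolynomial σ A) (e : ℕ) :
    (G.eval₂ (Polynomial.C.comp MvPolynomial.C) (fun i ↦ Polynomial.X * Polynomial.C
      (MvPolynomial.X i))).coeff e = MvPolynomial.homogeneousComponent e G := by
  have h1 (n : ℕ) : (MvPolynomial.homogeneousComponent n G).eval₂
      (Polynomial.C.comp MvPolynomial.C) (fun i ↦ Polynomial.X * Polynomial.C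
      (MvPolynomial.X i)) = Polynomial.X ^ n * Polynomial.C
        (MvPolynomial.homogeneousComponent n G) := by
    rw [eval₂_smul_of_isHomogeneous (MvPolynomial.homogeneousComponent_isHomogeneous n G)]
    congr 1
    have := MvPolynomial.hom_eval₂ (MvPolynomial.homogeneousComponent n G) MvPolynomial.C
      (Polynomial.C (R := MvPolynomial σ A)) MvPolynomial.X
    rw [MvPolynomial.eval₂_eta] at this
    exact this.symm
  conv_lhs => rw [← MvPolynomial.sum_homogeneousComponent G]
  rw [MvPolynomial.eval₂_sum, Polynomial.finsetSum_coeff]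
  simp_rw [h1, Polynomial.coeff_X_pow_mul', Polynomial.coeff_C]
  by_cases he : e ∈ Finset.range (G.totalDegree + 1)
  · rw [Finset.sum_eq_single e]
    · simp
    · intro b _ hb
      split_ifs with h1 h2
      · omega
      · rfl
      · rfl
    · exact fun h ↦ (h he).elim
  · rw [MvPolynomial.homogeneousComponent_eq_zero _ _ (by simpa using he), Finset.sum_eq_zero]
    intro b hb
    simp only [Finset.mem_range] at hb he
    split_ifs with h1 h2
    · omega
    · rfl
    · rfl

/-- The coefficient of `T ^ d` in `G(T x)` is the component of degree `d`, and here it is `G`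
itself. -/
lemma isHomogeneous_of_eval₂_eq {σ A : Type*} [CommRing A] {G : MvPolynomial σ A} {d : ℕ}
    (h : G.eval₂ (Polynomial.C.comp MvPolynomial.C) (fun i ↦ Polynomial.X * Polynomial.C
      (MvPolynomial.X i)) = Polynomial.X ^ d * Polynomial.C G) : G.IsHomogeneous d := by
  have h0 := coeff_eval₂_X_mul_C G d
  rw [h] at h0
  simp only [Polynomial.coeff_X_pow_mul', Polynomial.coeff_C, le_refl, if_true, Nat.sub_self] at h0
  rw [h0]
  exact MvPolynomial.homogeneousComponent_isHomogeneous _ _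

variable {A : Type u} [CommRing A] {σ : Type}

/-- The localization of `A[x][T]` at `T x_l`, a nonzerodivisor over any `A`. In it `x` and `T x` are
both coordinates of one point, and comparing them detects homogeneity. -/
lemma exists_scaling_ring (l : σ) : ∃ (E : Type u) (_ : CommRing E)
    (ι : Polynomial (MvPolynomial σ A) →+* E), Function.Injective ι ∧ IsUnit (ι Polynomial.X) ∧
      IsUnit (ι (Polynomial.C (MvPolynomial.X l))) := by
  let c := Polynomial.X * Polynomial.C (MvPolynomial.X (R := A) l)
  have hu := IsLocalization.Away.algebraMap_isUnit (S := Localization.Away c) c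
  rw [map_mul] at hu
  obtain ⟨hu1, hu2⟩ := IsUnit.mul_iff.1 hu
  refine ⟨Localization.Away c, inferInstance, algebraMap _ _, ?_, hu1, hu2⟩
  refine IsLocalization.injective (M := .powers c) _ (Submonoid.powers_le.2 ?_)
  refine mul_mem Polynomial.monic_X.mem_nonZeroDivisors ?_
  refine mem_nonZeroDivisors_iff_right.2 fun p hp ↦ Polynomial.ext fun n ↦ ?_
  have := congr(($hp).coeff n)
  rw [Polynomial.coeff_mul_C, Polynomial.coeff_zero] at this
  exact MvPolynomial.isRegular_X.right.mul_right_eq_zero_iff.1 this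

/-- The product of the variables is a nonzerodivisor over any `A`. A polynomial identity can
therefore be checked at a single point all of whose coordinates are units. -/
lemma exists_torus_ring [Fintype σ] : ∃ (E : Type u) (_ : CommRing E) (ι : MvPolynomial σ A →+* E),
    Function.Injective ι ∧ ∀ i, IsUnit (ι (MvPolynomial.X i)) := by
  let c := ∏ i, MvPolynomial.X (R := A) (σ := σ) i
  have hu := IsLocalization.Away.algebraMap_isUnit (S := Localization.Away c) c
  refine ⟨Localization.Away c, inferInstance, algebraMap _ _, ?_, fun i ↦ ?_⟩
  · refine IsLocalization.injective (M := .powers c) _ (Submonoid.powers_le.2 ?_)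
    exact prod_mem fun i _ ↦ mem_nonZeroDivisors_iff_right.2 fun p hp ↦
      MvPolynomial.isRegular_X.right.mul_right_eq_zero_iff.1 hp
  · exact isUnit_of_dvd_unit (map_dvd _ (Finset.dvd_prod_of_mem _ (Finset.mem_univ i))) hu

lemma eval₂_toΓ {D R : Type u} [CommRing D] [CommRing R] (ι : R →+* D) (φ : A →+* R)
    (w : σ → R) (F : MvPolynomial σ A) :
    F.eval₂ ((toΓ D).comp (ι.comp φ)) (fun i ↦ toΓ D (ι (w i))) = toΓ D (ι (F.eval₂ φ w)) := by
  rw [MvPolynomial.hom_eval₂, MvPolynomial.hom_eval₂]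

end Forms

/-! ### Identifications of a scheme with projective space over a base. -/

section Coord

variable {B P : Scheme.{u}} {m : ℕ}

/-- The morphisms `π` and `f` identify `P` with the projective space over `B`. -/
structure IsCoord (π : P ⟶ B) (f : P ⟶ ProjectiveSpaceInt.{u} m) : Prop where
  isPullback : IsPullback π f (terminal.from B) (terminal.from (ProjectiveSpaceInt.{u} m))

namespace IsCoord

variable {π : P ⟶ B} {f : P ⟶ ProjectiveSpaceInt.{u} m}

lemma baseChange {B' P' : Scheme.{u}} (h : IsCoord π f) {a : P' ⟶ P} {π' : P' ⟶ B'} {b : B' ⟶ B}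
    (hp : IsPullback a π' π b) : IsCoord π' (a ≫ f) := by
  have := hp.paste_horiz h.isPullback.flip
  rw [show b ≫ terminal.from B = terminal.from B' from Subsingleton.elim _ _] at this
  exact ⟨this.flip⟩

lemma exists_hom (h : IsCoord π f) {Y : Scheme.{u}} (q : Y ⟶ B) (g : Y ⟶ ProjectiveSpaceInt.{u} m) :
    ∃ y : Y ⟶ P, y ≫ π = q ∧ y ≫ f = g :=
  ⟨h.isPullback.lift q g (Subsingleton.elim _ _), h.isPullback.lift_fst _ _ _,
    h.isPullback.lift_snd _ _ _⟩

lemma exists_point (h : IsCoord π f) {Y : Scheme.{u}} (q : Y ⟶ B) (v : Fin (m + 1) → Γ(Y, ⊤))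
    (hv : ∀ x : Y, ∃ j, x ∈ Y.basicOpen (v j)) : ∃ y : Y ⟶ P, y ≫ π = q ∧ Rep (y ≫ f) v := by
  obtain ⟨g, hg⟩ := exists_rep v hv
  obtain ⟨y, h1, rfl⟩ := h.exists_hom q g
  exact ⟨y, h1, hg⟩

lemma point_ext (h : IsCoord π f) {Y : Scheme.{u}} {y y' : Y ⟶ P} (hπ : y ≫ π = y' ≫ π)
    {v w : Fin (m + 1) → Γ(Y, ⊤)} (hv : Rep (y ≫ f) v) (hw : Rep (y' ≫ f) w)
    (hvw : ∀ i j, v i * w j = v j * w i) : y = y' :=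
  h.isPullback.hom_ext hπ (Rep.ext (hv.of_mul_eq hvw hw.exists_mem) hw)

lemma exists_spec_point [IsAffine B] (h : IsCoord π f) {D : Type u} [CommRing D]
    (φ : Γ(B, ⊤) →+* D) (v : Fin (m + 1) → D) (hv : Ideal.span (Set.range v) = ⊤) :
    ∃ y : Spec (.of D) ⟶ P, (y ≫ π).appTop.hom = (toΓ D).comp φ ∧
      Rep (y ≫ f) fun i ↦ toΓ D (v i) := by
  obtain ⟨y, h1, h2⟩ := h.exists_point (Y := Spec (.of D)) (toAffine ((toΓ D).comp φ))
    (fun i ↦ toΓ D (v i)) fun x ↦ by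
      by_contra! hx
      refine x.2.ne_top (top_le_iff.1 (hv ▸ Ideal.span_le.2 ?_))
      rintro _ ⟨i, rfl⟩
      have := hx i
      rw [basicOpen_toΓ] at this
      exact not_not.1 this
  exact ⟨y, by rw [h1, toAffine_appTop_hom], h2⟩

lemma exists_spec_point_of_isUnit [IsAffine B] (h : IsCoord π f) {D : Type u} [CommRing D]
    (φ : Γ(B, ⊤) →+* D) (v : Fin (m + 1) → D) {l : Fin (m + 1)} (hv : IsUnit (v l)) :
    ∃ y : Spec (.of D) ⟶ P, (y ≫ π).appTop.hom = (toΓ D).comp φ ∧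
      Rep (y ≫ f) fun i ↦ toΓ D (v i) :=
  h.exists_spec_point φ v (Ideal.eq_top_of_isUnit_mem _ (Ideal.subset_span ⟨l, rfl⟩) hv)

lemma top_le_preimage {Y : Scheme.{u}} {y : Y ⟶ P} {v : Fin (m + 1) → Γ(Y, ⊤)}
    (hv : Rep (y ≫ f) v) {l : Fin (m + 1)} (hl : IsUnit (v l)) :
    ⊤ ≤ y ⁻¹ᵁ f ⁻¹ᵁ chart m l := by
  rw [← Scheme.Hom.comp_preimage, hv.preimage, Scheme.basicOpen_of_isUnit _ hl]

lemma isUnit_of_top_le {Y : Scheme.{u}} {y : Y ⟶ P} {v : Fin (m + 1) → Γ(Y, ⊤)}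
    (hv : Rep (y ≫ f) v) {l : Fin (m + 1)} (hl : ⊤ ≤ y ⁻¹ᵁ f ⁻¹ᵁ chart m l) : IsUnit (v l) := by
  rw [← Scheme.Hom.comp_preimage, hv.preimage] at hl
  exact isUnit_of_basicOpen_eq_top (top_le_iff.1 hl)

/-- The universal point of the cone over `D₊(x_l)`. -/
lemma exists_cone_point [IsAffine B] (h : IsCoord π f) (l : Fin (m + 1)) (E : Type u) [CommRing E]
    [Algebra (MvPolynomial (Fin (m + 1)) Γ(B, ⊤)) E]
    [IsLocalization.Away (MvPolynomial.X (R := Γ(B, ⊤)) l) E] :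
    ∃ k : Spec (.of E) ⟶ P,
      Rep (k ≫ f) (fun i ↦ toΓ _ (algebraMap (MvPolynomial (Fin (m + 1)) Γ(B, ⊤)) E (MvPolynomial.X i))) ∧
      (k ≫ π).appTop.hom = (toΓ _).comp ((algebraMap (MvPolynomial (Fin (m + 1)) Γ(B, ⊤)) E).comp MvPolynomial.C) ∧
      ∀ {Y : Scheme.{u}} (y : Y ⟶ P) (v : Fin (m + 1) → Γ(Y, ⊤)), Rep (y ≫ f) v → IsUnit (v l) →
        ∃ s : Y ⟶ Spec (.of E),
          s ≫ k = y ∧ ∀ F : MvPolynomial (Fin (m + 1)) Γ(B, ⊤),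
            s.appTop.hom (toΓ _ (algebraMap (MvPolynomial (Fin (m + 1)) Γ(B, ⊤)) E F)) = F.eval₂ (y ≫ π).appTop.hom v := by
  obtain ⟨k, hk1, hk2⟩ := h.exists_spec_point_of_isUnit
    ((algebraMap (MvPolynomial (Fin (m + 1)) Γ(B, ⊤)) E).comp MvPolynomial.C)
    (fun i ↦ algebraMap (MvPolynomial (Fin (m + 1)) Γ(B, ⊤)) E (MvPolynomial.X i)) (l := l) (IsLocalization.Away.algebraMap_isUnit _)
  refine ⟨k, hk2, hk1, fun {Y} y v hv hl ↦ ?_⟩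
  obtain ⟨s, hs⟩ := exists_hom_spec (D := E)
    (IsLocalization.Away.lift (MvPolynomial.X l)
      (g := MvPolynomial.eval₂Hom (y ≫ π).appTop.hom v) (by simpa using hl))
  have hs' (F : MvPolynomial (Fin (m + 1)) Γ(B, ⊤)) :
      s.appTop.hom (toΓ _ (algebraMap (MvPolynomial (Fin (m + 1)) Γ(B, ⊤)) E F)) = F.eval₂ (y ≫ π).appTop.hom v :=
    (hs _).trans (IsLocalization.Away.lift_eq _ _ _)
  refine ⟨s, ?_, hs'⟩
  have h2 := hk2.comp s
  rw [← Category.assoc] at h2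
  refine h.point_ext ?_ h2 hv fun i j ↦ ?_
  · refine hom_ext_of_appTop ?_
    ext a
    rw [Category.assoc, Scheme.Hom.comp_appTop, CommRingCat.hom_comp, hk1]
    exact (hs' (MvPolynomial.C a)).trans (MvPolynomial.eval₂_C _ _ _)
  · rw [hs', hs', MvPolynomial.eval₂_X, MvPolynomial.eval₂_X, mul_comm]

/-- The points with coordinates `x` and `T x` coincide because the coordinates are proportional. -/
lemma exists_scaled_point [IsAffine B] (h : IsCoord π f) (l : Fin (m + 1)) :
    ∃ (E : Type u) (_ : CommRing E)
      (ι : Polynomial (MvPolynomial (Fin (m + 1)) Γ(B, ⊤)) →+* E) (y : Spec (.of E) ⟶ P),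
      Function.Injective ι ∧ IsUnit (ι (Polynomial.C (MvPolynomial.X l))) ∧
      (y ≫ π).appTop.hom = (toΓ E).comp (ι.comp (Polynomial.C.comp MvPolynomial.C)) ∧
      Rep (y ≫ f) (fun i ↦ toΓ E (ι (Polynomial.C (MvPolynomial.X i)))) ∧
      Rep (y ≫ f) fun i ↦ toΓ E (ι (Polynomial.X * Polynomial.C (MvPolynomial.X i))) := by
  obtain ⟨E, _, ι, hι, hu1, hu2⟩ := exists_scaling_ring (A := Γ(B, ⊤)) l
  obtain ⟨y1, hy1, hy1'⟩ := h.exists_spec_point_of_isUnit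
    (ι.comp (Polynomial.C.comp MvPolynomial.C))
    (fun i ↦ ι (Polynomial.C (MvPolynomial.X i))) hu2
  obtain ⟨y2, hy2, hy2'⟩ := h.exists_spec_point_of_isUnit
    (ι.comp (Polynomial.C.comp MvPolynomial.C))
    (fun i ↦ ι (Polynomial.X * Polynomial.C (MvPolynomial.X i))) (l := l)
    (by rw [map_mul]; exact hu1.mul hu2)
  obtain rfl : y1 = y2 := h.point_ext (hom_ext_of_appTop (hy1.trans hy2.symm)) hy1' hy2'
    fun i j ↦ by simp only [map_mul]; ring
  exact ⟨E, _, ι, y1, hι, hu2, hy1, hy1', hy2'⟩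

lemma exists_torus_point [IsAffine B] (h : IsCoord π f) :
    ∃ (E : Type u) (_ : CommRing E)
      (ι : MvPolynomial (Fin (m + 1)) Γ(B, ⊤) →+* E) (y : Spec (.of E) ⟶ P),
      Function.Injective ι ∧ (∀ i, IsUnit (ι (MvPolynomial.X i))) ∧
      (y ≫ π).appTop.hom = (toΓ E).comp (ι.comp MvPolynomial.C) ∧
      Rep (y ≫ f) fun i ↦ toΓ E (ι (MvPolynomial.X i)) := by
  obtain ⟨E, _, ι, hι, hu⟩ := exists_torus_ring (A := Γ(B, ⊤)) (σ := Fin (m + 1))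
  obtain ⟨y, hy, hy'⟩ := h.exists_spec_point_of_isUnit (ι.comp MvPolynomial.C)
    (fun i ↦ ι (MvPolynomial.X i)) (hu 0)
  exact ⟨E, _, ι, y, hι, hu, hy, hy'⟩

lemma exists_form_aux [IsAffine B] (h : IsCoord π f) (l : Fin (m + 1)) (E : Type u) [CommRing E]
    [Algebra (MvPolynomial (Fin (m + 1)) Γ(B, ⊤)) E]
    [IsLocalization.Away (MvPolynomial.X (R := Γ(B, ⊤)) l) E]
    (g : Γ(P, f ⁻¹ᵁ chart m l)) :
    ∃ (d : ℕ) (G : MvPolynomial (Fin (m + 1)) Γ(B, ⊤)), G.IsHomogeneous d ∧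
      ∀ {Y : Scheme.{u}} (y : Y ⟶ P) (v : Fin (m + 1) → Γ(Y, ⊤)), Rep (y ≫ f) v →
        ∀ hy : ⊤ ≤ y ⁻¹ᵁ f ⁻¹ᵁ chart m l,
          (y.appLE (f ⁻¹ᵁ chart m l) ⊤ hy).hom g * v l ^ d = G.eval₂ (y ≫ π).appTop.hom v := by
  obtain ⟨k, hk1, hk2, hk3⟩ := h.exists_cone_point l E
  have hkl : IsUnit (toΓ _ (algebraMap (MvPolynomial (Fin (m + 1)) Γ(B, ⊤)) E (MvPolynomial.X l))) :=
    (IsLocalization.Away.algebraMap_isUnit (S := E)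
      (MvPolynomial.X (R := Γ(B, ⊤)) l)).map (toΓ _)
  have hk := top_le_preimage hk1 hkl
  -- At the universal point of the cone, `g` becomes a fraction `G / x_l ^ d`. Every other point
  -- factors through this one, so the formula persists.
  obtain ⟨γ, hγ⟩ := (toΓ_bijective E).2
    ((k.appLE (f ⁻¹ᵁ chart m l) ⊤ hk).hom g)
  obtain ⟨d, G, hG⟩ := IsLocalization.Away.surj (S := E)
    (MvPolynomial.X (R := Γ(B, ⊤)) l) γ
  have main : ∀ {Y : Scheme.{u}} (y : Y ⟶ P) (v : Fin (m + 1) → Γ(Y, ⊤)), Rep (y ≫ f) v →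
        ∀ hy : ⊤ ≤ y ⁻¹ᵁ f ⁻¹ᵁ chart m l,
          (y.appLE (f ⁻¹ᵁ chart m l) ⊤ hy).hom g * v l ^ d = G.eval₂ (y ≫ π).appTop.hom v := by
    intro Y y v hv hy
    obtain ⟨s, rfl, hs⟩ := hk3 y v hv (isUnit_of_top_le hv hy)
    have h1 := congr(s.appTop.hom (toΓ _ $hG))
    rw [map_mul, map_mul, hγ, map_pow, map_pow, appTop_eq, appLE_comp] at h1
    have h2 := hs (MvPolynomial.X l)
    rw [MvPolynomial.eval₂_X] at h2
    rw [← hs, ← h2]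
    exact h1
  -- The value of `g` depends only on the point and not on its coordinates; comparing `x` with `T x`
  -- gives `G(T x) = T ^ d G(x)`.
  refine ⟨d, G, isHomogeneous_of_eval₂_eq ?_, main⟩
  obtain ⟨E', _, ι, y, hι, hu2, hy1, hy1', hy2'⟩ := h.exists_scaled_point l
  have hy := top_le_preimage hy1' (hu2.map (toΓ _))
  have e1 := main _ _ hy1' hy
  have e2 := main _ _ hy2' hy
  rw [map_mul, map_mul, mul_pow, mul_left_comm, e1, hy1] at e2
  rw [eval₂_toΓ ι _ fun i ↦ Polynomial.C (MvPolynomial.X i),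
    eval₂_toΓ ι _ fun i ↦ Polynomial.X * Polynomial.C (MvPolynomial.X i), ← map_pow, ← map_pow, ← map_mul, ← map_mul] at e2
  have e4 := hι (toΓ_injective _ e2)
  rw [← e4]
  congr 1
  have := MvPolynomial.hom_eval₂ G MvPolynomial.C
    (Polynomial.C (R := MvPolynomial (Fin (m + 1)) Γ(B, ⊤))) MvPolynomial.X
  rw [MvPolynomial.eval₂_eta] at this
  exact this.symm

/-- A function on the chart `D₊(x_l)` is a quotient of a homogeneous form by a power of `x_l`. -/
lemma exists_form [IsAffine B] (h : IsCoord π f) (l : Fin (m + 1))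
    (g : Γ(P, f ⁻¹ᵁ chart m l)) :
    ∃ (d : ℕ) (G : MvPolynomial (Fin (m + 1)) Γ(B, ⊤)), G.IsHomogeneous d ∧
      ∀ {Y : Scheme.{u}} (y : Y ⟶ P) (v : Fin (m + 1) → Γ(Y, ⊤)), Rep (y ≫ f) v →
        ∀ hy : ⊤ ≤ y ⁻¹ᵁ f ⁻¹ᵁ chart m l,
          (y.appLE (f ⁻¹ᵁ chart m l) ⊤ hy).hom g * v l ^ d = G.eval₂ (y ≫ π).appTop.hom v :=
  h.exists_form_aux l (Localization.Away (MvPolynomial.X (R := Γ(B, ⊤)) l)) g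

end IsCoord

end Coord

/-! ### Vectors without common prime factor over a factorial ring. -/

section Factorial

/-- The members of the family have no common prime factor. -/
structure IsPrimitive {ι R : Type*} [CommRing R] (F : ι → R) : Prop where
  exists_ne_zero : ∃ i, F i ≠ 0
  exists_not_dvd : ∀ p, Prime p → ∃ i, ¬ p ∣ F i

/-- Induction on the prime factors of `a`: each prime misses some `F i`, so it must divide the
cofactor. -/
lemma IsPrimitive.dvd {ι R : Type*} [CommRing R] [IsDomain R] [UniqueFactorizationMonoid R]
    {F : ι → R} (hF : IsPrimitive F) (a : R) : ∀ s : R, (∀ i, a ∣ s * F i) → a ∣ s := by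
  induction a using UniqueFactorizationMonoid.induction_on_prime with
  | h₁ =>
    intro s hs
    obtain ⟨i, hi⟩ := hF.exists_ne_zero
    have := (mul_eq_zero.1 (zero_dvd_iff.1 (hs i))).resolve_right hi
    rw [this]
  | h₂ x hx => exact fun s _ ↦ hx.dvd
  | h₃ a p ha hp ih =>
    intro s hs
    obtain ⟨t, rfl⟩ := ih s fun i ↦ (dvd_mul_left _ _).trans (hs i)
    obtain ⟨i, hi⟩ := hF.exists_not_dvd p hp
    have h1 : a * p ∣ a * (t * F i) := by
      rw [mul_comm a p, ← mul_assoc]; exact hs i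
    have h2 := (hp.dvd_or_dvd ((mul_dvd_mul_iff_left ha).1 h1)).resolve_right hi
    rw [mul_comm p a]
    exact mul_dvd_mul_left a h2

/-- Clear denominators and divide by the greatest common divisor. -/
lemma exists_isPrimitive {ι R K : Type*} [Finite ι] [CommRing R] [IsDomain R]
    [UniqueFactorizationMonoid R] [Field K] [Algebra R K] [IsFractionRing R K] (ρ : ι → K)
    (hρ : ∃ i, ρ i ≠ 0) : ∃ F : ι → R, IsPrimitive F ∧
      ∀ i j, ρ i * algebraMap R K (F j) = ρ j * algebraMap R K (F i) := by
  classical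
  have := Fintype.ofFinite ι
  obtain ⟨b, hb⟩ := IsLocalization.exist_integer_multiples_of_finite (nonZeroDivisors R) ρ
  choose F hF using hb
  let : NormalizationMonoid R := Classical.arbitrary _
  let : NormalizedGCDMonoid R := UniqueFactorizationMonoid.toNormalizedGCDMonoid R
  obtain ⟨i₀, hi₀⟩ := hρ
  obtain ⟨G, hG, hG1⟩ := Finset.univ.extract_gcd F ⟨i₀, Finset.mem_univ _⟩
  have hb0 : algebraMap R K b ≠ 0 := by
    simp
  have hF0 : F i₀ ≠ 0 := by
    intro h
    have := hF i₀
    rw [h, map_zero, Algebra.smul_def] at this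
    exact hi₀ ((mul_eq_zero.1 this.symm).resolve_left hb0)
  have hc : Finset.univ.gcd F ≠ 0 := fun h ↦ hF0 (Finset.gcd_eq_zero_iff.1 h i₀ (Finset.mem_univ _))
  refine ⟨G, ⟨⟨i₀, fun h ↦ hF0 ?_⟩, fun p hp ↦ ?_⟩, fun i j ↦ ?_⟩
  · rw [hG i₀ (Finset.mem_univ _), h, mul_zero]
  · by_contra! h
    have := Finset.dvd_gcd (s := Finset.univ) (f := G) fun i _ ↦ h i
    rw [hG1] at this
    exact hp.not_isUnit (isUnit_of_dvd_one this)
  · have h1 (i) : algebraMap R K b * ρ i = algebraMap R K (Finset.univ.gcd F) *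
        algebraMap R K (G i) := by
      rw [← map_mul, ← hG i (Finset.mem_univ _), hF, Algebra.smul_def]
    have hc' : algebraMap R K (Finset.univ.gcd F) ≠ 0 := by simpa using hc
    refine mul_left_cancel₀ (mul_ne_zero hb0 hc') ?_
    linear_combination (algebraMap R K (Finset.univ.gcd F) * algebraMap R K (G j)) * h1 i -
      (algebraMap R K (Finset.univ.gcd F) * algebraMap R K (G i)) * h1 j

/-- The hypothesis says that the components of degree `e` form a vector proportional to `F`. By
primitivity `F j` divides its own component of degree `e`, and comparing degrees leaves only `e = (F
j).totalDegree`. -/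
lemma IsPrimitive.isHomogeneous {ι σ A : Type*} [CommRing A] [IsDomain A]
    [UniqueFactorizationMonoid A] {F : ι → MvPolynomial σ A} (hF : IsPrimitive F)
    (h : ∀ i j e, MvPolynomial.homogeneousComponent e (F i) * F j =
      MvPolynomial.homogeneousComponent e (F j) * F i) : ∃ d, ∀ i, (F i).IsHomogeneous d := by
  have h1 (j) (hj : F j ≠ 0) (e) (he : MvPolynomial.homogeneousComponent e (F j) ≠ 0) :
      e = (F j).totalDegree := by
    obtain ⟨c, hc⟩ := hF.dvd (F j) (MvPolynomial.homogeneousComponent e (F j)) fun i ↦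
      ⟨MvPolynomial.homogeneousComponent e (F i), by rw [← h i j, mul_comm]⟩
    have hc0 : c ≠ 0 := by rintro rfl; simp [he] at hc
    have h2 := (MvPolynomial.homogeneousComponent_isHomogeneous e (F j)).totalDegree he
    rw [hc, MvPolynomial.totalDegree_mul_of_isDomain hj hc0] at h2
    refine le_antisymm ?_ (by omega)
    by_contra! hlt
    exact he (MvPolynomial.homogeneousComponent_eq_zero _ _ hlt)
  have h2 (j) (hj : F j ≠ 0) :
      MvPolynomial.homogeneousComponent (F j).totalDegree (F j) = F j := by
    conv_rhs => rw [← MvPolynomial.sum_homogeneousComponent (F j)]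
    rw [Finset.sum_eq_single (F j).totalDegree]
    · intro e _ he
      by_contra! hne
      exact he (h1 j hj e hne)
    · simp
  obtain ⟨i, hi⟩ := hF.exists_ne_zero
  refine ⟨(F i).totalDegree, fun j ↦ ?_⟩
  by_cases hj : F j = 0
  · rw [hj]; exact MvPolynomial.isHomogeneous_zero _ _ _
  · have h3 := h i j (F i).totalDegree
    rw [h2 i hi, mul_comm] at h3
    rw [mul_right_cancel₀ hi h3]
    exact MvPolynomial.homogeneousComponent_isHomogeneous _ _

end Factorial

/-! ### Morphisms between projective spaces over a factorial base. -/

section Factorial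

variable {m n : ℕ}

/-- Every point specializes to the closed point, so a chart containing the image of the closed point
contains the whole image. -/
lemma exists_rep_of_isLocalRing {D : Type u} [CommRing D] [IsLocalRing D]
    (g : Spec (.of D) ⟶ ProjectiveSpaceInt.{u} m) :
    ∃ (r : Fin (m + 1) → D) (j : Fin (m + 1)), r j = 1 ∧ Rep g fun i ↦ toΓ D (r i) := by
  obtain ⟨j, hj⟩ := exists_mem_chart (g (IsLocalRing.closedPoint D))
  have hle : ⊤ ≤ g ⁻¹ᵁ chart m j := by
    intro x _
    exact ((IsLocalRing.specializes_closedPoint x).map g.continuous).mem_open (chart m j).2 hj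
  choose r hr using fun i ↦ (toΓ_bijective D).2 ((g.appLE (chart m j) ⊤ hle).hom (ratio m i j))
  refine ⟨r, j, toΓ_injective D ?_, ?_⟩
  · rw [hr, ratio_self, map_one, map_one]
  · simp_rw [hr]
    exact Rep.of_le_preimage g j hle

lemma spec_map_toΓ {D E : Type u} [CommRing D] [CommRing E] (φ : D →+* E) (a : D) :
    (Spec.map (CommRingCat.ofHom φ)).appTop.hom (toΓ D a) = toΓ E (φ a) :=
  congr(($((Scheme.ΓSpecIso_inv_naturality (CommRingCat.ofHom φ)).symm)).hom a)

lemma Rep.mul_eq_of_spec {D : Type u} [CommRing D] {g : Spec (.of D) ⟶ ProjectiveSpaceInt.{u} m}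
    {v w : Fin (m + 1) → D} (hv : Rep g fun i ↦ toΓ D (v i))
    (hw : Rep g fun i ↦ toΓ D (w i)) (i j : Fin (m + 1)) : v i * w j = v j * w i := by
  refine toΓ_injective D ?_
  rw [map_mul, map_mul]
  exact hv.mul_eq hw i j

lemma Rep.of_mul_eq_spec {D : Type u} [CommRing D] {g : Spec (.of D) ⟶ ProjectiveSpaceInt.{u} m}
    {v w : Fin (m + 1) → D} (hv : Rep g fun i ↦ toΓ D (v i))
    (h : ∀ i j, v i * w j = v j * w i) {l : Fin (m + 1)} (hl : IsUnit (w l)) :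
    Rep g fun i ↦ toΓ D (w i) := by
  refine hv.of_mul_eq (fun i j ↦ ?_) fun x ↦ ⟨l, ?_⟩
  · rw [← map_mul, ← map_mul, h]
  · rw [Scheme.basicOpen_of_isUnit _ (hl.map _)]; trivial

variable {B P : Scheme.{u}} [IsAffine B] {π : P ⟶ B} {f : P ⟶ ProjectiveSpaceInt.{u} m}

lemma IsCoord.spec_map_comp (h : IsCoord π f) {D E : Type u} [CommRing D] [CommRing E]
    {φ : Γ(B, ⊤) →+* D} {φ' : Γ(B, ⊤) →+* E} {v : Fin (m + 1) → D} {w : Fin (m + 1) → E}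
    {y : Spec (.of D) ⟶ P} {y' : Spec (.of E) ⟶ P}
    (h1 : (y ≫ π).appTop.hom = (toΓ D).comp φ) (h2 : Rep (y ≫ f) fun i ↦ toΓ D (v i))
    (h1' : (y' ≫ π).appTop.hom = (toΓ E).comp φ') (h2' : Rep (y' ≫ f) fun i ↦ toΓ E (w i))
    (ψ : D →+* E) (hφ : ∀ a, ψ (φ a) = φ' a) (hv : ∀ i, ψ (v i) = w i) :
    Spec.map (CommRingCat.ofHom ψ) ≫ y = y' := by
  have h3 := h2.comp (Spec.map (CommRingCat.ofHom ψ))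
  rw [← Category.assoc] at h3
  simp_rw [spec_map_toΓ, hv] at h3
  refine h.point_ext (hom_ext_of_appTop ?_) h3 h2' fun i j ↦ mul_comm _ _
  ext a
  rw [Category.assoc, Scheme.Hom.comp_appTop, CommRingCat.hom_comp, h1, h1']
  exact (spec_map_toΓ ψ _).trans congr(toΓ E $(hφ a))

instance isSeparated_projectiveSpaceInt : (ProjectiveSpaceInt.{u} m).IsSeparated :=
  inferInstanceAs (Proj (grading.{u} m)).IsSeparated

section

variable [IsDomain Γ(B, ⊤)] [UniqueFactorizationMonoid Γ(B, ⊤)]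
  (h : IsCoord π f) (g : P ⟶ ProjectiveSpaceInt.{u} n) {K : Type u} [Field K]
  [Algebra (MvPolynomial (Fin (m + 1)) Γ(B, ⊤)) K]
  [IsFractionRing (MvPolynomial (Fin (m + 1)) Γ(B, ⊤)) K] {ξ : Spec (.of K) ⟶ P}
  (h1 : (ξ ≫ π).appTop.hom = (toΓ K).comp
    ((algebraMap (MvPolynomial (Fin (m + 1)) Γ(B, ⊤)) K).comp MvPolynomial.C))
  (h2 : Rep (ξ ≫ f) fun i ↦ toΓ K (algebraMap _ K (MvPolynomial.X (R := Γ(B, ⊤)) i)))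
  {F : Fin (n + 1) → MvPolynomial (Fin (m + 1)) Γ(B, ⊤)} (hF : IsPrimitive F)
  (hξ : Rep (ξ ≫ g) fun i ↦ toΓ K (algebraMap _ K (F i)))

include h h1 h2 hF hξ

/-- The polynomials `F` have no common zero on the cone minus its vertex. In the local ring at `q`
the morphism has coordinates `r` with `r j = 1`, so generically `F i = r i * F j`. Clearing
denominators by some `s ∉ q` shows that `F j` divides all `s * F i`, hence `s` by primitivity, and
therefore `F j ∉ q`. -/
lemma exists_notMem_of_isPrimitive (q : Ideal (MvPolynomial (Fin (m + 1)) Γ(B, ⊤))) [q.IsPrime]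
    {l : Fin (m + 1)} (hq : MvPolynomial.X l ∉ q) (D : Type u) [CommRing D]
    [Algebra (MvPolynomial (Fin (m + 1)) Γ(B, ⊤)) D] [IsLocalization.AtPrime D q] :
    ∃ j, F j ∉ q := by
  have : IsLocalRing D := IsLocalization.AtPrime.isLocalRing D q
  let α := algebraMap (MvPolynomial (Fin (m + 1)) Γ(B, ⊤)) D
  let β := algebraMap (MvPolynomial (Fin (m + 1)) Γ(B, ⊤)) K
  have hβ : Function.Injective β := IsFractionRing.injective _ _
  let κ : D →+* K := IsLocalization.lift (M := q.primeCompl) (g := β) fun s ↦ by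
    refine (map_ne_zero_iff β hβ).2 ?_ |>.isUnit
    exact fun h ↦ s.2 (h ▸ q.zero_mem)
  have hκ (a) : κ (α a) = β a := IsLocalization.lift_eq _ _
  obtain ⟨η, hη1, hη2⟩ := h.exists_spec_point_of_isUnit (α.comp MvPolynomial.C)
    (fun i ↦ α (MvPolynomial.X i)) (l := l)
    (IsLocalization.map_units (M := q.primeCompl) D ⟨MvPolynomial.X l, hq⟩)
  have hs := h.spec_map_comp hη1 hη2 h1 h2 κ (fun a ↦ hκ _) fun i ↦ hκ _
  obtain ⟨r, j, hj, hr⟩ := exists_rep_of_isLocalRing (η ≫ g)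
  have hr' := hr.comp (Spec.map (CommRingCat.ofHom κ))
  rw [← Category.assoc, hs] at hr'
  simp_rw [spec_map_toΓ] at hr'
  have e (i) := hr'.mul_eq_of_spec hξ i j
  rw [hj, map_one] at e
  obtain ⟨s, hs⟩ := IsLocalization.exist_integer_multiples_of_finite q.primeCompl r
  choose N hN using hs
  refine ⟨j, fun hjq ↦ s.2 ?_⟩
  refine q.mem_of_dvd (hF.dvd (F j) s fun i ↦ ⟨N i, hβ ?_⟩) hjq
  have h3 := congr(κ $(hN i))
  rw [Algebra.smul_def, map_mul] at h3
  erw [hκ, hκ] at h3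
  rw [map_mul, map_mul]
  erw [h3]
  linear_combination (β s) * -e i

/-- Without common zeros, `F` defines a morphism `g'` on the cone point. It agrees with `k ≫ g` at
the generic point, which is dense in a reduced scheme, and the target is separated. -/
lemma rep_cone_point {l : Fin (m + 1)} (E : Type u) [CommRing E]
    [Algebra (MvPolynomial (Fin (m + 1)) Γ(B, ⊤)) E]
    [IsLocalization.Away (MvPolynomial.X (R := Γ(B, ⊤)) l) E] {k : Spec (.of E) ⟶ P}
    (hk : (k ≫ π).appTop.hom = (toΓ _).comp
      ((algebraMap (MvPolynomial (Fin (m + 1)) Γ(B, ⊤)) E).comp MvPolynomial.C))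
    (hk' : Rep (k ≫ f) fun i ↦ toΓ E (algebraMap _ E (MvPolynomial.X (R := Γ(B, ⊤)) i))) :
    Rep (k ≫ g) fun i ↦ toΓ E (algebraMap _ E (F i)) := by
  let α := algebraMap (MvPolynomial (Fin (m + 1)) Γ(B, ⊤)) E
  let β := algebraMap (MvPolynomial (Fin (m + 1)) Γ(B, ⊤)) K
  have hβ : Function.Injective β := IsFractionRing.injective _ _
  have hXl : MvPolynomial.X (R := Γ(B, ⊤)) l ≠ 0 := MvPolynomial.X_ne_zero l
  have hpow : Submonoid.powers (MvPolynomial.X (R := Γ(B, ⊤)) l) ≤ nonZeroDivisors _ :=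
    Submonoid.powers_le.2 (mem_nonZeroDivisors_of_ne_zero hXl)
  have : IsDomain E := IsLocalization.isDomain_of_le_nonZeroDivisors _ hpow
  let κ : E →+* K := IsLocalization.Away.lift (MvPolynomial.X (R := Γ(B, ⊤)) l) (g := β)
    ((map_ne_zero_iff β hβ).2 hXl).isUnit
  have hκ (a) : κ (α a) = β a := IsLocalization.Away.lift_eq _ _ _
  have hκi : Function.Injective κ := by
    refine (injective_iff_map_eq_zero κ).2 fun a ha ↦ ?_
    obtain ⟨d, G, hG⟩ := IsLocalization.Away.surj (MvPolynomial.X (R := Γ(B, ⊤)) l) a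
    have := congr(κ $hG)
    rw [map_mul, ha, zero_mul] at this
    erw [hκ] at this
    rw [hβ (this.symm.trans (map_zero β).symm), map_zero] at hG
    exact ((IsLocalization.Away.algebraMap_isUnit (S := E)
      (MvPolynomial.X (R := Γ(B, ⊤)) l)).pow d).mul_left_eq_zero.1 hG
  have hs := h.spec_map_comp hk hk' h1 h2 κ (fun a ↦ hκ _) fun i ↦ hκ _
  obtain ⟨g', hg'⟩ := exists_rep (X := Spec (.of E)) (fun i ↦ toΓ E (α (F i))) fun x ↦ by
    let q : Ideal (MvPolynomial (Fin (m + 1)) Γ(B, ⊤)) := (PrimeSpectrum.comap α x).asIdeal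
    have : q.IsPrime := (PrimeSpectrum.comap α x).2
    obtain ⟨j, hj⟩ := exists_notMem_of_isPrimitive h g h1 h2 hF hξ q (l := l)
      (fun hl ↦ x.2.ne_top (Ideal.eq_top_of_isUnit_mem _ hl
        (IsLocalization.Away.algebraMap_isUnit _))) (Localization.AtPrime q)
    refine ⟨j, ?_⟩
    rw [basicOpen_toΓ]
    exact hj
  have hd : IsDominant (Spec.map (CommRingCat.ofHom κ)) := by
    refine ⟨(PrimeSpectrum.denseRange_comap_iff_ker_le_nilRadical κ).2 ?_⟩
    rw [(RingHom.injective_iff_ker_eq_bot κ).1 hκi]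
    exact bot_le
  have hred : IsReduced (Spec (.of E)) := inferInstance
  suffices k ≫ g = g' by rw [this]; exact hg'
  refine ext_of_isDominant (Spec.map (CommRingCat.ofHom κ)) ?_
  rw [← Category.assoc, hs]
  refine hξ.ext ?_
  have := hg'.comp (Spec.map (CommRingCat.ofHom κ))
  simp_rw [spec_map_toΓ] at this
  erw [funext fun i ↦ congr(toΓ K $(hκ (F i)))] at this
  exact this

end

lemma IsCoord.rep_eval₂_of_cone_point (h : IsCoord π f) (g : P ⟶ ProjectiveSpaceInt.{u} n)
    (F : Fin (n + 1) → MvPolynomial (Fin (m + 1)) Γ(B, ⊤))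
    (hF : ∀ (l : Fin (m + 1)) (E : Type u) [CommRing E]
      [Algebra (MvPolynomial (Fin (m + 1)) Γ(B, ⊤)) E]
      [IsLocalization.Away (MvPolynomial.X (R := Γ(B, ⊤)) l) E] (k : Spec (.of E) ⟶ P),
      (k ≫ π).appTop.hom = (toΓ _).comp
        ((algebraMap (MvPolynomial (Fin (m + 1)) Γ(B, ⊤)) E).comp MvPolynomial.C) →
      Rep (k ≫ f) (fun i ↦ toΓ E (algebraMap _ E (MvPolynomial.X (R := Γ(B, ⊤)) i))) →
      Rep (k ≫ g) fun i ↦ toΓ E (algebraMap _ E (F i)))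
    {Y : Scheme.{u}} (y : Y ⟶ P) (v : Fin (m + 1) → Γ(Y, ⊤)) (hv : Rep (y ≫ f) v) :
    Rep (y ≫ g) fun i ↦ (F i).eval₂ (y ≫ π).appTop.hom v := by
  refine Rep.of_local fun x ↦ ?_
  obtain ⟨l, hl⟩ := hv.exists_mem x
  refine ⟨_, hl, ?_⟩
  have hv' := hv.comp (Y.basicOpen (v l)).ι
  rw [← Category.assoc] at hv'
  obtain ⟨k, hk1, hk2, hk3⟩ := h.exists_cone_point l
    (Localization.Away (MvPolynomial.X (R := Γ(B, ⊤)) l))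
  obtain ⟨s, hs1, hs2⟩ := hk3 _ _ hv' (by
    refine isUnit_of_basicOpen_eq_top ?_
    rw [basicOpen_appTop]
    simp)
  have := (hF l _ k hk2 hk1).comp s
  simp_rw [hs2] at this
  rw [← Category.assoc, hs1, Category.assoc] at this
  convert this using 2 with i
  rw [MvPolynomial.hom_eval₂, Category.assoc, Scheme.Hom.comp_appTop (Y.basicOpen (v l)).ι]
  rfl

/-- Over a factorial base, a morphism from projective space to projective space is given by
polynomials without common factor. -/
lemma IsCoord.exists_polynomials [IsDomain Γ(B, ⊤)] [UniqueFactorizationMonoid Γ(B, ⊤)]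
    (h : IsCoord π f) (g : P ⟶ ProjectiveSpaceInt.{u} n) :
    ∃ F : Fin (n + 1) → MvPolynomial (Fin (m + 1)) Γ(B, ⊤), IsPrimitive F ∧
      ∀ {Y : Scheme.{u}} (y : Y ⟶ P) (v : Fin (m + 1) → Γ(Y, ⊤)), Rep (y ≫ f) v →
        Rep (y ≫ g) fun i ↦ (F i).eval₂ (y ≫ π).appTop.hom v := by
  let K := FractionRing (MvPolynomial (Fin (m + 1)) Γ(B, ⊤))
  let β := algebraMap (MvPolynomial (Fin (m + 1)) Γ(B, ⊤)) K
  have hβ : Function.Injective β := IsFractionRing.injective _ _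
  obtain ⟨ξ, h1, h2⟩ := h.exists_spec_point_of_isUnit (β.comp MvPolynomial.C)
    (fun i ↦ β (MvPolynomial.X i)) (l := 0)
    ((map_ne_zero_iff β hβ).2 (MvPolynomial.X_ne_zero 0)).isUnit
  obtain ⟨r, j, hj, hr⟩ := exists_rep_of_isLocalRing (ξ ≫ g)
  obtain ⟨F, hF, hrF⟩ := exists_isPrimitive (R := MvPolynomial (Fin (m + 1)) Γ(B, ⊤)) r
    ⟨j, by rw [hj]; exact one_ne_zero⟩
  obtain ⟨i, hi⟩ := hF.exists_ne_zero
  have hξ := hr.of_mul_eq_spec hrF (l := i) ((map_ne_zero_iff β hβ).2 hi).isUnit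
  exact ⟨F, hF, fun y v hv ↦ h.rep_eval₂_of_cone_point g F
    (fun l E _ _ _ _ hk hk' ↦ rep_cone_point h g h1 h2 hF hξ (l := l) E hk hk') y v hv⟩

end Factorial

/-! ### Coordinate changes over a factorial base. -/

section Linear

lemma exists_field_hom {R : Type u} [CommRing R] (q : Ideal R) [q.IsPrime] :
    ∃ (D : Type u) (_ : Field D) (ψ : R →+* D), RingHom.ker ψ = q :=
  ⟨FractionRing (R ⧸ q), inferInstance, (algebraMap (R ⧸ q) _).comp (Ideal.Quotient.mk q), by
    ext a
    rw [RingHom.mem_ker, RingHom.comp_apply,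
      map_eq_zero_iff _ (IsFractionRing.injective (R ⧸ q) _), Ideal.Quotient.eq_zero_iff_mem]⟩

lemma exists_sum_of_isHomogeneous_one {σ A : Type*} [Fintype σ] [CommRing A]
    {F : MvPolynomial σ A} (hF : F.IsHomogeneous 1) :
    ∃ c : σ → A, F = ∑ j, MvPolynomial.C (c j) * MvPolynomial.X j := by
  have h : F ∈ MvPolynomial.homogeneousSubmodule σ A 1 := hF
  rw [MvPolynomial.homogeneousSubmodule_one_eq_span_X] at h
  obtain ⟨c, hc⟩ := (Submodule.mem_span_range_iff_exists_fun A).1 h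
  exact ⟨c, by simp_rw [← hc, MvPolynomial.smul_eq_C_mul]⟩

variable {B P : Scheme.{u}} {m n : ℕ} [IsAffine B] {π : P ⟶ B}
  {f : P ⟶ ProjectiveSpaceInt.{u} m}

lemma Rep.exists_ne_zero {X : Scheme.{u}} [Nonempty X] {f : X ⟶ ProjectiveSpaceInt.{u} m}
    {v : Fin (m + 1) → Γ(X, ⊤)} (h : Rep f v) : ∃ j, v j ≠ 0 := by
  obtain ⟨j, hj⟩ := h.exists_mem (Classical.arbitrary X)
  refine ⟨j, fun h0 ↦ ?_⟩
  rw [h0, Scheme.basicOpen_zero] at hj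
  exact hj

/-- At the point with coordinates both `x` and `T x`, the vectors `F(x)` and `F(T x)` are
proportional. The coefficients of the powers of `T` give the hypothesis of
`IsPrimitive.isHomogeneous`. -/
lemma IsCoord.exists_homogeneous [IsDomain Γ(B, ⊤)] [UniqueFactorizationMonoid Γ(B, ⊤)]
    (h : IsCoord π f) (g : P ⟶ ProjectiveSpaceInt.{u} n) :
    ∃ (d : ℕ) (F : Fin (n + 1) → MvPolynomial (Fin (m + 1)) Γ(B, ⊤)),
      (∀ i, (F i).IsHomogeneous d) ∧
      ∀ {Y : Scheme.{u}} (y : Y ⟶ P) (v : Fin (m + 1) → Γ(Y, ⊤)), Rep (y ≫ f) v →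
        Rep (y ≫ g) fun i ↦ (F i).eval₂ (y ≫ π).appTop.hom v := by
  obtain ⟨F, hF, hrep⟩ := h.exists_polynomials g
  obtain ⟨E, _, ι, y, hι, -, hy, hy1, hy2⟩ := h.exists_scaled_point 0
  obtain ⟨d, hd⟩ := hF.isHomogeneous fun i j e ↦ by
    have h1 := hrep y _ hy1
    have h2 := hrep y _ hy2
    simp_rw [hy] at h1 h2
    simp_rw [eval₂_toΓ ι _ fun i ↦ Polynomial.C (MvPolynomial.X i)] at h1
    simp_rw [eval₂_toΓ ι _ fun i ↦ Polynomial.X * Polynomial.C (MvPolynomial.X i)] at h2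
    have h3 := h2.mul_eq_of_spec h1 i j
    rw [← map_mul, ← map_mul] at h3
    have h4 (G : MvPolynomial (Fin (m + 1)) Γ(B, ⊤)) :
        G.eval₂ (Polynomial.C.comp MvPolynomial.C) (fun i ↦ Polynomial.C (MvPolynomial.X i)) =
          Polynomial.C G := by
      have := MvPolynomial.hom_eval₂ G MvPolynomial.C
        (Polynomial.C (R := MvPolynomial (Fin (m + 1)) Γ(B, ⊤))) MvPolynomial.X
      rw [MvPolynomial.eval₂_eta] at this
      exact this.symm
    have h5 := congr(($(hι h3)).coeff e)
    rw [h4, h4, Polynomial.coeff_mul_C, Polynomial.coeff_mul_C, coeff_eval₂_X_mul_C,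
      coeff_eval₂_X_mul_C] at h5
    exact h5
  exact ⟨d, F, hd, hrep⟩

/-- Over a factorial base, two systems of coordinates differ by a linear substitution. -/
lemma IsCoord.exists_matrix_of_factorial [IsDomain Γ(B, ⊤)] [UniqueFactorizationMonoid Γ(B, ⊤)]
    {f f' : P ⟶ ProjectiveSpaceInt.{u} (m + 1)} (h : IsCoord π f) (h' : IsCoord π f') :
    ∃ T : Matrix (Fin (m + 1 + 1)) (Fin (m + 1 + 1)) Γ(B, ⊤), IsUnit T.det ∧
      ∀ {Y : Scheme.{u}} (y : Y ⟶ P) (v : Fin (m + 1 + 1) → Γ(Y, ⊤)), Rep (y ≫ f) v →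
        Rep (y ≫ f') ((T.map (y ≫ π).appTop.hom).mulVec v) := by
  obtain ⟨d, F, hF, hFrep⟩ := h.exists_homogeneous f'
  obtain ⟨e, G, hG, hGrep⟩ := h'.exists_homogeneous f
  -- The composite of the two coordinate changes is the identity, so `H` is a multiple of the vector
  -- of variables.
  let H (i) : MvPolynomial (Fin (m + 1 + 1)) Γ(B, ⊤) := (G i).eval₂ MvPolynomial.C F
  have hH (i) : (H i).IsHomogeneous (d * e) :=
    (hG i).eval₂ _ _ (fun _ ↦ MvPolynomial.isHomogeneous_C _ _) hF
  have hHrep {D : Type u} [CommRing D] (ι : MvPolynomial (Fin (m + 1 + 1)) Γ(B, ⊤) →+* D)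
      (y : Spec (.of D) ⟶ P) (hy : (y ≫ π).appTop.hom = (toΓ D).comp (ι.comp MvPolynomial.C))
      (hy' : Rep (y ≫ f) fun i ↦ toΓ D (ι (MvPolynomial.X i))) :
      Rep (y ≫ f) fun i ↦ toΓ D (ι (H i)) := by
    have h1 := hFrep y _ hy'
    simp_rw [hy, eval₂_toΓ] at h1
    have h2 := hGrep y _ h1
    simp_rw [hy, MvPolynomial.eval₂_eta, eval₂_toΓ] at h2
    exact h2
  obtain ⟨E, _, ι, y, hι, hu, hy, hy'⟩ := h.exists_torus_point
  have : Nontrivial E := hι.nontrivial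
  have hHX (i j) : H i * MvPolynomial.X j = H j * MvPolynomial.X i := hι <| by
    rw [map_mul, map_mul]
    exact (hHrep ι y hy hy').mul_eq_of_spec hy' i j
  -- The prime `X 0` divides `H 0 * X 1` and not `X 1`. At least two variables are present because
  -- the dimension has the form `m + 1`.
  obtain ⟨c, hc⟩ : MvPolynomial.X 0 ∣ H 0 := by
    refine ((MvPolynomial.X_prime (i := 0)).dvd_or_dvd (Dvd.intro_left _ (hHX 0 1).symm)).resolve_right ?_
    rw [MvPolynomial.X_dvd_X]
    exact (Fin.zero_ne_one)
  have hcX (i) : H i = c * MvPolynomial.X i := by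
    refine mul_right_cancel₀ (MvPolynomial.X_ne_zero 0) ?_
    rw [hHX, hc]; ring
  -- A prime factor `p` of `c` would make all of `H` vanish at a point over the residue field of `p`
  -- where some variable survives, but coordinates have no common zero.
  have hcu : IsUnit c := by
    by_contra hcn
    have hc0 : c ≠ 0 := by
      rintro rfl
      obtain ⟨j, hj⟩ := (hHrep ι y hy hy').exists_ne_zero
      exact hj (by rw [hcX, zero_mul, map_zero, map_zero])
    obtain ⟨p, hp, hpc⟩ := WfDvdMonoid.exists_irreducible_factor hcn hc0
    have hp' := hp.prime
    obtain ⟨l, hl⟩ : ∃ l, ¬ p ∣ MvPolynomial.X l := by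
      by_contra! hl
      have h0 := (hp'.dvd_prime_iff_associated (MvPolynomial.X_prime (i := 0))).1 (hl 0)
      have h1 := (MvPolynomial.X_dvd_X (R := Γ(B, ⊤)) (i := 0) (j := 1)).1 (h0.symm.dvd.trans (hl 1))
      exact Fin.zero_ne_one h1
    have hpp := (Ideal.span_singleton_prime hp'.ne_zero).2 hp'
    obtain ⟨D, _, ψ, hψ'⟩ := exists_field_hom (Ideal.span {p})
    have hψ (a) : ψ a = 0 ↔ p ∣ a := by
      rw [← Ideal.mem_span_singleton, ← hψ', RingHom.mem_ker]
    obtain ⟨z, hz, hz'⟩ := h.exists_spec_point_of_isUnit (ψ.comp MvPolynomial.C)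
      (fun i ↦ ψ (MvPolynomial.X i)) (l := l) (isUnit_iff_ne_zero.2 fun h0 ↦ hl ((hψ _).1 h0))
    obtain ⟨j, hj⟩ := (hHrep ψ z hz hz').exists_ne_zero
    refine hj ?_
    rw [(hψ _).2 ?_, map_zero]
    rw [hcX]
    exact hpc.mul_right _
  obtain ⟨c', hc', rfl⟩ := MvPolynomial.isUnit_iff_eq_C_of_isReduced.1 hcu
  -- `H = c X` with `c` constant has degree 1, and composing multiplies degrees, so both coordinate
  -- changes are linear.
  have hde : d * e = 1 := by
    refine (hH 0).inj_right ?_ ?_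
    · rw [hcX]
      exact MvPolynomial.isHomogeneous_C_mul_X _ _
    · rw [hcX]
      exact mul_ne_zero hcu.ne_zero (MvPolynomial.X_ne_zero 0)
  obtain ⟨rfl, rfl⟩ := mul_eq_one.1 hde
  choose T hT using fun i ↦ exists_sum_of_isHomogeneous_one (hF i)
  choose T' hT' using fun i ↦ exists_sum_of_isHomogeneous_one (hG i)
  refine ⟨Matrix.of T, ?_, fun {Y} y v hv ↦ ?_⟩
  · have h1 : Matrix.of T' * Matrix.of T = c' • 1 := by
      ext i j
      have h2 : H i = ∑ j, MvPolynomial.C ((Matrix.of T' * Matrix.of T) i j) * MvPolynomial.X j := by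
        simp only [H]
        rw [hT']
        simp only [MvPolynomial.eval₂_sum, MvPolynomial.eval₂_mul, MvPolynomial.eval₂_C,
          MvPolynomial.eval₂_X, Matrix.mul_apply, map_sum, map_mul, Matrix.of_apply]
        simp_rw [hT, Finset.mul_sum, Finset.sum_mul]
        rw [Finset.sum_comm]
        simp_rw [mul_assoc]
      have h3 := congr(MvPolynomial.coeff (Finsupp.single j 1) $(h2.symm.trans (hcX i)))
      simp only [MvPolynomial.coeff_sum, MvPolynomial.coeff_C_mul, MvPolynomial.coeff_X] at h3
      simp only [Finsupp.single_left_inj one_ne_zero, mul_ite, mul_one, mul_zero,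
        Finset.sum_ite_eq', Finset.mem_univ, if_true] at h3
      rw [h3, Matrix.smul_apply, Matrix.one_apply, smul_eq_mul, mul_ite, mul_one, mul_zero]
    have h2 := congr(($h1).det)
    rw [Matrix.det_mul, Matrix.det_smul, Matrix.det_one, mul_one] at h2
    exact isUnit_of_dvd_unit (Dvd.intro_left _ h2) (hc'.pow _)
  · convert hFrep y v hv using 2 with i
    rw [hT]
    simp [MvPolynomial.eval₂_sum, Matrix.mulVec, dotProduct]

end Linear

/-! ### Nilpotent deformations of the identity of projective space. -/

section Deformation

variable {σ A : Type*} [CommRing A]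

/-- Multiplication by `X i ^ a` leaves the exponent of `X k` unchanged. Coefficients are compared
because `A` need not be a domain. -/
lemma X_pow_dvd_of_mul_eq {p q : MvPolynomial σ A} {i k : σ} (hik : i ≠ k) {a e : ℕ}
    (h : MvPolynomial.X i ^ a * p = MvPolynomial.X k ^ e * q) : MvPolynomial.X k ^ e ∣ p := by
  classical
  rw [MvPolynomial.X_pow_eq_monomial, MvPolynomial.monomial_one_dvd_iff_modMonomial_eq_zero]
  ext μ
  rw [MvPolynomial.coeff_zero]
  by_cases hμ : Finsupp.single k e ≤ μ
  · exact MvPolynomial.coeff_modMonomial_of_le _ hμ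
  · rw [MvPolynomial.coeff_modMonomial_of_not_le _ hμ]
    have h1 := congr(MvPolynomial.coeff (Finsupp.single i a + μ) $h)
    rw [MvPolynomial.X_pow_eq_monomial, MvPolynomial.X_pow_eq_monomial,
      MvPolynomial.coeff_monomial_mul, one_mul, MvPolynomial.coeff_monomial_mul', if_neg] at h1
    · exact h1
    · rw [Finsupp.single_le_iff] at hμ ⊢
      simpa [Finsupp.single_apply, hik] using hμ

lemma exists_eq_single_add_single {μ : σ →₀ ℕ} (hμ : μ.degree = 2) {i : σ} (hi : μ i ≠ 0) :
    ∃ l, μ = Finsupp.single i 1 + Finsupp.single l 1 := by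
  have key : ∀ (ν : σ →₀ ℕ) (j : σ), ν j ≠ 0 → ∃ ν', ν = Finsupp.single j 1 + ν' ∧
      ν.degree = 1 + ν'.degree := by
    intro ν j hj
    obtain ⟨ν', rfl⟩ := exists_add_of_le (Finsupp.single_le_iff.2 (Nat.one_le_iff_ne_zero.2 hj))
    exact ⟨ν', rfl, by rw [map_add, Finsupp.degree_single]⟩
  obtain ⟨ν, rfl, h1⟩ := key μ i hi
  obtain ⟨l, hl⟩ : ∃ l, ν l ≠ 0 := by
    by_contra! h
    have : ν = 0 := Finsupp.ext h
    rw [hμ, this, map_zero] at h1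
    omega
  obtain ⟨ν', rfl, h2⟩ := key ν l hl
  have : ν'.degree = 0 := by omega
  rw [Finsupp.degree_eq_zero_iff] at this
  exact ⟨l, by rw [this, add_zero]⟩

lemma eval_single_of_isHomogeneous [Fintype σ] [DecidableEq σ] {p : MvPolynomial σ A} {n : ℕ}
    (hp : p.IsHomogeneous n) (j : σ) :
    MvPolynomial.eval (Pi.single j 1) p = p.coeff (Finsupp.single j n) := by
  have h : p = MvPolynomial.monomial (Finsupp.single j n) (p.coeff (Finsupp.single j n)) +
      (p - MvPolynomial.monomial (Finsupp.single j n) (p.coeff (Finsupp.single j n))) := by ring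
  rw [h, map_add]
  have h1 : MvPolynomial.eval (Pi.single j 1)
      (p - MvPolynomial.monomial (Finsupp.single j n) (p.coeff (Finsupp.single j n))) = 0 := by
    rw [MvPolynomial.eval_eq']
    refine Finset.sum_eq_zero fun μ hμ ↦ ?_
    have hne : μ ≠ Finsupp.single j n := by
      rintro rfl
      simp at hμ
    have hc : p.coeff μ ≠ 0 := by
      intro h0
      rw [MvPolynomial.mem_support_iff, MvPolynomial.coeff_sub, MvPolynomial.coeff_monomial,
        if_neg hne.symm, h0] at hμ
      simp at hμ
    have hdeg : μ.degree = n := by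
      by_contra hd
      exact hc (hp.coeff_eq_zero hd)
    obtain ⟨i, hij, hi⟩ : ∃ i, i ≠ j ∧ μ i ≠ 0 := by
      by_contra! h
      have h2 : μ = Finsupp.single j (μ j) := by
        ext i
        rw [Finsupp.single_apply]
        split_ifs with hji
        · rw [hji]
        · exact h i (Ne.symm hji)
      refine hne ?_
      rw [h2, Finsupp.degree_single] at hdeg
      rw [h2, hdeg]
    rw [Finset.prod_eq_zero (Finset.mem_univ i), mul_zero]
    rw [Pi.single_eq_of_ne hij, zero_pow hi]
  rw [h1, add_zero, MvPolynomial.eval_monomial]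
  simp

/-- `D i j / x_j ^ (e + 2)` is the first-order variation of `x_i / x_j` under an infinitesimal
automorphism. Division by `x_j ^ e` leaves quadrics `q i j` that are antisymmetric and satisfy `x_k
q_ij = x_j q_ik + x_i q_kj`, as do `v_i x_j - x_i v_j` for a linear vector field `v`. Fixing the
coordinate points removes every monomial but `x_i x_j`, and fixing the unit point removes that one
too. -/
lemma eq_zero_of_linearized_cocycle [Fintype σ] [DecidableEq σ]
    (h3 : ∀ i j : σ, ∃ k, k ≠ i ∧ k ≠ j) {e : ℕ}
    {D : σ → σ → MvPolynomial σ A} (hD : ∀ i j, (D i j).IsHomogeneous (e + 2))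
    (hii : ∀ i, D i i = 0)
    (hcoc : ∀ i j k, MvPolynomial.X k ^ (e + 2) * D i j =
      MvPolynomial.X k * MvPolynomial.X j ^ (e + 1) * D i k +
        MvPolynomial.X i * MvPolynomial.X k ^ (e + 1) * D k j)
    (hfr : ∀ i j, MvPolynomial.eval (Pi.single j 1) (D i j) = 0)
    (hone : ∀ i j, MvPolynomial.eval 1 (D i j) = 0) (i j : σ) : D i j = 0 := by
  have hX (i : σ) (n : ℕ) : IsLeftRegular (MvPolynomial.X (R := A) i ^ n) :=
    (MvPolynomial.isRegular_X_pow n).left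
  have hX1 (i : σ) : IsLeftRegular (MvPolynomial.X (R := A) i) := MvPolynomial.isRegular_X.left
  have anti (i k : σ) : MvPolynomial.X i ^ e * D i k = -(MvPolynomial.X k ^ e * D k i) := by
    have h := hcoc i i k
    rw [hii, mul_zero] at h
    refine ((hX1 k).mul (hX1 i)) ?_
    simp only
    linear_combination -h
  choose q hq using fun i j ↦ show ∃ q, D i j = MvPolynomial.X j ^ e * q by
    by_cases hij : i = j
    · exact ⟨0, by rw [hij, hii, mul_zero]⟩
    · exact X_pow_dvd_of_mul_eq (q := -D j i) hij (by rw [anti]; ring)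
  suffices hq0 : ∀ i j, i ≠ j → q i j = 0 by
    by_cases hij : i = j
    · rw [hij, hii]
    · rw [hq, hq0 i j hij, mul_zero]
  have hqa (i j) : q i j = -q j i := by
    have h := anti i j
    rw [hq i j, hq j i] at h
    refine ((hX i e).mul (hX j e)) ?_
    simp only
    linear_combination h
  have hqc (i j k) : MvPolynomial.X k * q i j =
      MvPolynomial.X j * q i k + MvPolynomial.X i * q k j := by
    have h := hcoc i j k
    rw [hq i j, hq i k, hq k j] at h
    refine ((hX k (e + 1)).mul (hX j e)) ?_
    simp only
    linear_combination h
  have hqd (i j) : (q i j).IsHomogeneous 2 := by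
    intro μ hμ
    have : (D i j).coeff (Finsupp.single j e + μ) ≠ 0 := by
      rwa [hq, MvPolynomial.X_pow_eq_monomial, MvPolynomial.coeff_monomial_mul, one_mul]
    have h := hD i j this
    have hw (ν : σ →₀ ℕ) : Finsupp.weight 1 ν = ν.degree :=
      (DFunLike.congr_fun (Finsupp.degree_eq_weight_one (R := ℕ)) ν).symm
    rw [map_add, hw, hw, Finsupp.degree_single] at h
    rw [hw]
    omega
  have hqone (i j) : MvPolynomial.eval 1 (q i j) = 0 := by
    have h := hone i j
    rw [hq] at h
    simpa using h
  have hqfr (i j) : (q i j).coeff (Finsupp.single j 1 + Finsupp.single j 1) = 0 := by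
    have h := hfr i j
    rw [hq, map_mul, map_pow, MvPolynomial.eval_X, Pi.single_eq_same, one_pow, one_mul,
      eval_single_of_isHomogeneous (hqd i j)] at h
    rw [← Finsupp.single_add]
    exact h
  have hqfr' (i j) : (q i j).coeff (Finsupp.single i 1 + Finsupp.single i 1) = 0 := by
    rw [hqa, MvPolynomial.coeff_neg, hqfr, neg_zero]
  -- Compare the coefficients of `x_i x_l ^ 2`. The term with `x_j` cannot contribute, and the other
  -- one contributes the coefficient of `x_l ^ 2` in `q l j`, which vanishes since a coordinate
  -- point is fixed.
  have hb (i j l : σ) (hij : i ≠ j) (hlj : l ≠ j) :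
      (q i j).coeff (Finsupp.single i 1 + Finsupp.single l 1) = 0 := by
    by_cases hli : l = i
    · rw [hli]; exact hqfr' i j
    · have h := congr(MvPolynomial.coeff (Finsupp.single l 1 +
        (Finsupp.single i 1 + Finsupp.single l 1)) $(hqc i j l))
      rw [MvPolynomial.coeff_X_mul, MvPolynomial.coeff_add, MvPolynomial.coeff_X_mul', if_neg,
        add_left_comm, MvPolynomial.coeff_X_mul, hqfr', zero_add] at h
      · exact h
      · simp [hij, hlj]
  have main (i j : σ) (hij : i ≠ j) (μ : σ →₀ ℕ)
      (hμ : μ ≠ Finsupp.single i 1 + Finsupp.single j 1) : (q i j).coeff μ = 0 := by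
    by_cases hd : μ.degree = 2
    swap
    · exact (hqd i j).coeff_eq_zero hd
    by_cases hi : μ i = 0
    · by_cases hj : μ j = 0
      -- A monomial containing neither `x_i` nor `x_j` is excluded by a third index: multiplied by
      -- `x_k`, it occurs in neither term on the right.
      · obtain ⟨k, hki, hkj⟩ := h3 i j
        have h := congr(MvPolynomial.coeff (Finsupp.single k 1 + μ) $(hqc i j k))
        rw [MvPolynomial.coeff_X_mul, MvPolynomial.coeff_add, MvPolynomial.coeff_X_mul', if_neg,
          MvPolynomial.coeff_X_mul', if_neg, zero_add] at h
        · exact h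
        · simp [hki, hi]
        · simp [hkj, hj]
      · obtain ⟨l, rfl⟩ := exists_eq_single_add_single hd hj
        rw [hqa, MvPolynomial.coeff_neg, hb j i l hij.symm ?_, neg_zero]
        rintro rfl
        simp at hi
    · obtain ⟨l, rfl⟩ := exists_eq_single_add_single hd hi
      exact hb i j l hij fun hl ↦ hμ (by rw [hl])
  intro i j hij
  have h1 : q i j = MvPolynomial.monomial (Finsupp.single i 1 + Finsupp.single j 1)
      ((q i j).coeff (Finsupp.single i 1 + Finsupp.single j 1)) := by
    ext μ
    rw [MvPolynomial.coeff_monomial]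
    split_ifs with h
    · rw [h]
    · exact main i j hij μ (Ne.symm h)
  have h2 := hqone i j
  rw [h1, MvPolynomial.eval_monomial] at h2
  rw [h1]
  have : (q i j).coeff (Finsupp.single i 1 + Finsupp.single j 1) = 0 := by simpa using h2
  rw [this, map_zero]

/-- The coefficients of the deviations `D` generate a finitely generated nil, hence nilpotent, ideal
`I`. Modulo `I ^ 2` the products of deviations vanish and the linearized lemma applies, so `I = I ^
2` and thus `I = 0`. -/
lemma eq_of_cocycle_of_isNilpotent [Fintype σ] [DecidableEq σ]
    (h3 : ∀ i j : σ, ∃ k, k ≠ i ∧ k ≠ j) {e : ℕ}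
    {G : σ → σ → MvPolynomial σ A} (hG : ∀ i j, (G i j).IsHomogeneous (e + 2))
    (hii : ∀ i, G i i = MvPolynomial.X i ^ (e + 2))
    (hcoc : ∀ i j k, MvPolynomial.X k ^ (e + 2) * G i j = G i k * G k j)
    (hfr : ∀ i j, i ≠ j → MvPolynomial.eval (Pi.single j 1) (G i j) = 0)
    (hone : ∀ i j, MvPolynomial.eval 1 (G i j) = 1)
    (hnil : ∀ i j μ, IsNilpotent
      ((G i j - MvPolynomial.X i * MvPolynomial.X j ^ (e + 1)).coeff μ)) (i j : σ) :
    G i j = MvPolynomial.X i * MvPolynomial.X j ^ (e + 1) := by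
  let D (i j) := G i j - MvPolynomial.X i * MvPolynomial.X j ^ (e + 1)
  have hGD (i j) : G i j = MvPolynomial.X i * MvPolynomial.X j ^ (e + 1) + D i j := by
    simp only [D]; ring
  let s : Set A := ⋃ i, ⋃ j, (fun μ ↦ (D i j).coeff μ) '' (D i j).support
  have hs : s.Finite := Set.finite_iUnion fun i ↦ Set.finite_iUnion fun j ↦
    (Finset.finite_toSet _).image _
  let I := Ideal.span s
  have hDI (i j μ) : (D i j).coeff μ ∈ I := by
    by_cases hμ : (D i j).coeff μ = 0
    · rw [hμ]; exact I.zero_mem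
    · exact Ideal.subset_span (Set.mem_iUnion.2 ⟨i, Set.mem_iUnion.2 ⟨j, μ,
        MvPolynomial.mem_support_iff.2 hμ, rfl⟩⟩)
  have hI : IsNilpotent I := by
    refine (Ideal.FG.isNilpotent_iff_le_nilradical ⟨hs.toFinset, by simp [I]⟩).2
      (Ideal.span_le.2 fun a ha ↦ ?_)
    obtain ⟨i, hi⟩ := Set.mem_iUnion.1 ha
    obtain ⟨j, hj⟩ := Set.mem_iUnion.1 hi
    obtain ⟨μ, -, rfl⟩ := hj
    exact hnil i j μ
  have hD (i j) : (D i j).IsHomogeneous (e + 2) := by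
    refine (hG i j).sub ?_
    have := (MvPolynomial.isHomogeneous_X A i).mul (MvPolynomial.isHomogeneous_X_pow (R := A) j (e + 1))
    rwa [show 1 + (e + 1) = e + 2 by ring] at this
  have hDii (i) : D i i = 0 := by
    simp only [D, hii]; ring
  have hDfr (i j) : MvPolynomial.eval (Pi.single j 1) (D i j) = 0 := by
    by_cases hij : i = j
    · rw [hij, hDii, map_zero]
    · simp [D, hfr i j hij, hij]
  have hDone (i j) : MvPolynomial.eval 1 (D i j) = 0 := by
    simp [D, hone]
  have hII : I ≤ I * I := by
    let φ := Ideal.Quotient.mk (I * I)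
    have hev (v : σ → A) (p : MvPolynomial σ A) :
        p.eval₂ φ (φ ∘ v) = φ (MvPolynomial.eval v p) := by
      have := MvPolynomial.hom_eval₂ p (RingHom.id A) φ v
      rw [RingHom.comp_id] at this
      exact this.symm
    have hmul (i j k l) : MvPolynomial.map φ (D i j * D k l) = 0 := by
      ext μ
      rw [MvPolynomial.coeff_map, MvPolynomial.coeff_zero, Ideal.Quotient.eq_zero_iff_mem,
        MvPolynomial.coeff_mul]
      exact sum_mem fun x _ ↦ Ideal.mul_mem_mul (hDI _ _ _) (hDI _ _ _)
    have h0 := eq_zero_of_linearized_cocycle (σ := σ) h3 (e := e)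
      (D := fun i j ↦ MvPolynomial.map φ (D i j)) (fun i j ↦ (hD i j).map φ)
      (fun i ↦ by rw [hDii, map_zero])
      (fun i j k ↦ by
        have h := hcoc i j k
        rw [hGD i j, hGD i k, hGD k j] at h
        have h' : MvPolynomial.X k ^ (e + 2) * D i j = MvPolynomial.X k * MvPolynomial.X j ^ (e + 1) *
          D i k + MvPolynomial.X i * MvPolynomial.X k ^ (e + 1) * D k j + D i k * D k j := by
          linear_combination h
        have := congr(MvPolynomial.map φ $h')
        rw [map_add, hmul, add_zero] at this
        simpa using this)
      (fun i j ↦ by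
        rw [MvPolynomial.eval_map, show (Pi.single j 1 : σ → A ⧸ I * I) =
          φ ∘ (Pi.single j 1 : σ → A) by
            ext k; by_cases hk : k = j <;> simp [hk], hev, hDfr, map_zero])
      (fun i j ↦ by
        rw [MvPolynomial.eval_map, show (1 : σ → A ⧸ I * I) = φ ∘ (1 : σ → A) by
          ext k; simp, hev, hDone, map_zero])
    refine Ideal.span_le.2 fun a ha ↦ ?_
    obtain ⟨i, hi⟩ := Set.mem_iUnion.1 ha
    obtain ⟨j, hj⟩ := Set.mem_iUnion.1 hi
    obtain ⟨μ, -, rfl⟩ := hj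
    have := congr(MvPolynomial.coeff μ $(h0 i j))
    rw [MvPolynomial.coeff_map, MvPolynomial.coeff_zero] at this
    exact Ideal.Quotient.eq_zero_iff_mem.1 this
  have hpow (n : ℕ) : I ≤ I ^ n := by
    induction n with
    | zero => simp
    | succ n ih =>
      rw [pow_succ]
      exact hII.trans (Ideal.mul_mono_left ih)
  obtain ⟨n, hn⟩ := hI
  have hI0 : I = ⊥ := le_bot_iff.1 ((hpow n).trans (by rw [hn]; exact le_rfl))
  rw [hGD, add_eq_left]
  ext μ
  have := hDI i j μ
  rw [hI0] at this
  simpa using this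

end Deformation

/-! ### Morphisms that fix a frame, and the action of matrices. -/

section Frames

variable {B P X : Scheme.{u}} {m : ℕ} {π : P ⟶ B} {f : P ⟶ ProjectiveSpaceInt.{u} m}

lemma Rep.appLE_mul {g : X ⟶ ProjectiveSpaceInt.{u} m} {w : Fin (m + 1) → Γ(X, ⊤)} (hw : Rep g w)
    (j : Fin (m + 1)) (hj : ⊤ ≤ g ⁻¹ᵁ chart m j) (i : Fin (m + 1)) :
    (g.appLE (chart m j) ⊤ hj).hom (ratio m i j) * w j = w i := by
  have := (Rep.of_le_preimage g j hj).mul_eq hw i j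
  rw [this, ratio_self, map_one, one_mul]

lemma exists_local_rep (g : X ⟶ ProjectiveSpaceInt.{u} m) (x : X) :
    ∃ U : X.Opens, x ∈ U ∧ ∃ w, Rep (U.ι ≫ g) w := by
  obtain ⟨j, hj⟩ := exists_mem_chart (g x)
  let U : X.Opens := g ⁻¹ᵁ chart m j
  have h1 : ⊤ ≤ (U.ι ≫ g) ⁻¹ᵁ chart m j := fun y _ ↦ y.2
  exact ⟨U, hj, _, Rep.of_le_preimage _ j h1⟩

lemma mulVec_mul_eq {D α β : Type*} [CommRing D] [Fintype β] (M : Matrix α β D) {v w : β → D}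
    (h : ∀ i j, v i * w j = v j * w i) (a b : α) :
    M.mulVec v a * M.mulVec w b = M.mulVec v b * M.mulVec w a := by
  simp only [Matrix.mulVec, dotProduct, Finset.sum_mul_sum]
  rw [Finset.sum_comm]
  refine Finset.sum_congr rfl fun i _ ↦ Finset.sum_congr rfl fun j _ ↦ ?_
  linear_combination (M a j * M b i) * h j i

lemma map_mulVec' {D E A α β : Type*} [CommRing A] [CommRing D] [CommRing E] [Fintype β]
    (M : Matrix α β A) (φ : A →+* D) (ψ : D →+* E) (v : β → D) (a : α) :
    ψ ((M.map φ).mulVec v a) = (M.map (ψ.comp φ)).mulVec (fun i ↦ ψ (v i)) a := by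
  simp [Matrix.mulVec, dotProduct]

lemma mem_basicOpen_iff_evaluation (x : X) (s : Γ(X, ⊤)) :
    x ∈ X.basicOpen s ↔ (X.Γevaluation x).hom s ≠ 0 :=
  (Scheme.evaluation_ne_zero_iff_mem_basicOpen X (U := ⊤) x trivial s).symm

lemma exists_mem_basicOpen_mulVec {α : Type*} [Fintype α] [DecidableEq α] (T : Matrix α α Γ(X, ⊤))
    (hT : IsUnit T.det)
    {v : α → Γ(X, ⊤)} {x : X} (hv : ∃ j, x ∈ X.basicOpen (v j)) :
    ∃ j, x ∈ X.basicOpen (T.mulVec v j) := by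
  by_contra! h
  obtain ⟨j, hj⟩ := hv
  rw [mem_basicOpen_iff_evaluation] at hj
  refine hj ?_
  have h1 : v = T⁻¹.mulVec (T.mulVec v) := by
    rw [Matrix.mulVec_mulVec, Matrix.nonsing_inv_mul _ hT, Matrix.one_mulVec]
  rw [h1, Matrix.mulVec, dotProduct, map_sum]
  refine Finset.sum_eq_zero fun i _ ↦ ?_
  have := h i
  rw [mem_basicOpen_iff_evaluation, not_not] at this
  rw [map_mul, this, mul_zero]

lemma isUnit_det_map {D E α : Type*} [CommRing D] [CommRing E] [Fintype α] [DecidableEq α]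
    {T : Matrix α α D} (hT : IsUnit T.det) (φ : D →+* E) : IsUnit (T.map φ).det := by
  have := hT.map φ
  rwa [RingHom.map_det] at this

/-- The linear action on morphisms to projective space. -/
lemma exists_smul (g : X ⟶ ProjectiveSpaceInt.{u} m) (T : Matrix (Fin (m + 1)) (Fin (m + 1)) Γ(X, ⊤))
    (hT : IsUnit T.det) : ∃ g' : X ⟶ ProjectiveSpaceInt.{u} m,
      ∀ {Y : Scheme.{u}} (y : Y ⟶ X) (v : Fin (m + 1) → Γ(Y, ⊤)), Rep (y ≫ g) v →
        Rep (y ≫ g') ((T.map y.appTop.hom).mulVec v) := by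
  have hle (j : Fin (m + 1)) : ⊤ ≤ ((g ⁻¹ᵁ chart m j).ι ≫ g) ⁻¹ᵁ chart m j := fun y _ ↦ y.2
  choose v hv using fun j : Fin (m + 1) ↦ show ∃ v, Rep ((g ⁻¹ᵁ chart m j).ι ≫ g) v from
    ⟨_, Rep.of_le_preimage _ j (hle j)⟩
  have hcov (j) := exists_rep (X := (g ⁻¹ᵁ chart m j : X.Opens))
    ((T.map (g ⁻¹ᵁ chart m j).ι.appTop.hom).mulVec (v j))
    fun x ↦ exists_mem_basicOpen_mulVec _ (isUnit_det_map hT _) ((hv j).exists_mem x)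
  obtain ⟨g', hg'⟩ := Rep.glue (ι := ULift (Fin (m + 1))) (fun j ↦ g ⁻¹ᵁ chart m j.down)
    (fun x ↦ (exists_mem_chart (g x)).elim fun j hj ↦ ⟨⟨j⟩, hj⟩)
    (fun j ↦ (T.map (g ⁻¹ᵁ chart m j.down).ι.appTop.hom).mulVec (v j.down))
    (fun j ↦ hcov j.down) (fun i j a b ↦ by
      simp_rw [map_mulVec', ← CommRingCat.hom_comp, ← Scheme.Hom.comp_appTop, Scheme.homOfLE_ι]
      refine mulVec_mul_eq _ (fun c d ↦ ?_) a b
      have h1 := (hv i.down).comp (X.homOfLE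
        (inf_le_left : g ⁻¹ᵁ chart m i.down ⊓ g ⁻¹ᵁ chart m j.down ≤ _))
      have h2 := (hv j.down).comp (X.homOfLE
        (inf_le_right : g ⁻¹ᵁ chart m i.down ⊓ g ⁻¹ᵁ chart m j.down ≤ _))
      rw [Scheme.homOfLE_ι_assoc] at h1 h2
      exact h1.mul_eq h2 c d)
  refine ⟨g', fun {Y} y w hw ↦ Rep.of_local fun x ↦ ?_⟩
  obtain ⟨j, hj⟩ := exists_mem_chart (g (y x))
  refine ⟨y ⁻¹ᵁ g ⁻¹ᵁ chart m j, hj, ?_⟩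
  have h1 := (hg' ⟨j⟩).comp (y ∣_ (g ⁻¹ᵁ chart m j))
  have h2 := (hv j).comp (y ∣_ (g ⁻¹ᵁ chart m j))
  have h3 := hw.comp (y ⁻¹ᵁ g ⁻¹ᵁ chart m j).ι
  simp_rw [map_mulVec', ← CommRingCat.hom_comp, ← Scheme.Hom.comp_appTop] at h1 ⊢
  rw [morphismRestrict_ι_assoc] at h1 h2
  rw [morphismRestrict_ι] at h1
  exact h1.of_mul_eq (mulVec_mul_eq _ (h2.mul_eq h3)) fun x ↦
    exists_mem_basicOpen_mulVec _ (isUnit_det_map hT _) (h3.exists_mem x)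

/-- The form `G i j` represents the function `g^*(x_i / x_j)` as `G i j / x_j ^ (e + 2)`; the ratios
satisfy the multiplicative cocycle relation. -/
lemma IsCoord.exists_ratio_forms [IsAffine B] (h : IsCoord π f) (g : P ⟶ ProjectiveSpaceInt.{u} m)
    (hle : ∀ j, f ⁻¹ᵁ chart m j ≤ g ⁻¹ᵁ chart m j) :
    ∃ (e : ℕ) (G : Fin (m + 1) → Fin (m + 1) → MvPolynomial (Fin (m + 1)) Γ(B, ⊤)),
      (∀ i j, (G i j).IsHomogeneous (e + 2)) ∧ (∀ i, G i i = MvPolynomial.X i ^ (e + 2)) ∧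
      ∀ {Y : Scheme.{u}} (y : Y ⟶ P) (v w : Fin (m + 1) → Γ(Y, ⊤)), Rep (y ≫ f) v →
        Rep (y ≫ g) w → ∀ j, IsUnit (v j) → ∀ i,
          (G i j).eval₂ (y ≫ π).appTop.hom v * w j = w i * v j ^ (e + 2) := by
  choose d G hG hrep using fun i j ↦ h.exists_form j
    ((g.appLE (chart m j) (f ⁻¹ᵁ chart m j) (hle j)).hom (ratio m i j))
  -- A common exponent: the sum bounds every `d i j`, and multiplying by powers of `x_j` makes up
  -- the difference.
  let e := ∑ i, ∑ j, d i j
  have hde (i j) : d i j ≤ e :=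
    (Finset.single_le_sum (f := d i) (fun _ _ ↦ Nat.zero_le _) (Finset.mem_univ j)).trans
      (Finset.single_le_sum (f := fun i ↦ ∑ j, d i j) (fun _ _ ↦ Nat.zero_le _)
        (Finset.mem_univ i))
  -- On the diagonal the ratio is 1, and its form is prescribed so that it is exactly a power of the
  -- variable.
  refine ⟨e, fun i j ↦ if i = j then MvPolynomial.X i ^ (e + 2) else
    MvPolynomial.X j ^ (e + 2 - d i j) * G i j, fun i j ↦ ?_, fun i ↦ if_pos rfl,
    fun {Y} y v w hv hw j hj i ↦ ?_⟩
  · beta_reduce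
    split_ifs with hij
    · exact MvPolynomial.isHomogeneous_X_pow _ _
    · have := (MvPolynomial.isHomogeneous_X_pow (R := Γ(B, ⊤)) j (e + 2 - d i j)).mul (hG i j)
      rwa [Nat.sub_add_cancel ((hde i j).trans (by omega))] at this
  · beta_reduce
    split_ifs with hij
    · subst hij
      rw [MvPolynomial.eval₂_pow, MvPolynomial.eval₂_X, mul_comm]
    · have hy := IsCoord.top_le_preimage hv hj
      have hy' : ⊤ ≤ (y ≫ g) ⁻¹ᵁ chart m j := hy.trans (y.preimage_mono (hle j))
      have h1 := hrep i j y v hv hy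
      have h2 := hw.appLE_mul j hy' i
      rw [appLE_comp] at h1
      rw [MvPolynomial.eval₂_mul, MvPolynomial.eval₂_pow, MvPolynomial.eval₂_X, ← h1, ← h2,
        ← pow_sub_mul_pow (v j) ((hde i j).trans (by omega : e ≤ e + 2))]
      ring

/-- Whether a point lies over a chart is visible at its residue field. -/
lemma IsCoord.preimage_chart_eq (g : P ⟶ ProjectiveSpaceInt.{u} m)
    (hfield : ∀ (D : Type u) [Field D] (y : Spec (.of D) ⟶ P) (v : Fin (m + 1) → D),
      Rep (y ≫ f) (fun i ↦ toΓ D (v i)) → Rep (y ≫ g) fun i ↦ toΓ D (v i)) (j : Fin (m + 1)) :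
    f ⁻¹ᵁ chart m j = g ⁻¹ᵁ chart m j := by
  ext x
  let y : Spec (.of (P.residueField x)) ⟶ P := P.fromSpecResidueField x
  have hy (z : Spec (.of (P.residueField x))) : y z = x := Scheme.fromSpecResidueField_apply x z
  obtain ⟨v, -, -, hv⟩ := exists_rep_of_isLocalRing (y ≫ f)
  have e := (hv.preimage j).trans ((hfield _ y v hv).preimage j).symm
  let z : Spec (.of (P.residueField x)) := IsLocalRing.closedPoint (P.residueField x)
  have h1 : y z ∈ f ⁻¹ᵁ chart m j ↔ y z ∈ g ⁻¹ᵁ chart m j := SetLike.ext_iff.1 e z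
  exact (hy z) ▸ h1

/-- A morphism from projective space to itself that is the identity on geometric points and fixes
the standard frame is the identity. -/
lemma IsCoord.eq_of_frame [IsAffine B] {f g : P ⟶ ProjectiveSpaceInt.{u} m} (h : IsCoord π f)
    (hm : 2 ≤ m)
    (hfield : ∀ (D : Type u) [Field D] (y : Spec (.of D) ⟶ P) (v : Fin (m + 1) → D),
      Rep (y ≫ f) (fun i ↦ toΓ D (v i)) → Rep (y ≫ g) fun i ↦ toΓ D (v i))
    (hframe : ∀ j, ∃ y : B ⟶ P, y ≫ π = 𝟙 B ∧ Rep (y ≫ f) (Pi.single j 1) ∧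
      Rep (y ≫ g) (Pi.single j 1))
    (hone : ∃ y : B ⟶ P, y ≫ π = 𝟙 B ∧ Rep (y ≫ f) 1 ∧ Rep (y ≫ g) 1) : f = g := by
  have heq := preimage_chart_eq g hfield
  obtain ⟨e, G, hG, hii, hrep⟩ := h.exists_ratio_forms g fun j ↦ (heq j).le
  have hid : (𝟙 B : B ⟶ B).appTop.hom = RingHom.id _ := by simp
  have hmain := eq_of_cocycle_of_isNilpotent (σ := Fin (m + 1)) (e := e) (G := G)
    (fun i j ↦ by
      have := Finset.exists_mem_notMem_of_card_lt_card (s := {i, j})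
        (t := (Finset.univ : Finset (Fin (m + 1)))) ((Finset.card_le_two).trans_lt (by simp; omega))
      obtain ⟨k, -, hk⟩ := this
      exact ⟨k, by simpa using hk⟩) hG hii (fun i j k ↦ by
      -- The cocycle relation is the identity `(w_i / w_k)(w_k / w_j) = w_i / w_j` at the torus
      -- point, where all `w j` are units.
      obtain ⟨E, _, ι, y, hι, hu, hy, hy'⟩ := h.exists_torus_point
      have hl (j) : ⊤ ≤ (y ≫ g) ⁻¹ᵁ chart m j :=
        (IsCoord.top_le_preimage hy' ((hu j).map (toΓ E))).trans (y.preimage_mono (heq j).le)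
      have hw := Rep.of_le_preimage (y ≫ g) 0 (hl 0)
      set w := fun i ↦ ((y ≫ g).appLE (chart m 0) ⊤ (hl 0)).hom (ratio m i 0)
      have hwu (j) : IsUnit (w j) := by
        refine isUnit_of_basicOpen_eq_top ?_
        rw [← hw.preimage]
        exact top_le_iff.1 (hl j)
      have key (i j) := hrep y _ w hy' hw j ((hu j).map (toΓ E)) i
      simp_rw [hy, eval₂_toΓ, MvPolynomial.eval₂_eta] at key
      refine hι (toΓ_injective E (((hwu j).mul (hwu k)).mul_left_cancel ?_))
      simp only [map_mul, map_pow]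
      linear_combination (w k * (toΓ E) (ι (MvPolynomial.X k)) ^ (e + 2)) * key i j -
        (toΓ E (ι (G k j)) * w j) * key i k -
        (w i * (toΓ E) (ι (MvPolynomial.X k)) ^ (e + 2)) * key k j)
    (fun i j hij ↦ by
      obtain ⟨y, hy, h1, h2⟩ := hframe j
      have := hrep y _ _ h1 h2 j (by simp) i
      rw [hy, hid, Pi.single_eq_same, Pi.single_eq_of_ne hij] at this
      simpa using this) (fun i j ↦ by
      obtain ⟨y, hy, h1, h2⟩ := hone
      have := hrep y _ _ h1 h2 j (by simp) i
      rw [hy, hid] at this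
      simpa using this) (fun i j μ ↦ by
      -- A coefficient is nilpotent if it lies in every prime `q`. Modulo `q` the two forms are
      -- compared at the generic point of projective space over a field, where `hfield` applies.
      rw [← mem_nilradical, nilradical_eq_sInf, Ideal.mem_sInf]
      intro q hq
      have : q.IsPrime := hq
      obtain ⟨D, _, ψ, hψ⟩ := exists_field_hom q
      rw [← hψ, RingHom.mem_ker, ← MvPolynomial.coeff_map]
      suffices MvPolynomial.map ψ (G i j - MvPolynomial.X i * MvPolynomial.X j ^ (e + 1)) = 0 by
        rw [this, MvPolynomial.coeff_zero]
      obtain ⟨K, _, β, hβ⟩ := exists_field_hom (⊥ : Ideal (MvPolynomial (Fin (m + 1)) D))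
      have hβi : Function.Injective β := (RingHom.injective_iff_ker_eq_bot β).2 hβ
      have hu (i) : IsUnit (β (MvPolynomial.X i)) :=
        ((map_ne_zero_iff β hβi).2 (MvPolynomial.X_ne_zero i)).isUnit
      obtain ⟨y, hy, hy'⟩ := h.exists_spec_point_of_isUnit
        ((β.comp (MvPolynomial.map ψ)).comp MvPolynomial.C) (fun i ↦ β (MvPolynomial.X i)) (hu 0)
      have h1 := hrep y _ _ hy' (hfield K y _ hy') j ((hu j).map (toΓ K)) i
      have h2 : (fun i ↦ toΓ K (β (MvPolynomial.X i))) = fun i ↦ toΓ K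
        ((β.comp (MvPolynomial.map ψ)) (MvPolynomial.X i)) := by simp
      rw [hy, h2, eval₂_toΓ, MvPolynomial.eval₂_eta] at h1
      simp only [← map_mul, ← map_pow] at h1
      have h3 := toΓ_injective _ h1
      rw [RingHom.comp_apply, ← map_mul] at h3
      have h4 := hβi h3
      refine mul_right_cancel₀ (MvPolynomial.X_ne_zero (R := D) j) ?_
      simp only [map_mul, map_pow, MvPolynomial.map_X, map_sub] at h4 ⊢
      linear_combination h4)
  refine hom_ext_of_local fun x ↦ ?_
  obtain ⟨j, hj⟩ := exists_mem_chart (f x)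
  refine ⟨f ⁻¹ᵁ chart m j, hj, ?_⟩
  have h1 : ⊤ ≤ ((f ⁻¹ᵁ chart m j).ι ≫ f) ⁻¹ᵁ chart m j := fun y _ ↦ y.2
  have h2 : ⊤ ≤ ((f ⁻¹ᵁ chart m j).ι ≫ g) ⁻¹ᵁ chart m j := fun y _ ↦ (heq j).le y.2
  refine hom_ext_of_le_preimage h1 h2 fun i ↦ ?_
  have key := hrep _ _ _ (Rep.of_le_preimage _ j h1) (Rep.of_le_preimage _ j h2) j (by simp) i
  rw [hmain] at key
  simpa using key

end Frames

/-! ### Field-valued points and frames. -/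

section FieldPoints

variable {B P X : Scheme.{u}} {m : ℕ}

lemma exists_ringHom_spec {D : Type u} [CommRing D] (s : Spec (.of D) ⟶ X) :
    ∃ φ : Γ(X, ⊤) →+* D, s.appTop.hom = (toΓ D).comp φ := by
  let e : D ≃+* Γ(Spec (.of D), ⊤) := RingEquiv.ofBijective (toΓ D) (toΓ_bijective D)
  refine ⟨e.symm.toRingHom.comp s.appTop.hom, ?_⟩
  ext a
  exact (e.apply_symm_apply _).symm

lemma mem_basicOpen_toΓ_field {D : Type u} [Field D] (z : Spec (.of D)) (a : D) :
    z ∈ (Spec (.of D)).basicOpen (toΓ D a) ↔ a ≠ 0 := by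
  rw [basicOpen_toΓ]
  refine ⟨fun h ↦ ?_, fun h h' ↦ z.2.ne_top (Ideal.eq_top_of_isUnit_mem _ h' h.isUnit)⟩
  rintro rfl
  exact h (zero_mem _)

lemma exists_field_point (b : X) : ∃ (D : Type u) (_ : Field D) (s : Spec (.of D) ⟶ X)
    (φ : Γ(X, ⊤) →+* D), s.appTop.hom = (toΓ D).comp φ ∧ (∀ z, s z = b) ∧
      ∀ g, b ∈ X.basicOpen g ↔ φ g ≠ 0 := by
  let s : Spec (.of (X.residueField b)) ⟶ X := X.fromSpecResidueField b
  have hs (z : Spec (.of (X.residueField b))) : s z = b := Scheme.fromSpecResidueField_apply b z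
  obtain ⟨φ, hφ⟩ := exists_ringHom_spec s
  refine ⟨_, inferInstance, s, φ, hφ, hs, fun g ↦ ?_⟩
  let z : Spec (.of (X.residueField b)) := IsLocalRing.closedPoint (X.residueField b)
  rw [← mem_basicOpen_toΓ_field z]
  have h1 : toΓ _ (φ g) = s.appTop.hom g := congr($hφ g).symm
  rw [h1, basicOpen_appTop]
  change _ ↔ s z ∈ X.basicOpen g
  rw [hs]

lemma Rep.exists_smul_of_field {D : Type u} [Field D] {g : Spec (.of D) ⟶ ProjectiveSpaceInt.{u} m}
    {v w : Fin (m + 1) → D} (hv : Rep g fun i ↦ toΓ D (v i)) (hw : Rep g fun i ↦ toΓ D (w i)) :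
    ∃ a : D, a ≠ 0 ∧ w = a • v := by
  obtain ⟨j, hj⟩ := hv.exists_ne_zero
  obtain ⟨i, hi⟩ := hw.exists_ne_zero
  have hj' : v j ≠ 0 := fun h ↦ hj (by rw [h, map_zero])
  have hi' : w i ≠ 0 := fun h ↦ hi (by rw [h, map_zero])
  have key (k) : w k = w j / v j * v k := by
    have := hv.mul_eq_of_spec hw j k
    field_simp
    linear_combination this
  refine ⟨w j / v j, fun h ↦ hi' ?_, funext key⟩
  rw [key, h, zero_mul]

lemma Rep.smul_spec {D : Type u} [CommRing D] {g : Spec (.of D) ⟶ ProjectiveSpaceInt.{u} m}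
    {v : Fin (m + 1) → D} (hv : Rep g fun i ↦ toΓ D (v i)) {a : D} (ha : IsUnit a) :
    Rep g fun i ↦ toΓ D ((a • v) i) := by
  refine hv.of_mul_eq (fun i j ↦ ?_) fun x ↦ ?_
  · simp only [← map_mul, Pi.smul_apply, smul_eq_mul]
    congr 1
    ring
  · obtain ⟨j, hj⟩ := hv.exists_mem x
    refine ⟨j, ?_⟩
    rw [Pi.smul_apply, smul_eq_mul, map_mul, Scheme.basicOpen_mul,
      Scheme.basicOpen_of_isUnit _ (ha.map (toΓ D))]
    exact ⟨trivial, hj⟩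

lemma toΓ_mulVec {D α β A : Type*} [CommRing D] [CommRing A] [Fintype β] (φ : D →+* A)
    (T : Matrix α β D) (v : β → D) (a : α) :
    (T.map φ).mulVec (fun i ↦ φ (v i)) a = φ (T.mulVec v a) := by
  simp [Matrix.mulVec, dotProduct]

/-- Over a field, two systems of coordinates differ by a linear substitution. -/
lemma IsCoord.exists_matrix_of_field {π : P ⟶ B} {f f' : P ⟶ ProjectiveSpaceInt.{u} (m + 1)}
    (h : IsCoord π f) (h' : IsCoord π f') {D : Type u} [Field D] (s : Spec (.of D) ⟶ B) :
    ∃ T : Matrix (Fin (m + 1 + 1)) (Fin (m + 1 + 1)) D, IsUnit T.det ∧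
      ∀ (y : Spec (.of D) ⟶ P), y ≫ π = s →
        ∀ v, Rep (y ≫ f) (fun i ↦ toΓ D (v i)) →
          Rep (y ≫ f') (fun i ↦ toΓ D (T.mulVec v i)) := by
  let e : D ≃+* Γ(Spec (.of D), ⊤) := RingEquiv.ofBijective (toΓ D) (toΓ_bijective D)
  have : IsDomain Γ(Spec (.of D), ⊤) := e.symm.toMulEquiv.isDomain D
  have : UniqueFactorizationMonoid Γ(Spec (.of D), ⊤) :=
    e.toMulEquiv.uniqueFactorizationMonoid inferInstance
  have hp := IsPullback.of_hasPullback π s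
  obtain ⟨T, hT, hT'⟩ := (h.baseChange hp).exists_matrix_of_factorial (h'.baseChange hp)
  obtain ⟨T, rfl⟩ : ∃ T' : Matrix _ _ D, T = T'.map (toΓ D) :=
    ⟨T.map e.symm, by ext i j; exact (e.apply_symm_apply _).symm⟩
  refine ⟨T, ?_, fun y hy v hv ↦ ?_⟩
  · have := isUnit_det_map hT e.symm.toRingHom
    rwa [Matrix.map_map, show (e.symm.toRingHom : _ → D) ∘ toΓ D = id from
      funext e.symm_apply_apply, Matrix.map_id] at this
  · have hy' : y ≫ π = 𝟙 _ ≫ s := by rw [hy, Category.id_comp]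
    have h1 := hT' (pullback.lift y (𝟙 _) hy') (fun i ↦ toΓ D (v i))
    rw [pullback.lift_fst_assoc, pullback.lift_fst_assoc, pullback.lift_snd] at h1
    have h2 := h1 hv
    have e : (T.map (toΓ D)).map (𝟙 (Spec (.of D)) : Spec (.of D) ⟶ _).appTop.hom = T.map (toΓ D) := by
      simp
    rw [e] at h2
    exact (funext (toΓ_mulVec (toΓ D) T v)) ▸ h2

lemma mulVec_diagonal_single {D α : Type*} [CommRing D] [Fintype α] [DecidableEq α]
    (W : α → α → D) (c : α → D) (j : α) :
    (Matrix.of (fun a b ↦ W b a) * Matrix.diagonal c).mulVec (Pi.single j 1) = c j • W j := by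
  ext i
  simp [Matrix.mulVec_single, mul_comm]

lemma mulVec_one_eq_sum {D α : Type*} [CommRing D] [Fintype α] [DecidableEq α] (T : Matrix α α D) :
    T.mulVec 1 = ∑ j, T.mulVec (Pi.single j 1) := by
  ext i
  rw [Finset.sum_apply]
  simp [Matrix.mulVec, dotProduct, Pi.single_apply]

/-- Scaling the columns of `W` by the entries of `adj(W) w` makes their sum proportional to `w`,
without dividing by the determinant. This is the candidate matrix for prescribed images of a frame.
-/
lemma frame_mulVec_one {D α : Type*} [CommRing D] [Fintype α] [DecidableEq α]
    (W : Matrix α α D) (w : α → D) :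
    (W * Matrix.diagonal (W.adjugate.mulVec w)).mulVec 1 = W.det • w := by
  rw [← Matrix.mulVec_mulVec, show (Matrix.diagonal (W.adjugate.mulVec w)).mulVec 1 =
    W.adjugate.mulVec w by ext; simp [Matrix.mulVec_diagonal], Matrix.mulVec_mulVec,
    Matrix.mul_adjugate, Matrix.smul_mulVec, Matrix.one_mulVec]

lemma single_appTop {Y : Scheme.{u}} (y : Y ⟶ X) {n : ℕ} (j : Fin n) :
    (fun i ↦ y.appTop.hom ((Pi.single j 1 : Fin n → Γ(X, ⊤)) i)) = Pi.single j 1 := by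
  ext i
  rw [Pi.single_apply, Pi.single_apply]
  split_ifs <;> simp

lemma one_appTop {Y : Scheme.{u}} (y : Y ⟶ X) {n : ℕ} :
    (fun i ↦ y.appTop.hom ((1 : Fin n → Γ(X, ⊤)) i)) = 1 := by
  ext i
  simp

lemma single_toΓ {D : Type u} [CommRing D] {n : ℕ} (j : Fin n) :
    (fun i ↦ toΓ D ((Pi.single j 1 : Fin n → D) i)) = Pi.single j 1 := by
  ext i
  rw [Pi.single_apply, Pi.single_apply]
  split_ifs <;> simp

lemma one_toΓ {D : Type u} [CommRing D] {n : ℕ} :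
    (fun i ↦ toΓ D ((1 : Fin n → D) i)) = 1 := by
  ext i
  simp

end FieldPoints

/-! ### Two coordinate systems differ locally by a matrix. -/

section Automorphisms

variable {B P : Scheme.{u}} {m : ℕ} {π : P ⟶ B} {f f' : P ⟶ ProjectiveSpaceInt.{u} (m + 1)}

/-- Two invertible matrices that agree on the points of a frame are proportional. -/
lemma smul_of_frame {D : Type*} [Field D] {n : ℕ} {S T : Matrix (Fin n) (Fin n) D}
    (hS : IsUnit S.det) {c : Fin n → D} {d : D}
    (hc : ∀ j, T.mulVec (Pi.single j 1) = c j • S.mulVec (Pi.single j 1))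
    (hd : T.mulVec 1 = d • S.mulVec 1) : T = d • S := by
  have h1 : S.mulVec c = S.mulVec (d • 1) := by
    rw [Matrix.mulVec_smul, ← hd, mulVec_one_eq_sum, Finset.sum_congr rfl fun j _ ↦ hc j]
    simp_rw [← Matrix.mulVec_smul]
    rw [← Matrix.mulVec_sum]
    congr 1
    ext i
    simp [Finset.sum_apply, Pi.single_apply]
  have h2 := congr((S⁻¹).mulVec $h1)
  rw [Matrix.mulVec_mulVec, Matrix.mulVec_mulVec, Matrix.nonsing_inv_mul _ hS, Matrix.one_mulVec,
    Matrix.one_mulVec] at h2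
  subst h2
  ext i j
  have := congr($(hc j) i)
  simpa [Matrix.mulVec_single] using this

/-- At the residue field of `b` the two systems differ by an invertible matrix, so the images of the
frame again form a frame: `det W` and each entry of `adj(W) w` are nonzero there. -/
lemma IsCoord.mem_basicOpen_det_frame [IsAffine B] (h : IsCoord π f) (h' : IsCoord π f') (b : B)
    {p : Fin (m + 1 + 1) → (B ⟶ P)} {o : B ⟶ P} (hp : ∀ j, p j ≫ π = 𝟙 B) (ho : o ≫ π = 𝟙 B)
    (hpf : ∀ j, Rep (p j ≫ f) (Pi.single j 1)) (hof : Rep (o ≫ f) 1)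
    {W : Fin (m + 1 + 1) → Fin (m + 1 + 1) → Γ(B, ⊤)} {w : Fin (m + 1 + 1) → Γ(B, ⊤)}
    (hpf' : ∀ j, Rep (p j ≫ f') (W j)) (hof' : Rep (o ≫ f') w) :
    b ∈ B.basicOpen (Matrix.det (Matrix.of (fun a b ↦ W b a) *
      Matrix.diagonal ((Matrix.of (fun a b ↦ W b a)).adjugate.mulVec w))) := by
  obtain ⟨D, _, s, φ, hφ, -, hb⟩ := exists_field_point b
  rw [hb]
  obtain ⟨T, hT, hT'⟩ := h.exists_matrix_of_field h' s
  have hφ' (a) : s.appTop.hom a = toΓ D (φ a) := congr($hφ a)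
  have h1 (j) : ∃ c : D, c ≠ 0 ∧ (fun i ↦ φ (W j i)) = c • T.mulVec (Pi.single j 1) := by
    have e1 := (hpf j).comp s
    have e2 := (hpf' j).comp s
    rw [single_appTop, ← single_toΓ, ← Category.assoc] at e1
    simp_rw [hφ'] at e2
    rw [← Category.assoc] at e2
    exact (hT' _ (by rw [Category.assoc, hp, Category.comp_id]) _ e1).exists_smul_of_field e2
  have h2 : ∃ c : D, c ≠ 0 ∧ (fun i ↦ φ (w i)) = c • T.mulVec 1 := by
    have e1 := hof.comp s
    have e2 := hof'.comp s
    rw [one_appTop, ← one_toΓ, ← Category.assoc] at e1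
    simp_rw [hφ'] at e2
    rw [← Category.assoc] at e2
    exact (hT' _ (by rw [Category.assoc, ho, Category.comp_id]) _ e1).exists_smul_of_field e2
  choose c hc hc' using h1
  obtain ⟨d, hd, hd'⟩ := h2
  set V : Matrix (Fin (m + 1 + 1)) (Fin (m + 1 + 1)) Γ(B, ⊤) := Matrix.of fun a b ↦ W b a
  have hV : V.map φ = T * Matrix.diagonal c := by
    ext i j
    have := congr($(hc' j) i)
    simp only [Pi.smul_apply, Matrix.mulVec_single_one, Matrix.col_apply, smul_eq_mul] at this
    simpa [V, mul_comm] using this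
  have hcd : (Matrix.diagonal c).det ≠ 0 := by
    rw [Matrix.det_diagonal]
    exact Finset.prod_ne_zero_iff.2 fun i _ ↦ hc i
  have hVd : (V.map φ).det ≠ 0 := by
    rw [hV, Matrix.det_mul]
    exact mul_ne_zero hT.ne_zero hcd
  have hdet : φ V.det = (V.map φ).det := RingHom.map_det _ _
  rw [Matrix.det_mul, map_mul, hdet]
  refine mul_ne_zero hVd ?_
  rw [Matrix.det_diagonal, map_prod]
  refine Finset.prod_ne_zero_iff.2 fun i _ ↦ ?_
  have h3 : φ (V.adjugate.mulVec w i) = (V.map φ).adjugate.mulVec (fun i ↦ φ (w i)) i := by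
    rw [← toΓ_mulVec]
    congr 1
    exact RingHom.map_adjugate φ V
  rw [h3, hd']
  have h4 : (V.map φ).adjugate.mulVec (T.mulVec 1) i * c i = (V.map φ).det := by
    have : T.mulVec 1 = (V.map φ).mulVec (fun i ↦ (c i)⁻¹) := by
      rw [hV, ← Matrix.mulVec_mulVec]
      congr 1
      ext i
      simp [Matrix.mulVec_diagonal, hc]
    rw [this, Matrix.mulVec_mulVec, Matrix.adjugate_mul, Matrix.smul_mulVec, Matrix.one_mulVec]
    simp [hc]
  rw [Matrix.mulVec_smul, Pi.smul_apply, smul_eq_mul]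
  exact mul_ne_zero hd fun h0 ↦ hVd (by rw [← h4, h0, zero_mul])

lemma Rep.of_smul {X : Scheme.{u}} {g : X ⟶ ProjectiveSpaceInt.{u} m}
    {v : Fin (m + 1) → Γ(X, ⊤)} (hv : Rep g v) {a : Γ(X, ⊤)} (ha : IsUnit a) : Rep g (a • v) := by
  refine hv.of_mul_eq (fun i j ↦ ?_) fun x ↦ ?_
  · simp only [Pi.smul_apply, smul_eq_mul]
    ring
  · obtain ⟨j, hj⟩ := hv.exists_mem x
    refine ⟨j, ?_⟩
    rw [Pi.smul_apply, smul_eq_mul, Scheme.basicOpen_mul, Scheme.basicOpen_of_isUnit _ ha]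
    exact ⟨trivial, hj⟩

/-- Correct `f'` by `T⁻¹` to obtain `g`. On field-valued points `f` and `f'` differ by some matrix
that agrees with `T` on a frame and so is proportional to it. Hence `g` and `f` agree on these
points and on the frame, and `eq_of_frame` gives `f = g`. That lemma requires dimension at least 2,
which is `hm`. -/
lemma IsCoord.rep_mulVec_of_frame [IsAffine B] (h : IsCoord π f) (h' : IsCoord π f') (hm : 1 ≤ m)
    {p : Fin (m + 1 + 1) → (B ⟶ P)} {o : B ⟶ P} (hp : ∀ j, p j ≫ π = 𝟙 B) (ho : o ≫ π = 𝟙 B)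
    (hpf : ∀ j, Rep (p j ≫ f) (Pi.single j 1)) (hof : Rep (o ≫ f) 1)
    {T : Matrix (Fin (m + 1 + 1)) (Fin (m + 1 + 1)) Γ(B, ⊤)} (hT : IsUnit T.det)
    (hpf' : ∀ j, Rep (p j ≫ f') (T.mulVec (Pi.single j 1))) (hof' : Rep (o ≫ f') (T.mulVec 1))
    {Y : Scheme.{u}} (y : Y ⟶ P) (v : Fin (m + 1 + 1) → Γ(Y, ⊤)) (hv : Rep (y ≫ f) v) :
    Rep (y ≫ f') ((T.map (y ≫ π).appTop.hom).mulVec v) := by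
  have hTi : IsUnit (T⁻¹).det := Matrix.isUnit_nonsing_inv_det_iff.2 hT
  have hinv {D : Type u} [CommRing D] (φ : Γ(B, ⊤) →+* D) : (T⁻¹).map φ * T.map φ = 1 := by
    rw [← Matrix.map_mul, Matrix.nonsing_inv_mul _ hT]
    simp
  obtain ⟨g, hg⟩ := exists_smul f' ((T⁻¹).map π.appTop.hom) (isUnit_det_map hTi _)
  have hg' {Y : Scheme.{u}} (y : Y ⟶ P) (v : Fin (m + 1 + 1) → Γ(Y, ⊤)) (hv : Rep (y ≫ f') v) :
      Rep (y ≫ g) (((T⁻¹).map (y ≫ π).appTop.hom).mulVec v) := by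
    have := hg y v hv
    rwa [Matrix.map_map, ← RingHom.coe_comp, ← CommRingCat.hom_comp, ← Scheme.Hom.comp_appTop]
      at this
  have hg1 {y : B ⟶ P} (hy : y ≫ π = 𝟙 B) (v : Fin (m + 1 + 1) → Γ(B, ⊤))
      (hv : Rep (y ≫ f') (T.mulVec v)) : Rep (y ≫ g) v := by
    have h1 := hg' y _ hv
    have h2 : (T⁻¹).map (y ≫ π).appTop.hom = T⁻¹ := by
      rw [hy]; ext; simp
    rwa [h2, Matrix.mulVec_mulVec, Matrix.nonsing_inv_mul _ hT, Matrix.one_mulVec] at h1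
  have hfg : f = g := by
    refine h.eq_of_frame (by omega) (fun D _ y v hv ↦ ?_) (fun j ↦ ⟨p j, hp j, hpf j, hg1 (hp j) _ (hpf' j)⟩)
      ⟨o, ho, hof, hg1 ho _ hof'⟩
    obtain ⟨S, hS, hS'⟩ := h.exists_matrix_of_field h' (y ≫ π)
    obtain ⟨φ, hφ⟩ := exists_ringHom_spec (y ≫ π)
    have hφ' (a) : (y ≫ π).appTop.hom a = toΓ D (φ a) := congr($hφ a)
    have hφs (j : Fin (m + 1 + 1)) : (fun i ↦ φ ((Pi.single j 1 : Fin (m + 1 + 1) → Γ(B, ⊤)) i)) =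
        Pi.single j 1 := by
      ext i
      rw [Pi.single_apply, Pi.single_apply]
      split_ifs <;> simp
    have h1 (j) : ∃ c : D, c ≠ 0 ∧
        (T.map φ).mulVec (Pi.single j 1) = c • S.mulVec (Pi.single j 1) := by
      have e1 := (hpf j).comp (y ≫ π)
      have e2 := (hpf' j).comp (y ≫ π)
      rw [single_appTop, ← single_toΓ, ← Category.assoc] at e1
      simp_rw [hφ', ← toΓ_mulVec φ, hφs] at e2
      rw [← Category.assoc] at e2
      exact (hS' _ (by rw [Category.assoc, hp, Category.comp_id]) _ e1).exists_smul_of_field e2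
    have h2 : ∃ c : D, c ≠ 0 ∧ (T.map φ).mulVec 1 = c • S.mulVec 1 := by
      have e1 := hof.comp (y ≫ π)
      have e2 := hof'.comp (y ≫ π)
      have e3 : (fun i ↦ φ ((1 : Fin (m + 1 + 1) → Γ(B, ⊤)) i)) = 1 := by ext; simp
      rw [one_appTop, ← one_toΓ, ← Category.assoc] at e1
      simp_rw [hφ', ← toΓ_mulVec φ, e3] at e2
      rw [← Category.assoc] at e2
      exact (hS' _ (by rw [Category.assoc, ho, Category.comp_id]) _ e1).exists_smul_of_field e2
    choose c hc hc' using h1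
    obtain ⟨d, hd, hd'⟩ := h2
    have hTS := smul_of_frame hS hc' hd'
    have e1 := (hS' y rfl v hv).smul_spec hd.isUnit
    rw [← Matrix.smul_mulVec, ← hTS] at e1
    have e2 := hg' y _ e1
    rw [hφ] at e2
    have e3 : ((T⁻¹).map ((toΓ D).comp φ)).mulVec (fun i ↦ toΓ D ((T.map φ).mulVec v i)) =
        fun i ↦ toΓ D (v i) := by
      have e4 : (fun i ↦ toΓ D ((T.map φ).mulVec v i)) =
          (T.map ((toΓ D).comp φ)).mulVec fun i ↦ toΓ D (v i) := by
        ext i; exact map_mulVec' T φ (toΓ D) v i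
      rw [e4, Matrix.mulVec_mulVec, hinv ((toΓ D).comp φ), Matrix.one_mulVec]
    rwa [e3] at e2
  subst hfg
  -- From `f = g` back to `f'`: locally `y ≫ f'` has coordinates `w`, the vector `T⁻¹ w` represents
  -- `y ≫ f`, and so `T v` is proportional to `w`.
  refine Rep.of_local fun x ↦ ?_
  obtain ⟨U, hxU, w, hw⟩ := exists_local_rep (y ≫ f') x
  refine ⟨U, hxU, ?_⟩
  rw [← Category.assoc] at hw
  have h1 := hg' _ _ hw
  have h2 := hv.comp U.ι
  rw [← Category.assoc] at h2
  simp_rw [map_mulVec', ← CommRingCat.hom_comp, ← Scheme.Hom.comp_appTop, ← Category.assoc]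
  have h3 := mulVec_mul_eq (T.map ((U.ι ≫ y) ≫ π).appTop.hom) (h1.mul_eq h2)
  rw [Matrix.mulVec_mulVec, ← Matrix.map_mul, Matrix.mul_nonsing_inv _ hT,
    Matrix.map_one _ (map_zero _) (map_one _), Matrix.one_mulVec] at h3
  exact hw.of_mul_eq h3 fun x ↦ exists_mem_basicOpen_mulVec _ (isUnit_det_map hT _) (h2.exists_mem x)

/-- The conclusion that two coordinate systems differ by a linear substitution over `C`. -/
def IsLinearOver {C : Scheme.{u}} (π : P ⟶ B) (f f' : P ⟶ ProjectiveSpaceInt.{u} m) (j : C ⟶ B)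
    (T : Matrix (Fin (m + 1)) (Fin (m + 1)) Γ(C, ⊤)) : Prop :=
  ∀ {Y : Scheme.{u}} (y : Y ⟶ P) (t : Y ⟶ C), y ≫ π = t ≫ j → ∀ v, Rep (y ≫ f) v →
    Rep (y ≫ f') ((T.map t.appTop.hom).mulVec v)

lemma IsCoord.exists_linear_of_rep [IsAffine B] (h : IsCoord π f) (h' : IsCoord π f') (hm : 1 ≤ m)
    (b : B) {p : Fin (m + 1 + 1) → (B ⟶ P)} {o : B ⟶ P} (hp : ∀ j, p j ≫ π = 𝟙 B)
    (ho : o ≫ π = 𝟙 B) (hpf : ∀ j, Rep (p j ≫ f) (Pi.single j 1)) (hof : Rep (o ≫ f) 1)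
    {W : Fin (m + 1 + 1) → Fin (m + 1 + 1) → Γ(B, ⊤)} {w : Fin (m + 1 + 1) → Γ(B, ⊤)}
    (hpf' : ∀ j, Rep (p j ≫ f') (W j)) (hof' : Rep (o ≫ f') w) :
    ∃ (C : Scheme.{u}) (j : C ⟶ B), IsAffine C ∧ IsOpenImmersion j ∧ b ∈ Set.range j ∧
      ∃ T, IsUnit T.det ∧ IsLinearOver π f f' j T := by
  have hb := h.mem_basicOpen_det_frame h' b hp ho hpf hof hpf' hof'
  set T := Matrix.of (fun a b ↦ W b a) *
      Matrix.diagonal ((Matrix.of (fun a b ↦ W b a)).adjugate.mulVec w)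
  let U := B.basicOpen T.det
  let T' := T.map U.ι.appTop.hom
  have hU : IsUnit (U.ι.appTop.hom T.det) := isUnit_of_basicOpen_eq_top (by
    rw [basicOpen_appTop]
    exact top_le_iff.1 fun x _ ↦ x.2)
  have hT' : IsUnit T'.det := by
    have : T'.det = U.ι.appTop.hom T.det := (RingHom.map_det _ _).symm
    rwa [this]
  have hq := IsPullback.of_hasPullback π U.ι
  have : IsAffine (U : Scheme.{u}) := (isAffineOpen_top B).basicOpen T.det
  have hc (y : B ⟶ P) (hy : y ≫ π = 𝟙 B) : (U.ι ≫ y) ≫ π = 𝟙 _ ≫ U.ι := by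
    rw [Category.assoc, hy, Category.comp_id, Category.id_comp]
  refine ⟨U, U.ι, this, inferInstance, ⟨⟨b, hb⟩, rfl⟩, T', hT', fun {Y} y t hyt v hv ↦ ?_⟩
  have key := (h.baseChange hq).rep_mulVec_of_frame (h'.baseChange hq) hm
    (p := fun j ↦ pullback.lift (U.ι ≫ p j) (𝟙 _) (hc _ (hp j)))
    (o := pullback.lift (U.ι ≫ o) (𝟙 _) (hc _ ho)) (fun j ↦ pullback.lift_snd _ _ _)
    (pullback.lift_snd _ _ _) (fun j ↦ ?_) ?_ hT' (fun j ↦ ?_) ?_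
    (pullback.lift y t hyt) v ?_
  · rwa [pullback.lift_fst_assoc, pullback.lift_snd] at key
  · rw [pullback.lift_fst_assoc, Category.assoc, ← single_appTop U.ι]
    exact (hpf j).comp _
  · rw [pullback.lift_fst_assoc, Category.assoc, ← one_appTop U.ι]
    exact hof.comp _
  · rw [pullback.lift_fst_assoc, Category.assoc, ← single_appTop U.ι]
    have e1 : T'.mulVec (fun i ↦ U.ι.appTop.hom ((Pi.single j 1 : Fin _ → Γ(B, ⊤)) i)) =
        fun i ↦ U.ι.appTop.hom (T.mulVec (Pi.single j 1) i) := funext (toΓ_mulVec _ _ _)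
    rw [e1, mulVec_diagonal_single]
    have e2 := (hpf' j).comp U.ι
    have e3 : IsUnit (U.ι.appTop.hom ((Matrix.of (fun a b ↦ W b a)).adjugate.mulVec w j)) := by
      refine isUnit_of_dvd_unit (map_dvd _ ?_) hU
      rw [Matrix.det_mul, Matrix.det_diagonal]
      exact (Finset.dvd_prod_of_mem _ (Finset.mem_univ j)).mul_left _
    convert e2.of_smul e3 using 1
    ext i
    simp
  · rw [pullback.lift_fst_assoc, Category.assoc, ← one_appTop U.ι]
    have e1 : T'.mulVec (fun i ↦ U.ι.appTop.hom ((1 : Fin _ → Γ(B, ⊤)) i)) =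
        fun i ↦ U.ι.appTop.hom (T.mulVec 1 i) := funext (toΓ_mulVec _ _ _)
    rw [e1, frame_mulVec_one]
    have e2 := hof'.comp U.ι
    have e3 : IsUnit (U.ι.appTop.hom (Matrix.of (fun a b ↦ W b a)).det) := by
      refine isUnit_of_dvd_unit (map_dvd _ ?_) hU
      rw [Matrix.det_mul]
      exact Dvd.intro _ rfl
    convert e2.of_smul e3 using 1
    ext i
    simp
  · rwa [pullback.lift_fst_assoc]

/-- Locally on the base, two systems of coordinates differ by a linear substitution. -/
theorem IsCoord.exists_linear (h : IsCoord π f) (h' : IsCoord π f') (hm : 1 ≤ m) (b : B) :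
    ∃ (C : Scheme.{u}) (j : C ⟶ B), IsAffine C ∧ IsOpenImmersion j ∧ b ∈ Set.range j ∧
      ∃ T, IsUnit T.det ∧ IsLinearOver π f f' j T := by
  -- The standard frame for `f`: the sections through the coordinate points and through the point
  -- `(1 : … : 1)`.
  choose p hp hpf using fun j : Fin (m + 1 + 1) ↦ h.exists_point (𝟙 B) (Pi.single j 1)
    fun x ↦ ⟨j, by rw [Pi.single_eq_same, Scheme.basicOpen_of_isUnit _ isUnit_one]; trivial⟩
  obtain ⟨o, ho, hof⟩ := h.exists_point (𝟙 B) 1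
    fun x ↦ ⟨0, by rw [Pi.one_apply, Scheme.basicOpen_of_isUnit _ isUnit_one]; trivial⟩
  -- Near `b` the image under `f'` of each section of the frame stays in one chart, which gives it
  -- global homogeneous coordinates.
  choose a ha using fun j ↦ exists_mem_chart ((p j ≫ f') b)
  obtain ⟨c, hc⟩ := exists_mem_chart ((o ≫ f') b)
  let V : B.Opens := (o ≫ f') ⁻¹ᵁ chart (m + 1) c ⊓
    Finset.univ.inf fun j ↦ (p j ≫ f') ⁻¹ᵁ chart (m + 1) (a j)
  have hbV : b ∈ V := by
    refine ⟨hc, ?_⟩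
    rw [Opens.coe_finset_inf]
    simpa using ha
  obtain ⟨U, hU, hbU, hUV⟩ := exists_isAffineOpen_mem_and_subset (x := b) (U := V) hbV
  have hUo : ⊤ ≤ (U.ι ≫ o ≫ f') ⁻¹ᵁ chart (m + 1) c := fun x _ ↦ (hUV x.2).1
  have hUp (j) : ⊤ ≤ (U.ι ≫ p j ≫ f') ⁻¹ᵁ chart (m + 1) (a j) := fun x _ ↦
    Finset.inf_le (f := fun j ↦ (p j ≫ f') ⁻¹ᵁ chart (m + 1) (a j)) (Finset.mem_univ j) (hUV x.2).2
  have hcU (y : B ⟶ P) (hy : y ≫ π = 𝟙 B) : (U.ι ≫ y) ≫ π = 𝟙 _ ≫ U.ι := by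
    rw [Category.assoc, hy, Category.comp_id, Category.id_comp]
  have hq := IsPullback.of_hasPullback π U.ι
  have : IsAffine (U : Scheme.{u}) := hU
  obtain ⟨C, j, hC, hj, ⟨b', hb'⟩, T, hT, hTl⟩ := (h.baseChange hq).exists_linear_of_rep (h'.baseChange hq) hm
    (⟨b, hbU⟩ : U) (p := fun j ↦ pullback.lift (U.ι ≫ p j) (𝟙 _) (hcU _ (hp j)))
    (o := pullback.lift (U.ι ≫ o) (𝟙 _) (hcU _ ho)) (fun j ↦ pullback.lift_snd _ _ _)
    (pullback.lift_snd _ _ _) (fun j ↦ by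
      rw [pullback.lift_fst_assoc, Category.assoc, ← single_appTop U.ι]
      exact (hpf j).comp _) (by
      rw [pullback.lift_fst_assoc, Category.assoc, ← one_appTop U.ι]
      exact hof.comp _) (fun j ↦ by
      rw [pullback.lift_fst_assoc, Category.assoc]
      exact Rep.of_le_preimage _ _ (hUp j)) (by
      rw [pullback.lift_fst_assoc, Category.assoc]
      exact Rep.of_le_preimage _ _ hUo)
  refine ⟨C, j ≫ U.ι, hC, inferInstance, ⟨b', ?_⟩, T, hT, fun {Y} y t hyt v hv ↦ ?_⟩
  · rw [Scheme.Hom.comp_apply, hb']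
    rfl
  · have := hTl (pullback.lift y (t ≫ j) (by rw [hyt, Category.assoc])) t
      (pullback.lift_snd _ _ _) v
    rw [pullback.lift_fst_assoc, pullback.lift_fst_assoc] at this
    exact this hv

end Automorphisms

/-! ### Sections and generators of invertible sheaves. -/

section ModuleSections

variable {X : Scheme.{u}} {L : X.Modules} {U V W : X.Opens}

@[simp]
lemma res_res (h : V ≤ U) (h' : W ≤ V) (s : Γ(L, U)) :
    res L h' (res L h s) = res L (h'.trans h) s :=
  congr(($((L.presheaf.map_comp (homOfLE h).op (homOfLE h').op).symm)).hom s)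

@[simp]
lemma res_self (h : U ≤ U) (s : Γ(L, U)) : res L h s = s :=
  congr(($(L.presheaf.map_id (.op U))).hom s)

lemma res_smul (h : V ≤ U) (a : Γ(X, U)) (s : Γ(L, U)) :
    res L h (a • s) = rs h a • res L h s :=
  Scheme.Modules.map_smul L (homOfLE h) a s

lemma IsGenerator.res {s : Γ(L, U)} (hs : IsGenerator L s) (h : V ≤ U) :
    IsGenerator L (res L h s) := fun W hW ↦ by
  simp_rw [res_res]
  exact hs W _

lemma IsGenerator.exists_smul {s : Γ(L, U)} (hs : IsGenerator L s) (t : Γ(L, U)) :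
    ∃ a : Γ(X, U), t = a • s := by
  obtain ⟨a, ha⟩ := (hs U le_rfl).2 t
  exact ⟨a, by simpa using ha.symm⟩

lemma IsGenerator.smul_injective {s : Γ(L, U)} (hs : IsGenerator L s) {a b : Γ(X, U)}
    (h : a • s = b • s) : a = b :=
  (hs U le_rfl).1 (by simpa using h)

lemma IsGenerator.isUnit {s t : Γ(L, U)} (hs : IsGenerator L s) (ht : IsGenerator L t)
    {a : Γ(X, U)} (h : t = a • s) : IsUnit a := by
  obtain ⟨b, hb⟩ := ht.exists_smul s
  refine IsUnit.of_mul_eq_one b (hs.smul_injective ?_)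
  rw [mul_comm, mul_smul, ← h, ← hb, one_smul]

/-- A section of the restriction of a sheaf of modules as a section of that sheaf. -/
def unres (L : X.Modules) (U : X.Opens) {V : (U : Scheme.{u}).Opens} (s : Γ(restr L U, V)) :
    Γ(L, U.ι ''ᵁ V) := s

lemma unres_smul {V : (U : Scheme.{u}).Opens} (a : Γ((U : Scheme.{u}), V)) (s : Γ(restr L U, V)) :
    unres L U (a • s) = (show Γ(X, U.ι ''ᵁ V) from a) • unres L U s := by
  have := congr($(Scheme.Modules.smul_restrictAppIso_hom U.ι L V a) s)
  rw [Scheme.Opens.ι_appIso] at this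
  exact this

lemma unres_restrSection (s : Γ(L, ⊤)) :
    unres L U (restrSection L U s) = res L le_top s := rfl

lemma IsGenerator.unres {V : (U : Scheme.{u}).Opens} {s : Γ(restr L U, V)}
    (hs : IsGenerator (restr L U) s) : IsGenerator L (unres L U s) := by
  intro W hW
  obtain ⟨W, rfl⟩ : ∃ W' : (U : Scheme.{u}).Opens, W = U.ι ''ᵁ W' := by
    refine ⟨U.ι ⁻¹ᵁ W, ?_⟩
    ext x
    refine ⟨fun hx ↦ ?_, fun ⟨y, hy, h⟩ ↦ h ▸ hy⟩
    obtain ⟨y, -, rfl⟩ := hW hx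
    exact ⟨y, hx, rfl⟩
  have hW' : W ≤ V := by
    intro x hx
    obtain ⟨y, hy, h⟩ := hW ⟨x, hx, rfl⟩
    rwa [← U.ι.isOpenEmbedding.injective h]
  have := hs W hW'
  have e : (fun a : Γ((U : Scheme.{u}), W) ↦ a • Multiview.res (restr L U) hW' s) =
      fun a : Γ(X, U.ι ''ᵁ W) ↦ a • Multiview.res L hW (Multiview.unres L U s) :=
    funext fun a ↦ unres_smul _ _
  exact e ▸ this

/-- The classification of a morphism from an open subscheme, in terms of sections over the
ambient scheme. -/
lemma IsClassifiedBy.unres {m : ℕ} {f : (U : Scheme.{u}) ⟶ ProjectiveSpaceInt.{u} m}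
    {s : Fin (m + 1) → Γ(restr L U, ⊤)} (h : IsClassifiedBy f (restr L U) s) (j : Fin (m + 1)) :
    IsGenerator L (res L (U.ι.image_mono (le_top : f ⁻¹ᵁ chart m j ≤ ⊤)) (unres L U (s j))) ∧
      ∀ i, res L (U.ι.image_mono (le_top : f ⁻¹ᵁ chart m j ≤ ⊤)) (unres L U (s i)) =
        (show Γ(X, U.ι ''ᵁ (f ⁻¹ᵁ chart m j)) from (f.app (chart m j)).hom (ratio m i j)) •
        res L (U.ι.image_mono (le_top : f ⁻¹ᵁ chart m j ≤ ⊤)) (unres L U (s j)) := by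
  refine ⟨(h j).1.unres, fun i ↦ ?_⟩
  have := congr(Multiview.unres L U $((h j).2 i))
  rwa [unres_smul] at this

end ModuleSections

/-! ### Cameras in local trivializations. -/

section CameraSections

variable {P S : Scheme.{u}} {π : P ⟶ S}

/-- If `σ a` generates `L` near a point `z x`, the cokernel `z_* N` vanishes near that point,
although a local generator of `N` at `x` is nonzero. -/
lemma not_mem_range_of_cokernel {L : P.Modules} {z : S ⟶ P} {k : ℕ} {σ : Fin k → Γ(L, ⊤)}
    (hz : Topology.IsInducing z) (hL : HasInvertibleCokernelAlong z L σ) {O : P.Opens}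
    (s : Γ(L, O)) (hs : IsGenerator L s) (a : Fin k) (g : Γ(P, O))
    (hg : res L le_top (σ a) = g • s) {p : P} (hp : p ∈ P.basicOpen g) : p ∉ Set.range z := by
  rintro ⟨x, rfl⟩
  obtain ⟨N, q, hN, hsurj, hker⟩ := hL
  obtain ⟨U, n, hxU, hn⟩ := hN x
  -- Since `z` is inducing, the open set on which `N` is free is cut out by an open set of `P`.
  obtain ⟨V₀, hV₀⟩ := hz.isOpen_iff.1 U.2
  let V : P.Opens := ⟨V₀, hV₀.1⟩ ⊓ P.basicOpen g
  have hVU : z ⁻¹ᵁ V ≤ U := fun y hy ↦ hV₀.2.le hy.1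
  have hxV : z x ∈ V := ⟨hV₀.2.ge hxU, hp⟩
  have hVO : V ≤ O := inf_le_right.trans (P.basicOpen_le g)
  obtain ⟨W, hW, s', hxW, hs'⟩ := hsurj V (res N hVU n) (z x) hxV
  obtain ⟨b, rfl⟩ := (hs.res (hW.trans hVO)).exists_smul s'
  have h0 : (q.app W).hom (res L (hW.trans hVO) s) = 0 := by
    refine (hker _ _).2 fun y hy ↦ ⟨W, le_rfl, hy, ?_⟩
    rw [res_self]
    have hu : IsUnit (rs (hW.trans hVO) g) := isUnit_rs_basicOpen g (hW.trans inf_le_right)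
    have h1 : res L (hW.trans hVO) s = (hu.unit⁻¹.1 : Γ(P, W)) • res L le_top (σ a) := by
      have := congr(res L (hW.trans hVO) $hg)
      rw [res_res, res_smul] at this
      rw [this, ← mul_smul, IsUnit.val_inv_mul, one_smul]
    rw [h1]
    exact Submodule.smul_mem _ _ (Submodule.subset_span ⟨a, rfl⟩)
  have h1 : (q.app W).hom (b • res L (hW.trans hVO) s) = 0 := by
    refine (Scheme.Modules.Hom.app_smul q b _).trans ?_
    refine (congrArg (b • ·) h0).trans (smul_zero b)
  rw [h1] at hs'
  have h2 : res N (z.preimage_mono hW) (res N hVU n) = 0 := hs'.symm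
  rw [res_res] at h2
  have h3 := (hn (z ⁻¹ᵁ W) ((z.preimage_mono hW).trans hVU)).1
  have h4 : (1 : Γ(S, z ⁻¹ᵁ W)) = 0 := h3 (by simp only [h2, smul_zero])
  have h5 : x ∈ S.basicOpen (1 : Γ(S, z ⁻¹ᵁ W)) := by
    rw [Scheme.basicOpen_of_isUnit _ isUnit_one]; exact hxW
  rw [h4, Scheme.basicOpen_zero] at h5
  exact h5

lemma Camera.isClosedImmersion_center [IsSeparated π] (c : Camera π) :
    IsClosedImmersion c.center := by
  have : IsClosedImmersion (c.center ≫ π) := by rw [c.center_comp]; infer_instance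
  exact IsClosedImmersion.of_comp c.center π

lemma Camera.support_Z [IsSeparated π] (c : Camera π) :
    (c.Z.support : Set P) = Set.range c.center := by
  have := c.isClosedImmersion_center
  rw [Scheme.Hom.support_ker, c.center.isClosedEmbedding.isClosed_range.closure_eq]

lemma Camera.mem_compl_iff [IsSeparated π] (c : Camera π) (p : P) :
    p ∈ compl c.Z ↔ p ∉ Set.range c.center := by
  rw [← c.support_Z]
  rfl

/-- The local form of a camera: with `D l` the standard charts of `P` over an open subset of the
base and `W b` those given by the camera, the camera is given by functions `g a l` on `D l`. -/
lemma Camera.exists_sections_local [IsSeparated π] (c : Camera π) (b : S) :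
    ∃ (U : S.Opens) (f : ((π ⁻¹ᵁ U : P.Opens) : Scheme.{u}) ⟶ ProjectiveSpaceInt.{u} 3)
      (g : Fin 3 → ∀ l, Γ(P, (π ⁻¹ᵁ U).ι ''ᵁ (f ⁻¹ᵁ chart 3 l))), b ∈ U ∧
      IsCoord (π ∣_ U) f ∧
      (∀ a l k (O : P.Opens) (hl : O ≤ (π ⁻¹ᵁ U).ι ''ᵁ (f ⁻¹ᵁ chart 3 l))
        (hk : O ≤ (π ⁻¹ᵁ U).ι ''ᵁ (f ⁻¹ᵁ chart 3 k)),
        rs hl (g a l) = rs hl ((f.app (chart 3 l)).hom (ratio 3 k l)) * rs hk (g a k)) ∧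
      (∀ l d (O : P.Opens) (hl : O ≤ (π ⁻¹ᵁ U).ι ''ᵁ (f ⁻¹ᵁ chart 3 l))
        (hd : O ≤ (compl c.Z).ι ''ᵁ ((c.map ≫ ProjectiveSpace.toInt 2 S) ⁻¹ᵁ chart 2 d)),
        IsUnit (rs hl (g d l)) ∧ ∀ a, rs hl (g a l) =
          rs hd (((c.map ≫ ProjectiveSpace.toInt 2 S).app (chart 2 d)).hom (ratio 2 a d)) *
            rs hl (g d l)) ∧
      ∀ a l, P.basicOpen (g a l) ≤ compl c.Z := by
  obtain ⟨L, σ, hform, hcok, hcl⟩ := c.exists_sections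
  obtain ⟨U, hb, e, s, he, hs⟩ := hform b
  have hD (l) := hs.unres l
  have hW (d) := hcl.unres d
  have hsi (l) : IsGenerator L _ := (hD l).1
  -- On the chart `D₊(x_l)` the sheaf is free on the `l`-th coordinate section, and `g a l` is the
  -- coefficient of `σ a`.
  choose g hg using fun (a : Fin 3) l ↦ (hD l).1.exists_smul (res L le_top (σ a))
  refine ⟨U, _, g, hb, ⟨?_⟩, fun a l k O hl hk ↦ ?_, fun l d O hl hd ↦ ?_, fun a l ↦ ?_⟩
  · rw [← he]
    exact IsPullback.of_iso (IsPullback.of_hasPullback _ _) e.symm (Iso.refl _) (Iso.refl _)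
      (Iso.refl _) ((Category.comp_id _).trans (e.inv_hom_id_assoc _).symm)
      ((Category.comp_id _).trans (e.inv_hom_id_assoc _).symm)
      (by simp) (by simp)
  · have h1 := congr(res L hl $(hg a l))
    have h2 := congr(res L hk $(hg a k))
    have h3 := congr(res L hl $((hD l).2 k))
    rw [res_smul, res_res, res_res] at h1 h2 h3
    rw [h1, h3, ← mul_smul, mul_comm] at h2
    exact ((hsi l).res hl).smul_injective (by rw [res_res]; exact h2)
  -- On the overlap both `σ d` and the coordinate section generate, so their quotient `g d l` is a
  -- unit.
  · have hgen := (hW d).1.res hd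
    rw [unres_restrSection, res_res, res_res] at hgen
    have h1 (a) := congr(res L hl $(hg a l))
    simp_rw [res_smul, res_res] at h1
    have hgen' := (hsi l).res hl
    rw [res_res] at hgen'
    refine ⟨hgen'.isUnit hgen (h1 d), fun a ↦ hgen'.smul_injective ?_⟩
    have h2 := congr(res L hd $((hW d).2 a))
    rw [res_smul, unres_restrSection, unres_restrSection, res_res, res_res, res_res, res_res,
      h1, h1, ← mul_smul] at h2
    exact h2
  · intro p hp
    rw [c.mem_compl_iff]
    have := c.isClosedImmersion_center
    exact not_mem_range_of_cokernel c.center.isClosedEmbedding.isInducing hcok _ (hsi l) a _ (hg a l) hp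

end CameraSections

/-! ### Global sections of `𝒪(1)` are linear forms. -/

section LinearForms

open MvPolynomial in
-- The fractions `G l * X l / X l ^ d l` agree by hypothesis. Comparing with a second index `k`
-- shows that `X l ^ d l` divides the numerator, because powers of `X k` do not affect the exponent
-- of `X l`.
lemma exists_linear_form {σ A : Type*} [Nontrivial σ] [CommRing A] (G : σ → MvPolynomial σ A)
    (d : σ → ℕ) (hG : ∀ l, (G l).IsHomogeneous (d l))
    (h : ∀ l k, G l * X l * X k ^ d k = X k * G k * X l ^ d l) :
    ∃ F : MvPolynomial σ A, F.IsHomogeneous 1 ∧ ∀ l, X l ^ d l * F = G l * X l := by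
  classical
  have key (l) : X l ^ d l ∣ G l * X l := by
    obtain ⟨k, hk⟩ := exists_ne l
    rw [X_pow_eq_monomial, monomial_one_dvd_iff_modMonomial_eq_zero]
    ext μ
    rw [coeff_zero]
    by_cases hμ : Finsupp.single l (d l) ≤ μ
    · exact coeff_modMonomial_of_le _ hμ
    · rw [coeff_modMonomial_of_not_le _ hμ]
      have h1 := congr(coeff (μ + Finsupp.single k (d k)) $(h l k))
      rw [X_pow_eq_monomial, X_pow_eq_monomial, coeff_mul_monomial, mul_one,
        coeff_mul_monomial', if_neg] at h1
      · exact h1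
      · intro hle
        refine hμ (Finsupp.single_le_iff.2 ?_)
        have := Finsupp.single_le_iff.1 hle
        simpa [Finsupp.single_apply, hk] using this
  have hreg (l : σ) (n : ℕ) : IsRegular (X l ^ n : MvPolynomial σ A) := isRegular_X.pow n
  choose F hF using key
  have hFF (l k) : F l = F k := by
    refine (hreg l (d l)).left ((hreg k (d k)).left ?_)
    have := h l k
    rw [hF l, mul_comm (X k), hF k] at this
    beta_reduce
    linear_combination this
  obtain ⟨l₀⟩ : Nonempty σ := inferInstance
  refine ⟨F l₀, fun μ hμ ↦ ?_, fun l ↦ by rw [hFF l₀ l, hF]⟩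
  have h1 : (G l₀ * X l₀).IsHomogeneous (d l₀ + 1) := (hG l₀).mul (isHomogeneous_X _ _)
  rw [hF] at h1
  have h2 : coeff (Finsupp.single l₀ (d l₀) + μ) (X l₀ ^ d l₀ * F l₀) = coeff μ (F l₀) := by
    rw [X_pow_eq_monomial, coeff_monomial_mul, one_mul]
  have h3 := h1 (h2.trans_ne hμ)
  rw [map_add] at h3
  have h4 : Finsupp.weight (1 : σ → ℕ) (Finsupp.single l₀ (d l₀)) = d l₀ := by
    simp [Finsupp.weight_single]
  omega

end LinearForms

/-! ### The matrix of a camera. -/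

section CameraMatrix

/-- Coordinates on the restriction of an `S`-scheme to `C`. -/
structure CoordOver {P S C : Scheme.{u}} (π : P ⟶ S) (j : C ⟶ S) where
  /-- The restriction to `C`. -/
  Q : Scheme.{u}
  /-- The projection to `P`. -/
  i : Q ⟶ P
  /-- The structure morphism. -/
  q : Q ⟶ C
  isPullback : IsPullback i q π j
  /-- The coordinates. -/
  f : Q ⟶ ProjectiveSpaceInt.{u} 3
  isCoord : IsCoord q f

variable {P S C : Scheme.{u}} {π : P ⟶ S} {j : C ⟶ S}

/-- The camera is given by the matrix `M` in the coordinates `χ`. -/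
structure IsCameraMatrix (c : Camera π) (χ : CoordOver π j)
    (M : Matrix (Fin 3) (Fin 4) Γ(C, ⊤)) : Prop where
  mem_iff : ∀ {Y : Scheme.{u}} (y : Y ⟶ χ.Q) (v : Fin 4 → Γ(Y, ⊤)), Rep (y ≫ χ.f) v → ∀ x : Y,
    (y ≫ χ.i) x ∈ compl c.Z ↔ ∃ a, x ∈ Y.basicOpen ((M.map (y ≫ χ.q).appTop.hom).mulVec v a)
  rep : ∀ {Y : Scheme.{u}} (y : Y ⟶ χ.Q) (v : Fin 4 → Γ(Y, ⊤)), Rep (y ≫ χ.f) v →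
    ∀ y' : Y ⟶ compl c.Z, y' ≫ (compl c.Z).ι = y ≫ χ.i →
      Rep (y' ≫ c.map ≫ ProjectiveSpace.toInt 2 S) ((M.map (y ≫ χ.q).appTop.hom).mulVec v)

lemma appLE_ι_image {X Y : Scheme.{u}} (U : X.Opens) (y : Y ⟶ U) {V : (U : Scheme.{u}).Opens}
    (s : Γ((U : Scheme.{u}), V)) (h : ⊤ ≤ (y ≫ U.ι) ⁻¹ᵁ U.ι ''ᵁ V) (h' : ⊤ ≤ y ⁻¹ᵁ V) :
    ((y ≫ U.ι).appLE (U.ι ''ᵁ V) ⊤ h).hom (show Γ(X, U.ι ''ᵁ V) from s) =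
      (y.appLE V ⊤ h').hom s := by
  have hV : V ≤ U.ι ⁻¹ᵁ (U.ι ''ᵁ V) := fun x hx ↦ ⟨x, hx, rfl⟩
  rw [← appLE_comp y U.ι hV h']
  have := ι_appLE_eq_rs U hV (show Γ(X, U.ι ''ᵁ V) from s)
  rw [rs_self] at this
  exact congr((y.appLE V ⊤ h').hom $this)

lemma appLE_congr_hom {X Y : Scheme.{u}} {f g : X ⟶ Y} (e : f = g) {U : Y.Opens} {V : X.Opens}
    (h : V ≤ f ⁻¹ᵁ U) (s : Γ(Y, U)) :
    (f.appLE U V h).hom s = (g.appLE U V (e ▸ h)).hom s := by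
  subst e
  rfl

lemma Rep.of_eq {X : Scheme.{u}} {m : ℕ} {f g : X ⟶ ProjectiveSpaceInt.{u} m}
    {v : Fin (m + 1) → Γ(X, ⊤)} (h : Rep f v) (e : f = g) : Rep g v := e ▸ h

lemma eval₂_sum_C_mul_X {A D : Type*} [CommRing A] [CommRing D] {n : ℕ} (φ : A →+* D)
    (r : Fin n → A) (v : Fin n → D) :
    (∑ k, MvPolynomial.C (r k) * MvPolynomial.X k).eval₂ φ v = ∑ k, φ (r k) * v k := by
  simp [MvPolynomial.eval₂_sum]

/-- The local form of `exists_sections_local` in coordinates. -/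
theorem Camera.exists_matrix [IsSeparated π] (c : Camera π) (b : S) :
    ∃ (C : Scheme.{u}) (j : C ⟶ S), IsAffine C ∧ IsOpenImmersion j ∧ b ∈ Set.range j ∧
      ∃ (χ : CoordOver π j) (M : Matrix (Fin 3) (Fin 4) Γ(C, ⊤)), IsCameraMatrix c χ M := by
  obtain ⟨U, f, g, hb, hf, hg, hgW, hgZ⟩ := c.exists_sections_local b
  obtain ⟨C, hC, hbC, -⟩ :=
    exists_isAffineOpen_mem_and_subset (X := (U : Scheme.{u})) (x := ⟨b, hb⟩) (U := ⊤) trivial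
  have : IsAffine (C : Scheme.{u}) := hC
  have hp := IsPullback.of_hasPullback (π ∣_ U) C.ι
  let χ : CoordOver π (C.ι ≫ U.ι) :=
    { Q := pullback (π ∣_ U) C.ι
      i := pullback.fst _ _ ≫ (π ⁻¹ᵁ U).ι
      q := pullback.snd _ _
      isPullback := hp.paste_horiz (isPullback_morphismRestrict π U).flip
      f := pullback.fst _ _ ≫ f
      isCoord := hf.baseChange hp }
  let D (l) : P.Opens := (π ⁻¹ᵁ U).ι ''ᵁ (f ⁻¹ᵁ chart 3 l)
  have hD (l) : χ.f ⁻¹ᵁ chart 3 l ≤ χ.i ⁻¹ᵁ D l := fun x hx ↦ ⟨_, hx, rfl⟩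
  have hDy {Y : Scheme.{u}} {y : Y ⟶ χ.Q} {l} (hy : ⊤ ≤ y ⁻¹ᵁ χ.f ⁻¹ᵁ chart 3 l) :
      ⊤ ≤ (y ≫ χ.i) ⁻¹ᵁ D l := hy.trans (y.preimage_mono (hD l))
  let h := c.map ≫ ProjectiveSpace.toInt 2 S
  let W (e) : P.Opens := (compl c.Z).ι ''ᵁ (h ⁻¹ᵁ chart 2 e)
  obtain ⟨ρ, hρ⟩ : ∃ ρ : Fin 4 → ∀ l, Γ(P, D l),
      ∀ k l, ρ k l = (f.app (chart 3 l)).hom (ratio 3 k l) := ⟨_, fun _ _ ↦ rfl⟩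
  obtain ⟨ω, hω⟩ : ∃ ω : Fin 3 → ∀ e, Γ(P, W e),
      ∀ a e, ω a e = (h.app (chart 2 e)).hom (ratio 2 a e) := ⟨_, fun _ _ ↦ rfl⟩
  obtain ⟨g, rfl⟩ : ∃ g' : Fin 3 → ∀ l, Γ(P, D l), g = g' := ⟨g, rfl⟩
  replace hg : ∀ a l k (O : P.Opens) (hl : O ≤ D l) (hk : O ≤ D k),
      rs hl (g a l) = rs hl (ρ k l) * rs hk (g a k) := fun a l k O hl hk ↦ by
    rw [hρ]; exact hg a l k O hl hk
  replace hgW : ∀ l e (O : P.Opens) (hl : O ≤ D l) (he : O ≤ W e), IsUnit (rs hl (g e l)) ∧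
      ∀ a, rs hl (g a l) = rs he (ω a e) * rs hl (g e l) := fun l e O hl he ↦ by
    simp_rw [hω]; exact hgW l e O hl he
  choose d G hG hrep using fun a l ↦ χ.isCoord.exists_form l
    ((χ.i.appLE (D l) (χ.f ⁻¹ᵁ chart 3 l) (hD l)).hom (g a l))
  simp_rw [appLE_comp] at hrep
  have hratio {Y : Scheme.{u}} (y : Y ⟶ χ.Q) (v : Fin 4 → Γ(Y, ⊤)) (hv : Rep (y ≫ χ.f) v) (l k)
      (hy : ⊤ ≤ y ⁻¹ᵁ χ.f ⁻¹ᵁ chart 3 l) :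
      ((y ≫ χ.i).appLE (D l) ⊤ (hDy hy)).hom (ρ k l) * v l = v k := by
    have h1 := hv.appLE_mul l hy k
    rw [← h1]
    congr 1
    have hy' : ⊤ ≤ (y ≫ pullback.fst (π ∣_ U) C.ι) ⁻¹ᵁ f ⁻¹ᵁ chart 3 l := hy
    have h2 := appLE_ι_image (π ⁻¹ᵁ U) (y ≫ pullback.fst _ _)
      ((f.app (chart 3 l)).hom (ratio 3 k l)) (hDy hy) hy'
    rw [hρ]
    refine (?_ : _ = _).trans (h2.trans ?_)
    · exact appLE_congr_hom (Category.assoc _ _ _).symm _ _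
    · rw [app_eq, appLE_comp]
      exact appLE_congr_hom (Category.assoc _ _ _) _ _
  -- The forms representing `g a l` on the different charts satisfy the compatibility of a section
  -- of `𝒪(1)`; it is checked at the torus point.
  have hform (a) : ∃ F, F.IsHomogeneous 1 ∧ ∀ l,
      MvPolynomial.X l ^ d a l * F = G a l * MvPolynomial.X l := by
    refine exists_linear_form (G a) (d a) (hG a) fun l k ↦ ?_
    obtain ⟨E, _, ι, y, hι, hu, hy, hy'⟩ := χ.isCoord.exists_torus_point
    have hl (l) : ⊤ ≤ y ⁻¹ᵁ χ.f ⁻¹ᵁ chart 3 l := IsCoord.top_le_preimage hy' ((hu l).map _)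
    have h1 := hrep a l y _ hy' (hl l)
    have h2 := hrep a k y _ hy' (hl k)
    have h3 := hratio y _ hy' l k (hl l)
    have hO : ⊤ ≤ (y ≫ χ.i) ⁻¹ᵁ (D l ⊓ D k) := fun x hx ↦ ⟨hDy (hl l) hx, hDy (hl k) hx⟩
    have h4 := congr(((y ≫ χ.i).appLE (D l ⊓ D k) ⊤ hO).hom
      $(hg a l k (D l ⊓ D k) inf_le_left inf_le_right))
    rw [map_mul, appLE_rs, appLE_rs, appLE_rs] at h4
    rw [hy, eval₂_toΓ, MvPolynomial.eval₂_eta] at h1 h2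
    refine hι (toΓ_injective E ?_)
    simp only [map_mul, map_pow] at h1 h2 h3 ⊢
    rw [← h1, ← h2, h4, ← h3]
    ring
  choose F hF hFG using hform
  choose M hM using fun a ↦ exists_sum_of_isHomogeneous_one (hF a)
  -- The coordinates `M v` of the image are the coefficients `g a l` up to the unit `v l`. Both
  -- properties of a camera matrix are read off from this.
  have key {Y : Scheme.{u}} (y : Y ⟶ χ.Q) (v : Fin 4 → Γ(Y, ⊤)) (hv : Rep (y ≫ χ.f) v) (l)
      (hy : ⊤ ≤ y ⁻¹ᵁ χ.f ⁻¹ᵁ chart 3 l) (a) :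
      ((y ≫ χ.i).appLE (D l) ⊤ (hDy hy)).hom (g a l) * v l =
        ((Matrix.of M).map (y ≫ χ.q).appTop.hom).mulVec v a := by
    have h1 := congr(MvPolynomial.eval₂ (y ≫ χ.q).appTop.hom v $(hFG a l))
    rw [MvPolynomial.eval₂_mul, MvPolynomial.eval₂_mul, MvPolynomial.eval₂_pow,
      MvPolynomial.eval₂_X, ← hrep a l y v hv hy, hM a, eval₂_sum_C_mul_X] at h1
    refine ((IsCoord.isUnit_of_top_le hv hy).pow (d a l)).mul_left_cancel ?_
    refine Eq.trans ?_ h1.symm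
    ring
  have hloc {Y : Scheme.{u}} (y : Y ⟶ χ.Q) (v : Fin 4 → Γ(Y, ⊤)) (hv : Rep (y ≫ χ.f) v)
      {O : Y.Opens} {l} (hO : O ≤ Y.basicOpen (v l)) :
      Rep ((O.ι ≫ y) ≫ χ.f) (fun i ↦ O.ι.appTop.hom (v i)) ∧
        ⊤ ≤ (O.ι ≫ y) ⁻¹ᵁ χ.f ⁻¹ᵁ chart 3 l := by
    refine ⟨by rw [Category.assoc]; exact hv.comp O.ι, fun x _ ↦ ?_⟩
    have := hO x.2
    rw [← hv.preimage] at this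
    exact this
  have hmv {Y : Scheme.{u}} (y : Y ⟶ χ.Q) (v : Fin 4 → Γ(Y, ⊤)) (O : Y.Opens) (a) :
      O.ι.appTop.hom (((Matrix.of M).map (y ≫ χ.q).appTop.hom).mulVec v a) =
      ((Matrix.of M).map ((O.ι ≫ y) ≫ χ.q).appTop.hom).mulVec (fun i ↦ O.ι.appTop.hom (v i)) a := by
    rw [map_mulVec', ← CommRingCat.hom_comp, ← Scheme.Hom.comp_appTop, Category.assoc]
  have hunit {O : P.Opens} {l : Fin 4} {t : Γ(P, D l)} (hO : O ≤ D l) (ht : IsUnit (rs hO t)) :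
      O ≤ P.basicOpen t := by
    have h1 := Scheme.basicOpen_of_isUnit _ ht
    rw [basicOpen_rs] at h1
    exact h1.ge.trans inf_le_right
  refine ⟨C, C.ι ≫ U.ι, hC, inferInstance, ⟨⟨⟨b, hb⟩, hbC⟩, rfl⟩, χ, Matrix.of M,
    fun {Y} y v hv x ↦ ?_, fun {Y} y v hv y' hy' ↦ Rep.of_local fun x ↦ ?_⟩
  · obtain ⟨l, hl⟩ := hv.exists_mem x
    obtain ⟨hv1, hy1⟩ := hloc y v hv (le_refl (Y.basicOpen (v l)))
    have hx (a) : x ∈ Y.basicOpen (((Matrix.of M).map (y ≫ χ.q).appTop.hom).mulVec v a) ↔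
        (y ≫ χ.i) x ∈ P.basicOpen (g a l) := by
      let x1 : Y.basicOpen (v l) := ⟨x, hl⟩
      have h1 : x1 ∈ Scheme.basicOpen _ ((Y.basicOpen (v l)).ι.appTop.hom
          (((Matrix.of M).map (y ≫ χ.q).appTop.hom).mulVec v a)) ↔
          x ∈ Y.basicOpen (((Matrix.of M).map (y ≫ χ.q).appTop.hom).mulVec v a) := by
        rw [basicOpen_appTop]; exact Iff.rfl
      refine h1.symm.trans ?_
      rw [hmv, ← key _ _ hv1 l hy1, Scheme.basicOpen_mul, Scheme.basicOpen_of_isUnit _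
        (IsCoord.isUnit_of_top_le hv1 hy1), Scheme.basicOpen_appLE]
      exact ⟨fun h ↦ h.1.2, fun h ↦ ⟨⟨trivial, h⟩, trivial⟩⟩
    simp_rw [hx]
    -- Away from the center some chart of the plane contains the image, and there `g e l` is a unit.
    -- On the center all `g a l` vanish by `hgZ`.
    refine ⟨fun hx' ↦ ?_, fun ⟨a, ha⟩ ↦ hgZ a l ha⟩
    obtain ⟨e, he⟩ := exists_mem_chart (h ⟨_, hx'⟩)
    have hlD : (y ≫ χ.i) x ∈ D l := hDy hy1 (x := (⟨x, hl⟩ : Y.basicOpen (v l))) trivial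
    exact ⟨e, hunit inf_le_left (hgW l e (D l ⊓ W e) inf_le_left inf_le_right).1
      ⟨hlD, ⟨⟨_, hx'⟩, he, rfl⟩⟩⟩
  · obtain ⟨l, hl⟩ := hv.exists_mem x
    obtain ⟨e, he⟩ := exists_mem_chart (h (y' x))
    let O : Y.Opens := Y.basicOpen (v l) ⊓ y' ⁻¹ᵁ h ⁻¹ᵁ chart 2 e
    obtain ⟨hv1, hy1⟩ := hloc y v hv (inf_le_left : O ≤ Y.basicOpen (v l))
    refine ⟨O, ⟨hl, he⟩, ?_⟩
    rw [funext fun a ↦ (hmv y v O a).trans (key _ _ hv1 l hy1 a).symm]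
    have hO' : ⊤ ≤ (O.ι ≫ y') ⁻¹ᵁ h ⁻¹ᵁ chart 2 e := fun x _ ↦ x.2.2
    have hyi : (O.ι ≫ y') ≫ (compl c.Z).ι = (O.ι ≫ y) ≫ χ.i := by
      rw [Category.assoc, hy', Category.assoc]
    have hOW : ⊤ ≤ ((O.ι ≫ y') ≫ (compl c.Z).ι) ⁻¹ᵁ W e := fun x hx ↦ ⟨_, hO' hx, rfl⟩
    have hOW' : ⊤ ≤ ((O.ι ≫ y) ≫ χ.i) ⁻¹ᵁ W e := hyi ▸ hOW
    have hOD : ⊤ ≤ ((O.ι ≫ y) ≫ χ.i) ⁻¹ᵁ (D l ⊓ W e) := fun x hx ↦ ⟨hDy hy1 hx, hOW' hx⟩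
    obtain ⟨hu, hmul⟩ := hgW l e (D l ⊓ W e) inf_le_left inf_le_right
    have h1 := hu.map (((O.ι ≫ y) ≫ χ.i).appLE (D l ⊓ W e) ⊤ hOD).hom
    rw [appLE_rs] at h1
    have h2 (a) := congr((((O.ι ≫ y) ≫ χ.i).appLE (D l ⊓ W e) ⊤ hOD).hom $(hmul a))
    simp_rw [map_mul, appLE_rs] at h2
    have h3 := Rep.of_le_preimage ((O.ι ≫ y') ≫ h) e hO'
    have h4 := (h3.of_smul (h1.mul (IsCoord.isUnit_of_top_le hv1 hy1))).of_eq
      (Category.assoc O.ι y' h)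
    convert h4 using 1
    ext a
    rw [h2, Pi.smul_apply, smul_eq_mul]
    have h5 : (((O.ι ≫ y) ≫ χ.i).appLE (W e) ⊤ hOW').hom (ω a e) =
        (((O.ι ≫ y') ≫ h).appLE (chart 2 e) ⊤ hO').hom (ratio 2 a e) := by
      rw [hω]
      refine (appLE_congr_hom hyi.symm _ _).trans ((appLE_ι_image _ _ _ hOW hO').trans ?_)
      rw [app_eq, appLE_comp]
    rw [h5]
    ring

end CameraMatrix

/-! ### Shrinking the base and choosing common coordinates. -/

section Refinement

variable {P S C : Scheme.{u}} {π : P ⟶ S} {j : C ⟶ S}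

/-- Finitely many conditions that are local and stable under base change hold together on an affine
open set inside the intersection of their domains. -/
lemma exists_common {ι : Type*} [Finite ι] (b : S)
    (p : ι → ∀ (C : Scheme.{u}), (C ⟶ S) → Prop)
    (stable : ∀ k (C C' : Scheme.{u}) (j : C ⟶ S) (r : C' ⟶ C), p k C j → p k C' (r ≫ j))
    (ex : ∀ k, ∃ (C : Scheme.{u}) (j : C ⟶ S), IsOpenImmersion j ∧ b ∈ Set.range j ∧ p k C j) :
    ∃ (C : Scheme.{u}) (j : C ⟶ S), IsAffine C ∧ IsOpenImmersion j ∧ b ∈ Set.range j ∧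
      ∀ k, p k C j := by
  classical
  have := Fintype.ofFinite ι
  choose C j hj hb hp using ex
  let V : S.Opens := Finset.univ.inf fun k ↦ (j k).opensRange
  have hbV : b ∈ V := by
    have : b ∈ (V : Set S) := by
      rw [Opens.coe_finset_inf]
      simpa using hb
    exact this
  obtain ⟨U, hU, hbU, hUV⟩ := exists_isAffineOpen_mem_and_subset (x := b) (U := V) hbV
  refine ⟨U, U.ι, hU, inferInstance, ⟨⟨b, hbU⟩, rfl⟩, fun k ↦ ?_⟩
  have hr : Set.range U.ι ⊆ Set.range (j k) := by
    rintro _ ⟨x, rfl⟩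
    exact Finset.inf_le (f := fun k ↦ (j k).opensRange) (Finset.mem_univ k) (hUV x.2)
  have := stable k _ _ (j k) (IsOpenImmersion.lift (j k) U.ι hr) (hp k)
  rwa [IsOpenImmersion.lift_fac] at this

/-- Restriction of coordinates. -/
def CoordOver.restrict (χ : CoordOver π j) {C' : Scheme.{u}} (r : C' ⟶ C) : CoordOver π (r ≫ j) where
  Q := pullback χ.q r
  i := pullback.fst _ _ ≫ χ.i
  q := pullback.snd _ _
  isPullback := (IsPullback.of_hasPullback χ.q r).paste_horiz χ.isPullback
  f := pullback.fst _ _ ≫ χ.f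
  isCoord := χ.isCoord.baseChange (IsPullback.of_hasPullback χ.q r)

/-- The camera is given by the matrix `M` in the coordinates `χ` after restriction along `r`. -/
structure IsCameraMatrixOver {C' : Scheme.{u}} (c : Camera π) (χ : CoordOver π j) (r : C' ⟶ C)
    (M : Matrix (Fin 3) (Fin 4) Γ(C', ⊤)) : Prop where
  mem_iff : ∀ {Y : Scheme.{u}} (y : Y ⟶ χ.Q) (t : Y ⟶ C'), y ≫ χ.q = t ≫ r →
    ∀ (v : Fin 4 → Γ(Y, ⊤)), Rep (y ≫ χ.f) v → ∀ x : Y,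
    (y ≫ χ.i) x ∈ compl c.Z ↔ ∃ a, x ∈ Y.basicOpen ((M.map t.appTop.hom).mulVec v a)
  rep : ∀ {Y : Scheme.{u}} (y : Y ⟶ χ.Q) (t : Y ⟶ C'), y ≫ χ.q = t ≫ r →
    ∀ (v : Fin 4 → Γ(Y, ⊤)), Rep (y ≫ χ.f) v →
    ∀ y' : Y ⟶ compl c.Z, y' ≫ (compl c.Z).ι = y ≫ χ.i →
      Rep (y' ≫ c.map ≫ ProjectiveSpace.toInt 2 S) ((M.map t.appTop.hom).mulVec v)

variable {c : Camera π} {χ : CoordOver π j}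

lemma map_map_appTop {X Y Z : Scheme.{u}} (f : X ⟶ Y) (g : Y ⟶ Z) {α β : Type*}
    (M : Matrix α β Γ(Z, ⊤)) :
    (M.map g.appTop.hom).map f.appTop.hom = M.map (f ≫ g).appTop.hom := by
  rw [Matrix.map_map, ← RingHom.coe_comp, ← CommRingCat.hom_comp, ← Scheme.Hom.comp_appTop]

lemma IsCameraMatrixOver.comp {C' C'' : Scheme.{u}} {r : C' ⟶ C}
    {M : Matrix (Fin 3) (Fin 4) Γ(C', ⊤)} (h : IsCameraMatrixOver c χ r M) (r' : C'' ⟶ C') :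
    IsCameraMatrixOver c χ (r' ≫ r) (M.map r'.appTop.hom) where
  mem_iff y t hyt v hv x := by
    rw [map_map_appTop]
    exact h.mem_iff y (t ≫ r') (by rw [hyt, Category.assoc]) v hv x
  rep y t hyt v hv y' hy' := by
    rw [map_map_appTop]
    exact h.rep y (t ≫ r') (by rw [hyt, Category.assoc]) v hv y' hy'

lemma IsCameraMatrix.over {M : Matrix (Fin 3) (Fin 4) Γ(C, ⊤)} (h : IsCameraMatrix c χ M) :
    IsCameraMatrixOver c χ (𝟙 C) M where
  mem_iff y t hyt v hv x := by
    rw [h.mem_iff y v hv x, hyt, Category.comp_id]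
  rep y t hyt v hv y' hy' := by
    rw [← Category.comp_id t, ← hyt]
    exact h.rep y v hv y' hy'

/-- The projection from the restriction of coordinates. -/
def CoordOver.proj (χ : CoordOver π j) {C' : Scheme.{u}} (r : C' ⟶ C) : (χ.restrict r).Q ⟶ χ.Q :=
  pullback.fst _ _

lemma CoordOver.isPullback_proj (χ : CoordOver π j) {C' : Scheme.{u}} (r : C' ⟶ C) :
    IsPullback (χ.proj r) (χ.restrict r).q χ.q r := IsPullback.of_hasPullback χ.q r

lemma CoordOver.proj_f (χ : CoordOver π j) {C' : Scheme.{u}} (r : C' ⟶ C) :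
    χ.proj r ≫ χ.f = (χ.restrict r).f := rfl

lemma CoordOver.proj_i (χ : CoordOver π j) {C' : Scheme.{u}} (r : C' ⟶ C) :
    χ.proj r ≫ χ.i = (χ.restrict r).i := rfl

lemma IsCameraMatrixOver.restrict {C' : Scheme.{u}} {r : C' ⟶ C}
    {M : Matrix (Fin 3) (Fin 4) Γ(C', ⊤)} (h : IsCameraMatrixOver c χ r M) :
    IsCameraMatrix c (χ.restrict r) M where
  mem_iff y v hv x := by
    have h1 := h.mem_iff (y ≫ χ.proj r) (y ≫ (χ.restrict r).q)
      (by rw [Category.assoc, Category.assoc, (χ.isPullback_proj r).w]) v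
      (hv.of_eq (by rw [Category.assoc, χ.proj_f])) x
    rwa [Category.assoc, χ.proj_i] at h1
  rep y v hv y' hy' :=
    h.rep (y ≫ χ.proj r) (y ≫ (χ.restrict r).q)
      (by rw [Category.assoc, Category.assoc, (χ.isPullback_proj r).w]) v
      (hv.of_eq (by rw [Category.assoc, χ.proj_f])) y' (by rw [Category.assoc, χ.proj_i, hy'])

lemma IsCameraMatrix.restrict {M : Matrix (Fin 3) (Fin 4) Γ(C, ⊤)} (h : IsCameraMatrix c χ M)
    {C' : Scheme.{u}} (r : C' ⟶ C) : IsCameraMatrix c (χ.restrict r) (M.map r.appTop.hom) := by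
  have := (h.over.comp r)
  rw [Category.comp_id] at this
  exact this.restrict

/-- A second camera on the same scheme is given by a matrix in the coordinates of the first. -/
lemma Camera.exists_matrix_over [IsSeparated π] [IsOpenImmersion j] (c : Camera π)
    (χ : CoordOver π j) (b : C) :
    ∃ (C' : Scheme.{u}) (r : C' ⟶ C), IsOpenImmersion r ∧ b ∈ Set.range r ∧
      ∃ M, IsCameraMatrixOver c χ r M := by
  obtain ⟨C', j', -, hj', hb', χ', M', hM'⟩ := c.exists_matrix (j b)
  -- The two conditions, indexed by `Bool`, say that the new base maps to `C` and to `C'`.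
  obtain ⟨C₁, j₁, -, hj₁, ⟨b₁, hb₁⟩, h₁⟩ := exists_common (j b)
    (fun k : Bool ↦ k.rec (fun C₁ j₁ ↦ ∃ r : C₁ ⟶ C, r ≫ j = j₁)
      (fun C₁ j₁ ↦ ∃ r : C₁ ⟶ C', r ≫ j' = j₁))
    (by
      rintro (_ | _) D D' k r ⟨s, rfl⟩
      · exact ⟨r ≫ s, Category.assoc _ _ _⟩
      · exact ⟨r ≫ s, Category.assoc _ _ _⟩)
    (by
      rintro (_ | _)
      · exact ⟨C, j, inferInstance, ⟨b, rfl⟩, 𝟙 _, Category.id_comp _⟩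
      · exact ⟨C', j', inferInstance, hb', 𝟙 _, Category.id_comp _⟩)
  obtain ⟨r, rfl⟩ := h₁ false
  obtain ⟨r', hr'⟩ := h₁ true
  have hr : IsOpenImmersion r := .of_comp r j
  have hrb : r b₁ = b := j.isOpenEmbedding.injective hb₁
  have h0 := IsPullback.of_hasPullback χ.q r
  have h1 := h0.paste_horiz χ.isPullback
  rw [← hr'] at h1
  have hl := χ'.isPullback.lift_fst (pullback.fst χ.q r ≫ χ.i) (pullback.snd χ.q r ≫ r')
    (by rw [h1.w, Category.assoc])
  have hl' := χ'.isPullback.lift_snd (pullback.fst χ.q r ≫ χ.i) (pullback.snd χ.q r ≫ r')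
    (by rw [h1.w, Category.assoc])
  set l := χ'.isPullback.lift (pullback.fst χ.q r ≫ χ.i) (pullback.snd χ.q r ≫ r')
    (by rw [h1.w, Category.assoc])
  rw [← hl] at h1
  have h2 : IsPullback l (pullback.snd χ.q r) χ'.q r' := IsPullback.of_right h1 hl' χ'.isPullback
  -- Both coordinate systems now live on one scheme and differ by `T`, so the matrix of the camera
  -- in the given coordinates is `M' * T`.
  obtain ⟨C₂, r₂, -, hr₂, ⟨b₂, hb₂⟩, T, -, hT⟩ :=
    (χ.isCoord.baseChange h0).exists_linear (m := 2) (χ'.isCoord.baseChange h2) (by omega) b₁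
  refine ⟨C₂, r₂ ≫ r, inferInstance, ⟨b₂, by rw [Scheme.Hom.comp_apply, hb₂, hrb]⟩,
    M'.map (r₂ ≫ r').appTop.hom * T, ?_⟩
  have key {Y : Scheme.{u}} (y : Y ⟶ χ.Q) (t : Y ⟶ C₂) (hyt : y ≫ χ.q = t ≫ r₂ ≫ r)
      (v : Fin 4 → Γ(Y, ⊤)) (hv : Rep (y ≫ χ.f) v) :
      ∃ y' : Y ⟶ χ'.Q, y' ≫ χ'.i = y ≫ χ.i ∧ y' ≫ χ'.q = t ≫ r₂ ≫ r' ∧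
        Rep (y' ≫ χ'.f) ((T.map t.appTop.hom).mulVec v) := by
    let y₁ : Y ⟶ pullback χ.q r := pullback.lift y (t ≫ r₂) (by rw [hyt, Category.assoc])
    have hy₁ : y₁ ≫ pullback.fst _ _ = y := pullback.lift_fst _ _ _
    have hy₁' : y₁ ≫ pullback.snd _ _ = t ≫ r₂ := pullback.lift_snd _ _ _
    refine ⟨y₁ ≫ l, ?_, ?_, ?_⟩
    · rw [Category.assoc, hl, reassoc_of% hy₁]
    · rw [Category.assoc, hl', reassoc_of% hy₁']
    · rw [Category.assoc]
      exact hT y₁ t hy₁' v (hv.of_eq (by rw [reassoc_of% hy₁]))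
  have hmat {Y : Scheme.{u}} (t : Y ⟶ C₂) (v : Fin 4 → Γ(Y, ⊤)) :
      ((M'.map (r₂ ≫ r').appTop.hom * T).map t.appTop.hom).mulVec v =
        (M'.map (t ≫ r₂ ≫ r').appTop.hom).mulVec ((T.map t.appTop.hom).mulVec v) := by
    rw [Matrix.map_mul, map_map_appTop, Matrix.mulVec_mulVec]
  constructor
  · intro Y y t hyt v hv x
    obtain ⟨y', h1, h2, h3⟩ := key y t hyt v hv
    rw [hmat, ← h1, hM'.mem_iff y' _ h3, h2]
  · intro Y y t hyt v hv z hz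
    obtain ⟨y', h1, h2, h3⟩ := key y t hyt v hv
    rw [hmat, ← h2]
    exact hM'.rep y' _ h3 z (by rw [hz, h1])

/-- Locally on the base, finitely many cameras on one scheme are given by matrices in common
coordinates. -/
theorem exists_matrices [IsSeparated π] {n : ℕ} (hn : 1 ≤ n) (c : Fin n → Camera π) (b : S) :
    ∃ (C : Scheme.{u}) (j : C ⟶ S), IsOpenImmersion j ∧ b ∈ Set.range j ∧
      ∃ (χ : CoordOver π j) (M : Fin n → Matrix (Fin 3) (Fin 4) Γ(C, ⊤)),
        ∀ k, IsCameraMatrix (c k) χ (M k) := by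
  obtain ⟨C, j, -, hj, ⟨b', rfl⟩, χ, -⟩ := (c ⟨0, hn⟩).exists_matrix b
  obtain ⟨C', r, -, hr, ⟨b'', hb''⟩, h⟩ := exists_common b'
    (fun (k : Fin n) C' r ↦ ∃ M, IsCameraMatrixOver (c k) χ r M)
    (fun k D D' r r' ⟨M, hM⟩ ↦ ⟨_, hM.comp r'⟩) fun k ↦ (c k).exists_matrix_over χ b'
  choose M hM using h
  exact ⟨C', r ≫ j, inferInstance, ⟨b'', by rw [Scheme.Hom.comp_apply, hb'']⟩, χ.restrict r, M,
    fun k ↦ (hM k).restrict⟩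

end Refinement

/-! ### Camera matrices have rank 3, and their kernels are the centers. -/

section Rank

variable {P S C : Scheme.{u}} {π : P ⟶ S} {j : C ⟶ S} {χ : CoordOver π j}

/-- The preimage of the center in the spectrum of the field is a nonempty closed subscheme of a
reduced point, hence everything. So the point factors through the section. -/
lemma Camera.comp_center_of_field [IsSeparated π] (c : Camera π) {D : Type u} [Field D]
    (y : Spec (.of D) ⟶ P) (z : Spec (.of D)) (hz : y z ∉ compl c.Z) : (y ≫ π) ≫ c.center = y := by
  have := c.isClosedImmersion_center
  rw [c.mem_compl_iff, not_not] at hz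
  obtain ⟨x, hx⟩ := hz
  have hsurj : Surjective (pullback.snd c.center y) := by
    refine ⟨fun z' ↦ ?_⟩
    obtain ⟨w, -, hw⟩ := Scheme.Pullback.exists_preimage_pullback x z' (by
      rw [hx]; congr 1; exact Subsingleton.elim (α := PrimeSpectrum D) _ _)
    exact ⟨w, hw⟩
  have : IsReduced (Spec (.of D)) := inferInstance
  have : IsIso (pullback.snd c.center y) := isIso_of_isClosedImmersion_of_surjective _
  have h1 : y = inv (pullback.snd c.center y) ≫ pullback.fst c.center y ≫ c.center := by
    rw [pullback.condition, IsIso.inv_hom_id_assoc]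
  have h2 := congr($h1 ≫ π)
  rw [Category.assoc, Category.assoc, c.center_comp, Category.comp_id] at h2
  rw [h2, Category.assoc, ← h1]

variable {c : Camera π} {M : Matrix (Fin 3) (Fin 4) Γ(C, ⊤)}

lemma IsCameraMatrix.not_mem_compl (h : IsCameraMatrix c χ M) {D : Type u} [Field D]
    {y : Spec (.of D) ⟶ χ.Q} {φ : Γ(C, ⊤) →+* D} (hy : (y ≫ χ.q).appTop.hom = (toΓ D).comp φ)
    {w : Fin 4 → D} (hw : Rep (y ≫ χ.f) fun i ↦ toΓ D (w i)) (hMw : (M.map φ).mulVec w = 0)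
    (z : Spec (.of D)) : (y ≫ χ.i) z ∉ compl c.Z := by
  rw [h.mem_iff y _ hw z]
  rintro ⟨a, ha⟩
  rw [hy, ← map_mulVec', mem_basicOpen_toΓ_field, hMw] at ha
  exact ha rfl

/-- Kernel vectors are coordinates of points on the center, and the center has only one point over a
given point of the base. -/
lemma IsCameraMatrix.kernel [IsSeparated π] [IsAffine C] (h : IsCameraMatrix c χ M) {D : Type u}
    [Field D] (φ : Γ(C, ⊤) →+* D) {w w' : Fin 4 → D} (hw0 : w ≠ 0) (hw0' : w' ≠ 0)
    (hw : (M.map φ).mulVec w = 0) (hw' : (M.map φ).mulVec w' = 0) : ∃ a : D, w' = a • w := by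
  have hpt {w : Fin 4 → D} (hw0 : w ≠ 0) : ∃ y : Spec (.of D) ⟶ χ.Q,
      (y ≫ χ.q).appTop.hom = (toΓ D).comp φ ∧ Rep (y ≫ χ.f) fun i ↦ toΓ D (w i) := by
    obtain ⟨l, hl⟩ := Function.ne_iff.1 hw0
    exact χ.isCoord.exists_spec_point_of_isUnit φ w (l := l) (Ne.isUnit hl)
  obtain ⟨y, hy, hyw⟩ := hpt hw0
  obtain ⟨y', hy', hyw'⟩ := hpt hw0'
  let z : Spec (.of D) := IsLocalRing.closedPoint D
  have e1 := c.comp_center_of_field _ z (h.not_mem_compl hy hyw hw z)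
  have e2 := c.comp_center_of_field _ z (h.not_mem_compl hy' hyw' hw' z)
  have e3 : y ≫ χ.q = y' ≫ χ.q := hom_ext_of_appTop (hy.trans hy'.symm)
  have e4 : y = y' := by
    refine χ.isPullback.hom_ext ?_ e3
    rw [← e1, ← e2]
    simp only [Category.assoc, χ.isPullback.w_assoc]
    rw [reassoc_of% e3]
  subst e4
  obtain ⟨a, -, ha⟩ := hyw.exists_smul_of_field hyw'
  exact ⟨a, ha⟩

/-- The kernel has dimension at most 1 in a space of dimension 4, so the three rows are independent.
-/
lemma IsCameraMatrix.linearIndependent [IsSeparated π] [IsAffine C] (h : IsCameraMatrix c χ M)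
    {D : Type u} [Field D] (φ : Γ(C, ⊤) →+* D) : LinearIndependent D (M.map φ).row := by
  set N := M.map φ
  have h1 : Module.finrank D (LinearMap.ker N.mulVecLin) ≤ 1 := by
    by_cases h0 : LinearMap.ker N.mulVecLin = ⊥
    · rw [h0, finrank_bot]; omega
    · obtain ⟨w, hw, hw0⟩ := Submodule.exists_mem_ne_zero_of_ne_bot h0
      refine finrank_le_one (⟨w, hw⟩ : LinearMap.ker N.mulVecLin) fun ⟨w', hw'⟩ ↦ ?_
      by_cases hw0' : w' = 0
      · exact ⟨0, by ext; simp [hw0']⟩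
      · obtain ⟨a, ha⟩ := h.kernel φ hw0 hw0' (by simpa using hw) (by simpa using hw')
        exact ⟨a, Subtype.ext ha.symm⟩
  have h2 := LinearMap.finrank_range_add_finrank_ker N.mulVecLin
  rw [Module.finrank_pi, Fintype.card_fin] at h2
  rw [linearIndependent_iff_card_eq_finrank_span]
  have h3 : N.rank = Module.finrank D (LinearMap.range N.mulVecLin) := rfl
  have h4 := N.rank_le_height
  rw [Matrix.rank_eq_finrank_span_row] at h3 h4
  rw [Fintype.card_fin, Set.finrank]
  omega

/-- A common kernel vector would be a point on both centers. -/
lemma IsCameraMatrix.eq_zero_of_mulVec [IsAffine C] {c' : Camera π}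
    {M' : Matrix (Fin 3) (Fin 4) Γ(C, ⊤)} (h : IsCameraMatrix c χ M) (h' : IsCameraMatrix c' χ M')
    (hd : Disjoint c.Z.support c'.Z.support) {D : Type u} [Field D] (φ : Γ(C, ⊤) →+* D)
    (w : Fin 4 → D) (hw : (M.map φ).mulVec w = 0) (hw' : (M'.map φ).mulVec w = 0) : w = 0 := by
  by_contra hw0
  obtain ⟨l, hl⟩ := Function.ne_iff.1 hw0
  obtain ⟨y, hy, hyw⟩ := χ.isCoord.exists_spec_point_of_isUnit φ w (l := l) (Ne.isUnit hl)
  let z : Spec (.of D) := IsLocalRing.closedPoint D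
  have e1 := h.not_mem_compl hy hyw hw z
  have e2 := h'.not_mem_compl hy hyw hw' z
  have e3 : (y ≫ χ.i) z ∈ c.Z.support := not_not.1 e1
  have e4 : (y ≫ χ.i) z ∈ c'.Z.support := not_not.1 e2
  have e5 : (y ≫ χ.i) z ∈ (c.Z.support ⊓ c'.Z.support) := ⟨e3, e4⟩
  rw [hd.eq_bot] at e5
  exact e5

end Rank

/-! ### Linear forms and linear substitutions over a ring. -/

section LinearAlgebra

open Matrix

variable {A σ : Type*} [CommRing A] [Fintype σ]

/-- The linear form with the given coefficients. -/
def lin (r : σ → A) : MvPolynomial σ A := ∑ j, MvPolynomial.C (r j) * MvPolynomial.X j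

lemma lin_add (r s : σ → A) : lin (r + s) = lin r + lin s := by
  simp [lin, add_mul, Finset.sum_add_distrib]

lemma lin_smul (a : A) (r : σ → A) : lin (a • r) = MvPolynomial.C a * lin r := by
  simp [lin, mul_assoc, Finset.mul_sum]

lemma lin_neg (r : σ → A) : lin (-r) = -lin r := by
  simp [lin]

@[simp]
lemma lin_zero : lin (0 : σ → A) = 0 := by simp [lin]

lemma eval₂_lin {D : Type*} [CommRing D] (φ : A →+* D) (r : σ → A) (v : σ → D) :
    (lin r).eval₂ φ v = (fun j ↦ φ (r j)) ⬝ᵥ v := by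
  simp [lin, MvPolynomial.eval₂_sum, dotProduct]

lemma eval_lin (r x : σ → A) : MvPolynomial.eval x (lin r) = r ⬝ᵥ x := by
  simp [lin, dotProduct]

/-- The linear substitution given by a matrix. -/
def subst (V : Matrix σ σ A) : MvPolynomial σ A →ₐ[A] MvPolynomial σ A :=
  MvPolynomial.aeval fun i ↦ lin (V i)

lemma subst_lin (V : Matrix σ σ A) (r : σ → A) : subst V (lin r) = lin (r ᵥ* V) := by
  simp only [subst, lin, map_sum, map_mul, MvPolynomial.aeval_C, MvPolynomial.aeval_X,
    Matrix.vecMul, dotProduct, Finset.sum_mul, MvPolynomial.algebraMap_eq, Finset.mul_sum]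
  rw [Finset.sum_comm]
  simp [mul_assoc]

@[simp]
lemma subst_C (V : Matrix σ σ A) (a : A) : subst V (MvPolynomial.C a) = MvPolynomial.C a :=
  MvPolynomial.aeval_C _ _

variable [DecidableEq σ]

lemma lin_single (i : σ) : lin (Pi.single i (1 : A)) = MvPolynomial.X i := by
  simp [lin, Pi.single_apply]

lemma subst_nonsing_inv (V : Matrix σ σ A) (hV : IsUnit V.det) (F : MvPolynomial σ A) :
    subst V⁻¹ (subst V F) = F := by
  have : (subst V⁻¹).comp (subst V) = AlgHom.id A _ := by
    ext1 i
    have : subst V (MvPolynomial.X i) = lin (V i) := MvPolynomial.aeval_X _ _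
    rw [AlgHom.comp_apply, this, subst_lin, AlgHom.id_apply, ← lin_single]
    congr 1
    have := congr($(Matrix.mul_nonsing_inv V hV) i)
    rw [Matrix.mul_apply_eq_vecMul] at this
    rw [this]
    ext k
    simp [Matrix.one_apply, Pi.single_apply, eq_comm]
  exact congr($this F)

/-- The inverse substitution turns this linear form into a variable. -/
lemma lin_mem_nonZeroDivisors_of_row {V : Matrix σ σ A} (hV : IsUnit V.det) (i : σ) :
    lin (V i) ∈ nonZeroDivisors (MvPolynomial σ A) := by
  refine mem_nonZeroDivisors_iff_right.2 fun F hF ↦ ?_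
  have h1 := congr(subst V⁻¹ $hF)
  have h2 : V i ᵥ* V⁻¹ = Pi.single i 1 := by
    have := congr($(Matrix.mul_nonsing_inv V hV) i)
    rw [Matrix.mul_apply_eq_vecMul] at this
    rw [this]
    ext k
    simp [Matrix.one_apply, Pi.single_apply, eq_comm]
  rw [map_mul, subst_lin, h2, lin_single, map_zero] at h1
  have h3 := MvPolynomial.isRegular_X.right.mul_right_eq_zero_iff.1 h1
  have h4 : subst V⁻¹⁻¹ (subst V⁻¹ F) = F :=
    subst_nonsing_inv V⁻¹ (Matrix.isUnit_nonsing_inv_det_iff.2 hV) F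
  rw [← h4, h3, map_zero]

/-- The identity matrix with row `i` replaced by `r` has determinant `r i`. -/
lemma lin_mem_nonZeroDivisors {r : σ → A} {i : σ} (hr : IsUnit (r i)) :
    lin r ∈ nonZeroDivisors (MvPolynomial σ A) := by
  have h : ((1 : Matrix σ σ A).updateRow i r).det = r i := by
    rw [← Matrix.cramer_transpose_apply, Matrix.transpose_one, Matrix.cramer_one]
    rfl
  have := lin_mem_nonZeroDivisors_of_row (V := (1 : Matrix σ σ A).updateRow i r) (by rwa [h]) i
  rwa [Matrix.updateRow_self] at this

/-- If `u : v` and `r : s` are equal, with `u` and `v` independent, then `(r, s)` is a multiple of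
`(u, v)`. -/
lemma exists_smul_of_lin_mul_eq {V : Matrix σ σ A} (hV : IsUnit V.det) {i j : σ} (hij : i ≠ j)
    {r s : σ → A} (h : lin (V i) * lin s = lin (V j) * lin r) :
    ∃ a : A, r = a • V i ∧ s = a • V j := by
  -- The basis dual to the rows of `V`. The identity is evaluated at its members and at sums of two
  -- of them, which determines `r` and `s` on it.
  let e (k : σ) : σ → A := fun l ↦ V⁻¹ l k
  have he (i k) : V i ⬝ᵥ e k = if i = k then 1 else 0 := by
    have := congr($(Matrix.mul_nonsing_inv V hV) i k)
    rwa [Matrix.one_apply] at this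
  have hx (x : σ → A) : (V i ⬝ᵥ x) * (s ⬝ᵥ x) = (V j ⬝ᵥ x) * (r ⬝ᵥ x) := by
    have := congr(MvPolynomial.eval x $h)
    simpa only [map_mul, eval_lin] using this
  have hext {r r' : σ → A} (h : ∀ k, r ⬝ᵥ e k = r' ⬝ᵥ e k) : r = r' := by
    have h1 : r ᵥ* V⁻¹ = r' ᵥ* V⁻¹ := funext h
    have h2 := congr($h1 ᵥ* V)
    rwa [Matrix.vecMul_vecMul, Matrix.vecMul_vecMul, Matrix.nonsing_inv_mul _ hV,
      Matrix.vecMul_one, Matrix.vecMul_one] at h2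
  have hri : r ⬝ᵥ e j = 0 := by
    have := hx (e j)
    simpa [he, hij] using this.symm
  have hsi : s ⬝ᵥ e i = 0 := by
    have := hx (e i)
    simpa [he, hij.symm] using this
  have hr {k} (hk : k ≠ i) (hk' : k ≠ j) : r ⬝ᵥ e k = 0 := by
    have := hx (e j + e k)
    simpa [dotProduct_add, he, hij, hk.symm, hk'.symm, hri] using this.symm
  have hs {k} (hk : k ≠ i) (hk' : k ≠ j) : s ⬝ᵥ e k = 0 := by
    have := hx (e i + e k)
    simpa [dotProduct_add, he, hij.symm, hk.symm, hk'.symm, hsi] using this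
  have hrs : s ⬝ᵥ e j = r ⬝ᵥ e i := by
    have := hx (e i + e j)
    simpa [dotProduct_add, he, hij, hij.symm, hri, hsi] using this
  refine ⟨r ⬝ᵥ e i, hext fun k ↦ ?_, hext fun k ↦ ?_⟩
  · rw [smul_dotProduct, he, smul_eq_mul]
    split_ifs with hk
    · rw [← hk, mul_one]
    · rw [mul_zero]
      by_cases hk' : k = j
      · rw [hk', hri]
      · exact hr (Ne.symm hk) hk'
  · rw [smul_dotProduct, he, smul_eq_mul]
    split_ifs with hk
    · rw [← hk, mul_one, hrs]
    · rw [mul_zero]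
      by_cases hk' : k = i
      · rw [hk', hsi]
      · exact hs hk' (Ne.symm hk)

end LinearAlgebra

/-! ### Trilinear relations determine the matrices, over a local ring. -/

section Residual

open Matrix

variable {A D : Type*} [CommRing A] [Field D] (φ : A →+* D)

lemma isUnit_det_of_kernel {φ : A →+* D} (hφ : ∀ a, φ a ≠ 0 → IsUnit a) {n : ℕ}
    {W : Matrix (Fin n) (Fin n) A} (h : ∀ x, (W.map φ) *ᵥ x = 0 → x = 0) : IsUnit W.det := by
  refine hφ _ fun h0 ↦ ?_
  have h1 : (W.map φ).det = 0 := by rw [← h0]; exact (RingHom.map_det _ _).symm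
  obtain ⟨v, hv, hv'⟩ := Matrix.exists_mulVec_eq_zero_iff.2 h1
  exact hv (h v hv')

/-- The matrix with one more row. -/
def addRow {m : ℕ} {τ R : Type*} (v : Matrix (Fin m) τ R) (w : τ → R) : Matrix (Fin (m + 1)) τ R :=
  Fin.snoc (α := fun _ ↦ τ → R) v w

@[simp]
lemma addRow_castSucc {m : ℕ} {τ R : Type*} (v : Matrix (Fin m) τ R) (w : τ → R) (i : Fin m) :
    addRow v w i.castSucc = v i := Fin.snoc_castSucc (α := fun _ ↦ τ → R) _ _ _

@[simp]
lemma addRow_last {m : ℕ} {τ R : Type*} (v : Matrix (Fin m) τ R) (w : τ → R) :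
    addRow v w (Fin.last m) = w := Fin.snoc_last (α := fun _ ↦ τ → R) _ _

lemma map_addRow {m : ℕ} {τ R R' : Type*} (f : R → R') (v : Matrix (Fin m) τ R) (w : τ → R) :
    (addRow v w).map f = addRow (v.map f) (fun i ↦ f (w i)) := by
  ext i j
  rw [Matrix.map_apply]
  induction i using Fin.lastCases with
  | last => rw [addRow_last, addRow_last]
  | cast i => rw [addRow_castSucc, addRow_castSucc, Matrix.map_apply]

lemma addRow_mulVec_eq_zero {m : ℕ} {τ R : Type*} [Fintype τ] [CommRing R] (v : Matrix (Fin m) τ R)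
    (w : τ → R) {x : τ → R} (h : addRow v w *ᵥ x = 0) : v *ᵥ x = 0 ∧ w ⬝ᵥ x = 0 := by
  refine ⟨funext fun i ↦ ?_, ?_⟩
  · have h1 : addRow v w i.castSucc ⬝ᵥ x = 0 := congr($h i.castSucc)
    rwa [addRow_castSucc] at h1
  · have h1 : addRow v w (Fin.last m) ⬝ᵥ x = 0 := congr($h (Fin.last m))
    rwa [addRow_last] at h1

lemma addRow_mulVec_eq_zero_of {m : ℕ} {τ R : Type*} [Fintype τ] [CommRing R]
    (v : Matrix (Fin m) τ R) (w : τ → R) {x : τ → R} (h : v *ᵥ x = 0) (h' : w ⬝ᵥ x = 0) :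
    addRow v w *ᵥ x = 0 := by
  ext i
  change addRow v w i ⬝ᵥ x = 0
  induction i using Fin.lastCases with
  | last => rwa [addRow_last]
  | cast i => rw [addRow_castSucc]; exact congr($h i)

lemma eq_zero_of_mulVec {φ : A →+* D} {n : ℕ} {W : Matrix (Fin n) (Fin n) A} (hW : IsUnit W.det)
    {x : Fin n → D} (h : (W.map φ) *ᵥ x = 0) : x = 0 := by
  by_contra hx
  refine (isUnit_det_map hW φ).ne_zero ?_
  exact Matrix.exists_mulVec_eq_zero_iff.1 ⟨x, hx, h⟩

lemma mul_left_cancel_of_isUnit_det {n : ℕ} {τ : Type*} {W : Matrix (Fin n) (Fin n) A}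
    (hW : IsUnit W.det) {X Y : Matrix (Fin n) τ A} (h : W * X = W * Y) : X = Y := by
  have := congr(W⁻¹ * $h)
  rwa [← Matrix.mul_assoc, ← Matrix.mul_assoc, Matrix.nonsing_inv_mul _ hW, Matrix.one_mul,
    Matrix.one_mul] at this

lemma row_smul_injective {n : ℕ} {V : Matrix (Fin n) (Fin n) A} (hV : IsUnit V.det) (i : Fin n)
    {a b : A} (h : a • V i = b • V i) : a = b := by
  have h1 : V i ⬝ᵥ (fun l ↦ V⁻¹ l i) = 1 := by
    have := congr($(Matrix.mul_nonsing_inv V hV) i i)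
    rwa [Matrix.one_apply_eq] at this
  have h2 := congr($h ⬝ᵥ (fun l ↦ V⁻¹ l i))
  simpa [smul_dotProduct, h1] using h2

lemma addRow_mul {m : ℕ} {τ ρ R : Type*} [Fintype τ] [CommRing R] (v : Matrix (Fin m) τ R)
    (w : τ → R) (T : Matrix τ ρ R) : addRow v w * T = addRow (v * T) (w ᵥ* T) := by
  ext i j
  rw [Matrix.mul_apply_eq_vecMul]
  induction i using Fin.lastCases with
  | last => rw [addRow_last, addRow_last]
  | cast i => rw [addRow_castSucc, addRow_castSucc, Matrix.mul_apply_eq_vecMul]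

lemma vecMul_addRow {m : ℕ} {τ R : Type*} [CommRing R] (v : Matrix (Fin m) τ R)
    (w : τ → R) (g : Fin (m + 1) → R) :
    g ᵥ* addRow v w = (fun i ↦ g i.castSucc) ᵥ* v + g (Fin.last m) • w := by
  ext j
  simp only [Matrix.vecMul, dotProduct, Fin.sum_univ_castSucc, addRow_castSucc, addRow_last,
    Pi.add_apply, Pi.smul_apply, smul_eq_mul]

/-- There are fewer rows than columns in `v`, so it kills a nonzero vector over `D`. Were all rows
of `w` in the span of those of `v`, then `w` would kill this vector as well. -/
lemma exists_isUnit_det_addRow {φ : A →+* D} (hφ : ∀ a, φ a ≠ 0 → IsUnit a) {m : ℕ} {κ : Type*}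
    {v : Matrix (Fin m) (Fin (m + 1)) A} (hv : LinearIndependent D (v.map φ).row)
    {w : Matrix κ (Fin (m + 1)) A}
    (h : ∀ x, (v.map φ) *ᵥ x = 0 → (w.map φ) *ᵥ x = 0 → x = 0) :
    ∃ k, IsUnit (addRow v (w k)).det := by
  have h1 : ∃ k, (w.map φ).row k ∉ Submodule.span D (Set.range (v.map φ).row) := by
    by_contra! h1
    have h2 : LinearMap.ker (v.map φ).mulVecLin ≠ ⊥ := by
      refine LinearMap.ker_ne_bot_of_finrank_lt ?_
      simp
    obtain ⟨x, hx, hx0⟩ := Submodule.exists_mem_ne_zero_of_ne_bot h2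
    have hx' : (v.map φ) *ᵥ x = 0 := hx
    refine hx0 (h x hx' (funext fun k ↦ ?_))
    have h3 := h1 k
    rw [Submodule.mem_span_range_iff_exists_fun] at h3
    obtain ⟨c, hc⟩ := h3
    change (w.map φ).row k ⬝ᵥ x = 0
    rw [← hc, sum_dotProduct]
    refine Finset.sum_eq_zero fun i _ ↦ ?_
    rw [smul_dotProduct]
    exact (congrArg (c i • ·) congr($hx' i)).trans (smul_zero _)
  obtain ⟨k, hk⟩ := h1
  refine ⟨k, hφ _ ?_⟩
  have h2 := linearIndependent_finSnoc.2 ⟨hv, hk⟩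
  have h3 : ((addRow v (w k)).map φ).row =
      Fin.snoc (α := fun _ ↦ Fin (m + 1) → D) (v.map φ).row ((w.map φ).row k) := map_addRow _ _ _
  rw [← h3, Matrix.linearIndependent_rows_iff_isUnit, Matrix.isUnit_iff_isUnit_det] at h2
  have h4 : φ (addRow v (w k)).det = ((addRow v (w k)).map φ).det := RingHom.map_det φ _
  rw [h4]
  exact h2.ne_zero

lemma exists_isUnit_det_addRow_one {φ : A →+* D} (hφ : ∀ a, φ a ≠ 0 → IsUnit a) {m : ℕ}
    {v : Matrix (Fin m) (Fin (m + 1)) A} (hv : LinearIndependent D (v.map φ).row) :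
    ∃ w, IsUnit (addRow v w).det := by
  obtain ⟨e, he⟩ := exists_isUnit_det_addRow hφ hv (w := (1 : Matrix (Fin (m + 1)) (Fin (m + 1)) A))
    fun x _ hx ↦ by
      rwa [Matrix.map_one _ (map_zero _) (map_one _), Matrix.one_mulVec] at hx
  exact ⟨_, he⟩

lemma linearIndependent_row_mul {m n : ℕ} {U : Matrix (Fin m) (Fin n) D} {τ : Type*}
    {K : Matrix (Fin n) τ D} [Fintype τ] (hU : LinearIndependent D U.row)
    (hK : LinearIndependent D K.row) : LinearIndependent D (U * K).row := by
  rw [← Matrix.vecMul_injective_iff] at hU hK ⊢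
  intro x y hxy
  refine hU (hK ?_)
  simpa only [Matrix.vecMul_vecMul] using hxy

/-- Two rank `3` matrices of size `3 × 4` with different kernels have two-dimensional
intersection of row spaces. -/
lemma exists_pencil {φ : A →+* D} (hφ : ∀ a, φ a ≠ 0 → IsUnit a) {K L : Matrix (Fin 3) (Fin 4) A}
    (hK : LinearIndependent D (K.map φ).row) (hL : LinearIndependent D (L.map φ).row)
    (hKL : ∀ x, (K.map φ) *ᵥ x = 0 → (L.map φ) *ᵥ x = 0 → x = 0) :
    ∃ (a : Fin 3) (α β : Matrix (Fin 2) (Fin 3) A) (k : Fin 3), IsUnit (addRow K (L a)).det ∧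
      α * K = β * L ∧ IsUnit (addRow α (Pi.single k 1)).det ∧
      IsUnit (addRow β (Pi.single a 1)).det ∧ LinearIndependent D (β.map φ).row := by
  obtain ⟨a, ha⟩ := exists_isUnit_det_addRow hφ hK hKL
  -- The coordinates of row `b` of `L` in the basis formed by the rows of `K` and the row `L a`.
  let g (b) : Fin 4 → A := L b ᵥ* (addRow K (L a))⁻¹
  have hg (b) : L b = (fun i ↦ g b (Fin.castSucc i)) ᵥ* K + g b (Fin.last 3) • L a := by
    rw [← vecMul_addRow, Matrix.vecMul_vecMul, Matrix.nonsing_inv_mul _ ha, Matrix.vecMul_one]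
  -- For the two rows other than `a`, subtracting the component along `L a` leaves a form in the row
  -- space of `K`, with coordinates `α`.
  let β : Matrix (Fin 2) (Fin 3) A := Matrix.of fun r ↦
    Pi.single (a.succAbove r) 1 - g (a.succAbove r) (Fin.last 3) • Pi.single a 1
  let α : Matrix (Fin 2) (Fin 3) A := Matrix.of fun r i ↦ g (a.succAbove r) i.castSucc
  have hβa (r s) : β r (a.succAbove s) = if r = s then 1 else 0 := by
    simp [β, Pi.single_apply, eq_comm]
  have hαβ : α * K = β * L := by
    ext r l
    have h1 : (β r) ᵥ* L = L (a.succAbove r) - g (a.succAbove r) (Fin.last 3) • L a := by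
      change (Pi.single (a.succAbove r) 1 - g (a.succAbove r) (Fin.last 3) • Pi.single a 1) ᵥ* L = _
      rw [Matrix.sub_vecMul, Matrix.smul_vecMul, Matrix.single_one_vecMul, Matrix.single_one_vecMul]
      rfl
    rw [Matrix.mul_apply_eq_vecMul, Matrix.mul_apply_eq_vecMul, h1]
    have h2 := congr($(hg (a.succAbove r)) l)
    rw [Pi.sub_apply, h2, Pi.add_apply, add_sub_cancel_right]
    rfl
  have hβ : LinearIndependent D (β.map φ).row := by
    rw [Fintype.linearIndependent_iff]
    intro c hc s
    have := congr($hc (a.succAbove s))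
    simpa [Finset.sum_apply, Matrix.row, hβa, apply_ite φ] using this
  have hα : LinearIndependent D (α.map φ).row := by
    have h1 := linearIndependent_row_mul hβ hL
    rw [← Matrix.map_mul, ← hαβ, Matrix.map_mul] at h1
    rw [← Matrix.vecMul_injective_iff] at h1 ⊢
    intro x y hxy
    refine h1 ?_
    simp only [← Matrix.vecMul_vecMul] at hxy ⊢
    rw [hxy]
  obtain ⟨k, hk⟩ := exists_isUnit_det_addRow hφ hα (w := (1 : Matrix (Fin 3) (Fin 3) A))
    fun x _ hx ↦ by
      rwa [Matrix.map_one _ (map_zero _) (map_one _), Matrix.one_mulVec] at hx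
  refine ⟨a, α, β, k, ha, hαβ, ?_, isUnit_det_of_kernel hφ fun x hx ↦ ?_, hβ⟩
  · convert hk using 3
    ext l
    simp [Matrix.one_apply, Pi.single_apply, eq_comm]
  · rw [map_addRow] at hx
    obtain ⟨h1, h2⟩ := addRow_mulVec_eq_zero _ _ hx
    have h3 : x a = 0 := by simpa [Pi.single_apply, dotProduct, apply_ite φ] using h2
    ext b
    obtain rfl | ⟨s, rfl⟩ := Fin.eq_self_or_eq_succAbove a b
    · exact h3
    · have h4 : (β.map φ) s ⬝ᵥ x = 0 := congr($h1 s)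
      rw [dotProduct, Fin.sum_univ_succAbove _ a, h3, mul_zero, zero_add] at h4
      simpa [hβa, apply_ite φ] using h4

/-- Any two rows of `K'` are a common multiple of the corresponding rows of `K`, and the multiples
agree because two pairs share row 0. -/
lemma exists_smul_of_forall_lin_mul_eq {φ : A →+* D} (hφ : ∀ a, φ a ≠ 0 → IsUnit a)
    {K K' : Matrix (Fin 3) (Fin 4) A} (hK : LinearIndependent D (K.map φ).row)
    (key : ∀ d e, lin (K d) * lin (K' e) = lin (K e) * lin (K' d)) : ∃ c : A, K' = c • K := by
  obtain ⟨w, hw⟩ := exists_isUnit_det_addRow_one hφ hK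
  have key' {d e : Fin 3} (hde : d ≠ e) : ∃ c : A, K' d = c • K d ∧ K' e = c • K e := by
    have := exists_smul_of_lin_mul_eq hw (i := d.castSucc) (j := e.castSucc)
      (fun h ↦ hde (Fin.castSucc_injective _ h)) (r := K' d) (s := K' e)
    rw [addRow_castSucc, addRow_castSucc] at this
    exact this (key d e)
  obtain ⟨c, hc0, hc1⟩ := key' (d := 0) (e := 1) (by decide)
  obtain ⟨c', hc0', hc2⟩ := key' (d := 0) (e := 2) (by decide)
  have hcc : c' = c := by
    refine row_smul_injective hw (0 : Fin 3).castSucc ?_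
    rw [addRow_castSucc, ← hc0', hc0]
  subst hcc
  refine ⟨c', ?_⟩
  ext d l
  fin_cases d
  exacts [congr($hc0 l), congr($hc1 l), congr($hc2 l)]

/-- Matrices with equal trilinear relations differ by a substitution. -/
theorem exists_substitution {φ : A →+* D} (hφ : ∀ a, φ a ≠ 0 → IsUnit a) {n : ℕ}
    {M N : Fin n → Matrix (Fin 3) (Fin 4) A} {i j : Fin n}
    (hM : ∀ k, LinearIndependent D ((M k).map φ).row)
    (hN : ∀ k, LinearIndependent D ((N k).map φ).row)
    (hMij : ∀ x, ((M i).map φ) *ᵥ x = 0 → ((M j).map φ) *ᵥ x = 0 → x = 0)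
    (hNij : ∀ x, ((N i).map φ) *ᵥ x = 0 → ((N j).map φ) *ᵥ x = 0 → x = 0)
    (hrel : ∀ (k) (α β γ : Fin 4 → Fin 3 → A),
      ∑ r, lin (α r ᵥ* M i) * lin (β r ᵥ* M j) * lin (γ r ᵥ* M k) = 0 →
      ∑ r, lin (α r ᵥ* N i) * lin (β r ᵥ* N j) * lin (γ r ᵥ* N k) = 0) :
    ∃ T : Matrix (Fin 4) (Fin 4) A, IsUnit T.det ∧
      ∀ k, ∃ a : A, IsUnit a ∧ N k * T = a • M k := by
  -- The common pencil of the row spaces of `M i` and `M j`, with the row `M j a` completing `M i`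
  -- to a basis.
  obtain ⟨a, α, β, k₀, hV, hαβ, hα, hβ, hβ'⟩ := exists_pencil hφ (hM i) (hM j) hMij
  have hαr (r) : α r ᵥ* M i = β r ᵥ* M j := by
    rw [← Matrix.mul_apply_eq_vecMul, ← Matrix.mul_apply_eq_vecMul, hαβ]
  have hrow (K : Matrix (Fin 3) (Fin 4) A) (e : Fin 3) :
      (Pi.single e 1 : Fin 3 → A) ᵥ* K = K e := Matrix.single_one_vecMul _ _
  -- The bilinear relation of the pencil, multiplied by the first row of the camera `i` to become
  -- trilinear. That row of `N i` is regular and can be cancelled afterwards.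
  have hlin : lin (α 0 ᵥ* N i) * lin (β 1 ᵥ* N j) = lin (α 1 ᵥ* N i) * lin (β 0 ᵥ* N j) := by
    obtain ⟨e, he⟩ := exists_isUnit_det_addRow_one hφ (hN i)
    have h1 := lin_mem_nonZeroDivisors_of_row he (0 : Fin 3).castSucc
    rw [addRow_castSucc] at h1
    have h2 := hrel i ![α 0, -α 1, 0, 0] ![β 1, β 0, 0, 0] ![Pi.single 0 1, Pi.single 0 1, 0, 0] (by
      simp [Fin.sum_univ_four, Matrix.neg_vecMul, lin_neg, hαr]
      ring)
    simp [Fin.sum_univ_four, Matrix.neg_vecMul, lin_neg, hrow] at h2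
    refine sub_eq_zero.1 ((mem_nonZeroDivisors_iff_right.1 h1) _ ?_)
    linear_combination h2
  obtain ⟨U₀, hU₀d⟩ : ∃ U, U = addRow α (Pi.single k₀ 1) := ⟨_, rfl⟩
  obtain ⟨U₁, hU₁d⟩ : ∃ U, U = addRow β (Pi.single a 1) := ⟨_, rfl⟩
  rw [← hU₀d] at hα
  rw [← hU₁d] at hβ
  have hU₀ (K : Matrix (Fin 3) (Fin 4) A) (r : Fin 2) : (U₀ * K) r.castSucc = α r ᵥ* K := by
    rw [Matrix.mul_apply_eq_vecMul, hU₀d, addRow_castSucc]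
  have hU₀k {K : Matrix (Fin 3) (Fin 4) A} {x : Fin 4 → D} (h : ((U₀ * K).map φ) *ᵥ x = 0) :
      (K.map φ) *ᵥ x = 0 := by
    rw [Matrix.map_mul, ← Matrix.mulVec_mulVec] at h
    exact eq_zero_of_mulVec hα h
  have hU₁k {K : Matrix (Fin 3) (Fin 4) A} {x : Fin 4 → D} (h : ((U₁ * K).map φ) *ᵥ x = 0) :
      (K.map φ) *ᵥ x = 0 := by
    rw [Matrix.map_mul, ← Matrix.mulVec_mulVec] at h
    exact eq_zero_of_mulVec hβ h
  -- Two independent forms and two others in the same ratio are proportional, so `N i` and `N j`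
  -- share a pencil with the same coefficients up to `μ`.
  obtain ⟨μ, hμ⟩ : ∃ μ : A, ∀ r, β r ᵥ* N j = μ • (α r ᵥ* N i) := by
    obtain ⟨w, hw⟩ := exists_isUnit_det_addRow_one hφ (hN i)
    have h0 : IsUnit (addRow (U₀ * N i) w).det := isUnit_det_of_kernel hφ fun x hx ↦ by
      rw [map_addRow] at hx
      obtain ⟨h1, h2⟩ := addRow_mulVec_eq_zero _ _ hx
      refine eq_zero_of_mulVec (φ := φ) hw ?_
      rw [map_addRow]
      exact addRow_mulVec_eq_zero_of _ _ (hU₀k h1) h2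
    have hr (r : Fin 2) : addRow (U₀ * N i) w r.castSucc.castSucc = α r ᵥ* N i := by
      rw [addRow_castSucc, hU₀]
    obtain ⟨μ, h1, h2⟩ := exists_smul_of_lin_mul_eq h0 (i := (0 : Fin 2).castSucc.castSucc)
      (j := (1 : Fin 2).castSucc.castSucc) (by decide) (r := β 0 ᵥ* N j) (s := β 1 ᵥ* N j)
      (by rw [hr, hr]; exact hlin)
    rw [hr] at h1 h2
    exact ⟨μ, fun r ↦ by fin_cases r; exacts [h1, h2]⟩
  have hμu : IsUnit μ := hφ _ fun h0 ↦ by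
    have h1 := linearIndependent_row_mul hβ' (hN j)
    rw [← Matrix.map_mul] at h1
    refine h1.ne_zero 0 (funext fun l ↦ ?_)
    have h2 : (β * N j) 0 l = μ * (α 0 ᵥ* N i) l := by
      rw [Matrix.mul_apply_eq_vecMul, hμ]
      rfl
    change φ ((β * N j) 0 l) = 0
    rw [h2, map_mul, h0, zero_mul]
  obtain ⟨ν, hν⟩ := hμu.exists_left_inv
  have hVM : IsUnit (addRow (U₀ * M i) (M j a)).det := isUnit_det_of_kernel hφ fun x hx ↦ by
    rw [map_addRow] at hx
    obtain ⟨h1, h2⟩ := addRow_mulVec_eq_zero _ _ hx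
    refine eq_zero_of_mulVec (φ := φ) hV ?_
    rw [map_addRow]
    exact addRow_mulVec_eq_zero_of _ _ (hU₀k h1) h2
  -- A vector killed by `N i` is killed by the pencil, hence by `β * N j`. If `N j a` kills it too,
  -- then so does `N j`, and the centers of `N` are disjoint.
  have hVN : IsUnit (addRow (U₀ * N i) (ν • N j a)).det := isUnit_det_of_kernel hφ fun x hx ↦ by
    rw [map_addRow] at hx
    obtain ⟨h1, h2⟩ := addRow_mulVec_eq_zero _ _ hx
    have h3 := hU₀k h1
    refine hNij x h3 (hU₁k ?_)
    have h4 : β * N j = μ • (α * N i) := by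
      ext r l
      rw [Matrix.mul_apply_eq_vecMul, hμ, Matrix.smul_apply, Matrix.mul_apply_eq_vecMul]
      rfl
    rw [hU₁d, addRow_mul, map_addRow]
    refine addRow_mulVec_eq_zero_of _ _ ?_ ?_
    · have h5 : (μ • (α * N i)).map φ = φ μ • ((α.map φ) * (N i).map φ) := by
        rw [← Matrix.map_mul]
        ext r l
        exact map_mul φ _ _
      rw [h4, h5, Matrix.smul_mulVec, ← Matrix.mulVec_mulVec, h3, Matrix.mulVec_zero, smul_zero]
    · rw [hrow]
      have h5 : (fun l ↦ φ ((ν • N j a) l)) = φ ν • fun l ↦ φ (N j a l) := by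
        ext l
        simp
      rw [h5, smul_dotProduct, smul_eq_mul] at h2
      have h6 : φ μ * φ ν = 1 := by rw [← map_mul, mul_comm, hν, map_one]
      have h7 := congr(φ μ * $h2)
      rwa [← mul_assoc, h6, one_mul, mul_zero] at h7
  obtain ⟨VM, hVMd⟩ : ∃ V, V = addRow (U₀ * M i) (M j a) := ⟨_, rfl⟩
  obtain ⟨VN, hVNd⟩ : ∃ V, V = addRow (U₀ * N i) (ν • N j a) := ⟨_, rfl⟩
  rw [← hVMd] at hVM
  rw [← hVNd] at hVN
  -- `T` matches the two bases. The factor `ν = μ⁻¹` in the last row of `VN` makes `N j * T` equal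
  -- to `μ • M j` on all rows, not only on the pencil.
  obtain ⟨T, hTd⟩ : ∃ T, T = VN⁻¹ * VM := ⟨_, rfl⟩
  have hT : VN * T = VM := by
    rw [hTd, ← Matrix.mul_assoc, Matrix.mul_nonsing_inv _ hVN, Matrix.one_mul]
  rw [hVNd, addRow_mul, hVMd] at hT
  have hTi : N i * T = M i := by
    refine mul_left_cancel_of_isUnit_det hα ?_
    rw [← Matrix.mul_assoc]
    ext r l
    have := congr($hT r.castSucc l)
    rwa [addRow_castSucc, addRow_castSucc] at this
  have hTja : N j a ᵥ* T = μ • M j a := by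
    have := congr($hT (Fin.last 3))
    rw [addRow_last, addRow_last, Matrix.smul_vecMul] at this
    rw [← this, smul_smul, mul_comm, hν, one_smul]
  have hTr (r) : (β r ᵥ* N j) ᵥ* T = μ • (β r ᵥ* M j) := by
    rw [hμ, Matrix.smul_vecMul, Matrix.vecMul_vecMul, hTi, hαr]
  have hTu : IsUnit T.det := by
    rw [hTd, Matrix.det_mul]
    exact (Matrix.isUnit_nonsing_inv_det_iff.2 hVN).mul hVM
  refine ⟨T, hTu, fun k ↦ ?_⟩
  have hξ := lin_mem_nonZeroDivisors_of_row hVM (0 : Fin 2).castSucc.castSucc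
  rw [show VM (0 : Fin 2).castSucc.castSucc = β 0 ᵥ* M j by
    rw [hVMd, addRow_castSucc, hU₀, hαr]] at hξ
  -- Each row of `M k` is a combination of the rows of `M i` plus a multiple of `M j a`.
  let g (d) : Fin 4 → A := M k d ᵥ* (addRow (M i) (M j a))⁻¹
  have hg (d) : M k d = (fun i ↦ g d (Fin.castSucc i)) ᵥ* M i + g d (Fin.last 3) • M j a := by
    rw [← vecMul_addRow, Matrix.vecMul_vecMul, Matrix.nonsing_inv_mul _ hV, Matrix.vecMul_one]
  have hg' (d) : lin (M k d) = lin ((fun i ↦ g d (Fin.castSucc i)) ᵥ* M i) +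
      MvPolynomial.C (g d (Fin.last 3)) * lin (M j a) := by
    rw [← lin_smul, ← lin_add, ← hg]
  -- Let `ξ = α₀ M i = β₀ M j`. By the expansion of row `d`, the product of `ξ` with rows `d` and
  -- `e` of `M k` is a sum of two trilinear terms. Exchanging `d` and `e` and subtracting gives a
  -- relation with four terms. It is carried over to `N`, transformed by `T`, and divided by `μ ξ`.
  have key (d e) : lin (M k d) * lin ((N k * T) e) = lin (M k e) * lin ((N k * T) d) := by
    have h1 := hrel k ![fun i ↦ g d (Fin.castSucc i), g d (Fin.last 3) • α 0,
        -fun i ↦ g e (Fin.castSucc i), -(g e (Fin.last 3) • α 0)]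
      ![β 0, Pi.single a 1, β 0, Pi.single a 1]
      ![Pi.single e 1, Pi.single e 1, Pi.single d 1, Pi.single d 1] (by
        simp only [Fin.sum_univ_four, Matrix.cons_val, Matrix.neg_vecMul, lin_neg, hrow,
          Matrix.smul_vecMul, lin_smul, hαr, hg']
        ring)
    have h2 := congr(subst T $h1)
    simp only [Fin.sum_univ_four, Matrix.cons_val, Matrix.neg_vecMul, lin_neg, hrow, map_add,
      map_mul, map_neg, Matrix.smul_vecMul, subst_lin, hTr, hTja, Matrix.vecMul_vecMul, hTi, hαr,
      ← Matrix.mul_apply_eq_vecMul (N k), lin_smul, map_zero, subst_C] at h2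
    refine sub_eq_zero.1 ((mem_nonZeroDivisors_iff_right.1 hξ) _ ?_)
    refine (hμu.map (MvPolynomial.C (σ := Fin 4))).mul_left_cancel ?_
    rw [hg' d, hg' e]
    linear_combination h2
  obtain ⟨c', hfin⟩ := exists_smul_of_forall_lin_mul_eq hφ (hM k) key
  -- If the scalar were not a unit, the first row of `N k` would vanish over `D`, against its rank.
  refine ⟨c', hφ _ fun h0 ↦ ?_, hfin⟩
  have h1 : N k = c' • (M k * T⁻¹) := by
    rw [← Matrix.smul_mul, ← hfin, Matrix.mul_assoc, Matrix.mul_nonsing_inv _ hTu, Matrix.mul_one]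
  refine (hN k).ne_zero 0 (funext fun l ↦ ?_)
  change φ (N k 0 l) = 0
  rw [h1, Matrix.smul_apply, smul_eq_mul, map_mul, h0, zero_mul]

/-- A substitution preserving two matrices up to scalars is a scalar. -/
theorem eq_smul_one_of_substitution {φ : A →+* D} (hφ : ∀ a, φ a ≠ 0 → IsUnit a)
    {K L : Matrix (Fin 3) (Fin 4) A} (hK : LinearIndependent D (K.map φ).row)
    (hL : LinearIndependent D (L.map φ).row)
    (hKL : ∀ x, (K.map φ) *ᵥ x = 0 → (L.map φ) *ᵥ x = 0 → x = 0)
    {T : Matrix (Fin 4) (Fin 4) A} {a b : A} (hKT : K * T = a • K) (hLT : L * T = b • L) :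
    T = a • (1 : Matrix (Fin 4) (Fin 4) A) := by
  obtain ⟨e, α, β, k₀, hV, hαβ, hα, -⟩ := exists_pencil hφ hK hL hKL
  obtain ⟨w, hw⟩ := exists_isUnit_det_addRow_one hφ hK
  have h0 : IsUnit (addRow (addRow α (Pi.single k₀ 1) * K) w).det :=
    isUnit_det_of_kernel hφ fun x hx ↦ by
      rw [map_addRow] at hx
      obtain ⟨h1, h2⟩ := addRow_mulVec_eq_zero _ _ hx
      refine eq_zero_of_mulVec (φ := φ) hw ?_
      rw [map_addRow]
      rw [Matrix.map_mul, ← Matrix.mulVec_mulVec] at h1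
      exact addRow_mulVec_eq_zero_of _ _ (eq_zero_of_mulVec hα h1) h2
  -- On the common pencil `T` acts both by `a` and by `b`.
  have hab : a = b := by
    refine row_smul_injective h0 (0 : Fin 2).castSucc.castSucc ?_
    rw [addRow_castSucc, Matrix.mul_apply_eq_vecMul, addRow_castSucc]
    have h1 : α * K * T = a • (α * K) := by rw [Matrix.mul_assoc, hKT, Matrix.mul_smul]
    have h2 : α * K * T = b • (α * K) := by
      rw [hαβ, Matrix.mul_assoc, hLT, Matrix.mul_smul]
    exact congr($(h1.symm.trans h2) 0)
  subst hab
  refine mul_left_cancel_of_isUnit_det hV ?_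
  rw [addRow_mul, Matrix.mul_smul, Matrix.mul_one, hKT, ← Matrix.mul_apply_eq_vecMul, hLT]
  ext r l
  rw [Matrix.smul_apply]
  induction r using Fin.lastCases with
  | last => rw [addRow_last, addRow_last]; rfl
  | cast r => rw [addRow_castSucc, addRow_castSucc]; rfl

end Residual

/-! ### From the local ring to a neighbourhood: clearing denominators. -/

section Spread

open Matrix

variable {A D : Type*} [CommRing A] [Field D]

/-- The elements not in the kernel of a homomorphism to a field. -/
abbrev unitsAt (φ : A →+* D) : Submonoid A := (nonZeroDivisors D).comap φ

lemma mem_unitsAt {φ : A →+* D} {a : A} : a ∈ unitsAt φ ↔ φ a ≠ 0 := by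
  simp

/-- Localizing at the elements outside the kernel of `φ` produces the hypothesis `hφ` of the
preceding results. -/
lemma exists_lift_unitsAt (φ : A →+* D) (L : Type*) [CommRing L] [Algebra A L]
    [IsLocalization (unitsAt φ) L] : ∃ ψ : L →+* D, (∀ a, ψ (algebraMap A L a) = φ a) ∧
      ∀ b, ψ b ≠ 0 → IsUnit b := by
  have h (s : unitsAt φ) : IsUnit (φ s) := (mem_unitsAt.1 s.2).isUnit
  refine ⟨IsLocalization.lift h, fun a ↦ IsLocalization.lift_eq h a, fun b hb ↦ ?_⟩
  obtain ⟨x, s, rfl⟩ := IsLocalization.exists_mk'_eq (unitsAt φ) b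
  rw [IsLocalization.lift_mk'] at hb
  rw [IsLocalization.mk'_eq_mul_mk'_one]
  refine IsUnit.mul ?_ (IsUnit.of_mul_eq_one (algebraMap A L s) ?_)
  · exact IsLocalization.map_units L (⟨x, mem_unitsAt.2 fun h0 ↦ hb (by rw [h0, zero_mul])⟩ :
      unitsAt φ)
  · rw [mul_comm, IsLocalization.mul_mk'_eq_mk'_of_mul, mul_one, IsLocalization.mk'_self']

lemma exists_clear {S : Submonoid A} {L : Type*} [CommRing L] [Algebra A L] [IsLocalization S L]
    {ι : Type*} [Finite ι] (f : ι → L) :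
    ∃ s ∈ S, ∃ g : ι → A, ∀ i, algebraMap A L (g i) = algebraMap A L s * f i := by
  obtain ⟨b, hb⟩ := IsLocalization.exist_integer_multiples_of_finite S f
  choose g hg using hb
  exact ⟨b, b.2, g, fun i ↦ (hg i).trans (Algebra.smul_def _ _)⟩

lemma exists_mul_eq_of_finite {S : Submonoid A} {L : Type*} [CommRing L] [Algebra A L]
    [IsLocalization S L] {ι : Type*} [Finite ι] (f g : ι → A)
    (h : ∀ i, algebraMap A L (f i) = algebraMap A L (g i)) : ∃ s ∈ S, ∀ i, s * f i = s * g i := by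
  cases nonempty_fintype ι
  choose c hc using fun i ↦ IsLocalization.exists_of_eq (M := S) (h i)
  refine ⟨∏ i, (c i : A), prod_mem fun i _ ↦ (c i).2, fun i ↦ ?_⟩
  obtain ⟨d, hd⟩ := Finset.dvd_prod_of_mem (fun i ↦ (c i : A)) (Finset.mem_univ i)
  rw [hd, mul_comm _ d, mul_assoc, mul_assoc, hc]

lemma map_lin {L σ : Type*} [CommRing L] [Fintype σ] (f : A →+* L) (r : σ → A) :
    MvPolynomial.map f (lin r) = lin fun i ↦ f (r i) := by
  simp [lin]

lemma map_lin_vecMul {L σ τ : Type*} [CommRing L] [Fintype σ] [Fintype τ] (f : A →+* L)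
    (r : τ → A) (M : Matrix τ σ A) :
    MvPolynomial.map f (lin (r ᵥ* M)) = lin ((fun i ↦ f (r i)) ᵥ* M.map f) := by
  rw [map_lin]
  congr 1
  ext i
  simp [Matrix.vecMul, dotProduct]

/-- Trilinear relations with coefficients in a localization. -/
lemma relation_of_isLocalization {S : Submonoid A} {L : Type*} [CommRing L] [Algebra A L]
    [IsLocalization S L] {K₁ K₂ K₃ N₁ N₂ N₃ : Matrix (Fin 3) (Fin 4) A}
    (hrel : ∀ (α β γ : Fin 4 → Fin 3 → A),
      ∑ r, lin (α r ᵥ* K₁) * lin (β r ᵥ* K₂) * lin (γ r ᵥ* K₃) = 0 →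
      ∑ r, lin (α r ᵥ* N₁) * lin (β r ᵥ* N₂) * lin (γ r ᵥ* N₃) = 0)
    (α β γ : Fin 4 → Fin 3 → L)
    (h : ∑ r, lin (α r ᵥ* K₁.map (algebraMap A L)) * lin (β r ᵥ* K₂.map (algebraMap A L)) *
      lin (γ r ᵥ* K₃.map (algebraMap A L)) = 0) :
    ∑ r, lin (α r ᵥ* N₁.map (algebraMap A L)) * lin (β r ᵥ* N₂.map (algebraMap A L)) *
      lin (γ r ᵥ* N₃.map (algebraMap A L)) = 0 := by
  have clear (f : Fin 4 → Fin 3 → L) : ∃ s ∈ S, ∃ g : Fin 4 → Fin 3 → A,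
      ∀ r, (fun i ↦ algebraMap A L (g r i)) = algebraMap A L s • f r := by
    obtain ⟨s, hs, g, hg⟩ := exists_clear (S := S) fun x : Fin 4 × Fin 3 ↦ f x.1 x.2
    exact ⟨s, hs, fun r i ↦ g (r, i), fun r ↦ funext fun i ↦ hg (r, i)⟩
  obtain ⟨s, hs, α', hα⟩ := clear α
  obtain ⟨t, ht, β', hβ⟩ := clear β
  obtain ⟨u, hu, γ', hγ⟩ := clear γ
  have key (K₁ K₂ K₃ : Matrix (Fin 3) (Fin 4) A) : MvPolynomial.map (algebraMap A L)
      (∑ r, lin (α' r ᵥ* K₁) * lin (β' r ᵥ* K₂) * lin (γ' r ᵥ* K₃)) =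
      MvPolynomial.C (algebraMap A L (s * t * u)) *
        ∑ r, lin (α r ᵥ* K₁.map (algebraMap A L)) * lin (β r ᵥ* K₂.map (algebraMap A L)) *
          lin (γ r ᵥ* K₃.map (algebraMap A L)) := by
    simp only [map_sum, map_mul, map_lin_vecMul, hα, hβ, hγ, Matrix.smul_vecMul, lin_smul,
      Finset.mul_sum]
    exact Finset.sum_congr rfl fun r _ ↦ by ring
  have h1 := key K₁ K₂ K₃
  rw [h, mul_zero, ← map_zero (MvPolynomial.map (algebraMap A L))] at h1
  let : Algebra (MvPolynomial (Fin 4) A) (MvPolynomial (Fin 4) L) :=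
    MvPolynomial.algebraMvPolynomial
  have := MvPolynomial.isLocalization (σ := Fin 4) S L
  -- The relation with cleared denominators holds over `A` only after multiplication by a constant
  -- `w`, which is absorbed into `α'`.
  obtain ⟨⟨_, w, hw, rfl⟩, hc⟩ := IsLocalization.exists_of_eq
    (M := S.map (MvPolynomial.C (σ := Fin 4))) (S := MvPolynomial (Fin 4) L) h1
  have h2 := hrel (fun r ↦ w • α' r) β' γ' (by
    simp only [Matrix.smul_vecMul, lin_smul, mul_assoc]
    rw [← Finset.mul_sum]
    simpa only [mul_assoc, mul_zero] using hc)
  have h3 := congr(MvPolynomial.map (algebraMap A L) $h2)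
  simp only [Matrix.smul_vecMul, lin_smul, mul_assoc] at h3
  rw [← Finset.mul_sum, map_mul, map_zero, MvPolynomial.map_C] at h3
  simp only [← mul_assoc] at h3
  rw [key, ← mul_assoc, ← map_mul, ← map_mul] at h3
  have h4 : IsUnit (algebraMap A L (w * (s * t * u))) :=
    IsLocalization.map_units L (⟨_, mul_mem hw (mul_mem (mul_mem hs ht) hu)⟩ : S)
  exact (h4.map MvPolynomial.C).mul_right_eq_zero.1 h3

lemma map_map_algebraMap {L σ τ : Type*} [CommRing L] [Algebra A L] {φ : A →+* D} {ψ : L →+* D}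
    (hψ : ∀ a, ψ (algebraMap A L a) = φ a) (M : Matrix σ τ A) :
    (M.map (algebraMap A L)).map ψ = M.map φ := by
  ext i j
  exact hψ _

/-- Matrices with equal trilinear relations differ locally by a substitution. -/
theorem exists_substitution_of_field (φ : A →+* D) {n : ℕ}
    {M N : Fin n → Matrix (Fin 3) (Fin 4) A} {i j : Fin n}
    (hM : ∀ k, LinearIndependent D ((M k).map φ).row)
    (hN : ∀ k, LinearIndependent D ((N k).map φ).row)
    (hMij : ∀ x, ((M i).map φ) *ᵥ x = 0 → ((M j).map φ) *ᵥ x = 0 → x = 0)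
    (hNij : ∀ x, ((N i).map φ) *ᵥ x = 0 → ((N j).map φ) *ᵥ x = 0 → x = 0)
    (hrel : ∀ (k) (α β γ : Fin 4 → Fin 3 → A),
      ∑ r, lin (α r ᵥ* M i) * lin (β r ᵥ* M j) * lin (γ r ᵥ* M k) = 0 →
      ∑ r, lin (α r ᵥ* N i) * lin (β r ᵥ* N j) * lin (γ r ᵥ* N k) = 0) :
    ∃ (T : Matrix (Fin 4) (Fin 4) A) (a : Fin n → A), φ T.det ≠ 0 ∧
      ∀ k, φ (a k) ≠ 0 ∧ N k * T = a k • M k := by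
  let L := Localization (unitsAt φ)
  obtain ⟨ψ, hψ, hψu⟩ := exists_lift_unitsAt φ L
  have hmap (K : Matrix (Fin 3) (Fin 4) A) : (K.map (algebraMap A L)).map ψ = K.map φ :=
    map_map_algebraMap hψ K
  obtain ⟨T, hT, hTk⟩ := exists_substitution (φ := ψ) hψu
    (M := fun k ↦ (M k).map (algebraMap A L)) (N := fun k ↦ (N k).map (algebraMap A L))
    (i := i) (j := j) (fun k ↦ by rw [hmap]; exact hM k) (fun k ↦ by rw [hmap]; exact hN k)
    (by simpa only [hmap] using hMij) (by simpa only [hmap] using hNij)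
    (fun k ↦ relation_of_isLocalization (S := unitsAt φ) (hrel k))
  choose a ha haT using hTk
  -- One denominator `s` serves for the entries of `T` and all scalars; the factor `t` found next
  -- makes the equations hold in `A` itself.
  obtain ⟨s, hs, g, hg⟩ := exists_clear (S := unitsAt φ)
    (Sum.elim (fun x : Fin 4 × Fin 4 ↦ T x.1 x.2) a)
  obtain ⟨T₀, hT₀⟩ : ∃ T₀ : Matrix (Fin 4) (Fin 4) A,
      T₀.map (algebraMap A L) = algebraMap A L s • T :=
    ⟨Matrix.of fun x y ↦ g (.inl (x, y)), by ext x y; exact hg (.inl (x, y))⟩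
  obtain ⟨t, ht, hg'⟩ := exists_mul_eq_of_finite (S := unitsAt φ) (L := L)
    (fun x : Fin n × Fin 3 × Fin 4 ↦ (N x.1 * T₀) x.2.1 x.2.2)
    (fun x ↦ (g (.inr x.1) • M x.1) x.2.1 x.2.2) (by
      rintro ⟨k, x, y⟩
      have h1 : (N k * T₀).map (algebraMap A L) = (g (.inr k) • M k).map (algebraMap A L) := by
        rw [Matrix.map_mul, hT₀, Matrix.mul_smul, haT]
        ext x y
        have := hg (.inr k)
        simp only [Matrix.smul_apply, Matrix.map_apply, smul_eq_mul, map_mul, this, Sum.elim_inr,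
          mul_assoc]
      exact congr($h1 x y))
  have hu {b : L} (hb : IsUnit b) : ψ b ≠ 0 := (hb.map ψ).ne_zero
  have hsu : IsUnit (algebraMap A L s) := IsLocalization.map_units L (⟨s, hs⟩ : unitsAt φ)
  refine ⟨t • T₀, fun k ↦ t * g (.inr k), ?_, fun k ↦ ⟨?_, ?_⟩⟩
  · rw [Matrix.det_smul, map_mul, map_pow]
    refine mul_ne_zero (pow_ne_zero _ (mem_unitsAt.1 ht)) ?_
    rw [← hψ]
    have h1 : algebraMap A L T₀.det = (T₀.map (algebraMap A L)).det := RingHom.map_det _ _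
    rw [h1, hT₀, Matrix.det_smul]
    exact hu ((hsu.pow _).mul hT)
  · rw [map_mul]
    refine mul_ne_zero (mem_unitsAt.1 ht) ?_
    have := hg (.inr k)
    rw [← hψ, this]
    exact hu (hsu.mul (ha k))
  · rw [Matrix.mul_smul, mul_smul]
    ext x y
    exact hg' (k, x, y)

/-- The substitution is unique up to scalars. -/
theorem exists_smul_eq_of_symmetric (φ : A →+* D) {K L : Matrix (Fin 3) (Fin 4) A}
    (hK : LinearIndependent D (K.map φ).row) (hL : LinearIndependent D (L.map φ).row)
    (hKL : ∀ x, (K.map φ) *ᵥ x = 0 → (L.map φ) *ᵥ x = 0 → x = 0)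
    {T T' : Matrix (Fin 4) (Fin 4) A} (hT : φ T.det ≠ 0) (hT' : φ T'.det ≠ 0)
    (hKT : ∀ d e, lin ((K * T) d) * lin ((K * T') e) = lin ((K * T) e) * lin ((K * T') d))
    (hLT : ∀ d e, lin ((L * T) d) * lin ((L * T') e) = lin ((L * T) e) * lin ((L * T') d)) :
    ∃ s a : A, φ s ≠ 0 ∧ φ a ≠ 0 ∧ s • T' = a • T := by
  let B := Localization (unitsAt φ)
  obtain ⟨ψ, hψ, hψu⟩ := exists_lift_unitsAt φ B
  have hmap (K : Matrix (Fin 3) (Fin 4) A) : (K.map (algebraMap A B)).map ψ = K.map φ :=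
    map_map_algebraMap hψ K
  have hdet {T : Matrix (Fin 4) (Fin 4) A} (hT : φ T.det ≠ 0) :
      IsUnit (T.map (algebraMap A B)).det := by
    have h1 : algebraMap A B T.det = (T.map (algebraMap A B)).det := RingHom.map_det _ _
    rw [← h1]
    exact IsLocalization.map_units B (⟨_, mem_unitsAt.2 hT⟩ : unitsAt φ)
  have hTu := hdet hT
  have hTu' := hdet hT'
  -- The two images are proportional, so `T' T⁻¹` preserves each matrix up to a scalar; preserving
  -- two of them makes it scalar.
  have step {K : Matrix (Fin 3) (Fin 4) A} (hK : LinearIndependent D (K.map φ).row)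
      (hKT : ∀ d e, lin ((K * T) d) * lin ((K * T') e) = lin ((K * T) e) * lin ((K * T') d)) :
      ∃ c : B, K.map (algebraMap A B) * (T'.map (algebraMap A B) * (T.map (algebraMap A B))⁻¹) =
        c • K.map (algebraMap A B) := by
    obtain ⟨c, hc⟩ := exists_smul_of_forall_lin_mul_eq hψu
      (K := (K * T).map (algebraMap A B)) (K' := (K * T').map (algebraMap A B)) (by
        rw [hmap, Matrix.map_mul]
        have h0 : IsUnit (T.map φ) := by
          rw [Matrix.isUnit_iff_isUnit_det]
          have h1 : φ T.det = (T.map φ).det := RingHom.map_det _ _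
          rw [← h1]
          exact hT.isUnit
        exact linearIndependent_row_mul hK (Matrix.linearIndependent_rows_iff_isUnit.2 h0))
      (fun d e ↦ by
        have := congr(MvPolynomial.map (algebraMap A B) $(hKT d e))
        rwa [map_mul, map_mul, map_lin, map_lin, map_lin, map_lin] at this)
    refine ⟨c, ?_⟩
    rw [← Matrix.mul_assoc, ← Matrix.map_mul, hc, Matrix.map_mul, Matrix.smul_mul,
      Matrix.mul_assoc, Matrix.mul_nonsing_inv _ hTu, Matrix.mul_one]
  obtain ⟨c, hc⟩ := step hK hKT
  obtain ⟨c', hc'⟩ := step hL hLT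
  have h1 := eq_smul_one_of_substitution (φ := ψ) hψu (by rwa [hmap]) (by rwa [hmap])
    (by simpa only [hmap] using hKL) hc hc'
  have h2 : T'.map (algebraMap A B) = c • T.map (algebraMap A B) := by
    have := congr($h1 * T.map (algebraMap A B))
    rwa [Matrix.mul_assoc, Matrix.nonsing_inv_mul _ hTu, Matrix.mul_one, Matrix.smul_mul,
      Matrix.one_mul] at this
  obtain ⟨s, hs, g, hg⟩ := exists_clear (S := unitsAt φ) fun _ : Unit ↦ c
  obtain ⟨t, ht, hg'⟩ := exists_mul_eq_of_finite (S := unitsAt φ) (L := B)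
    (fun x : Fin 4 × Fin 4 ↦ s * T' x.1 x.2) (fun x ↦ g () * T x.1 x.2) (by
      rintro ⟨x, y⟩
      have := congr($h2 x y)
      rw [map_mul, map_mul, hg, mul_assoc]
      exact congrArg _ this)
  refine ⟨t * s, t * g (), ?_, ?_, ?_⟩
  · rw [map_mul]
    exact mul_ne_zero (mem_unitsAt.1 ht) (mem_unitsAt.1 hs)
  · rw [map_mul]
    refine mul_ne_zero (mem_unitsAt.1 ht) ?_
    rw [← hψ, hg, map_mul, hψ]
    refine mul_ne_zero (mem_unitsAt.1 hs) fun h0 ↦ ?_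
    refine (hTu'.map ψ).ne_zero ?_
    rw [h2, Matrix.det_smul, map_mul, map_pow, h0]
    simp
  · ext x y
    simp only [Matrix.smul_apply, smul_eq_mul, mul_assoc]
    exact hg' (x, y)

end Spread

/-! ### Finiteness of the camera maps and vanishing on scheme-theoretic images. -/

section QuasiCompactness

variable {P S X Y : Scheme.{u}} {π : P ⟶ S}

lemma mem_compl_iff_exists {I : X.IdealSheafData} {x : X} {U : X.affineOpens} (h : x ∈ U.1) :
    x ∈ compl I ↔ ∃ a ∈ I.ideal U, x ∈ X.basicOpen a := by
  have h1 : x ∈ compl I ↔ ¬ x ∈ I.support := Iff.rfl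
  rw [h1, Scheme.IdealSheafData.mem_support_iff_of_mem h, Scheme.mem_zeroLocus_iff]
  push Not
  exact ⟨fun ⟨a, ha, ha'⟩ ↦ ⟨a, ha, ha'⟩, fun ⟨a, ha, ha'⟩ ↦ ⟨a, ha, ha'⟩⟩

/-- If every ideal contains a function invertible at `x`, their intersection contains the product of
these functions. -/
lemma mem_compl_iInf_iff {ι : Type*} [Finite ι] (I : ι → X.IdealSheafData) {x : X} :
    x ∈ compl (⨅ i, I i) ↔ ∀ i, x ∈ compl (I i) := by
  refine ⟨fun h i hi ↦ h (Scheme.IdealSheafData.support_antitone (iInf_le I i) hi), fun h ↦ ?_⟩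
  cases nonempty_fintype ι
  obtain ⟨U, hU, hxU, -⟩ :=
    exists_isAffineOpen_mem_and_subset (X := X) (x := x) (U := ⊤) trivial
  choose a ha hxa using fun i ↦ (mem_compl_iff_exists (U := ⟨U, hU⟩) hxU).1 (h i)
  refine (mem_compl_iff_exists (U := ⟨U, hU⟩) hxU).2 ⟨∏ i, a i, ?_, ?_⟩
  · rw [Scheme.IdealSheafData.ideal_iInf, iInf_apply, Ideal.mem_iInf]
    exact fun i ↦ Ideal.mem_of_dvd _ (Finset.dvd_prod_of_mem a (Finset.mem_univ i)) (ha i)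
  · have h1 (s : Finset ι) : x ∈ X.basicOpen (∏ i ∈ s, a i) := by
      classical
      induction s using Finset.induction_on with
      | empty => rw [Finset.prod_empty, Scheme.basicOpen_of_isUnit _ isUnit_one]; exact hxU
      | insert i s hi ih => rw [Finset.prod_insert hi, Scheme.basicOpen_mul]; exact ⟨hxa i, ih⟩
    exact h1 _

/-- Over an affine open set, the complement is a finite union of basic open sets of the generators.
-/
lemma quasiCompact_ι_of_fg {I : X.IdealSheafData}
    (h : ∀ x : X, ∃ U : X.affineOpens, x ∈ U.1 ∧ (I.ideal U).FG) : QuasiCompact (compl I).ι := by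
  choose U hxU hU using h
  refine (@HasAffineProperty.iff_of_iSup_eq_top _ _
    instHasAffinePropertyQuasiCompactCompactSpaceCarrierCarrierCommRingCat.{u} _ _ _ _ U
    (top_le_iff.1 fun x _ ↦ Opens.mem_iSup.2 ⟨x, hxU x⟩)).2 fun x ↦ ?_
  obtain ⟨s, hs⟩ := hU x
  have h1 : (compl I).ι '' ((compl I).ι ⁻¹ᵁ (U x).1) =
      ⋃ a ∈ (s : Set Γ(X, (U x).1)), (X.basicOpen a : Set X) := by
    ext y
    constructor
    · rintro ⟨z, hz, rfl⟩
      have h2 : z.1 ∈ compl I := z.2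
      by_contra h3
      rw [Set.mem_iUnion₂] at h3
      refine h2 ((Scheme.IdealSheafData.mem_support_iff_of_mem (U := U x) hz).2 ?_)
      rw [← hs, Scheme.zeroLocus_span, Scheme.mem_zeroLocus_iff]
      exact fun a ha ha' ↦ h3 ⟨a, ha, ha'⟩
    · intro hy
      obtain ⟨a, ha, hy⟩ := Set.mem_iUnion₂.1 hy
      have hyU : y ∈ (U x).1 := X.basicOpen_le _ hy
      have hyI : y ∈ compl I := (mem_compl_iff_exists hyU).2
        ⟨a, by rw [← hs]; exact Ideal.subset_span ha, hy⟩
      exact ⟨⟨y, hyI⟩, hyU, rfl⟩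
  have h2 : IsCompact (((compl I).ι ⁻¹ᵁ (U x).1 : Opens _) : Set (compl I : Scheme.{u})) := by
    rw [(compl I).ι.isOpenEmbedding.isEmbedding.isCompact_iff, h1]
    exact s.finite_toSet.isCompact_biUnion fun a _ ↦ isCompact_basicOpen X (U x).2.isCompact a
  exact isCompact_iff_compactSpace.1 h2

/-- The center is a closed subscheme of finite presentation over `S` in a scheme of finite
presentation, and the kernel of a surjection between finitely presented algebras is finitely
generated. -/
lemma Camera.exists_fg [IsSeparated π] [LocallyOfFinitePresentation π] (c : Camera π) (x : P) :
    ∃ U : P.affineOpens, x ∈ U.1 ∧ (c.Z.ideal U).FG := by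
  have := c.isClosedImmersion_center
  obtain ⟨V, hV, hxV, -⟩ :=
    exists_isAffineOpen_mem_and_subset (X := S) (x := π x) (U := ⊤) trivial
  obtain ⟨U, hU, hxU, hUV⟩ :=
    exists_isAffineOpen_mem_and_subset (X := P) (x := x) (U := π ⁻¹ᵁ V) hxV
  replace hUV : U ≤ π ⁻¹ᵁ V := hUV
  refine ⟨⟨U, hU⟩, hxU, ?_⟩
  have hW : IsAffineOpen (c.center ⁻¹ᵁ U) := hU.preimage c.center
  have hle : c.center ⁻¹ᵁ U ≤ (c.center ≫ π) ⁻¹ᵁ V := c.center.preimage_mono hUV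
  have h1 : (π.appLE V U hUV).hom.FinitePresentation :=
    HasRingHomProperty.appLE (P := @LocallyOfFinitePresentation) π inferInstance ⟨V, hV⟩ ⟨U, hU⟩ hUV
  have hid : LocallyOfFinitePresentation (c.center ≫ π) := by
    rw [c.center_comp]; infer_instance
  have h2 : ((c.center ≫ π).appLE V (c.center ⁻¹ᵁ U) hle).hom.FinitePresentation :=
    HasRingHomProperty.appLE (P := @LocallyOfFinitePresentation) (c.center ≫ π) hid
      ⟨V, hV⟩ ⟨_, hW⟩ hle
  rw [Scheme.Hom.ker_apply]
  let i1 : Algebra Γ(S, V) Γ(P, U) := (π.appLE V U hUV).hom.toAlgebra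
  let i2 : Algebra Γ(S, V) Γ(S, c.center ⁻¹ᵁ U) :=
    ((c.center ≫ π).appLE V (c.center ⁻¹ᵁ U) hle).hom.toAlgebra
  let F : Γ(P, U) →ₐ[Γ(S, V)] Γ(S, c.center ⁻¹ᵁ U) :=
    { (c.center.app U).hom with
      commutes' := fun r ↦ by
        change (c.center.app U).hom ((π.appLE V U hUV).hom r) = _
        rw [app_eq, appLE_comp]
        rfl }
  have i3 : Algebra.FinitePresentation Γ(S, V) Γ(P, U) := h1
  have i4 : Algebra.FinitePresentation Γ(S, V) Γ(S, c.center ⁻¹ᵁ U) := h2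
  exact Algebra.FinitePresentation.ker_fG_of_surjective F
    (c.center.app_surjective U hU)

/-- The morphisms `p k` together are a monomorphism to an iterated fibre product, which is separated
over `S`. This is applied to `(ℙ²_S)ⁿ`. -/
lemma isSeparated_of_jointly_mono {n : ℕ} {X Y : Scheme.{u}} (y : Y ⟶ S) [IsSeparated y]
    (b : X ⟶ S) (p : Fin n → (X ⟶ Y)) (hp : ∀ k, p k ≫ y = b)
    (h : ∀ (Z : Scheme.{u}) (f g : Z ⟶ X), f ≫ b = g ≫ b → (∀ k, f ≫ p k = g ≫ p k) → f = g) :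
    IsSeparated b := by
  have key (n : ℕ) (p : Fin n → (X ⟶ Y)) (hp : ∀ k, p k ≫ y = b) :
      ∃ (E : Scheme.{u}) (e : E ⟶ S) (q : X ⟶ E), IsSeparated e ∧ q ≫ e = b ∧
        ∀ k, ∃ r, q ≫ r = p k := by
    induction n with
    | zero => exact ⟨S, 𝟙 S, b, inferInstance, Category.comp_id _, fun k ↦ k.elim0⟩
    | succ n ih =>
      obtain ⟨E, e, q, he, hq, hr⟩ := ih (fun k ↦ p k.castSucc) fun k ↦ hp _
      refine ⟨pullback e y, pullback.fst _ _ ≫ e,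
        pullback.lift q (p (Fin.last n)) (by rw [hq, hp]), inferInstance, ?_, fun k ↦ ?_⟩
      · rw [pullback.lift_fst_assoc, hq]
      · induction k using Fin.lastCases with
        | last => exact ⟨_, pullback.lift_snd _ _ _⟩
        | cast k =>
          obtain ⟨r, hr⟩ := hr k
          exact ⟨pullback.fst _ _ ≫ r, by rw [pullback.lift_fst_assoc, hr]⟩
  obtain ⟨E, e, q, he, rfl, hr⟩ := key n p hp
  have : Mono q := ⟨fun f g hfg ↦ h _ f g (by rw [reassoc_of% hfg]) fun k ↦ by
    obtain ⟨r, hr⟩ := hr k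
    rw [← hr, reassoc_of% hfg]⟩
  infer_instance

variable {n : ℕ}

/-- The structure morphism of `(ℙ²_S)ⁿ`. -/
def PlanePower.toBase (S : Scheme.{u}) (n : ℕ) : PlanePower S n ⟶ S :=
  WidePullback.base fun _ ↦ ProjectiveSpace.toBase 2 S

/-- The projections of `(ℙ²_S)ⁿ`. -/
def PlanePower.proj (S : Scheme.{u}) {n : ℕ} (k : Fin n) : PlanePower S n ⟶ ProjectiveSpace 2 S :=
  WidePullback.π (fun _ ↦ ProjectiveSpace.toBase 2 S) k

lemma PlanePower.proj_toBase (k : Fin n) :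
    PlanePower.proj S k ≫ ProjectiveSpace.toBase 2 S = PlanePower.toBase S n :=
  WidePullback.π_arrow _ _

lemma PlanePower.hom_ext {f g : X ⟶ PlanePower S n}
    (h : f ≫ PlanePower.toBase S n = g ≫ PlanePower.toBase S n)
    (h' : ∀ k, f ≫ PlanePower.proj S k = g ≫ PlanePower.proj S k) : f = g :=
  WidePullback.hom_ext _ _ _ h' h

instance isSeparated_toBase : IsSeparated (ProjectiveSpace.toBase 2 S) := by
  have := isSeparated_projectiveSpaceInt.{u} (m := 2)
  have := this.isSeparated_terminal_from
  exact inferInstanceAs (IsSeparated (pullback.fst _ _))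

instance : IsSeparated (PlanePower.toBase S n) :=
  isSeparated_of_jointly_mono (ProjectiveSpace.toBase 2 S) _ (PlanePower.proj S)
    PlanePower.proj_toBase fun _ _ _ h h' ↦ PlanePower.hom_ext h h'

variable (Φ : Configuration S n)

lemma Configuration.mem_compl_Z_iff {x : Φ.P} :
    x ∈ compl Φ.Z ↔ ∀ k, x ∈ compl (Φ.camera k).Z := mem_compl_iInf_iff _

lemma Configuration.map_toBase :
    Φ.map ≫ PlanePower.toBase S n = (compl Φ.Z).ι ≫ Φ.π := WidePullback.lift_base _ _ _ _

lemma Configuration.map_proj (k : Fin n) : Φ.map ≫ PlanePower.proj S k =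
    Φ.P.homOfLE (Φ.compl_Z_le k) ≫ (Φ.camera k).map := WidePullback.lift_π _ _ _ _ _

instance : IsProper Φ.π := Φ.isProper

instance : LocallyOfFinitePresentation Φ.π := Φ.locallyOfFinitePresentation

/-- Quasi-compactness ensures that the ideal of the scheme-theoretic image on an affine open set
consists of all functions that pull back to zero. -/
instance Configuration.quasiCompact_map : QuasiCompact Φ.map := by
  have h1 : QuasiCompact (compl Φ.Z).ι := by
    rw [quasiCompact_iff_isSpectralMap]
    have h (k) : IsRetrocompact (compl (Φ.camera k).Z : Set Φ.P) := by
      have := quasiCompact_ι_of_fg (I := (Φ.camera k).Z) (Φ.camera k).exists_fg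
      exact IsRetrocompact_iff_isSpectralMap_subtypeVal.2
        (compl (Φ.camera k).Z).ι.isSpectralMap
    have h' (s : Finset (Fin n)) : IsRetrocompact (⋂ k ∈ s, (compl (Φ.camera k).Z : Set Φ.P)) := by
      induction s using Finset.induction_on with
      | empty => simp
      | insert k s _ ih =>
        rw [Finset.set_biInter_insert]
        exact (ih.isOpen_inter (h k) (s.finite_toSet.isOpen_biInter fun k _ ↦
          (compl (Φ.camera k).Z).isOpen)) |> fun h ↦ by rwa [Set.inter_comm] at h
    have h'' : (compl Φ.Z : Set Φ.P) =
        ⋂ k ∈ Finset.univ, (compl (Φ.camera k).Z : Set Φ.P) := by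
      ext x
      simpa using Φ.mem_compl_Z_iff
    have h3 := h' Finset.univ
    rw [← h''] at h3
    exact IsRetrocompact_iff_isSpectralMap_subtypeVal.1 h3
  have h2 : QuasiCompact (Φ.map ≫ PlanePower.toBase S n) := by
    rw [Φ.map_toBase]
    infer_instance
  exact QuasiCompact.of_comp Φ.map (PlanePower.toBase S n)

/-- Functions vanishing on the image of a morphism also vanish on the image of any morphism with the
same scheme-theoretic image. -/
lemma appLE_eq_zero_of_ker_eq {X' : Scheme.{u}} {f : X ⟶ Y} {g : X' ⟶ Y} [QuasiCompact f]
    (h : f.ker = g.ker) {W : Y.Opens} (F : Γ(Y, W))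
    (hF : ∀ x ∈ f ⁻¹ᵁ W, ∃ (O : X.Opens) (hO : ⊤ ≤ (O.ι ≫ f) ⁻¹ᵁ W), x ∈ O ∧
      ((O.ι ≫ f).appLE W ⊤ hO).hom F = 0)
    {T : Scheme.{u}} (t : T ⟶ X') (ht : ⊤ ≤ (t ≫ g) ⁻¹ᵁ W) :
    ((t ≫ g).appLE W ⊤ ht).hom F = 0 := by
  have h0 : (f.app W).hom F = 0 := by
    refine ext_of_local _ _ fun x hx ↦ ?_
    obtain ⟨O, hO, hxO, hz⟩ := hF x hx
    have hOW : O ≤ f ⁻¹ᵁ W := fun x hx ↦ hO (x := ⟨x, hx⟩) trivial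
    refine ⟨O, hOW, hxO, ?_⟩
    have h1 : ⊤ ≤ O.ι ⁻¹ᵁ (f ⁻¹ᵁ W) := hO
    rw [map_zero, app_eq, rs_appLE]
    rw [← appLE_comp O.ι f (le_refl (f ⁻¹ᵁ W)) h1, ι_appLE_eq_rs, rs_appLE] at hz
    have h2 : O ≤ O.ι ''ᵁ ⊤ := fun x hx ↦ ⟨⟨x, hx⟩, trivial, rfl⟩
    have h3 := congr(rs h2 $hz)
    rw [rs_appLE] at h3
    exact h3.trans (map_zero _)
  refine ext_of_local _ _ fun x _ ↦ ?_
  have hx : (t ≫ g) x ∈ W := ht (x := x) trivial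
  obtain ⟨V, hV, hxV, hVW⟩ := exists_isAffineOpen_mem_and_subset (X := Y) (U := W) hx
  replace hVW : V ≤ W := hVW
  have h1 : rs hVW F ∈ f.ker.ideal ⟨V, hV⟩ := by
    have h2 := congr(rs (f.preimage_mono hVW) $h0)
    rw [app_eq, rs_appLE, map_zero] at h2
    have h3 : (f.app V).hom (rs hVW F) = 0 := by rwa [app_eq, appLE_rs]
    rw [Scheme.Hom.ker_apply]
    exact h3
  rw [h] at h1
  have h2 : (g.app V).hom (rs hVW F) = 0 := Scheme.Hom.ideal_ker_le g ⟨V, hV⟩ h1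
  refine ⟨(t ≫ g) ⁻¹ᵁ V, le_top, hxV, ?_⟩
  rw [map_zero, rs_appLE]
  have h3 := congr((t.appLE (g ⁻¹ᵁ V) (t ⁻¹ᵁ (g ⁻¹ᵁ V)) le_rfl).hom $h2)
  rw [app_eq, appLE_comp, appLE_rs, map_zero] at h3
  exact h3

end QuasiCompactness

/-! ### Trilinear relations as functions on the multiview scheme. -/

section Relations

open Matrix

variable {S C X Y : Scheme.{u}} {j : C ⟶ S}

lemma exists_appLE_eq [IsOpenImmersion j] (a : Γ(C, ⊤)) :
    ∃ (U : S.Opens) (hU : ⊤ ≤ j ⁻¹ᵁ U) (b : Γ(S, U)), (U : Set S) ⊆ Set.range j ∧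
      (j.appLE U ⊤ hU).hom b = a := by
  have hU : ⊤ ≤ j ⁻¹ᵁ (j ''ᵁ ⊤) := (j.preimage_image_eq ⊤).ge
  refine ⟨j ''ᵁ ⊤, hU, (j.appIso ⊤).inv.hom a, ?_, ?_⟩
  · rintro _ ⟨x, -, rfl⟩
    exact ⟨x, rfl⟩
  · have h1 : j.appLE (j ''ᵁ ⊤) ⊤ hU = (j.appIso ⊤).hom := (Scheme.Hom.appIso_hom' j ⊤).symm
    rw [h1]
    exact congr(($((j.appIso ⊤).inv_hom_id)).hom a)

/-- A function on the open subset of `X` lying over `C`. -/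
lemma exists_function_over [IsOpenImmersion j] (b : X ⟶ S) {W : X.Opens}
    (hW : W ≤ b ⁻¹ᵁ j.opensRange) (a : Γ(C, ⊤)) :
    ∃ F : Γ(X, W), ∀ {T : Scheme.{u}} (t : T ⟶ X) (c : T ⟶ C), t ≫ b = c ≫ j →
      ∀ h : ⊤ ≤ t ⁻¹ᵁ W, (t.appLE W ⊤ h).hom F = c.appTop.hom a := by
  obtain ⟨U, hU, a', hUr, rfl⟩ := exists_appLE_eq (j := j) a
  have hr : j.opensRange ≤ U := by
    rintro _ ⟨x, rfl⟩
    exact hU (x := x) trivial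
  have hWU : W ≤ b ⁻¹ᵁ U := hW.trans (b.preimage_mono hr)
  refine ⟨(b.appLE U W hWU).hom a', fun t c htc h ↦ ?_⟩
  rw [appLE_comp, appTop_eq, appLE_comp]
  exact appLE_congr_hom htc _ _

/-- The function whose vanishing expresses a trilinear relation. -/
lemma exists_test_function [IsOpenImmersion j] (b : X ⟶ S)
    (g₁ g₂ g₃ : X ⟶ ProjectiveSpaceInt.{u} 2) (α β γ : Fin 4 → Fin 3 → Γ(C, ⊤)) :
    ∃ (W : X.Opens) (F : Γ(X, W)),
      (∀ x ∈ W, b x ∈ Set.range j ∧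
        g₁ x ∈ chart 2 0 ∧ g₂ x ∈ chart 2 0 ∧ g₃ x ∈ chart 2 0) ∧
      ∀ {T : Scheme.{u}} (t : T ⟶ X) (c : T ⟶ C), t ≫ b = c ≫ j →
        ∀ v₁ v₂ v₃, Rep (t ≫ g₁) v₁ → Rep (t ≫ g₂) v₂ → Rep (t ≫ g₃) v₃ →
        (IsUnit (v₁ 0) → IsUnit (v₂ 0) → IsUnit (v₃ 0) → ⊤ ≤ t ⁻¹ᵁ W) ∧
        ∀ h : ⊤ ≤ t ⁻¹ᵁ W, IsUnit (v₁ 0 * v₂ 0 * v₃ 0) ∧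
          (t.appLE W ⊤ h).hom F * (v₁ 0 * v₂ 0 * v₃ 0) =
            ∑ r, ((fun d ↦ c.appTop.hom (α r d)) ⬝ᵥ v₁) * ((fun d ↦ c.appTop.hom (β r d)) ⬝ᵥ v₂) *
              ((fun d ↦ c.appTop.hom (γ r d)) ⬝ᵥ v₃) := by
  -- A trilinear form is not a function on the product of planes. It is dehomogenized on the open
  -- set where the zeroth coordinates of the three images are invertible.
  let W : X.Opens := b ⁻¹ᵁ j.opensRange ⊓
    (g₁ ⁻¹ᵁ chart 2 0 ⊓ (g₂ ⁻¹ᵁ chart 2 0 ⊓ g₃ ⁻¹ᵁ chart 2 0))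
  have hb : W ≤ b ⁻¹ᵁ j.opensRange := inf_le_left
  have h1 : W ≤ g₁ ⁻¹ᵁ chart 2 0 := inf_le_right.trans inf_le_left
  have h2 : W ≤ g₂ ⁻¹ᵁ chart 2 0 := inf_le_right.trans (inf_le_right.trans inf_le_left)
  have h3 : W ≤ g₃ ⁻¹ᵁ chart 2 0 := inf_le_right.trans (inf_le_right.trans inf_le_right)
  choose q hq using exists_function_over (j := j) b hb
  let L (g : X ⟶ ProjectiveSpaceInt.{u} 2) (hg : W ≤ g ⁻¹ᵁ chart 2 0) (α : Fin 3 → Γ(C, ⊤)) :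
    Γ(X, W) := ∑ d, q (α d) * (g.appLE (chart 2 0) W hg).hom (ratio 2 d 0)
  have hunit {T : Scheme.{u}} (t : T ⟶ X) (g : X ⟶ ProjectiveSpaceInt.{u} 2)
      (hg : W ≤ g ⁻¹ᵁ chart 2 0) {v} (hv : Rep (t ≫ g) v) (h : ⊤ ≤ t ⁻¹ᵁ W) : IsUnit (v 0) := by
    refine isUnit_of_basicOpen_eq_top (top_le_iff.1 ?_)
    rw [← hv.preimage]
    exact h.trans (t.preimage_mono hg)
  have hL {T : Scheme.{u}} (t : T ⟶ X) (c : T ⟶ C) (htc : t ≫ b = c ≫ j)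
      (g : X ⟶ ProjectiveSpaceInt.{u} 2)
      (hg : W ≤ g ⁻¹ᵁ chart 2 0) {v} (hv : Rep (t ≫ g) v) (h : ⊤ ≤ t ⁻¹ᵁ W) (α : Fin 3 → Γ(C, ⊤)) :
      (t.appLE W ⊤ h).hom (L g hg α) * v 0 = (fun d ↦ c.appTop.hom (α d)) ⬝ᵥ v := by
    rw [map_sum, Finset.sum_mul, dotProduct]
    refine Finset.sum_congr rfl fun d _ ↦ ?_
    rw [map_mul, hq _ t c htc, appLE_comp, mul_assoc]
    exact congrArg _ (hv.appLE_mul 0 _ d)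
  refine ⟨W, ∑ r, L g₁ h1 (α r) * L g₂ h2 (β r) * L g₃ h3 (γ r),
    fun x hx ↦ ⟨hb hx, h1 hx, h2 hx, h3 hx⟩, fun {T} t c htc v₁ v₂ v₃ hv₁ hv₂ hv₃ ↦
      ⟨fun u₁ u₂ u₃ x _ ↦ ⟨?_, ?_, ?_, ?_⟩, fun h ↦ ⟨?_, ?_⟩⟩⟩
  · have : b (t x) = j (c x) := by rw [← Scheme.Hom.comp_apply, htc, Scheme.Hom.comp_apply]
    exact ⟨c x, this.symm⟩
  · have : x ∈ (t ≫ g₁) ⁻¹ᵁ chart 2 0 := by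
      rw [hv₁.preimage, Scheme.basicOpen_of_isUnit _ u₁]; trivial
    exact this
  · have : x ∈ (t ≫ g₂) ⁻¹ᵁ chart 2 0 := by
      rw [hv₂.preimage, Scheme.basicOpen_of_isUnit _ u₂]; trivial
    exact this
  · have : x ∈ (t ≫ g₃) ⁻¹ᵁ chart 2 0 := by
      rw [hv₃.preimage, Scheme.basicOpen_of_isUnit _ u₃]; trivial
    exact this
  · exact ((hunit t g₁ h1 hv₁ h).mul (hunit t g₂ h2 hv₂ h)).mul (hunit t g₃ h3 hv₃ h)
  · rw [map_sum, Finset.sum_mul]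
    refine Finset.sum_congr rfl fun r _ ↦ ?_
    rw [map_mul, map_mul, ← hL t c htc g₁ h1 hv₁ h, ← hL t c htc g₂ h2 hv₂ h,
      ← hL t c htc g₃ h3 hv₃ h]
    ring

lemma dotProduct_mulVec_eq_eval₂ {A D : Type*} [CommRing A] [CommRing D] (φ : A →+* D)
    {σ τ : Type*} [Fintype σ] [Fintype τ] (α : τ → A) (M : Matrix τ σ A) (v : σ → D) :
    (fun d ↦ φ (α d)) ⬝ᵥ ((M.map φ) *ᵥ v) = (lin (α ᵥ* M)).eval₂ φ v := by
  rw [eval₂_lin, Matrix.dotProduct_mulVec]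
  congr 1
  ext i
  simp [Matrix.vecMul, dotProduct]

variable {n : ℕ} {Φ : Configuration S n} {χ : CoordOver Φ.π j}
  {M : Fin n → Matrix (Fin 3) (Fin 4) Γ(C, ⊤)}

lemma eval₂_relation {D : Type*} [CommRing D] (φ : Γ(C, ⊤) →+* D)
    (M₁ M₂ M₃ : Matrix (Fin 3) (Fin 4) Γ(C, ⊤)) (α β γ : Fin 4 → Fin 3 → Γ(C, ⊤)) (v : Fin 4 → D) :
    ∑ r, ((fun d ↦ φ (α r d)) ⬝ᵥ ((M₁.map φ) *ᵥ v)) * ((fun d ↦ φ (β r d)) ⬝ᵥ ((M₂.map φ) *ᵥ v)) *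
      ((fun d ↦ φ (γ r d)) ⬝ᵥ ((M₃.map φ) *ᵥ v)) =
    (∑ r, lin (α r ᵥ* M₁) * lin (β r ᵥ* M₂) * lin (γ r ᵥ* M₃)).eval₂ φ v := by
  rw [MvPolynomial.eval₂_sum]
  refine Finset.sum_congr rfl fun r _ ↦ ?_
  rw [MvPolynomial.eval₂_mul, MvPolynomial.eval₂_mul, dotProduct_mulVec_eq_eval₂,
    dotProduct_mulVec_eq_eval₂, dotProduct_mulVec_eq_eval₂]

/-- The components of the map of a configuration in coordinates. -/
lemma Configuration.rep_map (hM : ∀ k, IsCameraMatrix (Φ.camera k) χ (M k))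
    (y : Y ⟶ χ.Q) {v : Fin 4 → Γ(Y, ⊤)} (hv : Rep (y ≫ χ.f) v)
    (y' : Y ⟶ compl Φ.Z) (hy' : y' ≫ (compl Φ.Z).ι = y ≫ χ.i) (k : Fin n) :
    Rep ((y' ≫ Φ.map) ≫ PlanePower.proj S k ≫ ProjectiveSpace.toInt 2 S)
      (((M k).map (y ≫ χ.q).appTop.hom) *ᵥ v) := by
  refine ((hM k).rep y v hv (y' ≫ Φ.P.homOfLE (Φ.compl_Z_le k)) ?_).of_eq ?_
  · rw [Category.assoc, Scheme.homOfLE_ι, hy']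
  · rw [Category.assoc, Category.assoc, reassoc_of% Φ.map_proj k]

/-- A point at which all cameras are defined. -/
lemma Configuration.exists_lift_compl (hM : ∀ k, IsCameraMatrix (Φ.camera k) χ (M k))
    (y : Y ⟶ χ.Q) {v : Fin 4 → Γ(Y, ⊤)} (hv : Rep (y ≫ χ.f) v)
    (hu : ∀ k, IsUnit ((((M k).map (y ≫ χ.q).appTop.hom) *ᵥ v) 0)) :
    ∃ y' : Y ⟶ compl Φ.Z, y' ≫ (compl Φ.Z).ι = y ≫ χ.i := by
  have hr : Set.range (y ≫ χ.i) ⊆ Set.range (compl Φ.Z).ι := by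
    rintro _ ⟨x, rfl⟩
    rw [Scheme.Opens.range_ι]
    refine Φ.mem_compl_Z_iff.2 fun k ↦ ((hM k).mem_iff y v hv x).2 ⟨0, ?_⟩
    rw [Scheme.basicOpen_of_isUnit _ (hu k)]
    trivial
  exact ⟨IsOpenImmersion.lift (compl Φ.Z).ι (y ≫ χ.i) hr, IsOpenImmersion.lift_fac _ _ _⟩

/-- A generic point of the scheme with coordinates `χ`. -/
lemma CoordOver.exists_generic_point {P : Scheme.{u}} {π : P ⟶ S} [IsAffine C] (χ : CoordOver π j)
    {ι : Type*} [Finite ι] (r : ι → Fin 4 → Γ(C, ⊤)) (hr : ∀ k, ∃ l, IsUnit (r k l)) :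
    ∃ (E : Type u) (_ : CommRing E) (e : MvPolynomial (Fin 4) Γ(C, ⊤) →+* E)
      (y : Spec (.of E) ⟶ χ.Q), Function.Injective e ∧ (∀ k, IsUnit (e (lin (r k)))) ∧
      (y ≫ χ.q).appTop.hom = (toΓ E).comp (e.comp MvPolynomial.C) ∧
      Rep (y ≫ χ.f) fun i ↦ toΓ E (e (MvPolynomial.X i)) := by
  cases nonempty_fintype ι
  let c : MvPolynomial (Fin 4) Γ(C, ⊤) := MvPolynomial.X 0 * ∏ k, lin (r k)
  have hu := IsLocalization.Away.algebraMap_isUnit (S := Localization.Away c) c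
  rw [map_mul, map_prod] at hu
  obtain ⟨hu1, hu2⟩ := IsUnit.mul_iff.1 hu
  have hinj : Function.Injective
      (algebraMap (MvPolynomial (Fin 4) Γ(C, ⊤)) (Localization.Away c)) := by
    refine IsLocalization.injective (M := .powers c) _ (Submonoid.powers_le.2 ?_)
    refine mul_mem ?_ (prod_mem fun k _ ↦ ?_)
    · exact mem_nonZeroDivisors_iff_right.2 fun p hp ↦
        MvPolynomial.isRegular_X.right.mul_right_eq_zero_iff.1 hp
    · obtain ⟨l, hl⟩ := hr k
      exact lin_mem_nonZeroDivisors hl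
  obtain ⟨y, hy, hy'⟩ := χ.isCoord.exists_spec_point_of_isUnit
    ((algebraMap (MvPolynomial (Fin 4) Γ(C, ⊤)) (Localization.Away c)).comp MvPolynomial.C)
    (fun i ↦ algebraMap _ (Localization.Away c) (MvPolynomial.X i)) (l := 0) hu1
  refine ⟨_, inferInstance, _, y, hinj, fun k ↦ ?_, hy, hy'⟩
  exact (IsUnit.prod_univ_iff.1 hu2) k

lemma eval₂_generic {A E : Type u} [CommRing A] [CommRing E] (e : MvPolynomial (Fin 4) A →+* E)
    (G : MvPolynomial (Fin 4) A) :
    G.eval₂ ((toΓ E).comp (e.comp MvPolynomial.C)) (fun i ↦ toΓ E (e (MvPolynomial.X i))) =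
      toΓ E (e G) := by
  rw [eval₂_toΓ, MvPolynomial.eval₂_eta]

lemma mulVec_eq_eval₂ {A D : Type*} [CommRing A] [CommRing D] (φ : A →+* D)
    {σ τ : Type*} [Fintype σ] (M : Matrix τ σ A) (v : σ → D) (a : τ) :
    ((M.map φ) *ᵥ v) a = (lin (M a)).eval₂ φ v := (eval₂_lin φ (M a) v).symm

/-- Trilinear relations between the cameras of a configuration are determined by its
multiview scheme. -/
theorem relation_of_multiviewScheme_eq {Φ' : Configuration S n}
    (h : Φ.multiviewScheme = Φ'.multiviewScheme) [IsAffine C] [IsOpenImmersion j]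
    (hM : ∀ k, IsCameraMatrix (Φ.camera k) χ (M k)) {χ' : CoordOver Φ'.π j}
    {N : Fin n → Matrix (Fin 3) (Fin 4) Γ(C, ⊤)}
    (hN : ∀ k, IsCameraMatrix (Φ'.camera k) χ' (N k)) (hu : ∀ k, ∃ l, IsUnit (N k 0 l))
    (i₁ i₂ i₃ : Fin n) (α β γ : Fin 4 → Fin 3 → Γ(C, ⊤))
    (hrel : ∑ r, lin (α r ᵥ* M i₁) * lin (β r ᵥ* M i₂) * lin (γ r ᵥ* M i₃) = 0) :
    ∑ r, lin (α r ᵥ* N i₁) * lin (β r ᵥ* N i₂) * lin (γ r ᵥ* N i₃) = 0 := by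
  obtain ⟨W, F, hW, hF⟩ := exists_test_function (j := j) (PlanePower.toBase S n)
    (PlanePower.proj S i₁ ≫ ProjectiveSpace.toInt 2 S)
    (PlanePower.proj S i₂ ≫ ProjectiveSpace.toInt 2 S)
    (PlanePower.proj S i₃ ≫ ProjectiveSpace.toInt 2 S) α β γ
  -- Locally on the source of `Φ` the test function is the relation between the matrices `M` divided
  -- by a unit, hence zero. It then vanishes on the image of `Φ'` as well.
  have key {T : Scheme.{u}} (t : T ⟶ compl Φ'.Z) (ht : ⊤ ≤ (t ≫ Φ'.map) ⁻¹ᵁ W) :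
      ((t ≫ Φ'.map).appLE W ⊤ ht).hom F = 0 := by
    refine appLE_eq_zero_of_ker_eq h F (fun x hx ↦ ?_) t ht
    obtain ⟨⟨c, hc⟩, -⟩ := hW _ hx
    have hc' : j c = Φ.π x.1 := by
      rw [hc, ← Scheme.Hom.comp_apply, Φ.map_toBase]
      rfl
    obtain ⟨z, hz, -⟩ := Scheme.Pullback.exists_preimage_pullback x.1 c hc'.symm
    let p : χ.Q := χ.isPullback.isoPullback.inv z
    have hp : χ.i p = x.1 := by
      rw [← hz, ← Scheme.Hom.comp_apply, IsPullback.isoPullback_inv_fst]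
    have hio : IsOpenImmersion χ.i := MorphismProperty.of_isPullback χ.isPullback.flip inferInstance
    obtain ⟨U, hpU, v, hv⟩ := exists_local_rep χ.f p
    let O₀ : Φ.P.Opens := χ.i ''ᵁ U
    let O : (compl Φ.Z : Scheme.{u}).Opens := (compl Φ.Z).ι ⁻¹ᵁ O₀ ⊓ Φ.map ⁻¹ᵁ W
    have hr : Set.range (O.ι ≫ (compl Φ.Z).ι) ⊆ Set.range (U.ι ≫ χ.i) := by
      rintro _ ⟨a, rfl⟩
      obtain ⟨w, hw, hw'⟩ := a.2.1
      exact ⟨⟨w, hw⟩, hw'⟩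
    let y₀ := IsOpenImmersion.lift (U.ι ≫ χ.i) (O.ι ≫ (compl Φ.Z).ι) hr
    have hy₀ : y₀ ≫ U.ι ≫ χ.i = O.ι ≫ (compl Φ.Z).ι := IsOpenImmersion.lift_fac _ _ _
    have hv' : Rep ((y₀ ≫ U.ι) ≫ χ.f) fun i ↦ y₀.appTop.hom (v i) :=
      (hv.comp y₀).of_eq (Category.assoc _ _ _).symm
    have hO : ⊤ ≤ (O.ι ≫ Φ.map) ⁻¹ᵁ W := fun a _ ↦ a.2.2
    have hrep := Φ.rep_map hM (y₀ ≫ U.ι) hv' O.ι (by rw [Category.assoc, hy₀])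
    obtain ⟨-, h2⟩ := hF (O.ι ≫ Φ.map) ((y₀ ≫ U.ι) ≫ χ.q) (by
      rw [Category.assoc, Φ.map_toBase, ← reassoc_of% hy₀, χ.isPullback.w]
      simp only [Category.assoc]) _ _ _ (hrep i₁) (hrep i₂) (hrep i₃)
    obtain ⟨h3, h4⟩ := h2 hO
    refine ⟨O, hO, ⟨⟨p, hpU, hp⟩, hx⟩, ?_⟩
    rw [eval₂_relation, hrel, MvPolynomial.eval₂_zero] at h4
    exact h3.mul_left_eq_zero.1 h4
  -- At a point where the first coordinates of all images are units the test function is defined for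
  -- `Φ'`. Polynomials inject into the ring of this point, because a linear form with a unit
  -- coefficient is regular.
  obtain ⟨E, _, e, y, he, heu, hy, hv⟩ := χ'.exists_generic_point (fun k ↦ N k 0) hu
  have hu' (k) : IsUnit ((((N k).map (y ≫ χ'.q).appTop.hom) *ᵥ
      fun i ↦ toΓ E (e (MvPolynomial.X i))) 0) := by
    rw [mulVec_eq_eval₂, hy, eval₂_generic]
    exact (heu k).map _
  obtain ⟨y', hy'⟩ := Φ'.exists_lift_compl hN y hv hu'
  have hrep := Φ'.rep_map hN y hv y' hy'
  obtain ⟨h1, h2⟩ := hF (y' ≫ Φ'.map) (y ≫ χ'.q) (by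
    rw [Category.assoc, Φ'.map_toBase, reassoc_of% hy', χ'.isPullback.w, Category.assoc])
    _ _ _ (hrep i₁) (hrep i₂) (hrep i₃)
  have ht := h1 (hu' _) (hu' _) (hu' _)
  obtain ⟨-, h4⟩ := h2 ht
  rw [key, zero_mul, eval₂_relation, hy, eval₂_generic] at h4
  exact he (toΓ_injective E (by rw [← h4, map_zero, map_zero]))

end Relations

/-! ### Local isomorphisms between configurations with equal multiview schemes. -/

section LocalIsomorphisms

open Matrix

variable {S C X Y : Scheme.{u}} {n : ℕ} {j : C ⟶ S}

lemma exists_isUnit_restrict [IsAffine C] {x : C} {a : Γ(C, ⊤)} (hx : x ∈ C.basicOpen a) :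
    ∃ (C' : Scheme.{u}) (r : C' ⟶ C), IsAffine C' ∧ IsOpenImmersion r ∧ x ∈ Set.range r ∧
      IsUnit (r.appTop.hom a) := by
  refine ⟨C.basicOpen a, (C.basicOpen a).ι, (isAffineOpen_top C).basicOpen a, inferInstance,
    ⟨⟨x, hx⟩, rfl⟩, isUnit_of_basicOpen_eq_top ?_⟩
  rw [basicOpen_appTop]
  exact top_le_iff.1 fun x _ ↦ x.2

section Linear

variable {P₁ P₂ : Scheme.{u}} {π₁ : P₁ ⟶ S} {π₂ : P₂ ⟶ S}

lemma CoordOver.exists_linear_hom (χ₁ : CoordOver π₁ j) (χ₂ : CoordOver π₂ j)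
    {T : Matrix (Fin 4) (Fin 4) Γ(C, ⊤)} (hT : IsUnit T.det) :
    ∃ e : χ₁.Q ⟶ χ₂.Q, e ≫ χ₂.q = χ₁.q ∧ ∀ {Y : Scheme.{u}} (y : Y ⟶ χ₁.Q) v,
      Rep (y ≫ χ₁.f) v → Rep ((y ≫ e) ≫ χ₂.f) ((T.map (y ≫ χ₁.q).appTop.hom) *ᵥ v) := by
  obtain ⟨g, hg⟩ := exists_smul χ₁.f (T.map χ₁.q.appTop.hom) (isUnit_det_map hT _)
  obtain ⟨e, he, he'⟩ := χ₂.isCoord.exists_hom χ₁.q g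
  refine ⟨e, he, fun y v hv ↦ ?_⟩
  have := hg y v hv
  rw [map_map_appTop] at this
  exact this.of_eq (by rw [Category.assoc, he'])

lemma CoordOver.eq_id (χ : CoordOver π₁ j) {θ : χ.Q ⟶ χ.Q} (hθ : θ ≫ χ.q = χ.q)
    (h : ∀ {Y : Scheme.{u}} (y : Y ⟶ χ.Q) v, Rep (y ≫ χ.f) v → Rep ((y ≫ θ) ≫ χ.f) v) :
    θ = 𝟙 χ.Q := by
  refine χ.isCoord.isPullback.hom_ext (by rw [hθ, Category.id_comp]) ?_
  refine hom_ext_of_local fun x ↦ ?_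
  obtain ⟨U, hxU, v, hv⟩ := exists_local_rep χ.f x
  refine ⟨U, hxU, ?_⟩
  rw [Category.id_comp]
  have := h U.ι v hv
  rw [Category.assoc] at this
  exact this.ext hv

lemma CoordOver.exists_linear_iso (χ₁ : CoordOver π₁ j) (χ₂ : CoordOver π₂ j)
    {T : Matrix (Fin 4) (Fin 4) Γ(C, ⊤)} (hT : IsUnit T.det) :
    ∃ e : χ₁.Q ≅ χ₂.Q, e.hom ≫ χ₂.q = χ₁.q ∧ e.inv ≫ χ₁.q = χ₂.q ∧
      (∀ {Y : Scheme.{u}} (y : Y ⟶ χ₁.Q) v,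
        Rep (y ≫ χ₁.f) v → Rep ((y ≫ e.hom) ≫ χ₂.f) ((T.map (y ≫ χ₁.q).appTop.hom) *ᵥ v)) ∧
      ∀ {Y : Scheme.{u}} (y : Y ⟶ χ₂.Q) v,
        Rep (y ≫ χ₂.f) v → Rep ((y ≫ e.inv) ≫ χ₁.f) ((T⁻¹.map (y ≫ χ₂.q).appTop.hom) *ᵥ v) := by
  obtain ⟨e, he, he'⟩ := χ₁.exists_linear_hom χ₂ hT
  obtain ⟨d, hd, hd'⟩ := χ₂.exists_linear_hom χ₁ (Matrix.isUnit_nonsing_inv_det_iff.2 hT)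
  refine ⟨⟨e, d, χ₁.eq_id (by rw [Category.assoc, hd, he]) fun y v hv ↦ ?_,
    χ₂.eq_id (by rw [Category.assoc, he, hd]) fun y v hv ↦ ?_⟩, he, hd, he', hd'⟩
  · have := hd' _ _ (he' y v hv)
    rw [Category.assoc y e χ₂.q, he, Matrix.mulVec_mulVec, ← Matrix.map_mul,
      Matrix.nonsing_inv_mul _ hT, Matrix.map_one _ (map_zero _) (map_one _),
      Matrix.one_mulVec] at this
    rwa [← Category.assoc y e d]
  · have := he' _ _ (hd' y v hv)
    rw [Category.assoc y d χ₁.q, hd, Matrix.mulVec_mulVec, ← Matrix.map_mul,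
      Matrix.mul_nonsing_inv _ hT, Matrix.map_one _ (map_zero _) (map_one _),
      Matrix.one_mulVec] at this
    rwa [← Category.assoc y d e]

end Linear

/-- The map sending `i` to `e` is compatible with the cameras of the configurations. -/
structure PreservesCameras (Φ₁ Φ₂ : Configuration S n) {R : Scheme.{u}} (i : R ⟶ Φ₁.P)
    (e : R ⟶ Φ₂.P) : Prop where
  comp_π : i ≫ Φ₁.π = e ≫ Φ₂.π
  exists_lift : ∀ k {Y : Scheme.{u}} (y : Y ⟶ R) (y₁ : Y ⟶ compl (Φ₁.camera k).Z),
    y₁ ≫ (compl (Φ₁.camera k).Z).ι = y ≫ i → ∃ y₂ : Y ⟶ compl (Φ₂.camera k).Z,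
      y₂ ≫ (compl (Φ₂.camera k).Z).ι = y ≫ e ∧ y₁ ≫ (Φ₁.camera k).map = y₂ ≫ (Φ₂.camera k).map

namespace PreservesCameras

variable {Φ₁ Φ₂ Φ₃ : Configuration S n} {R : Scheme.{u}} {i : R ⟶ Φ₁.P} {e : R ⟶ Φ₂.P}

lemma comp (h : PreservesCameras Φ₁ Φ₂ i e) {R' : Scheme.{u}} (r : R' ⟶ R) :
    PreservesCameras Φ₁ Φ₂ (r ≫ i) (r ≫ e) where
  comp_π := by rw [Category.assoc, h.comp_π, Category.assoc]
  exists_lift k Y y y₁ hy := by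
    obtain ⟨y₂, h1, h2⟩ := h.exists_lift k (y ≫ r) y₁ (by rw [hy, Category.assoc])
    exact ⟨y₂, by rw [h1, Category.assoc], h2⟩

lemma trans (h : PreservesCameras Φ₁ Φ₂ i e) {d : R ⟶ Φ₃.P} (h' : PreservesCameras Φ₂ Φ₃ e d) :
    PreservesCameras Φ₁ Φ₃ i d where
  comp_π := h.comp_π.trans h'.comp_π
  exists_lift k Y y y₁ hy := by
    obtain ⟨y₂, h1, h2⟩ := h.exists_lift k y y₁ hy
    obtain ⟨y₃, h3, h4⟩ := h'.exists_lift k y y₂ h1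
    exact ⟨y₃, h3, h2.trans h4⟩

lemma of_local (h : ∀ x : R, ∃ (R' : Scheme.{u}) (r : R' ⟶ R), IsOpenImmersion r ∧
    x ∈ Set.range r ∧ PreservesCameras Φ₁ Φ₂ (r ≫ i) (r ≫ e)) : PreservesCameras Φ₁ Φ₂ i e where
  comp_π := hom_ext_of_local fun x ↦ by
    obtain ⟨R', r, hr, hx, hp⟩ := h x
    refine ⟨r.opensRange, hx, ?_⟩
    have h1 := IsOpenImmersion.lift_fac r r.opensRange.ι (by simp)
    have h2 := hp.comp_π
    simp only [Category.assoc] at h2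
    rw [← h1, Category.assoc, h2, Category.assoc]
  exists_lift k Y y y₁ hy := by
    have key (x : Y) : ∃ V : Y.Opens, x ∈ V ∧ ∃ y₂ : (V : Scheme.{u}) ⟶ compl (Φ₂.camera k).Z,
        y₂ ≫ (compl (Φ₂.camera k).Z).ι = V.ι ≫ y ≫ e ∧
        V.ι ≫ y₁ ≫ (Φ₁.camera k).map = y₂ ≫ (Φ₂.camera k).map := by
      obtain ⟨R', r, hr, hx, hp⟩ := h (y x)
      have hV : Set.range ((y ⁻¹ᵁ r.opensRange).ι ≫ y) ⊆ Set.range r := by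
        rintro _ ⟨x, rfl⟩
        exact x.2
      have h1 := IsOpenImmersion.lift_fac r _ hV
      obtain ⟨y₂, h2, h3⟩ := hp.exists_lift k (IsOpenImmersion.lift r _ hV)
        ((y ⁻¹ᵁ r.opensRange).ι ≫ y₁) (by rw [Category.assoc, hy, reassoc_of% h1])
      refine ⟨y ⁻¹ᵁ r.opensRange, hx, y₂, by rw [h2, reassoc_of% h1], ?_⟩
      rw [← h3, Category.assoc]
    have hr : Set.range (y ≫ e) ⊆ Set.range (compl (Φ₂.camera k).Z).ι := by
      rintro _ ⟨x, rfl⟩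
      obtain ⟨V, hxV, y₂, h1, -⟩ := key x
      have h2 := congr($h1 (⟨x, hxV⟩ : (V : Scheme.{u})))
      exact ⟨y₂ ⟨x, hxV⟩, h2⟩
    have h1 := IsOpenImmersion.lift_fac _ _ hr
    refine ⟨_, h1, hom_ext_of_local fun x ↦ ?_⟩
    obtain ⟨V, hxV, y₂, h2, h3⟩ := key x
    refine ⟨V, hxV, ?_⟩
    have h4 : V.ι ≫ IsOpenImmersion.lift _ _ hr = y₂ := by
      rw [← cancel_mono (compl (Φ₂.camera k).Z).ι, Category.assoc, h1, h2]
    rw [h3, ← h4, Category.assoc]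

end PreservesCameras

lemma ProjectiveSpace.hom_ext {m : ℕ} {f g : X ⟶ ProjectiveSpace m S}
    (h : f ≫ ProjectiveSpace.toBase m S = g ≫ ProjectiveSpace.toBase m S)
    (h' : f ≫ ProjectiveSpace.toInt m S = g ≫ ProjectiveSpace.toInt m S) : f = g :=
  pullback.hom_ext h h'

variable {Φ₁ Φ₂ : Configuration S n}

/-- A morphism which is given by a matrix compatible with the matrices of the cameras. -/
lemma preservesCameras_of_linear {χ₁ : CoordOver Φ₁.π j} {χ₂ : CoordOver Φ₂.π j}
    {M N : Fin n → Matrix (Fin 3) (Fin 4) Γ(C, ⊤)}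
    (hM : ∀ k, IsCameraMatrix (Φ₁.camera k) χ₁ (M k))
    (hN : ∀ k, IsCameraMatrix (Φ₂.camera k) χ₂ (N k)) {T : Matrix (Fin 4) (Fin 4) Γ(C, ⊤)}
    (hT : ∀ k, ∃ a : Γ(C, ⊤), IsUnit a ∧ N k * T = a • M k) {e : χ₁.Q ⟶ χ₂.Q} (he : e ≫ χ₂.q = χ₁.q)
    (her : ∀ {Y : Scheme.{u}} (y : Y ⟶ χ₁.Q) v, Rep (y ≫ χ₁.f) v →
      Rep ((y ≫ e) ≫ χ₂.f) ((T.map (y ≫ χ₁.q).appTop.hom) *ᵥ v)) :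
    PreservesCameras Φ₁ Φ₂ χ₁.i (e ≫ χ₂.i) := by
  have hπ : χ₁.i ≫ Φ₁.π = (e ≫ χ₂.i) ≫ Φ₂.π := by
    rw [Category.assoc, χ₂.isPullback.w, reassoc_of% he, χ₁.isPullback.w]
  refine .of_local fun x ↦ ?_
  obtain ⟨U, hxU, v, hv⟩ := exists_local_rep χ₁.f x
  refine ⟨U, U.ι, inferInstance, ⟨⟨x, hxU⟩, rfl⟩, ?_, fun k Y y y₁ hy₁ ↦ ?_⟩
  · rw [Category.assoc, Category.assoc, hπ]
  obtain ⟨a, ha, haT⟩ := hT k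
  have hw : Rep ((y ≫ U.ι) ≫ χ₁.f) fun i ↦ y.appTop.hom (v i) :=
    (hv.comp y).of_eq (Category.assoc _ _ _).symm
  have hw' := her _ _ hw
  set w := fun i ↦ y.appTop.hom (v i)
  have hq : ((y ≫ U.ι) ≫ e) ≫ χ₂.q = (y ≫ U.ι) ≫ χ₁.q := by rw [Category.assoc, he]
  obtain ⟨φ, hφ⟩ : ∃ φ, φ = ((y ≫ U.ι) ≫ χ₁.q).appTop.hom := ⟨_, rfl⟩
  -- The coordinates of the two images differ by the unit `φ a`, so the images and their domains of
  -- definition agree.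
  have hmat : ((N k).map φ) *ᵥ ((T.map φ) *ᵥ w) = φ a • ((M k).map φ) *ᵥ w := by
    rw [Matrix.mulVec_mulVec, ← Matrix.map_mul, haT, ← Matrix.smul_mulVec]
    congr 1
    ext
    exact map_mul φ _ _
  have h1 := (hM k).mem_iff _ _ hw
  have h2 := (hN k).mem_iff _ _ hw'
  rw [hq, ← hφ] at h2
  rw [hmat] at h2
  rw [← hφ] at h1
  have hr : Set.range (((y ≫ U.ι) ≫ e) ≫ χ₂.i) ⊆ Set.range (compl (Φ₂.camera k).Z).ι := by
    rintro _ ⟨x, rfl⟩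
    rw [Scheme.Opens.range_ι]
    refine (h2 x).2 ?_
    obtain ⟨d, hd⟩ := (h1 x).1 (by
      rw [Category.assoc, ← hy₁]
      exact (y₁ x).2)
    refine ⟨d, ?_⟩
    rw [Pi.smul_apply, smul_eq_mul, Scheme.basicOpen_mul, Scheme.basicOpen_of_isUnit _ (ha.map φ)]
    exact ⟨trivial, hd⟩
  have hl := IsOpenImmersion.lift_fac _ _ hr
  refine ⟨_, hl.trans (by simp only [Category.assoc]), ProjectiveSpace.hom_ext ?_ ?_⟩
  · rw [Category.assoc, Category.assoc, (Φ₁.camera k).map_toBase, (Φ₂.camera k).map_toBase]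
    refine (Category.assoc _ _ _).symm.trans (congr($hy₁ ≫ Φ₁.π).trans
      (Eq.trans ?_ (congr($hl ≫ Φ₂.π).symm.trans (Category.assoc _ _ _))))
    rw [Category.assoc, Category.assoc, hπ]
    simp only [Category.assoc]
  · have h3 := (hM k).rep _ _ hw y₁ (by rw [hy₁, Category.assoc])
    have h4 := (hN k).rep _ _ hw' _ hl
    rw [hq, ← hφ, hmat] at h4
    rw [← hφ] at h3
    rw [Category.assoc, Category.assoc]
    obtain ⟨c, hc⟩ := (ha.map φ).exists_left_inv
    have h5 := h4.of_smul (IsUnit.of_mul_eq_one _ hc)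
    rw [smul_smul, hc, one_smul] at h5
    exact h3.ext h5

/-- Local isomorphisms of configurations with the same multiview scheme. -/
theorem exists_local_iso (hn : 2 ≤ n) (h₁ : Φ₁.IsGeneral) (h₂ : Φ₂.IsGeneral)
    (h : Φ₁.multiviewScheme = Φ₂.multiviewScheme) (b : S) :
    ∃ (C : Scheme.{u}) (j : C ⟶ S) (R : Scheme.{u}) (i : R ⟶ Φ₁.P) (e : R ⟶ Φ₂.P) (q : R ⟶ C),
      IsOpenImmersion j ∧ b ∈ Set.range j ∧ IsPullback i q Φ₁.π j ∧ IsPullback e q Φ₂.π j ∧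
      PreservesCameras Φ₁ Φ₂ i e ∧ PreservesCameras Φ₂ Φ₁ e i := by
  let p (Φ : Configuration S n) (C : Scheme.{u}) (j : C ⟶ S) : Prop := ∃ (χ : CoordOver Φ.π j)
    (M : Fin n → Matrix (Fin 3) (Fin 4) Γ(C, ⊤)), ∀ k, IsCameraMatrix (Φ.camera k) χ (M k)
  obtain ⟨C, j, hC, hj, ⟨x, rfl⟩, hp⟩ := exists_common b (fun k : Bool ↦ p (k.rec Φ₁ Φ₂))
    (fun k C C' j r ⟨χ, M, hM⟩ ↦ ⟨χ.restrict r, _, fun k ↦ (hM k).restrict r⟩)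
    (fun k ↦ exists_matrices (by omega) _ b)
  obtain ⟨χ₁, M, hM⟩ : p Φ₁ C j := hp false
  obtain ⟨χ₂, N, hN⟩ : p Φ₂ C j := hp true
  obtain ⟨D, _, s, φ, -, -, hφ⟩ := exists_field_point x
  -- The first row of each `N k` is nonzero at the point. Making one entry a unit provides the point
  -- used in `relation_of_multiviewScheme_eq`.
  have hl (k) : ∃ l, φ (N k 0 l) ≠ 0 := by
    by_contra! hl
    exact ((hN k).linearIndependent φ).ne_zero 0 (funext hl)
  choose l hl using hl
  obtain ⟨C', r, hC', hr, ⟨x', rfl⟩, hu⟩ := exists_isUnit_restrict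
    (x := x) (a := ∏ k, N k 0 (l k)) ((hφ _).2 (by
      rw [map_prod]; exact Finset.prod_ne_zero_iff.2 fun k _ ↦ hl k))
  rw [map_prod, IsUnit.prod_univ_iff] at hu
  replace hM (k) := (hM k).restrict r
  replace hN (k) := (hN k).restrict r
  obtain ⟨D, _, s, φ, -, -, hφ⟩ := exists_field_point x'
  -- Of the disjointness of the centers, only that of the first two cameras is needed.
  have hd : (⟨0, by omega⟩ : Fin n) ≠ ⟨1, by omega⟩ := by simp
  obtain ⟨T, a, hT, haT⟩ := exists_substitution_of_field φ
    (fun k ↦ (hM k).linearIndependent φ) (fun k ↦ (hN k).linearIndependent φ)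
    ((hM _).eq_zero_of_mulVec (hM _) (h₁ _ _ hd) φ)
    ((hN _).eq_zero_of_mulVec (hN _) (h₂ _ _ hd) φ)
    (fun k α β γ ↦ relation_of_multiviewScheme_eq h hM hN (fun k ↦ ⟨l k, hu k⟩) _ _ k α β γ)
  -- Shrink the base once more, so that the determinant and all scalars become units.
  obtain ⟨C'', r', hC'', hr', ⟨x'', rfl⟩, hu'⟩ := exists_isUnit_restrict
    (x := x') (a := T.det * ∏ k, a k) ((hφ _).2 (by
      rw [map_mul, map_prod]
      exact mul_ne_zero hT (Finset.prod_ne_zero_iff.2 fun k _ ↦ (haT k).1)))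
  rw [map_mul, IsUnit.mul_iff, map_prod, IsUnit.prod_univ_iff] at hu'
  replace hM (k) := (hM k).restrict r'
  replace hN (k) := (hN k).restrict r'
  obtain ⟨T', hTd⟩ : ∃ T', T' = T.map r'.appTop.hom := ⟨_, rfl⟩
  have hT' : IsUnit T'.det := by
    have h1 : r'.appTop.hom T.det = T'.det := by rw [hTd]; exact RingHom.map_det _ _
    rw [← h1]
    exact hu'.1
  obtain ⟨e, he, he', her, her'⟩ :=
    ((χ₁.restrict r).restrict r').exists_linear_iso ((χ₂.restrict r).restrict r') hT'
  have hTk (k) : ((N k).map r.appTop.hom).map r'.appTop.hom * T' =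
      r'.appTop.hom (a k) • ((M k).map r.appTop.hom).map r'.appTop.hom := by
    rw [hTd, ← Matrix.map_mul, (haT k).2]
    ext
    exact map_mul r'.appTop.hom _ _
  have g1 := preservesCameras_of_linear hM hN (fun k ↦ ⟨_, hu'.2 k, hTk k⟩) he her
  have g2 := preservesCameras_of_linear hN hM (T := T'⁻¹) (fun k ↦ by
    obtain ⟨c, hc⟩ := (hu'.2 k).exists_left_inv
    refine ⟨c, IsUnit.of_mul_eq_one _ hc, ?_⟩
    have h1 := congr(c • ($(hTk k) * T'⁻¹))
    rw [Matrix.mul_assoc, Matrix.mul_nonsing_inv _ hT', Matrix.mul_one, Matrix.smul_mul, smul_smul,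
      hc, one_smul] at h1
    exact h1.symm) he' her'
  refine ⟨C'', r' ≫ r ≫ j, _, _, _, _, inferInstance, ⟨x'', rfl⟩,
    ((χ₁.restrict r).restrict r').isPullback, ?_, g1, ?_⟩
  · have h1 : IsPullback e.hom ((χ₁.restrict r).restrict r').q ((χ₂.restrict r).restrict r').q
      (𝟙 C'') := IsPullback.of_horiz_isIso ⟨by rw [he, Category.comp_id]⟩
    have h2 := h1.paste_horiz ((χ₂.restrict r).restrict r').isPullback
    rwa [Category.id_comp] at h2
  · have h1 := g2.comp e.hom
    rwa [e.hom_inv_id_assoc] at h1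

end LocalIsomorphisms

/-! ### Automorphisms of a general configuration are trivial. -/

section Rigidity

open Matrix

variable {S C : Scheme.{u}} {n : ℕ} {j : C ⟶ S} {Φ : Configuration S n} {χ : CoordOver Φ.π j}

lemma eq_zero_of_forall_exists_mul_eq_zero {X : Scheme.{u}} {a : Γ(X, ⊤)}
    (h : ∀ x : X, ∃ s : Γ(X, ⊤), x ∈ X.basicOpen s ∧ s * a = 0) : a = 0 := by
  refine ext_of_local _ _ fun x _ ↦ ?_
  obtain ⟨s, hx, hs⟩ := h x
  refine ⟨X.basicOpen s, le_top, hx, ?_⟩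
  have h1 := congr(rs (le_top : X.basicOpen s ≤ ⊤) $hs)
  rw [map_mul, map_zero] at h1
  rw [map_zero]
  exact (isUnit_rs_basicOpen s le_rfl).mul_right_eq_zero.1 h1

/-- Preserving the cameras makes `M k * T` and `M k` proportional as vectors of linear forms. For
two cameras with disjoint centers this forces `T` to be a scalar, which acts trivially on projective
space. -/
lemma eq_id_of_linear [IsAffine C] (hn : 2 ≤ n) (hΦ : Φ.IsGeneral)
    {M : Fin n → Matrix (Fin 3) (Fin 4) Γ(C, ⊤)} (hM : ∀ k, IsCameraMatrix (Φ.camera k) χ (M k))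
    (hu : ∀ k, ∃ l, IsUnit (M k 0 l)) {θ : χ.Q ⟶ χ.Q} (hθ : θ ≫ χ.q = χ.q)
    (hp : PreservesCameras Φ Φ χ.i (θ ≫ χ.i)) {T : Matrix (Fin 4) (Fin 4) Γ(C, ⊤)}
    (hT : IsUnit T.det) (hTθ : ∀ {Y : Scheme.{u}} (y : Y ⟶ χ.Q) v, Rep (y ≫ χ.f) v →
      Rep ((y ≫ θ) ≫ χ.f) ((T.map (y ≫ χ.q).appTop.hom) *ᵥ v)) : θ = 𝟙 χ.Q := by
  have hsym (k : Fin n) (d e) : lin ((M k * (1 : Matrix (Fin 4) (Fin 4) Γ(C, ⊤))) d) * lin ((M k * T) e) =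
      lin ((M k * (1 : Matrix (Fin 4) (Fin 4) Γ(C, ⊤))) e) * lin ((M k * T) d) := by
    obtain ⟨E, _, ε, y, hε, hεu, hy, hv⟩ := χ.exists_generic_point (fun k ↦ M k 0) hu
    have hu' (k) : IsUnit ((((M k).map (y ≫ χ.q).appTop.hom) *ᵥ
        fun i ↦ toΓ E (ε (MvPolynomial.X i))) 0) := by
      rw [mulVec_eq_eval₂, hy, eval₂_generic]
      exact (hεu k).map _
    obtain ⟨y', hy'⟩ := Φ.exists_lift_compl hM y hv hu'
    have hy₁ : (y' ≫ Φ.P.homOfLE (Φ.compl_Z_le k)) ≫ (compl (Φ.camera k).Z).ι = y ≫ χ.i := by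
      rw [Category.assoc, Scheme.homOfLE_ι, hy']
    obtain ⟨y₂, hy₂, h12⟩ := hp.exists_lift k y _ hy₁
    have r1 := (hM k).rep y _ hv _ hy₁
    have r2 := (hM k).rep (y ≫ θ) _ (hTθ y _ hv) y₂ (by rw [hy₂, Category.assoc])
    have hq : (y ≫ θ) ≫ χ.q = y ≫ χ.q := by rw [Category.assoc, hθ]
    rw [hq, Matrix.mulVec_mulVec, ← Matrix.map_mul] at r2
    have r3 := r1.mul_eq (r2.of_eq (by rw [← Category.assoc, ← h12, Category.assoc])) d e
    rw [mulVec_eq_eval₂, mulVec_eq_eval₂, mulVec_eq_eval₂, mulVec_eq_eval₂, hy, eval₂_generic,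
      eval₂_generic, eval₂_generic, eval₂_generic, ← map_mul, ← map_mul, ← map_mul, ← map_mul] at r3
    rw [Matrix.mul_one]
    exact hε (toΓ_injective E r3)
  -- Near each point some multiple `s • T` with `s` invertible there equals `a • 1`. Then `s * T 0 0
  -- = a`, so the local scalars are all given by the global function `T 0 0`.
  have hTs : T = T 0 0 • 1 := by
    ext i l
    rw [← sub_eq_zero]
    refine eq_zero_of_forall_exists_mul_eq_zero fun x ↦ ?_
    obtain ⟨D, _, s, φ, -, -, hφ⟩ := exists_field_point x
    have hd : (⟨0, by omega⟩ : Fin n) ≠ ⟨1, by omega⟩ := by simp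
    obtain ⟨s, a, hs, -, hsa⟩ := exists_smul_eq_of_symmetric φ ((hM _).linearIndependent φ)
      ((hM _).linearIndependent φ) ((hM _).eq_zero_of_mulVec (hM _) (hΦ _ _ hd) φ)
      (T := 1) (T' := T) (by rw [Matrix.det_one, map_one]; exact one_ne_zero) (hT.map φ).ne_zero
      (hsym _) (hsym _)
    refine ⟨s, (hφ s).2 hs, ?_⟩
    have h0 : s * T 0 0 = a := by
      have := congr_fun (congr_fun hsa 0) 0
      rwa [Matrix.smul_apply, Matrix.smul_apply, Matrix.one_apply_eq, smul_eq_mul, smul_eq_mul,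
        mul_one] at this
    have h1 : s * T i l = a * (1 : Matrix (Fin 4) (Fin 4) Γ(C, ⊤)) i l :=
      congr_fun (congr_fun hsa i) l
    rw [Matrix.smul_apply, smul_eq_mul, mul_sub, h1, ← mul_assoc, h0, sub_self]
  refine χ.eq_id hθ fun {Y} y v hv ↦ ?_
  have h1 := hTθ y v hv
  rw [hTs] at h1
  refine h1.of_mul_eq (fun i l ↦ ?_) hv.exists_mem
  obtain ⟨ψ, hψ⟩ : ∃ ψ, ψ = (y ≫ χ.q).appTop.hom := ⟨_, rfl⟩
  have h2 : ((T 0 0 • (1 : Matrix (Fin 4) (Fin 4) Γ(C, ⊤))).map ψ) *ᵥ v = ψ (T 0 0) • v := by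
    have : (T 0 0 • (1 : Matrix (Fin 4) (Fin 4) Γ(C, ⊤))).map ψ = ψ (T 0 0) • 1 := by
      ext i l
      simp only [Matrix.map_apply, Matrix.smul_apply, Matrix.one_apply, smul_eq_mul]
      split_ifs <;> simp
    rw [this, Matrix.smul_mulVec, Matrix.one_mulVec]
  rw [← hψ, h2]
  simp only [Pi.smul_apply, smul_eq_mul]
  ring

/-- The square `hθ` expresses that `θ` is an automorphism over `C`, a form that is stable under
restriction of the base. -/
lemma CoordOver.eq_id_of_restrict {P : Scheme.{u}} {π : P ⟶ S} (χ : CoordOver π j) {θ : χ.Q ⟶ χ.Q}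
    (hθ : IsPullback θ χ.q χ.q (𝟙 C))
    (h : ∀ x : C, ∃ (C' : Scheme.{u}) (r : C' ⟶ C), IsOpenImmersion r ∧ x ∈ Set.range r ∧
      ∀ θ' : (χ.restrict r).Q ⟶ (χ.restrict r).Q,
        IsPullback θ' (χ.restrict r).q (χ.restrict r).q (𝟙 C') →
        θ' ≫ χ.proj r = χ.proj r ≫ θ → θ' = 𝟙 _) : θ = 𝟙 χ.Q := by
  refine hom_ext_of_local fun x ↦ ?_
  obtain ⟨C', r, hr, hx, h⟩ := h (χ.q x)
  have hb := χ.isPullback_proj r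
  have hw : (χ.proj r ≫ θ) ≫ χ.q = (χ.restrict r).q ≫ r := by
    rw [Category.assoc, hθ.w, Category.comp_id, hb.w]
  have h1 := hb.lift_fst _ _ hw
  have h2 := hb.lift_snd _ _ hw
  have h3 : IsPullback (hb.lift _ _ hw) (χ.restrict r).q (χ.restrict r).q (𝟙 C') := by
    refine IsPullback.of_right ?_ (by rw [h2, Category.comp_id]) hb
    have := hb.paste_horiz hθ
    rw [h1, Category.id_comp]
    rwa [Category.comp_id] at this
  have h4 := h _ h3 h1
  rw [h4, Category.id_comp] at h1
  have hio : IsOpenImmersion (χ.proj r) := MorphismProperty.of_isPullback hb.flip hr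
  obtain ⟨c, hc⟩ := hx
  obtain ⟨z, hz, -⟩ := Scheme.Pullback.exists_preimage_pullback x c hc.symm
  refine ⟨(χ.proj r).opensRange, ⟨z, hz⟩, ?_⟩
  have h5 := IsOpenImmersion.lift_fac (χ.proj r) (χ.proj r).opensRange.ι (by simp)
  rw [← h5, Category.assoc, Category.assoc, ← h1, Category.comp_id]

lemma PreservesCameras.restrict {θ : χ.Q ⟶ χ.Q} (hp : PreservesCameras Φ Φ χ.i (θ ≫ χ.i))
    {C' : Scheme.{u}} {r : C' ⟶ C} {θ' : (χ.restrict r).Q ⟶ (χ.restrict r).Q}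
    (h : θ' ≫ χ.proj r = χ.proj r ≫ θ) :
    PreservesCameras Φ Φ (χ.restrict r).i (θ' ≫ (χ.restrict r).i) := by
  have h1 := hp.comp (χ.proj r)
  rw [χ.proj_i, ← reassoc_of% h, χ.proj_i] at h1
  exact h1

/-- Automorphisms of a general configuration are trivial. -/
theorem eq_id_of_preservesCameras (hn : 2 ≤ n) (hΦ : Φ.IsGeneral)
    {M : Fin n → Matrix (Fin 3) (Fin 4) Γ(C, ⊤)} (hM : ∀ k, IsCameraMatrix (Φ.camera k) χ (M k))
    {θ : χ.Q ⟶ χ.Q} (hθ : IsPullback θ χ.q χ.q (𝟙 C))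
    (hp : PreservesCameras Φ Φ χ.i (θ ≫ χ.i)) : θ = 𝟙 χ.Q := by
  have aux (C : Scheme.{u}) (j : C ⟶ S) (χ : CoordOver Φ.π j) [IsAffine C]
      (M : Fin n → Matrix (Fin 3) (Fin 4) Γ(C, ⊤)) (hM : ∀ k, IsCameraMatrix (Φ.camera k) χ (M k))
      (hu : ∀ k, ∃ l, IsUnit (M k 0 l)) (θ : χ.Q ⟶ χ.Q) (hθ : IsPullback θ χ.q χ.q (𝟙 C))
      (hp : PreservesCameras Φ Φ χ.i (θ ≫ χ.i)) : θ = 𝟙 χ.Q := by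
    refine χ.eq_id_of_restrict hθ fun x ↦ ?_
    -- `χ.f` and `θ ≫ χ.f` are two coordinate systems on `χ.Q`, so `θ` is given by a matrix locally
    -- on the base.
    obtain ⟨C', r, hC', hr, hx, T, hT, hTl⟩ :=
      χ.isCoord.exists_linear (χ.isCoord.baseChange hθ) (by omega) x
    refine ⟨C', r, hr, hx, fun θ' hθ' hθθ' ↦ ?_⟩
    refine eq_id_of_linear hn hΦ (fun k ↦ (hM k).restrict r) (fun k ↦ ?_)
      (by rw [hθ'.w, Category.comp_id]) (hp.restrict hθθ') hT fun y v hv ↦ ?_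
    · obtain ⟨l, hl⟩ := hu k
      exact ⟨l, hl.map r.appTop.hom⟩
    · refine (hTl (y ≫ χ.proj r) (y ≫ (χ.restrict r).q)
        (by rw [Category.assoc, (χ.isPullback_proj r).w, Category.assoc]) v
        (hv.of_eq (by rw [Category.assoc, χ.proj_f]))).of_eq ?_
      rw [Category.assoc, Category.assoc, ← χ.proj_f, ← reassoc_of% hθθ']
  have aux2 (C : Scheme.{u}) (j : C ⟶ S) (χ : CoordOver Φ.π j) [IsAffine C]
      (M : Fin n → Matrix (Fin 3) (Fin 4) Γ(C, ⊤)) (hM : ∀ k, IsCameraMatrix (Φ.camera k) χ (M k))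
      (θ : χ.Q ⟶ χ.Q) (hθ : IsPullback θ χ.q χ.q (𝟙 C))
      (hp : PreservesCameras Φ Φ χ.i (θ ≫ χ.i)) : θ = 𝟙 χ.Q := by
    refine χ.eq_id_of_restrict hθ fun x ↦ ?_
    obtain ⟨D, _, s, φ, -, -, hφ⟩ := exists_field_point x
    have hl (k) : ∃ l, φ (M k 0 l) ≠ 0 := by
      by_contra! hl
      exact ((hM k).linearIndependent φ).ne_zero 0 (funext hl)
    choose l hl using hl
    obtain ⟨C', r, hC', hr, hx, hu⟩ := exists_isUnit_restrict
      (x := x) (a := ∏ k, M k 0 (l k)) ((hφ _).2 (by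
        rw [map_prod]; exact Finset.prod_ne_zero_iff.2 fun k _ ↦ hl k))
    rw [map_prod, IsUnit.prod_univ_iff] at hu
    exact ⟨C', r, hr, hx, fun θ' hθ' h ↦ aux _ _ _ _ (fun k ↦ (hM k).restrict r)
      (fun k ↦ ⟨l k, hu k⟩) θ' hθ' (hp.restrict h)⟩
  refine χ.eq_id_of_restrict hθ fun x ↦ ?_
  obtain ⟨U, hU, hxU, -⟩ := exists_isAffineOpen_mem_and_subset (X := C) (x := x) (U := ⊤) trivial
  have : IsAffine (U : Scheme.{u}) := hU
  exact ⟨U, U.ι, inferInstance, ⟨⟨x, hxU⟩, rfl⟩, fun θ' hθ' h ↦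
    aux2 _ _ _ _ (fun k ↦ (hM k).restrict U.ι) θ' hθ' (hp.restrict h)⟩

/-- Two morphisms to the source of a general configuration which differ by an automorphism of the
configuration agree. -/
theorem eq_of_preservesCameras (hn : 2 ≤ n) (hΦ : Φ.IsGeneral) [IsOpenImmersion j] {R : Scheme.{u}}
    {q : R ⟶ C} {e e' : R ⟶ Φ.P} (he : IsPullback e q Φ.π j) (he' : IsPullback e' q Φ.π j)
    (hp : PreservesCameras Φ Φ e e') : e = e' := by
  refine hom_ext_of_local fun x ↦ ?_
  obtain ⟨C', r, -, hr, ⟨c, hc⟩, h⟩ := exists_common (q x)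
    (fun (_ : Unit) C' r ↦ ∃ (χ : CoordOver Φ.π (r ≫ j))
      (M : Fin n → Matrix (Fin 3) (Fin 4) Γ(C', ⊤)), ∀ k, IsCameraMatrix (Φ.camera k) χ (M k))
    (fun _ C' C'' r r' ⟨χ, M, hM⟩ ↦ by
      rw [Category.assoc]
      exact ⟨χ.restrict r', _, fun k ↦ (hM k).restrict r'⟩)
    (fun _ ↦ by
      obtain ⟨C', j', hj', hb, χ, M, hM⟩ := exists_matrices (by omega) Φ.camera (j (q x))
      obtain ⟨c', hc'⟩ := hb
      obtain ⟨z, hz, -⟩ := Scheme.Pullback.exists_preimage_pullback (q x) c' hc'.symm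
      refine ⟨pullback j j', pullback.fst j j', inferInstance, ⟨z, hz⟩, ?_⟩
      rw [pullback.condition]
      exact ⟨χ.restrict _, _, fun k ↦ (hM k).restrict _⟩)
  obtain ⟨χ, M, hM⟩ := h ()
  have hl := he.lift_fst χ.i (χ.q ≫ r) (by rw [χ.isPullback.w, Category.assoc])
  have hl' := he.lift_snd χ.i (χ.q ≫ r) (by rw [χ.isPullback.w, Category.assoc])
  set l := he.lift χ.i (χ.q ≫ r) (by rw [χ.isPullback.w, Category.assoc])
  have hlp : IsPullback l χ.q q r := by
    refine IsPullback.of_right ?_ hl' he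
    rw [hl]
    exact χ.isPullback
  have h1 := hlp.paste_horiz he'
  have hθ := χ.isPullback.lift_fst _ _ h1.w
  have hθ' := χ.isPullback.lift_snd _ _ h1.w
  -- The automorphism comparing `e` with `e'` in the coordinates `χ`.
  set θ := χ.isPullback.lift _ _ h1.w
  have hθp : IsPullback θ χ.q χ.q (𝟙 C') := by
    refine IsPullback.of_right ?_ (by rw [hθ', Category.comp_id]) χ.isPullback
    rw [hθ, Category.id_comp]
    exact h1
  have h2 := hp.comp l
  rw [hl, ← hθ] at h2
  have h3 := eq_id_of_preservesCameras hn hΦ hM hθp h2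
  rw [h3, Category.id_comp] at hθ
  have hio : IsOpenImmersion l := MorphismProperty.of_isPullback hlp.flip hr
  obtain ⟨z, hz, -⟩ := Scheme.Pullback.exists_preimage_pullback x c hc.symm
  refine ⟨l.opensRange, ⟨hlp.isoPullback.inv z, ?_⟩, ?_⟩
  · rw [← hz, ← Scheme.Hom.comp_apply, IsPullback.isoPullback_inv_fst]
  have h5 := IsOpenImmersion.lift_fac l l.opensRange.ι (by simp)
  rw [← h5, Category.assoc, Category.assoc, hl, hθ]

end Rigidity

/-! ### Gluing the local isomorphisms. -/

section Gluing

variable {X Y : Scheme.{u}}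

lemma mem_range_of_isPullback {P B C : Scheme.{u}} {i : X ⟶ P} {q : X ⟶ C} {π : P ⟶ B}
    {j : C ⟶ B} (h : IsPullback i q π j) {x : P} (hx : π x ∈ Set.range j) : x ∈ Set.range i := by
  obtain ⟨c, hc⟩ := hx
  obtain ⟨z, rfl, -⟩ := Scheme.Pullback.exists_preimage_pullback x c hc.symm
  refine ⟨h.isoPullback.inv z, ?_⟩
  rw [← Scheme.Hom.comp_apply, IsPullback.isoPullback_inv_fst]

lemma hom_ext_of_cover {f g : X ⟶ Y} (h : ∀ x : X, ∃ (R : Scheme.{u}) (r : R ⟶ X),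
    IsOpenImmersion r ∧ x ∈ Set.range r ∧ r ≫ f = r ≫ g) : f = g := by
  refine hom_ext_of_local fun x ↦ ?_
  obtain ⟨R, r, hr, hx, h⟩ := h x
  refine ⟨r.opensRange, hx, ?_⟩
  have h1 := IsOpenImmersion.lift_fac r r.opensRange.ι (by simp)
  rw [← h1, Category.assoc, h, Category.assoc]

lemma exists_glue_of_cover {ι : Type u} {R : ι → Scheme.{u}} (i : ∀ b, R b ⟶ X)
    (hi : ∀ b, IsOpenImmersion (i b)) (hX : ∀ x : X, ∃ b, x ∈ Set.range (i b)) (e : ∀ b, R b ⟶ Y)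
    (h : ∀ b b' (W : Scheme.{u}) (s : W ⟶ R b) (s' : W ⟶ R b'), s ≫ i b = s' ≫ i b' →
      s ≫ e b = s' ≫ e b') : ∃ g : X ⟶ Y, ∀ b, i b ≫ g = e b := by
  have hl (b) := IsOpenImmersion.lift_fac (i b) (i b).opensRange.ι (by simp)
  obtain ⟨g, hg⟩ := exists_glue (fun b ↦ (i b).opensRange) hX
    (fun b ↦ IsOpenImmersion.lift (i b) (i b).opensRange.ι (by simp) ≫ e b) fun b b' ↦ by
      rw [← Category.assoc, ← Category.assoc]
      refine h _ _ _ _ _ ?_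
      rw [Category.assoc, Category.assoc, hl, hl, Scheme.homOfLE_ι, Scheme.homOfLE_ι]
  refine ⟨g, fun b ↦ ?_⟩
  have h1 := IsOpenImmersion.lift_fac (i b).opensRange.ι (i b) (by simp)
  rw [← h1, Category.assoc, hg, ← Category.assoc]
  refine (congr($(?_) ≫ e b)).trans (Category.id_comp _)
  rw [← cancel_mono (i b), Category.assoc, hl, h1, Category.id_comp]

variable {S : Scheme.{u}} {n : ℕ} {Φ₁ Φ₂ : Configuration S n}

/-- Over the overlap of the two bases, the local isomorphisms differ by an automorphism of the
configuration `Φ₂`, which is the identity. -/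
lemma PreservesCameras.comp_eq_comp (hn : 2 ≤ n) (h₂ : Φ₂.IsGeneral) {C C' R R' : Scheme.{u}}
    {j : C ⟶ S} {j' : C' ⟶ S} [IsOpenImmersion j] [IsOpenImmersion j'] {i : R ⟶ Φ₁.P} {e : R ⟶ Φ₂.P}
    {q : R ⟶ C} {i' : R' ⟶ Φ₁.P} {e' : R' ⟶ Φ₂.P} {q' : R' ⟶ C'} (hi : IsPullback i q Φ₁.π j)
    (he : IsPullback e q Φ₂.π j) (hi' : IsPullback i' q' Φ₁.π j') (he' : IsPullback e' q' Φ₂.π j')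
    (hp : PreservesCameras Φ₂ Φ₁ e i) (hp' : PreservesCameras Φ₁ Φ₂ i' e') {W : Scheme.{u}}
    (s : W ⟶ R) (s' : W ⟶ R') (hs : s ≫ i = s' ≫ i') : s ≫ e = s' ≫ e' := by
  have hR := IsPullback.of_hasPullback q (pullback.fst j j')
  have hw : (pullback.fst q (pullback.fst j j') ≫ i) ≫ Φ₁.π =
      (pullback.snd q (pullback.fst j j') ≫ pullback.snd j j') ≫ j' := by
    rw [Category.assoc, hi.w, reassoc_of% hR.w, pullback.condition, Category.assoc]
  have ha := hi'.lift_fst _ _ hw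
  have ha' := hi'.lift_snd _ _ hw
  have hR' : IsPullback (hi'.lift _ _ hw) (pullback.snd q (pullback.fst j j')) q'
      (pullback.snd j j') := by
    refine IsPullback.of_right ?_ ha' hi'
    rw [ha, ← pullback.condition]
    exact hR.paste_horiz hi
  have h1 := hR.paste_horiz he
  have h2 := hR'.paste_horiz he'
  rw [← pullback.condition] at h2
  have h3 := hp'.comp (hi'.lift _ _ hw)
  rw [ha] at h3
  have h4 := eq_of_preservesCameras hn h₂ h1 h2 ((hp.comp _).trans h3)
  have h5 : (s ≫ q) ≫ j = (s' ≫ q') ≫ j' := by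
    rw [Category.assoc, ← hi.w, reassoc_of% hs, hi'.w, Category.assoc]
  let t : W ⟶ pullback q (pullback.fst j j') :=
    pullback.lift s (pullback.lift (s ≫ q) (s' ≫ q') h5) (pullback.lift_fst _ _ _).symm
  have ht : t ≫ pullback.fst _ _ = s := pullback.lift_fst _ _ _
  have ht' : t ≫ hi'.lift _ _ hw = s' := by
    refine hi'.hom_ext ?_ ?_
    · rw [Category.assoc, ha, reassoc_of% ht, hs]
    · rw [Category.assoc, ha', ← Category.assoc, pullback.lift_snd, pullback.lift_snd]
  rw [← ht, Category.assoc, h4, ← Category.assoc, ht']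

/-- Uniqueness lets the local isomorphisms glue in both directions, and the glued morphisms are
inverse to each other because they are so locally. -/
theorem exists_iso_of_multiviewScheme_eq (hn : 2 ≤ n) (h₁ : Φ₁.IsGeneral) (h₂ : Φ₂.IsGeneral)
    (h : Φ₁.multiviewScheme = Φ₂.multiviewScheme) :
    ∃ ε : Φ₁.P ≅ Φ₂.P, PreservesCameras Φ₁ Φ₂ (𝟙 _) ε.hom := by
  choose C j R i e q hj hb hi he hp hp' using exists_local_iso hn h₁ h₂ h
  have hio (b) : IsOpenImmersion (i b) := MorphismProperty.of_isPullback (hi b).flip (hj b)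
  have heo (b) : IsOpenImmersion (e b) := MorphismProperty.of_isPullback (he b).flip (hj b)
  have hic (x : Φ₁.P) : x ∈ Set.range (i (Φ₁.π x)) :=
    mem_range_of_isPullback (hi _) (hb _)
  have hec (x : Φ₂.P) : x ∈ Set.range (e (Φ₂.π x)) :=
    mem_range_of_isPullback (he _) (hb _)
  obtain ⟨g, hg⟩ := exists_glue_of_cover i hio (fun x ↦ ⟨_, hic x⟩) e fun b b' W s s' hs ↦
    (hp' b).comp_eq_comp hn h₂ (hi b) (he b) (hi b') (he b') (hp b') s s' hs
  obtain ⟨g', hg'⟩ := exists_glue_of_cover e heo (fun x ↦ ⟨_, hec x⟩) i fun b b' W s s' hs ↦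
    (hp b).comp_eq_comp hn h₁ (he b) (hi b) (he b') (hi b') (hp' b') s s' hs
  refine ⟨⟨g, g', hom_ext_of_cover fun x ↦ ⟨_, _, hio _, hic x, ?_⟩,
    hom_ext_of_cover fun x ↦ ⟨_, _, heo _, hec x, ?_⟩⟩,
    .of_local fun x ↦ ⟨_, _, hio _, hic x, ?_⟩⟩
  · rw [reassoc_of% hg, hg', Category.comp_id]
  · rw [reassoc_of% hg', hg, Category.comp_id]
  · rw [hg, Category.comp_id]
    exact hp _

/-- An isomorphism of the sources compatible with the cameras is an isomorphism of
configurations. -/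
def PreservesCameras.iso {ε : Φ₁.P ≅ Φ₂.P} (h : PreservesCameras Φ₁ Φ₂ (𝟙 _) ε.hom) :
    Configuration.Iso Φ₁ Φ₂ where
  ε := ε
  comp_π := by rw [← h.comp_π, Category.id_comp]
  comm := by
    have hπ : ε.hom ≫ Φ₂.π = Φ₁.π := by rw [← h.comp_π, Category.id_comp]
    refine PlanePower.hom_ext ?_ fun k ↦ ?_
    · rw [Category.assoc, Category.assoc, Category.assoc, Φ₁.map_toBase, Φ₂.map_toBase,
        Scheme.homOfLE_ι_assoc, morphismRestrict_ι_assoc, Scheme.homOfLE_ι_assoc, hπ]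
    · obtain ⟨y₂, h1, h2⟩ := h.exists_lift k (compl Φ₁.Z ⊓ ε.hom ⁻¹ᵁ compl Φ₂.Z).ι
        (Φ₁.P.homOfLE inf_le_left ≫ Φ₁.P.homOfLE (Φ₁.compl_Z_le k))
        (by rw [Category.assoc, Scheme.homOfLE_ι, Scheme.homOfLE_ι, Category.comp_id])
      have h3 : y₂ = Φ₁.P.homOfLE inf_le_right ≫ (ε.hom ∣_ compl Φ₂.Z) ≫
          Φ₂.P.homOfLE (Φ₂.compl_Z_le k) := by
        rw [← cancel_mono (compl (Φ₂.camera k).Z).ι, h1, Category.assoc, Category.assoc,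
          Scheme.homOfLE_ι, morphismRestrict_ι, Scheme.homOfLE_ι_assoc]
      rw [h3] at h2
      simp only [Category.assoc] at h2 ⊢
      rw [Φ₁.map_proj, Φ₂.map_proj]
      exact h2

end Gluing

/-! ### Schematically dense open subsets. -/

section SchematicDensity

open Matrix

variable {X Y : Scheme.{u}}

/-- An open subset is schematically dense if sections vanishing on it vanish. -/
def IsSchematicallyDense (U : X.Opens) : Prop :=
  ∀ (V : X.Opens) (s : Γ(X, V)), rs (inf_le_left : V ⊓ U ≤ V) s = 0 → s = 0

lemma appLE_bijective (f : X ⟶ Y) [IsOpenImmersion f] {V : Y.Opens} {W : X.Opens}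
    (hV : V ≤ f.opensRange) (h : W = f ⁻¹ᵁ V) : Function.Bijective (f.appLE V W h.le).hom := by
  subst h
  have := f.isIso_app V hV
  rw [Scheme.Hom.appLE_eq_app]
  exact ConcreteCategory.bijective_of_isIso (f.app V)

namespace IsSchematicallyDense

lemma top : IsSchematicallyDense (⊤ : X.Opens) := fun V s hs ↦ by
  refine ext_of_local _ _ fun x hx ↦ ⟨V ⊓ ⊤, inf_le_left, ⟨hx, trivial⟩, ?_⟩
  rw [hs, map_zero]

lemma inf {U U' : X.Opens} (h : IsSchematicallyDense U) (h' : IsSchematicallyDense U') :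
    IsSchematicallyDense (U ⊓ U') := fun V s hs ↦ by
  refine h V s (h' _ _ ?_)
  have hle : V ⊓ U ⊓ U' ≤ V ⊓ (U ⊓ U') := (inf_assoc _ _ _).le
  have := congr(rs hle $hs)
  rw [rs_rs, map_zero] at this
  rw [rs_rs]
  exact this

lemma finset_inf {ι : Type*} (s : Finset ι) {U : ι → X.Opens}
    (h : ∀ k, IsSchematicallyDense (U k)) : IsSchematicallyDense (s.inf U) := by
  classical
  induction s using Finset.induction_on with
  | empty => exact top
  | insert k s _ ih =>
    rw [Finset.inf_insert]
    exact (h k).inf ih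

lemma preimage {U : Y.Opens} (h : IsSchematicallyDense U) (f : X ⟶ Y) [IsOpenImmersion f] :
    IsSchematicallyDense (f ⁻¹ᵁ U) := fun V s hs ↦ by
  have hV : V = f ⁻¹ᵁ f ''ᵁ V := (f.preimage_image_eq V).symm
  have hr : f ''ᵁ V ≤ f.opensRange := by
    rintro _ ⟨x, -, rfl⟩
    exact ⟨x, rfl⟩
  obtain ⟨t, rfl⟩ := (appLE_bijective f hr hV).2 s
  have hW : V ⊓ f ⁻¹ᵁ U = f ⁻¹ᵁ (f ''ᵁ V ⊓ U) := by
    conv_lhs => rw [hV]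
    rfl
  have ht : t = 0 := by
    refine h _ _ ((appLE_bijective f (inf_le_left.trans hr) hW).1 ?_)
    rw [appLE_rs, map_zero, ← hs, rs_appLE]
  rw [ht, map_zero]

lemma of_cover {U : Y.Opens} (h : ∀ y : Y, ∃ (R : Scheme.{u}) (i : R ⟶ Y), IsOpenImmersion i ∧
    y ∈ Set.range i ∧ IsSchematicallyDense (i ⁻¹ᵁ U)) : IsSchematicallyDense U := fun V s hs ↦ by
  refine ext_of_local _ _ fun y hy ↦ ?_
  obtain ⟨R, i, hi, hyi, hd⟩ := h y
  refine ⟨V ⊓ i.opensRange, inf_le_left, ⟨hy, hyi⟩, ?_⟩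
  have hW : i ⁻¹ᵁ V = i ⁻¹ᵁ (V ⊓ i.opensRange) := by
    ext x
    exact ⟨fun hx ↦ ⟨hx, x, rfl⟩, fun hx ↦ hx.1⟩
  refine (appLE_bijective i inf_le_right hW).1 ?_
  rw [map_zero, map_zero, appLE_rs]
  refine hd _ _ ?_
  have h1 : i ⁻¹ᵁ V ⊓ i ⁻¹ᵁ U ≤ i ⁻¹ᵁ (V ⊓ U) := le_rfl
  have := congr((i.appLE _ _ h1).hom $hs)
  rw [appLE_rs, map_zero] at this
  rw [rs_appLE]
  exact this

/-- On a basic open set `D(h)` the section times a power of `h` extends to a global function `t`. It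
vanishes on `D(h δ)`, so `(h δ) ^ k * t = 0`; cancelling `δ ^ k` shows that `t` vanishes on `D(h)`.
-/
lemma of_mem_nonZeroDivisors [IsAffine X] {U : X.Opens} {δ : Γ(X, ⊤)}
    (hδ : δ ∈ nonZeroDivisors Γ(X, ⊤)) (hU : X.basicOpen δ ≤ U) : IsSchematicallyDense U := by
  intro V s hs
  refine ext_of_local _ _ fun x hx ↦ ?_
  obtain ⟨h, hle, hxh⟩ := (isAffineOpen_top X).exists_basicOpen_le ⟨x, hx⟩ trivial
  refine ⟨X.basicOpen h, hle, hxh, ?_⟩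
  rw [map_zero]
  obtain ⟨n, t, ht⟩ := exists_eq_pow_mul_of_isAffineOpen X ⊤ (isAffineOpen_top X) h (rs hle s)
  replace ht : rs (X.basicOpen_le h) t = rs (X.basicOpen_le h) h ^ n * rs hle s := ht
  have h0 : rs (X.basicOpen_le (h * δ)) t = 0 := by
    have h1 : X.basicOpen (h * δ) ≤ X.basicOpen h := by
      rw [Scheme.basicOpen_mul]; exact inf_le_left
    have h2 : X.basicOpen (h * δ) ≤ V ⊓ U := by
      rw [Scheme.basicOpen_mul]; exact inf_le_inf hle hU
    have h3 := congr(rs h1 $ht)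
    have h4 := congr(rs h2 $hs)
    rw [rs_rs, map_zero] at h4
    rw [rs_rs, map_mul, rs_rs, h4, mul_zero] at h3
    exact h3
  obtain ⟨k, hk⟩ := exists_pow_mul_eq_zero_of_res_basicOpen_eq_zero_of_isCompact X
    (isAffineOpen_top X).isCompact t (h * δ) h0
  rw [mul_pow, mul_right_comm] at hk
  have h5 := (mem_nonZeroDivisors_iff_right.1 (pow_mem hδ k)) _ hk
  have h6 := congr(rs (X.basicOpen_le h) $h5)
  have hu : IsUnit (rs (X.basicOpen_le h) h) := isUnit_rs_basicOpen h le_rfl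
  rw [map_mul, map_pow, map_zero, ht] at h6
  exact (hu.pow n).mul_right_eq_zero.1 ((hu.pow k).mul_right_eq_zero.1 h6)

lemma ker_eq_bot {f : X ⟶ Y} [IsOpenImmersion f] (h : IsSchematicallyDense f.opensRange) :
    f.ker = ⊥ := by
  rw [eq_bot_iff]
  intro V s hs
  have h1 : (f.app V).hom s = 0 := f.ideal_ker_le V hs
  have h2 : s = 0 := by
    have hW : f ⁻¹ᵁ V.1 = f ⁻¹ᵁ (V.1 ⊓ f.opensRange) := by
      ext x
      exact ⟨fun hx ↦ ⟨hx, x, rfl⟩, fun hx ↦ hx.1⟩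
    refine h _ _ ((appLE_bijective f inf_le_right hW).1 ?_)
    rw [map_zero, appLE_rs, ← h1, app_eq]
  rw [h2]
  exact zero_mem _

end IsSchematicallyDense

end SchematicDensity

/-! ### Density of the regular locus, and invariance of the multiview scheme. -/

section Cameras

open Matrix

variable {S C : Scheme.{u}} {P : Scheme.{u}} {π : P ⟶ S} {j : C ⟶ S}

/-- On a standard affine chart the first coordinate of the camera is nonzero only away from the
center. It is a nonzerodivisor because one of its coefficients is a unit. -/
lemma IsCameraMatrix.isSchematicallyDense [IsAffine C] {c : Camera π} {χ : CoordOver π j}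
    {M : Matrix (Fin 3) (Fin 4) Γ(C, ⊤)} (h : IsCameraMatrix c χ M) {l : Fin 4}
    (hl : IsUnit (M 0 l)) : IsSchematicallyDense (χ.i ⁻¹ᵁ compl c.Z) := by
  refine .of_cover fun x ↦ ?_
  obtain ⟨m, hm⟩ := exists_mem_chart (χ.f x)
  obtain ⟨W, hW⟩ : ∃ W, W = χ.f ⁻¹ᵁ chart 3 m := ⟨_, rfl⟩
  have hWa : IsAffineOpen W := by
    have h1 : IsAffineHom χ.f := MorphismProperty.of_isPullback χ.isCoord.isPullback
      (inferInstance : IsAffineHom (terminal.from C))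
    rw [hW]
    exact (isAffineOpen_chart m).preimage χ.f
  have : IsAffine (W : Scheme.{u}) := hWa
  have hWt : ⊤ ≤ W.ι ⁻¹ᵁ χ.f ⁻¹ᵁ chart 3 m := fun x _ ↦ hW.le x.2
  obtain ⟨v, hv, hvm⟩ : ∃ v, Rep (W.ι ≫ χ.f) v ∧ v m = 1 :=
    ⟨_, Rep.of_le_preimage (W.ι ≫ χ.f) m hWt, by rw [ratio_self, map_one]⟩
  refine ⟨W, W.ι, inferInstance, ⟨⟨x, hW.ge hm⟩, rfl⟩, .of_mem_nonZeroDivisors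
    (δ := ((M.map (W.ι ≫ χ.q).appTop.hom) *ᵥ v) 0) ?_
    fun x hx ↦ (h.mem_iff W.ι v hv x).2 ⟨0, hx⟩⟩
  refine mem_nonZeroDivisors_iff_right.2 fun a ha ↦ ?_
  obtain ⟨g, hg⟩ : ∃ g : Γ(χ.Q, χ.f ⁻¹ᵁ chart 3 m), (W.ι.appLE _ ⊤ hWt).hom g = a :=
    (appLE_bijective W.ι (by rw [Scheme.Opens.opensRange_ι, hW])
      (top_le_iff.1 hWt).symm).2 a
  obtain ⟨d, G, -, hG⟩ := χ.isCoord.exists_form m g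
  -- The function `a` is represented by the form `G`. It vanishes at a point where the first
  -- coordinate of the camera is a unit and into whose ring polynomials inject.
  have hG0 : G = 0 := by
    obtain ⟨E, _, ε, y, hε, hεu, hy, hyv⟩ := χ.exists_generic_point
      (fun k : Bool ↦ k.rec (Pi.single m 1) (M 0))
      (by rintro (_ | _); exacts [⟨m, by simp⟩, ⟨l, hl⟩])
    have hum : IsUnit (ε (MvPolynomial.X m)) := by rw [← lin_single]; exact hεu false
    have huM : IsUnit (ε (lin (M 0))) := hεu true
    have hyW := IsCoord.top_le_preimage hyv (hum.map (toΓ E))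
    have h1 := hG y _ hyv hyW
    have hr : Set.range y ⊆ Set.range W.ι := by
      rintro _ ⟨z, rfl⟩
      rw [Scheme.Opens.range_ι]
      exact hW.ge (hyW (x := z) trivial)
    obtain ⟨y', rfl⟩ : ∃ y', y' ≫ W.ι = y := ⟨_, IsOpenImmersion.lift_fac W.ι y hr⟩
    have hv' : Rep ((y' ≫ W.ι) ≫ χ.f) fun i ↦ y'.appTop.hom (v i) :=
      (hv.comp y').of_eq (Category.assoc _ _ _).symm
    have hδ : IsUnit (y'.appTop.hom (((M.map (W.ι ≫ χ.q).appTop.hom) *ᵥ v) 0)) := by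
      have h2 : y'.appTop.hom (((M.map (W.ι ≫ χ.q).appTop.hom) *ᵥ v) 0) =
          ((M.map ((y' ≫ W.ι) ≫ χ.q).appTop.hom) *ᵥ fun i ↦ y'.appTop.hom (v i)) 0 := by
        simp only [Matrix.mulVec, dotProduct, map_sum, map_mul, Matrix.map_apply, Category.assoc,
          Scheme.Hom.comp_appTop, CommRingCat.hom_comp, RingHom.comp_apply]
      have h3 : ((M.map ((y' ≫ W.ι) ≫ χ.q).appTop.hom) *ᵥ
          fun i ↦ toΓ E (ε (MvPolynomial.X i))) 0 = toΓ E (ε (MvPolynomial.X m)) *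
          y'.appTop.hom (((M.map (W.ι ≫ χ.q).appTop.hom) *ᵥ v) 0) := by
        rw [h2]
        simp only [Matrix.mulVec, dotProduct, Finset.mul_sum]
        refine Finset.sum_congr rfl fun i _ ↦ ?_
        have h4 := hyv.mul_eq hv' i m
        rw [hvm, map_one, mul_one] at h4
        rw [h4]
        ring
      rw [mulVec_eq_eval₂, hy, eval₂_generic] at h3
      have h5 := huM.map (toΓ E)
      rw [h3] at h5
      exact (IsUnit.mul_iff.1 h5).2
    have h2 : y'.appTop.hom a = 0 := by
      have := congr(y'.appTop.hom $ha)
      rw [map_mul, map_zero] at this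
      exact hδ.mul_left_eq_zero.1 this
    rw [hy, eval₂_generic] at h1
    have h3 : ((y' ≫ W.ι).appLE _ ⊤ hyW).hom g = 0 := by
      rw [← h2, ← hg, appTop_eq, appLE_comp]
    rw [h3, zero_mul] at h1
    exact hε (toΓ_injective E (by rw [← h1, map_zero, map_zero]))
  have h1 := hG W.ι v hv hWt
  rwa [hg, hG0, MvPolynomial.eval₂_zero, hvm, one_pow, mul_one] at h1

lemma Camera.isSchematicallyDense [IsSeparated π] (c : Camera π) :
    IsSchematicallyDense (compl c.Z) := by
  refine .of_cover fun p ↦ ?_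
  obtain ⟨C, j, hC, hj, ⟨x, hx⟩, χ, M, hM⟩ := c.exists_matrix (π p)
  obtain ⟨D, _, s, φ, -, -, hφ⟩ := exists_field_point x
  obtain ⟨l, hl⟩ : ∃ l, φ (M 0 l) ≠ 0 := by
    by_contra! hl
    exact (hM.linearIndependent φ).ne_zero 0 (funext hl)
  obtain ⟨C', r, hC', hr, ⟨x', hx'⟩, hu⟩ := exists_isUnit_restrict (x := x) ((hφ _).2 hl)
  have hp := (χ.restrict r).isPullback
  exact ⟨_, _, MorphismProperty.of_isPullback hp.flip inferInstance,
    mem_range_of_isPullback hp ⟨x', by rw [Scheme.Hom.comp_apply, hx', hx]⟩,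
    (hM.restrict r).isSchematicallyDense hu⟩

variable {n : ℕ} {Φ₁ Φ₂ : Configuration S n}

lemma Configuration.isSchematicallyDense (Φ : Configuration S n) :
    IsSchematicallyDense (compl Φ.Z) := by
  have : compl Φ.Z = Finset.univ.inf fun k ↦ compl (Φ.camera k).Z := by
    refine TopologicalSpace.Opens.ext ?_
    rw [Opens.coe_finset_inf]
    ext x
    simpa using Φ.mem_compl_Z_iff
  rw [this]
  exact .finset_inf _ fun k ↦ (Φ.camera k).isSchematicallyDense

/-- The two maps are only compared on the intersection of their regular loci. That intersection is
schematically dense in both, so restricting to it leaves the scheme-theoretic images unchanged. -/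
theorem Configuration.Iso.multiviewScheme_eq (e : Configuration.Iso Φ₁ Φ₂) :
    Φ₁.multiviewScheme = Φ₂.multiviewScheme := by
  have hd := Φ₁.isSchematicallyDense.inf (Φ₂.isSchematicallyDense.preimage e.ε.hom)
  have key {U : Φ₁.P.Opens} (h : compl Φ₁.Z ⊓ e.ε.hom ⁻¹ᵁ compl Φ₂.Z ≤ U) :
      (Φ₁.P.homOfLE h).ker = ⊥ := by
    refine IsSchematicallyDense.ker_eq_bot ?_
    have : (Φ₁.P.homOfLE h).opensRange = U.ι ⁻¹ᵁ (compl Φ₁.Z ⊓ e.ε.hom ⁻¹ᵁ compl Φ₂.Z) := by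
      rw [Scheme.opensRange_homOfLE]
    rw [this]
    exact hd.preimage _
  have h := congr(Scheme.Hom.ker $(e.comm))
  rwa [Scheme.Hom.ker_comp, Scheme.Hom.ker_comp, key, key, Scheme.IdealSheafData.map_bot,
    Scheme.IdealSheafData.map_bot, Scheme.Hom.ker_comp_of_isIso] at h

end Cameras

end Multiview

end

theorem proposition2 {S : AlgebraicGeometry.Scheme.{u}} {n : ℕ} (hn : 2 ≤ n)
    (Φ₁ Φ₂ : Multiview.Configuration S n) (h₁ : Φ₁.IsGeneral) (h₂ : Φ₂.IsGeneral) :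
    Nonempty (Multiview.Configuration.Iso Φ₁ Φ₂) ↔ Φ₁.multiviewScheme = Φ₂.multiviewScheme :=
  ⟨fun ⟨e⟩ ↦ e.multiviewScheme_eq, fun h ↦
    have ⟨_, hε⟩ := Multiview.exists_iso_of_multiviewScheme_eq hn h₁ h₂ h
    ⟨hε.iso⟩⟩
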